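/- Let $\varphi,\chi:\mathbb R^3\to[0,1]$ be a Littlewood–Paley pair: smooth functions with $\operatorname{supp}\varphi\subset\{\tfrac34\le|\xi|\le\tfrac83\}$, $\operatorname{supp}\chi\subset\{|\xi|\le\tfrac43\}$, $\chi(\xi)+\sum_{q\ge0}\varphi(2^{-q}\xi)=1$ for all $\xi$ and $\sum_{q\in\mathbb Z}\varphi(2^{-q}\xi)=1$ for $\xi\ne0$. Put $\dot\Delta_q=\varphi(2^{-q}D)$, $D=-i\nabla$. For a scalar or vector valued tempered distribution $f$ on $\mathbb R^3$ let $$\|f\|_{\dot B^s_{2,1}}=\sum_{q\in\mathbb Z}2^{qs}\|\dot\Delta_qf\|_{L^2},\qquad \|f\|_{B^s_{2,1}}=2^{-s}\|\chi(D)f\|_{L^2}+\sum_{q\ge0}2^{qs}\|\dot\Delta_qf\|_{L^2},$$ and for time-dependent $f$, $0\le T\le\infty$, $\theta\in\{2,\infty\}$, $s>0$, let $$\|f\|_{\widetilde L^\theta_T(B^s_{2,1})}=\|f\|_{L^\theta(0,T;L^2)}+\sum_{q\in\mathbb Z}2^{qs}\|\dot\Delta_qf\|_{L^\theta(0,T;L^2)}.$$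 Let $\tau,\beta,A,B\in\mathbb R$ with $0<\tau<\beta$ and $A\neq0$. For $\mathbf U=(u,v,w)$ and $X=L^2$ or $X=\dot B^s_{2,1}$ put $$N_X(\mathbf U)^2=\|v+\tau w\|_X^2+\|\nabla(v+\tau w)\|_X^2+\|\Delta v\|_X^2+\|\nabla v\|_X^2+\|\Delta(u+\tau v)\|_X^2+\|\nabla(u+\tau v)\|_X^2+\|w\|_X^2,$$ and $\|\mathbf U\|_{\mathcal B^s_{2,1}}=N_{L^2}(\mathbf U)+N_{\dot B^s_{2,1}}(\mathbf U)$. Further, let $\|\mathbf U\|_{\widetilde L^\infty_T(\mathcal B^s_{2,1})}$ be the sum of the $\widetilde L^\infty_T(B^s_{2,1})$ norms of the seven functions $v+\tau w$, $\nabla(v+\tau w)$, $\Delta v$, $\nabla v$, $\Delta(u+\tau v)$, $\nabla(u+\tau v)$, $w$, and let $\|\mathbf U\|_{\widetilde L^2_T(\mathbb B^s_{2,1})}$ be the sum of the $\widetilde L^2_T(B^s_{2,1})$ norms of the five functions $\nabla v$, $\Delta v$, $w$, $\Delta(u+\tau v)$, $\nabla(v+\tau w)$. Let $\widetilde{\mathcal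 C}(\mathcal B^s_{2,1})$ be the set of $\mathbf U\in C([0,\infty);\mathcal B^s_{2,1})$ with $\|\mathbf U\|_{\widetilde L^\infty_\infty(\mathcal B^s_{2,1})}<\infty$, and $\widetilde{\mathcal C}^1(\mathcal B^s_{2,1})$ the set of $\mathbf U\in C^1([0,\infty);\mathcal B^s_{2,1})$ with $\|\partial_t\mathbf U\|_{\widetilde L^\infty_\infty(\mathcal B^s_{2,1})}<\infty$. Consider the Cauchy problem for the Jordan–Moore–Gibson–Thompson equation in $\mathbb R^3$ (with speed of sound $1$), written as a first-order system in time for the real-valued unknown $\mathbf U=(u,v,w)=(u,u_t,u_{tt})$: $$u_t=v,\qquad v_t=w,\qquad \tau w_t=\Delta u+\beta\Delta v-w+\tfrac BA\,vw+2\nabla u\cdot\nabla v,\qquad \mathbf U(0)=\mathbf U_0=(u_0,v_0,w_0),$$ the equations being understood in the sense of tempered distributions in $x$ at every time $t\ge0$. **Theorem.** There are $\delta>0$ and $C>0$, depending only on $\varphi,\chi,\tau,\beta,A,B$, such that for all real-valued $u_0,v_0\in B^{7/2}_{2,1}(\mathbb R^3)$ and $w_0\in B^{5/2}_{2,1}(\mathbb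 R^3)$ with $\|\mathbf U_0\|_{\mathcal B^{3/2}_{2,1}}\le\delta$, the Cauchy problem has a unique global solution $$\mathbf U\in\widetilde{\mathcal C}(\mathcal B^{3/2}_{2,1})\cap\widetilde{\mathcal C}^1(\mathcal B^{1/2}_{2,1}),$$ and, for every $0\le T\le\infty$, $$\|\mathbf U\|_{\widetilde L^\infty_T(\mathcal B^{3/2}_{2,1})}+\|\mathbf U\|_{\widetilde L^2_T(\mathbb B^{3/2}_{2,1})}\le C\,\|\mathbf U_0\|_{\mathcal B^{3/2}_{2,1}}.$$ -/

import Mathlib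

open MeasureTheory Filter Topology
open scoped SchwartzMap LineDeriv Laplacian ENNReal

noncomputable section

namespace JMGT

/-- The space `ℝ³` with its Euclidean norm. -/
abbrev E3 : Type := EuclideanSpace ℝ (Fin 3)

/-- Tempered distributions on `ℝ³`. -/
abbrev TDist : Type := 𝓢'(E3, ℂ)

/-- A tempered distribution is real-valued if it takes real values on real test functions. -/
def IsReal (f : TDist) : Prop :=
  ∀ ψ : 𝓢(E3, ℂ), (∀ x, (ψ x).im = 0) → (f ψ).im = 0

/-- The gradient `(∂₁ f, ∂₂ f, ∂₃ f)`, as a triple of tempered distributions. -/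
def grad (f : TDist) : Fin 3 → TDist := fun j => ∂_{(EuclideanSpace.single j (1 : ℝ) : E3)} f

/-! ### Littlewood-Paley decomposition -/

/-- `(φ, χ)` is a pair of Littlewood-Paley cut-off functions on `ℝ³`. -/
structure IsLittlewoodPaley (φ χ : E3 → ℝ) : Prop where
  smooth_annulus : ContDiff ℝ ((⊤ : ℕ∞) : WithTop ℕ∞) φ
  smooth_ball : ContDiff ℝ ((⊤ : ℕ∞) : WithTop ℕ∞) χ
  range_annulus : ∀ ξ, φ ξ ∈ Set.Icc (0 : ℝ) 1
  range_ball : ∀ ξ, χ ξ ∈ Set.Icc (0 : ℝ) 1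
  supp_annulus : ∀ ξ, φ ξ ≠ 0 → 3 / 4 ≤ ‖ξ‖ ∧ ‖ξ‖ ≤ 8 / 3
  supp_ball : ∀ ξ, χ ξ ≠ 0 → ‖ξ‖ ≤ 4 / 3
  sum_inhom : ∀ ξ, HasSum (fun q : ℕ => φ ((2 : ℝ) ^ (-(q : ℤ)) • ξ)) (1 - χ ξ)
  sum_hom : ∀ ξ, ξ ≠ 0 → HasSum (fun q : ℤ => φ ((2 : ℝ) ^ (-q) • ξ)) 1

/-- The operator `m(D)` with `D = -i∇`. The Fourier transform of Mathlib has the kernel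
`exp (-2πi x·ξ)`, so that `D` has the symbol `2πξ`. -/
def multD (m : E3 → ℝ) (f : TDist) : TDist :=
  TemperedDistribution.fourierMultiplierCLM ℂ
    (fun ξ : E3 => ((m ((2 * Real.pi) • ξ) : ℝ) : ℂ)) f

/-- The dyadic block `φ(2^{-q} D) f`, for `q ∈ ℤ`. -/
def block (φ : E3 → ℝ) (q : ℤ) (f : TDist) : TDist :=
  multD (fun ξ => φ ((2 : ℝ) ^ (-q) • ξ)) f

/-! ### Norms of scalar and vector-valued distributions

A scalar distribution `f` is regarded as the one-component vector `![f]`. All norms take the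
value `∞` on the distributions that do not belong to the space in question. -/

/-- The `L²` norm of a tempered distribution: the norm of the `L²` function that represents it,
and `∞` if there is none. -/
def l2 (f : TDist) : ℝ≥0∞ :=
  ⨅ (g : Lp ℂ 2 (volume : Measure E3)) (_ : (g : TDist) = f), ‖g‖ₑ

variable {ι : Type} [Fintype ι]

/-- The `L²` norm of a vector of distributions. -/
def l2Vec (F : ι → TDist) : ℝ≥0∞ := (∑ i, l2 (F i) ^ 2) ^ (1 / 2 : ℝ)

/-- The homogeneous norm `‖F‖_{Ḃ^s_{2,1}}`. -/
def homBesov (φ : E3 → ℝ) (s : ℝ) (F : ι → TDist) : ℝ≥0∞ :=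
  ∑' q : ℤ, ENNReal.ofReal ((2 : ℝ) ^ ((q : ℝ) * s)) * l2Vec (fun i => block φ q (F i))

/-- The inhomogeneous norm `‖f‖_{B^s_{2,1}}`. -/
def inhomBesov (φ χ : E3 → ℝ) (s : ℝ) (f : TDist) : ℝ≥0∞ :=
  ENNReal.ofReal ((2 : ℝ) ^ (-s)) * l2 (multD χ f) +
    ∑' q : ℕ, ENNReal.ofReal ((2 : ℝ) ^ ((q : ℝ) * s)) * l2 (block φ q f)

/-- The norm in `L^θ(0,T)`, `0 ≤ T ≤ ∞`, of a function of time. -/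
def timeNorm (θ T : ℝ≥0∞) (N : ℝ → ℝ≥0∞) : ℝ≥0∞ :=
  eLpNorm N θ (volume.restrict {t : ℝ | 0 ≤ t ∧ ENNReal.ofReal t ≤ T})

/-- The Chemin-Lerner norm in `L̃^θ_T(Ḃ^s_{2,1})`. -/
def homChemin (φ : E3 → ℝ) (θ T : ℝ≥0∞) (s : ℝ) (F : ℝ → ι → TDist) : ℝ≥0∞ :=
  ∑' q : ℤ, ENNReal.ofReal ((2 : ℝ) ^ ((q : ℝ) * s)) *
    timeNorm θ T (fun t => l2Vec (fun i => block φ q (F t i)))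

/-- The Chemin-Lerner norm in `L̃^θ_T(B^s_{2,1})`, `s > 0`. -/
def chemin (φ : E3 → ℝ) (θ T : ℝ≥0∞) (s : ℝ) (F : ℝ → ι → TDist) : ℝ≥0∞ :=
  timeNorm θ T (fun t => l2Vec (F t)) + homChemin φ θ T s F

/-! ### States and energy norms -/

/-- A state `U = (u, v, w)`. -/
abbrev State : Type := TDist × TDist × TDist

/-- First component of a state. -/
def cu (U : State) : TDist := U.1
/-- Second component of a state. -/
def cv (U : State) : TDist := U.2.1
/-- Third component of a state. -/
def cw (U : State) : TDist := U.2.2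

/-- `u + τ v`. -/
def uv (τ : ℝ) (U : State) : TDist := cu U + (τ : ℂ) • cv U
/-- `v + τ w`. -/
def vw (τ : ℝ) (U : State) : TDist := cv U + (τ : ℂ) • cw U

/-- `‖U‖_{𝓛²}`. -/
def energyL2 (τ : ℝ) (U : State) : ℝ≥0∞ :=
  (l2Vec ![vw τ U] ^ 2 + l2Vec (grad (vw τ U)) ^ 2 + l2Vec ![Δ (cv U)] ^ 2
    + l2Vec (grad (cv U)) ^ 2 + l2Vec ![Δ (uv τ U)] ^ 2 + l2Vec (grad (uv τ U)) ^ 2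
    + l2Vec ![cw U] ^ 2) ^ (1 / 2 : ℝ)

/-- The homogeneous energy norm of order `s`. -/
def energyHom (φ : E3 → ℝ) (τ s : ℝ) (U : State) : ℝ≥0∞ :=
  (homBesov φ s ![vw τ U] ^ 2 + homBesov φ s (grad (vw τ U)) ^ 2
    + homBesov φ s ![Δ (cv U)] ^ 2 + homBesov φ s (grad (cv U)) ^ 2
    + homBesov φ s ![Δ (uv τ U)] ^ 2 + homBesov φ s (grad (uv τ U)) ^ 2
    + homBesov φ s ![cw U] ^ 2) ^ (1 / 2 : ℝ)

/-- The energy norm `‖U‖_{𝓑^s_{2,1}}`. -/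
def energy (φ : E3 → ℝ) (τ s : ℝ) (U : State) : ℝ≥0∞ :=
  energyL2 τ U + energyHom φ τ s U

/-- The Chemin-Lerner energy norm `‖U‖_{L̃^∞_T(𝓑^s_{2,1})}`. -/
def energyChemin (φ : E3 → ℝ) (τ : ℝ) (T : ℝ≥0∞) (s : ℝ) (U : ℝ → State) : ℝ≥0∞ :=
  chemin φ ∞ T s (fun t => ![vw τ (U t)]) + chemin φ ∞ T s (fun t => grad (vw τ (U t)))
    + chemin φ ∞ T s (fun t => ![Δ (cv (U t))]) + chemin φ ∞ T s (fun t => grad (cv (U t)))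
    + chemin φ ∞ T s (fun t => ![Δ (uv τ (U t))]) + chemin φ ∞ T s (fun t => grad (uv τ (U t)))
    + chemin φ ∞ T s (fun t => ![cw (U t)])

/-- The Chemin-Lerner dissipation norm `‖U‖_{L̃²_T(𝔹^s_{2,1})}`. -/
def dissipationChemin (φ : E3 → ℝ) (τ : ℝ) (T : ℝ≥0∞) (s : ℝ) (U : ℝ → State) : ℝ≥0∞ :=
  chemin φ 2 T s (fun t => grad (cv (U t))) + chemin φ 2 T s (fun t => ![Δ (cv (U t))])
    + chemin φ 2 T s (fun t => ![cw (U t)]) + chemin φ 2 T s (fun t => ![Δ (uv τ (U t))])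
    + chemin φ 2 T s (fun t => grad (vw τ (U t)))

/-! ### Function spaces in time -/

/-- `U ∈ C([0,∞); 𝓑^s_{2,1})`. -/
def IsCont (φ : E3 → ℝ) (τ s : ℝ) (U : ℝ → State) : Prop :=
  ∀ t : ℝ, 0 ≤ t → energy φ τ s (U t) < ∞ ∧
    Tendsto (fun r => energy φ τ s (U r - U t)) (𝓝[Set.Ici 0] t) (𝓝 0)

/-- `U ∈ C̃(𝓑^s_{2,1})`. -/
def IsContTilde (φ : E3 → ℝ) (τ s : ℝ) (U : ℝ → State) : Prop :=
  IsCont φ τ s U ∧ energyChemin φ τ ∞ s U < ∞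

/-- `V` is the time derivative of `U` on `[0,∞)` with respect to the norm of `𝓑^s_{2,1}`. -/
def IsTimeDeriv (φ : E3 → ℝ) (τ s : ℝ) (U V : ℝ → State) : Prop :=
  ∀ t : ℝ, 0 ≤ t →
    Tendsto (fun r => energy φ τ s ((((r - t)⁻¹ : ℝ) : ℂ) • (U r - U t) - V t))
      (𝓝[Set.Ici 0 \ {t}] t) (𝓝 0)

/-- `U ∈ C̃¹(𝓑^s_{2,1})`: `U` and its time derivative are continuous with values in
`𝓑^s_{2,1}`, and the time derivative has a finite Chemin-Lerner norm. -/
def IsContDiffTilde (φ : E3 → ℝ) (τ s : ℝ) (U : ℝ → State) : Prop :=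
  IsCont φ τ s U ∧ ∃ V : ℝ → State, IsTimeDeriv φ τ s U V ∧ IsContTilde φ τ s V

/-! ### The Cauchy problem -/

/-- The equation `τ w_t = Δ u + β Δ v - w + (B/A) v w + 2 ∇u·∇v` at the time `t`, tested against
Schwartz functions: `v`, `w` and the components of `∇u` and `∇v` are `L²` functions at that time,
so that the quadratic terms are integrable functions of `x`. -/
def ThirdEquationAt (τ β A B : ℝ) (U : ℝ → State) (t : ℝ) : Prop :=
  ∃ (v w : Lp ℂ 2 (volume : Measure E3)) (gu gv : Fin 3 → Lp ℂ 2 (volume : Measure E3)),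
    (v : TDist) = cv (U t) ∧ (w : TDist) = cw (U t) ∧
    (∀ j, (gu j : TDist) = grad (cu (U t)) j) ∧ (∀ j, (gv j : TDist) = grad (cv (U t)) j) ∧
    ∀ ψ : 𝓢(E3, ℂ),
      HasDerivWithinAt (fun r : ℝ => (τ : ℂ) * cw (U r) ψ)
        ((Δ (cu (U t)) + (β : ℂ) • Δ (cv (U t)) - cw (U t)) ψ
          + ∫ x, ψ x * (((B / A : ℝ) : ℂ) * (v x * w x) + 2 * ∑ j, gu j x * gv j x))
        (Set.Ici 0) t

/-- `U = (u, v, w)` is a real-valued global solution of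
`u_t = v`, `v_t = w`, `τ w_t = Δ u + β Δ v - w + (B/A) v w + 2 ∇u·∇v`
with `U(0) = U₀`, in the sense of tempered distributions at every time `t ≥ 0`. -/
structure IsSolution (τ β A B : ℝ) (U₀ : State) (U : ℝ → State) : Prop where
  real : ∀ t : ℝ, 0 ≤ t → IsReal (cu (U t)) ∧ IsReal (cv (U t)) ∧ IsReal (cw (U t))
  init : U 0 = U₀
  eq_u : ∀ t : ℝ, 0 ≤ t → ∀ ψ : 𝓢(E3, ℂ),
    HasDerivWithinAt (fun r : ℝ => cu (U r) ψ) (cv (U t) ψ) (Set.Ici 0) t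
  eq_v : ∀ t : ℝ, 0 ≤ t → ∀ ψ : 𝓢(E3, ℂ),
    HasDerivWithinAt (fun r : ℝ => cv (U r) ψ) (cw (U t) ψ) (Set.Ici 0) t
  eq_w : ∀ t : ℝ, 0 ≤ t → ThirdEquationAt τ β A B U t

/-- Global solutions in the class `C̃(𝓑^{3/2}_{2,1}) ∩ C̃¹(𝓑^{1/2}_{2,1})`. -/
def IsGlobalSolution (φ : E3 → ℝ) (τ β A B : ℝ) (U₀ : State) (U : ℝ → State) : Prop :=
  IsSolution τ β A B U₀ U ∧ IsContTilde φ τ (3 / 2) U ∧ IsContDiffTilde φ τ (1 / 2) U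

end JMGT

end

/-!
Small data for the Jordan–Moore–Gibson–Thompson equation in the critical Besov space.

On the Fourier side the system is written for `p = |D|(u + τv)^`, `q = (1+|D|²)^{1/2} v^` and
`y = (v + τw)^`. The linear part becomes a multiplication by a matrix for each frequency, and a
Lyapunov functional adapted to the damping `β - τ > 0` controls, with constants that do not depend on
the frequency, both the size of `(p, q, y)` and the square integral in time of `ρp`, `ρq`, `ρy` and
`(1+|D|²)^{-1/2} w^`, where `ρ = |D|(1+|D|²)^{-1/2}` (`lyapunov_diss`, `lyapunov_lower`,
`lyapunov_bounds`, `linear_estimate`). The estimates are applied on sharp dyadic frequency blocks,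
on each of which the generator is bounded; the low frequencies `|D| < 1` form one block.

The quadratic terms `vw` and `∂ⱼu ∂ⱼv` are products of a factor that is dissipated and a factor that is
dissipated after multiplication by `ρ`. The loss of `ρ` at low frequencies is compensated by
Bernstein's inequality, because `1/ρ²`, of size `|ξ|⁻²` near the origin, is integrable in dimension
three (`exists_lintegral_inv_rho`, `enorm_convBlk_proj_le`). Each product of two dissipated blocks is
integrable in time, and with the weights `2^{5k/2}` the bounds can be summed over the blocks
(`sum_bilC`). Hence the nonlinearity maps the Chemin–Lerner space, with its dissipation, to forcing
terms that are integrable in time, and Picard iteration converges for small data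
(`BlockSystem.exists_global`). Uniqueness holds in the larger class of locally bounded trajectories, by
a Gronwall argument (`BlockSystem.unique`).

It remains to translate. The weighted sum over the blocks is equivalent to the energy norm of order
`3/2` (`Rep.energy_le`, `Rep.wNorm_le`), and states of finite energy have a Fourier picture
(`exists_rep`), `u₀` being square integrable by `exists_L2_of_laplacian`. The Fourier picture of a global
trajectory gives a solution (`exists_trajectory`, `IsTrajectory.isSolution`). It is real-valued by
uniqueness, the system being invariant under reflection and complex conjugation. Conversely every
solution of the class in the theorem is a trajectory of the Fourier picture, since its weak time
derivatives are continuous in `L²` and therefore strong (`exists_trajectory_of_isSolution`); so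
uniqueness carries over.
-/
set_option linter.unusedSectionVars false

noncomputable section

namespace JMGT

open scoped NNReal FourierTransform

/-! ### The energy method -/

section Lyapunov

variable {E E' : Type*} [NormedAddCommGroup E] [InnerProductSpace ℂ E] [CompleteSpace E]
  [NormedAddCommGroup E'] [NormedSpace ℂ E']

/-- If the time derivative of `Re ⟨Q ζ, ζ⟩` along the homogeneous equation is at most
`-2 c ‖D ζ‖²`, then the functional and the dissipation of the forced equation are controlled by the
data and by the forcing term. -/
lemma lyapunov_integrated {Q A : E →L[ℂ] E} {D : E →L[ℂ] E'} {c : ℝ}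
    (hsym : ∀ x y, inner ℂ (Q x) y = inner ℂ x (Q y))
    {ζ g : ℝ → E} (hg : Continuous g) (hζ : Continuous ζ)
    (hode : ∀ t, 0 ≤ t → HasDerivWithinAt ζ (A (ζ t) + g t) (Set.Ici 0) t)
    (hdiss : ∀ t, 0 ≤ t → (inner ℂ (Q (ζ t)) (A (ζ t))).re ≤ -c * ‖D (ζ t)‖ ^ 2)
    {t : ℝ} (ht : 0 ≤ t) :
    (inner ℂ (Q (ζ t)) (ζ t)).re + 2 * c * (∫ s in (0 : ℝ)..t, ‖D (ζ s)‖ ^ 2)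
      ≤ (inner ℂ (Q (ζ 0)) (ζ 0)).re + 2 * ‖Q‖ * ∫ s in (0 : ℝ)..t, ‖ζ s‖ * ‖g s‖ := by
  set Φ : ℝ → ℝ := fun t => (inner ℂ (Q (ζ t)) (ζ t)).re
    + 2 * c * (∫ s in (0 : ℝ)..t, ‖D (ζ s)‖ ^ 2)
    - 2 * ‖Q‖ * ∫ s in (0 : ℝ)..t, ‖ζ s‖ * ‖g s‖ with hΦ
  have hD : Continuous fun s => ‖D (ζ s)‖ ^ 2 := by fun_prop
  have hG : Continuous fun s => ‖ζ s‖ * ‖g s‖ := by fun_prop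
  have hder : ∀ s, 0 < s → HasDerivAt Φ
      ((inner ℂ (Q (ζ s)) (A (ζ s) + g s) + inner ℂ (Q (A (ζ s) + g s)) (ζ s)).re
        + 2 * c * ‖D (ζ s)‖ ^ 2 - 2 * ‖Q‖ * (‖ζ s‖ * ‖g s‖)) s := by
    intro s hs
    have h1 : HasDerivAt ζ (A (ζ s) + g s) s := (hode s hs.le).hasDerivAt (Ici_mem_nhds hs)
    have h2 : HasDerivAt (fun t => Q (ζ t)) (Q (A (ζ s) + g s)) s :=
      (Q.restrictScalars ℝ).hasFDerivAt.comp_hasDerivAt s h1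
    have h3 := HasDerivAt.inner ℂ h2 h1
    have h4 := Complex.reCLM.hasFDerivAt.comp_hasDerivAt s h3
    exact (h4.add ((hD.integral_hasStrictDerivAt 0 s).hasDerivAt.const_mul (2 * c))).sub
      ((hG.integral_hasStrictDerivAt 0 s).hasDerivAt.const_mul (2 * ‖Q‖))
  have hcont : ContinuousOn Φ (Set.Ici 0) := by
    have h1 : Continuous fun t => (inner ℂ (Q (ζ t)) (ζ t)).re :=
      Complex.continuous_re.comp (Continuous.inner (by fun_prop) hζ)
    have h2 : Continuous fun t => ∫ s in (0 : ℝ)..t, ‖D (ζ s)‖ ^ 2 :=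
      continuous_iff_continuousAt.2 fun s => (hD.integral_hasStrictDerivAt 0 s).hasDerivAt.continuousAt
    have h3 : Continuous fun t => ∫ s in (0 : ℝ)..t, ‖ζ s‖ * ‖g s‖ :=
      continuous_iff_continuousAt.2 fun s => (hG.integral_hasStrictDerivAt 0 s).hasDerivAt.continuousAt
    exact ((h1.add (h2.const_mul _)).sub (h3.const_mul _)).continuousOn
  -- `Φ' ≤ 0` on `(0, ∞)`: the dissipation and the Cauchy-Schwarz bound of the forcing term
  -- compensate the last two terms of `Φ`
  have hanti : AntitoneOn Φ (Set.Ici 0) := by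
    refine antitoneOn_of_deriv_nonpos (convex_Ici 0) hcont ?_ ?_
    · intro s hs
      rw [interior_Ici] at hs
      exact (hder s hs).differentiableAt.differentiableWithinAt
    · intro s hs
      rw [interior_Ici] at hs
      rw [(hder s hs).deriv]
      have e1 : (inner ℂ (Q (A (ζ s) + g s)) (ζ s)).re
          = (inner ℂ (Q (ζ s)) (A (ζ s) + g s)).re := by
        rw [hsym, ← inner_conj_symm, Complex.conj_re]
      have e2 : (inner ℂ (Q (ζ s)) (g s)).re ≤ ‖Q‖ * (‖ζ s‖ * ‖g s‖) := by
        calc _ ≤ ‖inner ℂ (Q (ζ s)) (g s)‖ := Complex.re_le_norm _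
          _ ≤ ‖Q (ζ s)‖ * ‖g s‖ := norm_inner_le_norm _ _
          _ ≤ (‖Q‖ * ‖ζ s‖) * ‖g s‖ := by gcongr; exact Q.le_opNorm _
          _ = _ := by ring
      have e3 := hdiss s hs.le
      rw [Complex.add_re, e1, inner_add_right, Complex.add_re]
      linarith
  have := hanti (Set.mem_Ici.2 le_rfl) (Set.mem_Ici.2 ht) ht
  simp only [hΦ, intervalIntegral.integral_same, mul_zero, add_zero, sub_zero] at this
  linarith

/-- The energy method: a Lyapunov functional that is equivalent to the square of the norm bounds
the trajectory of a forced linear equation and its dissipation, with constants that do not depend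
on the size of the generator. -/
lemma lyapunov_bounds {Q A : E →L[ℂ] E} {D : E →L[ℂ] E'} {c : ℝ} (hc : 0 < c)
    (hsym : ∀ x y, inner ℂ (Q x) y = inner ℂ x (Q y))
    {ζ g : ℝ → E} (hg : Continuous g) (hζ : Continuous ζ)
    (hode : ∀ t, 0 ≤ t → HasDerivWithinAt ζ (A (ζ t) + g t) (Set.Ici 0) t)
    (hdiss : ∀ t, 0 ≤ t → (inner ℂ (Q (ζ t)) (A (ζ t))).re ≤ -c * ‖D (ζ t)‖ ^ 2)
    (hlow : ∀ t, 0 ≤ t → c * ‖ζ t‖ ^ 2 ≤ (inner ℂ (Q (ζ t)) (ζ t)).re)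
    {T : ℝ} (hT : 0 ≤ T) :
    (∀ t ∈ Set.Icc 0 T, ‖ζ t‖ ≤ (1 + 2 * ‖Q‖ / c) * (‖ζ 0‖ + ∫ s in (0 : ℝ)..T, ‖g s‖)) ∧
    ∫ s in (0 : ℝ)..T, ‖D (ζ s)‖ ^ 2
      ≤ ((1 + 2 * ‖Q‖ / c) * (‖ζ 0‖ + ∫ s in (0 : ℝ)..T, ‖g s‖)) ^ 2 := by
  obtain ⟨t₀, ht₀, hmax⟩ := isCompact_Icc.exists_isMaxOn (Set.nonempty_Icc.2 hT)
    (hζ.norm.continuousOn (s := Set.Icc 0 T))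
  set m := ‖ζ t₀‖
  set q := ‖Q‖
  set G := ∫ s in (0 : ℝ)..T, ‖g s‖
  have hG0 : 0 ≤ G := intervalIntegral.integral_nonneg hT fun _ _ => norm_nonneg _
  have hq : 0 ≤ q := norm_nonneg _
  have hm : 0 ≤ m := norm_nonneg _
  have hz : ‖ζ 0‖ ≤ m := hmax (Set.left_mem_Icc.2 hT)
  have key : ∀ t ∈ Set.Icc 0 T, (inner ℂ (Q (ζ t)) (ζ t)).re
      + 2 * c * (∫ s in (0 : ℝ)..t, ‖D (ζ s)‖ ^ 2) ≤ q * ‖ζ 0‖ ^ 2 + 2 * q * (m * G) := by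
    intro t ht
    refine (lyapunov_integrated hsym hg hζ hode hdiss ht.1).trans ?_
    have h1 : (inner ℂ (Q (ζ 0)) (ζ 0)).re ≤ q * ‖ζ 0‖ ^ 2 := by
      calc _ ≤ ‖inner ℂ (Q (ζ 0)) (ζ 0)‖ := Complex.re_le_norm _
        _ ≤ ‖Q (ζ 0)‖ * ‖ζ 0‖ := norm_inner_le_norm _ _
        _ ≤ (q * ‖ζ 0‖) * ‖ζ 0‖ := by gcongr; exact Q.le_opNorm _
        _ = _ := by ring
    have h2 : ∫ s in (0 : ℝ)..t, ‖ζ s‖ * ‖g s‖ ≤ m * G := by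
      calc _ ≤ ∫ s in (0 : ℝ)..T, ‖ζ s‖ * ‖g s‖ := by
            refine intervalIntegral.integral_mono_interval le_rfl ht.1 ht.2 ?_
              ((hζ.norm.mul hg.norm).intervalIntegrable _ _)
            exact Eventually.of_forall fun _ => by positivity
        _ ≤ ∫ s in (0 : ℝ)..T, m * ‖g s‖ := by
            refine intervalIntegral.integral_mono_on hT
              ((hζ.norm.mul hg.norm).intervalIntegrable _ _)
              ((hg.norm.const_mul m).intervalIntegrable _ _) fun s hs => ?_
            exact mul_le_mul_of_nonneg_right (hmax hs) (norm_nonneg _)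
        _ = _ := by rw [intervalIntegral.integral_const_mul]
    have := mul_le_mul_of_nonneg_left h2 (by positivity : 0 ≤ 2 * q)
    linarith
  have hDnn : ∀ t, 0 ≤ t → 0 ≤ ∫ s in (0 : ℝ)..t, ‖D (ζ s)‖ ^ 2 := fun t ht =>
    intervalIntegral.integral_nonneg ht fun _ _ => by positivity
  -- the maximum `m` of `‖ζ‖` is bounded by `2 q m S / c`, and one factor `m` cancels
  have hm2 : c * m ^ 2 ≤ q * ‖ζ 0‖ ^ 2 + 2 * q * (m * G) := by
    have h1 := key t₀ ht₀
    have h2 := hlow t₀ ht₀.1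
    have h3 := mul_nonneg (by positivity : 0 ≤ 2 * c) (hDnn t₀ ht₀.1)
    linarith
  set S := ‖ζ 0‖ + G with hS
  have hS0 : 0 ≤ S := by positivity
  have hb : q * ‖ζ 0‖ ^ 2 + 2 * q * (m * G) ≤ 2 * q * (m * S) := by
    have h1 : ‖ζ 0‖ ^ 2 ≤ m * ‖ζ 0‖ := by nlinarith [norm_nonneg (ζ 0)]
    have h2 : 0 ≤ q * (m * ‖ζ 0‖) := by positivity
    rw [hS]
    nlinarith [mul_le_mul_of_nonneg_left h1 hq]
  have hmK : m ≤ (2 * q / c) * S := by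
    rcases hm.eq_or_lt with h | h
    · rw [← h]; positivity
    · have : c * m ≤ 2 * q * S := by
        refine le_of_mul_le_mul_right ?_ h
        nlinarith
      rw [div_mul_eq_mul_div, le_div_iff₀ hc]
      linarith
  have hK0 : 0 ≤ 2 * q / c := by positivity
  refine ⟨fun t ht => (hmax ht).trans (hmK.trans ?_), ?_⟩
  · nlinarith
  · have h1 := key T ⟨hT, le_rfl⟩
    have h2 : 0 ≤ (inner ℂ (Q (ζ T)) (ζ T)).re := le_trans (by positivity) (hlow T hT)
    have h3 : 2 * c * (∫ s in (0 : ℝ)..T, ‖D (ζ s)‖ ^ 2) ≤ 2 * q * ((2 * q / c) * S * S) := by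
      have : 2 * q * (m * S) ≤ 2 * q * ((2 * q / c) * S * S) := by gcongr
      linarith
    have h4 : (∫ s in (0 : ℝ)..T, ‖D (ζ s)‖ ^ 2) ≤ (q / c) * (2 * q / c) * S ^ 2 := by
      have : 2 * c * ((q / c) * (2 * q / c) * S ^ 2) = 2 * q * ((2 * q / c) * S * S) := by
        field_simp
      rw [← this] at h3
      exact le_of_mul_le_mul_left h3 (by positivity)
    refine h4.trans ?_
    rw [mul_pow]
    gcongr
    have h5 : q / c * (2 * q / c) = (2 * q / c) ^ 2 / 2 := by ring
    rw [h5]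
    nlinarith [sq_nonneg (2 * q / c)]

end Lyapunov

/-! ### Linear equations with bounded generator -/

/-- Variation of constants for a bounded generator. -/
lemma exists_linear_ode {E : Type*} [NormedAddCommGroup E] [NormedSpace ℂ E] [CompleteSpace E]
    (A : E →L[ℂ] E) (z : E) {g : ℝ → E} (hg : Continuous g) :
    ∃ ζ : ℝ → E, ζ 0 = z ∧ ∀ t, HasDerivAt ζ (A (ζ t) + g t) t := by
  set S : ℝ → E →L[ℂ] E := fun t => NormedSpace.exp (t • A) with hS
  have hSd : ∀ t, HasDerivAt S (A * S t) t := fun t => hasDerivAt_exp_smul_const' A t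
  have hSc : Continuous S := continuous_iff_continuousAt.2 fun t => (hSd t).continuousAt
  have hinv : ∀ t, S t * S (-t) = 1 := fun t => by
    have h : Commute (t • A) ((-t) • A) := by
      refine Commute.smul_left (Commute.smul_right (Commute.refl A) _) _
    rw [hS]
    simp only
    let _ : NormedAlgebra ℚ (E →L[ℂ] E) := NormedAlgebra.restrictScalars ℚ ℝ _
    rw [← NormedSpace.exp_add_of_commute h, ← add_smul, add_neg_cancel, zero_smul,
      NormedSpace.exp_zero]
  have hint : Continuous fun s => S (-s) (g s) := (hSc.comp continuous_neg).clm_apply hg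
  set w : ℝ → E := fun t => z + ∫ s in (0 : ℝ)..t, S (-s) (g s)
  have hw : ∀ t, HasDerivAt w (S (-t) (g t)) t := fun t =>
    ((hint.integral_hasStrictDerivAt 0 t).hasDerivAt).const_add z
  refine ⟨fun t => S t (w t), by simp [hS, w], fun t => ?_⟩
  have hb := ((isBoundedBilinearMap_apply (𝕜 := ℂ) (E := E) (F := E)).hasFDerivAt
    (S t, w t)).restrictScalars ℝ
  have := hb.comp_hasDerivAt t ((hSd t).prodMk (hw t))
  refine this.congr_deriv ?_
  have h2 : S t (S (-t) (g t)) = g t := by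
    have := congrArg (fun B : E →L[ℂ] E => B (g t)) (hinv t)
    simpa using this
  change S t (S (-t) (g t)) + (A * S t) (w t) = A (S t (w t)) + g t
  rw [h2, add_comm]
  rfl

/-! ### Norms of trajectories -/

section TimeNorms

variable {F : Type*} [NormedAddCommGroup F]

/-- The supremum of the norm of a trajectory over `[0,∞)`. -/
def supN (f : ℝ → F) : ℝ≥0∞ := ⨆ t : Set.Ici (0 : ℝ), ‖f t‖ₑ

/-- The `L²(0,∞)` norm of a trajectory. -/
def l2N (f : ℝ → F) : ℝ≥0∞ := eLpNorm f 2 (volume.restrict (Set.Ici 0))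

lemma enorm_le_supN (f : ℝ → F) {t : ℝ} (ht : 0 ≤ t) : ‖f t‖ₑ ≤ supN f :=
  le_iSup (fun t : Set.Ici (0 : ℝ) => ‖f t‖ₑ) ⟨t, ht⟩

lemma l2N_sq (f : ℝ → F) : l2N f ^ 2 = ∫⁻ t in Set.Ici (0 : ℝ), ‖f t‖ₑ ^ 2 := by
  have := eLpNorm_nnreal_pow_eq_lintegral (f := f) (μ := volume.restrict (Set.Ici (0 : ℝ)))
    (p := 2) (by norm_num)
  rw [l2N]
  simpa using this

lemma l2N_eq (f : ℝ → F) :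
    l2N f = (∫⁻ t in Set.Ici (0 : ℝ), ‖f t‖ₑ ^ (2 : ℝ)) ^ (1 / 2 : ℝ) := by
  rw [l2N, eLpNorm_eq_lintegral_rpow_enorm_toReal (by norm_num) (by norm_num)]
  simp

lemma lintegral_mul_le_l2N {F' : Type*} [NormedAddCommGroup F'] {f : ℝ → F} {g : ℝ → F'}
    (hf : Continuous f) (hg : Continuous g) :
    ∫⁻ t in Set.Ici (0 : ℝ), ‖f t‖ₑ * ‖g t‖ₑ ≤ l2N f * l2N g := by
  have h := ENNReal.lintegral_mul_le_Lp_mul_Lq (volume.restrict (Set.Ici (0 : ℝ)))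
    Real.HolderConjugate.two_two hf.enorm.aemeasurable hg.enorm.aemeasurable
  rw [l2N_eq f, l2N_eq g]
  exact h

lemma ofReal_intervalIntegral {f : ℝ → ℝ} (hf : Continuous f) (h0 : ∀ t, 0 ≤ f t) {T : ℝ}
    (hT : 0 ≤ T) :
    ENNReal.ofReal (∫ t in (0 : ℝ)..T, f t) = ∫⁻ t in Set.Icc 0 T, ENNReal.ofReal (f t) := by
  rw [intervalIntegral.integral_of_le hT, ← integral_Icc_eq_integral_Ioc,
    ofReal_integral_eq_lintegral_ofReal]
  · exact hf.continuousOn.integrableOn_Icc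
  · exact Eventually.of_forall h0

lemma lintegral_Ici_eq_iSup (f : ℝ → ℝ≥0∞) :
    ∫⁻ t in Set.Ici (0 : ℝ), f t = ⨆ n : ℕ, ∫⁻ t in Set.Icc (0 : ℝ) n, f t := by
  rw [← setLIntegral_iUnion_of_directed]
  · congr 2
    ext t
    simp only [Set.mem_Ici, Set.mem_iUnion, Set.mem_Icc]
    exact ⟨fun h => let ⟨n, hn⟩ := exists_nat_ge t; ⟨n, h, hn⟩, fun ⟨_, h, _⟩ => h⟩
  · refine Monotone.directed_le (fun m n hmn => ?_)
    exact Set.Icc_subset_Icc_right (by exact_mod_cast hmn)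

end TimeNorms

/-! ### Block systems -/

/-- An evolution equation `Z' = A Z + N(Z, Z)` that is decomposed into blocks, on each of which the
generator is bounded. `D` is the dissipation: the linear equation controls the supremum of `‖P k Z‖`
and the `L²` norm in time of `‖D (P k Z)‖` with a constant `KL` that is independent of `k`, and the
nonlinearity is bounded by two dissipation factors. The weights `ω` define the space of data. -/
structure BlockSystem (E E' : Type*) [NormedAddCommGroup E] [NormedSpace ℂ E]
    [NormedAddCommGroup E'] [NormedSpace ℂ E'] where
  P : ℕ → E →L[ℂ] E
  A : ℕ → E →L[ℂ] E
  D : E →L[ℂ] E'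
  N : ℕ → E →L[ℂ] E →L[ℂ] E
  ω : ℕ → ℝ≥0∞
  c : ℕ → ℕ → ℕ → ℝ≥0∞
  KL : ℝ≥0
  KN : ℝ≥0
  one_le_ω : ∀ k, 1 ≤ ω k
  ω_ne_top : ∀ k, ω k ≠ ∞
  P_P : ∀ j k x, P j (P k x) = if j = k then P k x else 0
  eq_zero : ∀ x, (∀ k, P k x = 0) → x = 0
  P_A : ∀ k x, P k (A k x) = A k x
  A_P : ∀ k x, A k (P k x) = A k x
  P_N : ∀ k x y, P k (N k x y) = N k x y
  linear : ∀ (k : ℕ) (ζ g : ℝ → E), Continuous ζ → Continuous g → (∀ t, 0 ≤ t → P k (ζ t) = ζ t) →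
    (∀ t, 0 ≤ t → HasDerivWithinAt ζ (A k (ζ t) + g t) (Set.Ici 0) t) → ∀ T, 0 ≤ T →
    (∀ t ∈ Set.Icc 0 T, ‖ζ t‖ ≤ KL * (‖ζ 0‖ + ∫ s in (0 : ℝ)..T, ‖g s‖)) ∧
      ∫ s in (0 : ℝ)..T, ‖D (ζ s)‖ ^ 2 ≤ (KL * (‖ζ 0‖ + ∫ s in (0 : ℝ)..T, ‖g s‖)) ^ 2
  bilinear : ∀ l x y, ‖N l x y‖ₑ ≤ ∑' j, ∑' k, c l j k * (‖D (P j x)‖ₑ * ‖D (P k y)‖ₑ)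
  sum_c : ∀ j k, ∑' l, ω l * c l j k ≤ KN * (ω j * ω k)

namespace BlockSystem

variable {E E' : Type*} [NormedAddCommGroup E] [NormedSpace ℂ E]
  [NormedAddCommGroup E'] [NormedSpace ℂ E'] (S : BlockSystem E E')

/-- The norm of the space of data. -/
def X (x : E) : ℝ≥0∞ := ∑' k, S.ω k * ‖S.P k x‖ₑ

/-- The Chemin-Lerner norm of a trajectory, supremum in time. -/
def SX (Z : ℝ → E) : ℝ≥0∞ := ∑' k, S.ω k * supN (fun t => S.P k (Z t))

/-- The Chemin-Lerner norm of the dissipation of a trajectory, square integral in time. -/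
def SD (Z : ℝ → E) : ℝ≥0∞ := ∑' k, S.ω k * l2N (fun t => S.D (S.P k (Z t)))

/-- The norm of a forcing term, integral in time. -/
def SF (h : ℕ → ℝ → E) : ℝ≥0∞ := ∑' k, S.ω k * ∫⁻ t in Set.Ici (0 : ℝ), ‖h k t‖ₑ

/-- `Z` solves the linear equation with forcing `h k` on the block `k`. -/
def Solves (Z : ℝ → E) (h : ℕ → ℝ → E) : Prop :=
  ∀ k t, 0 ≤ t → HasDerivWithinAt (fun t => S.P k (Z t)) (S.A k (Z t) + h k t) (Set.Ici 0) t

lemma P_idem (k : ℕ) (x : E) : S.P k (S.P k x) = S.P k x := by simp [S.P_P]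

lemma ext_P {x y : E} (h : ∀ k, S.P k x = S.P k y) : x = y :=
  sub_eq_zero.1 (S.eq_zero _ fun k => by rw [map_sub, h, sub_self])

lemma tsum_enorm_le_X (x : E) : ∑' k, ‖S.P k x‖ₑ ≤ S.X x :=
  ENNReal.tsum_le_tsum fun k => le_mul_of_one_le_left' (S.one_le_ω k)

lemma X_le_SX (Z : ℝ → E) {t : ℝ} (ht : 0 ≤ t) : S.X (Z t) ≤ S.SX Z :=
  ENNReal.tsum_le_tsum fun _ => by gcongr; exact enorm_le_supN _ ht

lemma P_tsum [CompleteSpace E] {a : ℕ → E} (ha : ∀ k, S.P k (a k) = a k)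
    (hs : Summable a) (j : ℕ) : S.P j (∑' k, a k) = a j := by
  rw [(S.P j).map_tsum hs, tsum_eq_single j, ha]
  intro k hk
  rw [← ha k, S.P_P, if_neg hk.symm]

lemma enorm_le_tsum [CompleteSpace E] (x : E) : ‖x‖ₑ ≤ ∑' k, ‖S.P k x‖ₑ := by
  by_cases h : ∑' k, ‖S.P k x‖ₑ = ∞
  · simp [h]
  have hs : Summable fun k => S.P k x := by
    refine Summable.of_norm ?_
    have := ENNReal.summable_toReal h
    simpa using this
  have : x = ∑' k, S.P k x := S.ext_P fun j => (S.P_tsum (fun k => S.P_idem k x) hs j).symm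
  conv_lhs => rw [this]
  exact enorm_tsum_le_tsum_enorm

lemma enorm_le_X [CompleteSpace E] (x : E) : ‖x‖ₑ ≤ S.X x :=
  (S.enorm_le_tsum x).trans (S.tsum_enorm_le_X x)

/-- The sum over the output frequency `l` of the bilinear bounds factorizes. -/
lemma sum_bilinear_le (f g : ℕ → ℝ≥0∞) :
    ∑' l, S.ω l * ∑' j, ∑' k, S.c l j k * (f j * g k) ≤
      S.KN * ((∑' j, S.ω j * f j) * ∑' k, S.ω k * g k) := by
  calc _ = ∑' j, ∑' k, (∑' l, S.ω l * S.c l j k) * (f j * g k) := by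
        simp_rw [← ENNReal.tsum_mul_left, ← ENNReal.tsum_mul_right, ← mul_assoc]
        rw [ENNReal.tsum_comm]
        exact tsum_congr fun j => ENNReal.tsum_comm
    _ ≤ ∑' j, ∑' k, (S.KN * (S.ω j * S.ω k)) * (f j * g k) := by
        gcongr with j k
        exact S.sum_c j k
    _ = _ := by
        rw [← ENNReal.tsum_mul_right, ← ENNReal.tsum_mul_left]
        refine tsum_congr fun j => ?_
        rw [← ENNReal.tsum_mul_left, ← ENNReal.tsum_mul_left]
        exact tsum_congr fun k => by ring

/-- The linear estimate on one block, in the extended nonnegative reals. -/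
lemma block_linear {k : ℕ} {ζ g : ℝ → E} (hζ : Continuous ζ) (hg : Continuous g)
    (hP : ∀ t, 0 ≤ t → S.P k (ζ t) = ζ t)
    (hode : ∀ t, 0 ≤ t → HasDerivWithinAt ζ (S.A k (ζ t) + g t) (Set.Ici 0) t) {T : ℝ}
    (hT : 0 ≤ T) :
    (∀ t ∈ Set.Icc 0 T, ‖ζ t‖ₑ ≤ S.KL * (‖ζ 0‖ₑ + ∫⁻ s in Set.Icc 0 T, ‖g s‖ₑ)) ∧
      ∫⁻ s in Set.Icc 0 T, ‖S.D (ζ s)‖ₑ ^ 2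
        ≤ (S.KL * (‖ζ 0‖ₑ + ∫⁻ s in Set.Icc 0 T, ‖g s‖ₑ)) ^ 2 := by
  obtain ⟨h1, h2⟩ := S.linear k ζ g hζ hg hP hode T hT
  have e0 : 0 ≤ ∫ s in (0 : ℝ)..T, ‖g s‖ :=
    intervalIntegral.integral_nonneg hT fun _ _ => norm_nonneg _
  have e1 : ENNReal.ofReal (S.KL * (‖ζ 0‖ + ∫ s in (0 : ℝ)..T, ‖g s‖))
      = S.KL * (‖ζ 0‖ₑ + ∫⁻ s in Set.Icc 0 T, ‖g s‖ₑ) := by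
    rw [ENNReal.ofReal_mul (by positivity), ENNReal.ofReal_add (norm_nonneg _) e0,
      ofReal_intervalIntegral hg.norm (fun _ => norm_nonneg _) hT]
    simp only [ofReal_norm, ENNReal.ofReal_coe_nnreal]
  refine ⟨fun t ht => ?_, ?_⟩
  · rw [← e1, ← ofReal_norm]
    exact ENNReal.ofReal_le_ofReal (h1 t ht)
  · rw [← e1, ← ENNReal.ofReal_pow (by positivity)]
    refine le_trans (le_of_eq ?_) (ENNReal.ofReal_le_ofReal h2)
    rw [ofReal_intervalIntegral (by fun_prop) (fun _ => by positivity) hT]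
    refine lintegral_congr fun s => ?_
    rw [ENNReal.ofReal_pow (norm_nonneg _), ofReal_norm]

variable {S} in
/-- A priori estimate of the linear equation, summed over the blocks. -/
lemma Solves.size {Z : ℝ → E} {h : ℕ → ℝ → E} (hZ : S.Solves Z h) (hc : Continuous Z)
    (hh : ∀ k, Continuous (h k)) :
    S.SX Z ≤ S.KL * (S.X (Z 0) + S.SF h) ∧ S.SD Z ≤ S.KL * (S.X (Z 0) + S.SF h) := by
  have hsum : S.KL * (S.X (Z 0) + S.SF h)
      = ∑' k, S.ω k * (S.KL * (‖S.P k (Z 0)‖ₑ + ∫⁻ t in Set.Ici (0 : ℝ), ‖h k t‖ₑ)) := by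
    rw [X, SF, ← ENNReal.tsum_add, ← ENNReal.tsum_mul_left]
    exact tsum_congr fun k => by ring
  have hb : ∀ k, ∀ T : ℝ, 0 ≤ T → _ := fun k T hT =>
    S.block_linear (k := k) (ζ := fun t => S.P k (Z t)) (g := h k) (by fun_prop) (hh k)
      (fun t _ => S.P_idem k _) (fun t ht => by rw [S.A_P]; exact hZ k t ht) hT
  have hI : ∀ k T, ∫⁻ s in Set.Icc 0 T, ‖h k s‖ₑ ≤ ∫⁻ t in Set.Ici (0 : ℝ), ‖h k t‖ₑ :=
    fun k T => lintegral_mono_set fun t ht => ht.1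
  rw [hsum]
  constructor
  · refine ENNReal.tsum_le_tsum fun k => ?_
    gcongr
    refine iSup_le fun t => ((hb k t t.2).1 t ⟨t.2, le_rfl⟩).trans ?_
    exact mul_le_mul_right (add_le_add_right (hI k t) _) _
  · refine ENNReal.tsum_le_tsum fun k => ?_
    gcongr
    rw [← ENNReal.pow_le_pow_left_iff (two_ne_zero), l2N_sq, lintegral_Ici_eq_iSup]
    refine iSup_le fun n => ((hb k n n.cast_nonneg).2).trans ?_
    exact pow_le_pow_left₀ (zero_le) (mul_le_mul_right (add_le_add_right (hI k n) _) _) 2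

/-- The nonlinearity is integrable in time, being bounded by two factors that are square integrable
in time: Cauchy-Schwarz on every pair of blocks. -/
lemma SF_bilinear {Z Z' : ℝ → E} (hZ : Continuous Z) (hZ' : Continuous Z') :
    S.SF (fun l t => S.N l (Z t) (Z' t)) ≤ S.KN * (S.SD Z * S.SD Z') := by
  set I : ℕ → ℝ≥0∞ := fun j => l2N (fun t => S.D (S.P j (Z t)))
  set I' : ℕ → ℝ≥0∞ := fun j => l2N (fun t => S.D (S.P j (Z' t)))
  have h1 : ∀ l, ∫⁻ t in Set.Ici (0 : ℝ), ‖S.N l (Z t) (Z' t)‖ₑ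
      ≤ ∑' j, ∑' k, S.c l j k * (I j * I' k) := by
    intro l
    calc _ ≤ ∫⁻ t in Set.Ici (0 : ℝ),
          ∑' j, ∑' k, S.c l j k * (‖S.D (S.P j (Z t))‖ₑ * ‖S.D (S.P k (Z' t))‖ₑ) :=
          lintegral_mono fun t => S.bilinear l _ _
      _ = ∑' j, ∑' k, ∫⁻ t in Set.Ici (0 : ℝ),
          S.c l j k * (‖S.D (S.P j (Z t))‖ₑ * ‖S.D (S.P k (Z' t))‖ₑ) := by
          have hmeas : ∀ j k, Measurable fun t =>
              S.c l j k * (‖S.D (S.P j (Z t))‖ₑ * ‖S.D (S.P k (Z' t))‖ₑ) := fun j k => by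
            have a1 : Continuous fun t => S.D (S.P j (Z t)) := by fun_prop
            have a2 : Continuous fun t => S.D (S.P k (Z' t)) := by fun_prop
            exact (a1.enorm.measurable.mul a2.enorm.measurable).const_mul _
          rw [lintegral_tsum fun j => (Measurable.tsum fun k => hmeas j k).aemeasurable]
          exact tsum_congr fun j => lintegral_tsum fun k => (hmeas j k).aemeasurable
      _ ≤ _ := by
          refine ENNReal.tsum_le_tsum fun j => ENNReal.tsum_le_tsum fun k => ?_
          have a1 : Continuous fun t => S.D (S.P j (Z t)) := by fun_prop
          have a2 : Continuous fun t => S.D (S.P k (Z' t)) := by fun_prop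
          have a3 : Measurable fun t => ‖S.D (S.P j (Z t))‖ₑ * ‖S.D (S.P k (Z' t))‖ₑ :=
            a1.enorm.measurable.mul a2.enorm.measurable
          rw [lintegral_const_mul _ a3]
          gcongr
          exact lintegral_mul_le_l2N a1 a2
  calc _ ≤ ∑' l, S.ω l * ∑' j, ∑' k, S.c l j k * (I j * I' k) :=
        ENNReal.tsum_le_tsum fun l => by gcongr; exact h1 l
    _ ≤ _ := S.sum_bilinear_le I I'

end BlockSystem

/-! ### Existence and uniqueness for block systems -/

/-- Weighted `ℓ¹` norms are lower semicontinuous. -/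
lemma tsum_mul_le_of_le_liminf {ω : ℕ → ℝ≥0∞} {a : ℕ → ℝ≥0∞} {b : ℕ → ℕ → ℝ≥0∞} {M : ℝ≥0∞}
    (h : ∀ k, a k ≤ liminf (fun n => b n k) atTop) (hM : ∀ n, ∑' k, ω k * b n k ≤ M) :
    ∑' k, ω k * a k ≤ M := by
  calc ∑' k, ω k * a k ≤ ∑' k, liminf (fun n => ω k * b n k) atTop := by
        refine ENNReal.tsum_le_tsum fun k => (mul_le_mul_right (h k) _).trans ?_
        have := ENNReal.le_liminf_mul (f := atTop) (u := fun _ : ℕ => ω k) (v := fun n => b n k)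
        rw [liminf_const] at this
        exact this
    _ = ∫⁻ k, liminf (fun n => ω k * b n k) atTop ∂Measure.count := (lintegral_count _).symm
    _ ≤ liminf (fun n => ∫⁻ k, ω k * b n k ∂Measure.count) atTop :=
        lintegral_liminf_le fun n => measurable_of_countable _
    _ ≤ liminf (fun _ : ℕ => M) atTop := by
        refine liminf_le_liminf (Eventually.of_forall fun n => ?_)
        rw [lintegral_count]
        exact hM n
    _ = M := liminf_const _

namespace BlockSystem

variable {E E' : Type*} [NormedAddCommGroup E] [NormedSpace ℂ E] [CompleteSpace E]
  [NormedAddCommGroup E'] [NormedSpace ℂ E'] (S : BlockSystem E E')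

/-- The equation on one block has a bounded generator, so that it can be solved explicitly. -/
lemma exists_block (k : ℕ) (z : E) {h : ℝ → E} (hh : Continuous h) (hP : ∀ t, S.P k (h t) = h t) :
    ∃ ζ : ℝ → E, ζ 0 = S.P k z ∧ (∀ t, S.P k (ζ t) = ζ t) ∧
      ∀ t, HasDerivAt ζ (S.A k (ζ t) + h t) t := by
  obtain ⟨ζ, h0, hd⟩ := exists_linear_ode (S.A k) (S.P k z) hh
  refine ⟨ζ, h0, fun t => ?_, hd⟩
  have hd' : ∀ t, HasDerivAt (fun t => ζ t - S.P k (ζ t)) 0 t := fun t => by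
    have h1 := ((S.P k).restrictScalars ℝ).hasFDerivAt.comp_hasDerivAt t (hd t)
    refine ((hd t).sub h1).congr_deriv ?_
    simp [S.P_A, hP]
  have := is_const_of_deriv_eq_zero (fun t => (hd' t).differentiableAt) (fun t => (hd' t).deriv) t 0
  simp only [h0, S.P_idem, sub_self] at this
  exact (sub_eq_zero.1 this).symm

/-- The linear problem with forcing. The value at negative times is frozen at time `0`. -/
lemma exists_solves (z : E) (hX : S.X z ≠ ∞) (h : ℕ → ℝ → E) (hh : ∀ k, Continuous (h k))
    (hP : ∀ k t, S.P k (h k t) = h k t) (hF : S.SF h ≠ ∞) :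
    ∃ Z : ℝ → E, Continuous Z ∧ (∀ t, Z t = Z (max t 0)) ∧ Z 0 = z ∧ S.Solves Z h := by
  choose ζ h0 hPζ hd using fun k => S.exists_block k z (hh k) (hP k)
  set B : ℕ → ℝ≥0∞ := fun k => S.KL * (‖S.P k z‖ₑ + ∫⁻ t in Set.Ici (0 : ℝ), ‖h k t‖ₑ)
  have hB : ∑' k, B k ≠ ∞ := by
    have : ∑' k, B k ≤ S.KL * (S.X z + S.SF h) := by
      rw [X, SF, ← ENNReal.tsum_add, ← ENNReal.tsum_mul_left]
      refine ENNReal.tsum_le_tsum fun k => mul_le_mul_right (add_le_add ?_ ?_) _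
      · exact le_mul_of_one_le_left' (S.one_le_ω k)
      · exact le_mul_of_one_le_left' (S.one_le_ω k)
    refine ne_top_of_le_ne_top ?_ this
    exact ENNReal.mul_ne_top ENNReal.coe_ne_top (ENNReal.add_ne_top.2 ⟨hX, hF⟩)
  have hcont : ∀ k, Continuous (ζ k) := fun k =>
    continuous_iff_continuousAt.2 fun t => (hd k t).continuousAt
  have hle : ∀ k t, 0 ≤ t → ‖ζ k t‖ ≤ (B k).toReal := fun k t ht => by
    have := (S.block_linear (hcont k) (hh k) (fun t _ => hPζ k t)
      (fun t _ => (hd k t).hasDerivWithinAt) ht).1 t ⟨ht, le_rfl⟩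
    rw [← toReal_enorm]
    refine ENNReal.toReal_mono (ENNReal.ne_top_of_tsum_ne_top hB k) (this.trans ?_)
    rw [h0]
    refine mul_le_mul_right (add_le_add_right ?_ _) _
    exact lintegral_mono_set fun t ht => ht.1
  have hs : Summable fun k => (B k).toReal := ENNReal.summable_toReal hB
  set Z : ℝ → E := fun t => ∑' k, ζ k (max t 0) with hZ
  have hsum : ∀ t : ℝ, Summable fun k => ζ k (max t 0) := fun t =>
    Summable.of_norm_bounded hs fun k => hle k _ (le_max_right _ _)
  have hPZ : ∀ k t, S.P k (Z t) = ζ k (max t 0) := fun k t =>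
    S.P_tsum (fun k => hPζ k _) (hsum t) k
  refine ⟨Z, ?_, fun t => by simp [hZ], ?_, ?_⟩
  · exact continuous_tsum (fun k => (hcont k).comp (by fun_prop)) hs
      fun k t => hle k _ (le_max_right _ _)
  · refine S.ext_P fun k => ?_
    rw [hPZ, max_self, h0]
  · intro k t ht
    have e : S.A k (Z t) = S.A k (ζ k t) := by
      rw [← S.A_P, hPZ, max_eq_left ht]
    rw [e]
    refine ((hd k t).hasDerivWithinAt (s := Set.Ici 0)).congr (fun s hs => ?_) ?_
    · rw [hPZ, max_eq_left hs]
    · rw [hPZ, max_eq_left ht]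

lemma SX_le_of_tendsto {Z : ℝ → E} {Zn : ℕ → ℝ → E} {M : ℝ≥0∞}
    (hlim : ∀ t, 0 ≤ t → Tendsto (fun n => Zn n t) atTop (𝓝 (Z t))) (hM : ∀ n, S.SX (Zn n) ≤ M) :
    S.SX Z ≤ M := by
  refine tsum_mul_le_of_le_liminf (b := fun n k => supN fun t => S.P k (Zn n t)) (fun k => ?_) hM
  refine iSup_le fun t => ?_
  have h1 : Tendsto (fun n => ‖S.P k (Zn n t)‖ₑ) atTop (𝓝 ‖S.P k (Z t)‖ₑ) :=
    (continuous_enorm.tendsto _).comp (((S.P k).continuous.tendsto _).comp (hlim t t.2))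
  rw [← h1.liminf_eq]
  exact liminf_le_liminf (Eventually.of_forall fun n =>
    enorm_le_supN (fun t => S.P k (Zn n t)) t.2)

lemma SD_le_of_tendsto {Z : ℝ → E} {Zn : ℕ → ℝ → E} {M : ℝ≥0∞} (hc : ∀ n, Continuous (Zn n))
    (hlim : ∀ t, 0 ≤ t → Tendsto (fun n => Zn n t) atTop (𝓝 (Z t))) (hM : ∀ n, S.SD (Zn n) ≤ M) :
    S.SD Z ≤ M := by
  refine tsum_mul_le_of_le_liminf (b := fun n k => l2N fun t => S.D (S.P k (Zn n t)))
    (fun k => ?_) hM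
  refine Lp.eLpNorm_lim_le_liminf_eLpNorm (fun n => ?_) _ ?_
  · have : Continuous fun t => S.D (S.P k (Zn n t)) := by fun_prop
    exact this.aestronglyMeasurable
  · refine (ae_restrict_iff' measurableSet_Ici).2 (Eventually.of_forall fun t ht => ?_)
    exact ((S.D.comp (S.P k)).continuous.tendsto _).comp (hlim t ht)

/-- Global solutions for small data, by Picard iteration in the norms `SX` and `SD`. -/
theorem exists_global (z : E) (hX : S.X z ≠ ∞)
    (hsmall : 8 * (S.KL * S.KN * (S.KL * S.X z)) ≤ 1) :
    ∃ Z : ℝ → E, Continuous Z ∧ (∀ t, Z t = Z (max t 0)) ∧ Z 0 = z ∧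
      S.Solves Z (fun k t => S.N k (Z t) (Z t)) ∧
      S.SX Z ≤ 2 * (S.KL * S.X z) ∧ S.SD Z ≤ 2 * (S.KL * S.X z) := by
  set a : ℝ≥0∞ := S.KL * S.X z
  have ha : a ≠ ∞ := ENNReal.mul_ne_top ENNReal.coe_ne_top hX
  set M : ℝ≥0∞ := 2 * a
  have hM : M ≠ ∞ := ENNReal.mul_ne_top (by norm_num) ha
  have hsmall' : S.KL * S.KN * (2 * M) ≤ 2⁻¹ := by
    rw [ENNReal.le_inv_iff_mul_le]
    refine le_trans (le_of_eq ?_) hsmall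
    simp only [M]; ring
  have hNc : ∀ k {Z Z' : ℝ → E}, Continuous Z → Continuous Z' →
      Continuous fun t => S.N k (Z t) (Z' t) := fun k Z Z' h h' => by fun_prop
  -- the ball of radius `M` is stable under one step of the iteration
  set Good : (ℝ → E) → Prop := fun Z =>
    Continuous Z ∧ (∀ t, Z t = Z (max t 0)) ∧ S.SX Z ≤ M ∧ S.SD Z ≤ M
  have hstep : ∀ Z, Good Z → ∃ Z', Good Z' ∧ Z' 0 = z ∧
      S.Solves Z' (fun k t => S.N k (Z t) (Z t)) := by
    rintro Z ⟨hc, -, -, hD⟩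
    have hF : S.SF (fun k t => S.N k (Z t) (Z t)) ≤ S.KN * (M * M) :=
      (S.SF_bilinear hc hc).trans (by gcongr)
    have hF' : S.SF (fun k t => S.N k (Z t) (Z t)) ≠ ∞ := ne_top_of_le_ne_top
      (ENNReal.mul_ne_top ENNReal.coe_ne_top (ENNReal.mul_ne_top hM hM)) hF
    obtain ⟨Z', hc', hm', h0, hs⟩ := S.exists_solves z hX _ (fun k => hNc k hc hc)
      (fun k t => S.P_N k _ _) hF'
    have hb : S.KL * (S.X (Z' 0) + S.SF (fun k t => S.N k (Z t) (Z t))) ≤ M := by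
      calc _ ≤ S.KL * (S.X z + S.KN * (M * M)) := by rw [h0]; gcongr
        _ = a + (S.KL * S.KN * (2 * M)) * a := by simp only [a, M]; ring
        _ ≤ a + 1 * a := by
            gcongr
            exact hsmall'.trans (by norm_num)
        _ = M := by simp only [M]; ring
    obtain ⟨b1, b2⟩ := hs.size hc' (fun k => hNc k hc hc)
    exact ⟨Z', ⟨hc', hm', b1.trans hb, b2.trans hb⟩, h0, hs⟩
  choose! f hf using hstep
  set Zn : ℕ → ℝ → E := fun n => f^[n] 0 with hZn
  have hZ0 : Zn 0 = 0 := rfl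
  have hsucc : ∀ n, Zn (n + 1) = f (Zn n) := fun n => Function.iterate_succ_apply' f n 0
  have hgood : ∀ n, Good (Zn n) := by
    intro n
    induction n with
    | zero =>
      refine ⟨continuous_const, fun _ => rfl, ?_, ?_⟩
      · simp [SX, hZ0, supN]
      · simp [SD, hZ0, l2N]
    | succ n ih => rw [hsucc]; exact (hf _ ih).1
  have hinit : ∀ n, Zn (n + 1) 0 = z := fun n => by rw [hsucc]; exact (hf _ (hgood n)).2.1
  have hsol : ∀ n, S.Solves (Zn (n + 1)) (fun k t => S.N k (Zn n t) (Zn n t)) := fun n => by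
    rw [hsucc]; exact (hf _ (hgood n)).2.2
  -- the differences of the iterates decay geometrically in both norms
  set W : ℕ → ℝ → E := fun n t => Zn (n + 1) t - Zn n t
  have hWc : ∀ n, Continuous (W n) := fun n => (hgood (n + 1)).1.sub (hgood n).1
  have hW : ∀ n, S.SX (W n) ≤ 2⁻¹ ^ n * M ∧ S.SD (W n) ≤ 2⁻¹ ^ n * M := by
    intro n
    induction n with
    | zero =>
      have : W 0 = Zn 1 := by funext t; simp [W, hZ0]
      simpa [this] using (hgood 1).2.2
    | succ n ih =>
      have hs : S.Solves (W (n + 1)) (fun k t => S.N k (W n t) (Zn (n + 1) t)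
          + S.N k (Zn n t) (W n t)) := by
        intro k t ht
        refine (((hsol (n + 1) k t ht).sub (hsol n k t ht)).congr_deriv ?_).congr ?_ ?_
        · simp only [W, map_sub, sub_apply]
          abel
        · intro s _
          simp [W]
        · simp [W]
      obtain ⟨b1, b2⟩ := hs.size (hWc _) (fun k =>
        (hNc k (hWc n) (hgood (n + 1)).1).add (hNc k (hgood n).1 (hWc n)))
      have h0 : S.X (W (n + 1) 0) = 0 := by
        have : W (n + 1) 0 = 0 := by simp only [W]; rw [hinit, hinit, sub_self]
        simp [X, this]
      have hF : S.SF (fun k t => S.N k (W n t) (Zn (n + 1) t) + S.N k (Zn n t) (W n t))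
          ≤ S.KN * (2 * M) * (2⁻¹ ^ n * M) := by
        calc _ ≤ S.SF (fun k t => S.N k (W n t) (Zn (n + 1) t))
              + S.SF (fun k t => S.N k (Zn n t) (W n t)) := by
              rw [SF, SF, SF, ← ENNReal.tsum_add]
              refine ENNReal.tsum_le_tsum fun k => ?_
              rw [← mul_add, ← lintegral_add_left
                (hNc k (hWc n) (hgood (n + 1)).1).enorm.measurable]
              exact mul_le_mul_right (lintegral_mono fun t => enorm_add_le _ _) _
          _ ≤ S.KN * ((2⁻¹ ^ n * M) * M) + S.KN * (M * (2⁻¹ ^ n * M)) := by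
              refine add_le_add ((S.SF_bilinear (hWc n) (hgood (n + 1)).1).trans ?_)
                ((S.SF_bilinear (hgood n).1 (hWc n)).trans ?_)
              · gcongr
                · exact ih.2
                · exact (hgood (n + 1)).2.2.2
              · gcongr
                · exact (hgood n).2.2.2
                · exact ih.2
          _ = _ := by ring
      have hb : S.KL * (S.X (W (n + 1) 0)
          + S.SF (fun k t => S.N k (W n t) (Zn (n + 1) t) + S.N k (Zn n t) (W n t)))
          ≤ 2⁻¹ ^ (n + 1) * M := by
        calc _ ≤ S.KL * (0 + S.KN * (2 * M) * (2⁻¹ ^ n * M)) := by rw [h0]; gcongr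
          _ = S.KL * S.KN * (2 * M) * (2⁻¹ ^ n * M) := by ring
          _ ≤ 2⁻¹ * (2⁻¹ ^ n * M) := by gcongr
          _ = _ := by ring
      exact ⟨b1.trans hb, b2.trans hb⟩
  have hWle : ∀ n t, ‖W n t‖ ≤ 2⁻¹ ^ n * M.toReal := by
    intro n t
    have e : W n t = W n (max t 0) := by
      simp only [W]
      rw [(hgood (n + 1)).2.1 t, (hgood n).2.1 t]
    rw [e, ← toReal_enorm]
    have := ((S.enorm_le_X _).trans (S.X_le_SX (W n) (le_max_right t 0))).trans (hW n).1
    have h2 := ENNReal.toReal_mono (ENNReal.mul_ne_top (by simp) hM) this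
    simpa using h2
  have hsumm : Summable fun n : ℕ => (2⁻¹ : ℝ) ^ n * M.toReal :=
    (summable_geometric_of_lt_one (by norm_num) (by norm_num)).mul_right _
  set Z : ℝ → E := fun t => ∑' n, W n t
  have hZc : Continuous Z := continuous_tsum hWc hsumm hWle
  have hpart : ∀ n t, ∑ i ∈ Finset.range n, W i t = Zn n t := fun n t => by
    have := Finset.sum_range_sub (fun n => Zn n t) n
    simpa [W, hZ0] using this
  have hlim : ∀ t, Tendsto (fun n => Zn n t) atTop (𝓝 (Z t)) := fun t => by
    have := (Summable.of_norm_bounded hsumm fun n => hWle n t).hasSum.tendsto_sum_nat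
    simpa only [hpart] using this
  have hm : ∀ t, Z t = Z (max t 0) := fun t => by
    refine tendsto_nhds_unique (hlim t) ?_
    refine (hlim (max t 0)).congr fun n => ?_
    rw [(hgood n).2.1 t]
  have hZ0' : Z 0 = z := tendsto_nhds_unique (hlim 0)
    ((tendsto_const_nhds (x := z)).congr' (by
      filter_upwards [eventually_ge_atTop 1] with n hn
      obtain ⟨m, rfl⟩ := Nat.exists_eq_add_of_le' hn
      exact (hinit m).symm))
  refine ⟨Z, hZc, hm, hZ0', ?_, S.SX_le_of_tendsto (fun t _ => hlim t) (fun n => (hgood n).2.2.1),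
    S.SD_le_of_tendsto (fun n => (hgood n).1) (fun t _ => hlim t) (fun n => (hgood n).2.2.2)⟩
  have hbound : ∀ n t, ‖Zn n t‖ ≤ M.toReal := fun n t => by
    rw [(hgood n).2.1 t, ← toReal_enorm]
    exact ENNReal.toReal_mono hM
      (((S.enorm_le_X _).trans (S.X_le_SX (Zn n) (le_max_right t 0))).trans (hgood n).2.2.1)
  -- the limit solves the equation: pass to the limit in its integrated form on every block
  have hint : ∀ k t, 0 ≤ t → S.P k (Z t) = S.P k z
      + ∫ s in (0 : ℝ)..t, (S.A k (Z s) + S.N k (Z s) (Z s)) := by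
    intro k t ht
    have hn : ∀ n, S.P k (Zn (n + 1) t) = S.P k z
        + ∫ s in (0 : ℝ)..t, (S.A k (Zn (n + 1) s) + S.N k (Zn n s) (Zn n s)) := fun n => by
      have hc1 := (hgood (n + 1)).1
      have hc2 := (hgood n).1
      have hi : Continuous fun s => S.A k (Zn (n + 1) s) + S.N k (Zn n s) (Zn n s) := by fun_prop
      have := intervalIntegral.integral_eq_sub_of_hasDeriv_right
        (f := fun t => S.P k (Zn (n + 1) t)) (a := 0) (b := t)
        (by fun_prop) (fun s hs => ?_) (hi.intervalIntegrable _ _)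
      · rw [this, hinit]; abel
      · rw [min_eq_left ht] at hs
        exact (hsol n k s hs.1.le).mono fun r hr => hs.1.le.trans (le_of_lt hr)
    refine tendsto_nhds_unique (((S.P k).continuous.tendsto _).comp
      ((hlim t).comp (tendsto_add_atTop_nat 1))) ?_
    refine Tendsto.congr (fun n => (hn n).symm) (tendsto_const_nhds.add ?_)
    refine intervalIntegral.tendsto_integral_filter_of_dominated_convergence
      (fun _ => ‖S.A k‖ * M.toReal + ‖S.N k‖ * M.toReal * M.toReal) ?_ ?_ ?_ ?_
    · refine Eventually.of_forall fun n => ?_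
      have hc1 := (hgood (n + 1)).1
      have hc2 := (hgood n).1
      have hi : Continuous fun s => S.A k (Zn (n + 1) s) + S.N k (Zn n s) (Zn n s) := by fun_prop
      exact hi.aestronglyMeasurable
    · refine Eventually.of_forall fun n => Eventually.of_forall fun s _ => ?_
      refine (norm_add_le _ _).trans (add_le_add ?_ ?_)
      · exact (S.A k).le_opNorm_of_le (hbound _ _)
      · refine ((S.N k).le_opNorm₂ _ _).trans ?_
        gcongr <;> exact hbound _ _
    · exact intervalIntegrable_const
    · refine Eventually.of_forall fun s _ => ?_
      have l1 := (hlim s).comp (tendsto_add_atTop_nat 1)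
      have l2 := hlim s
      refine (((S.A k).continuous.tendsto _).comp l1).add ?_
      have : Continuous fun p : E × E => S.N k p.1 p.2 := by fun_prop
      exact (this.tendsto (Z s, Z s)).comp (l2.prodMk_nhds l2)
  intro k t ht
  have hi : Continuous fun s => S.A k (Z s) + S.N k (Z s) (Z s) := by fun_prop
  refine (((hi.integral_hasStrictDerivAt 0 t).hasDerivAt.const_add
    (S.P k z)).hasDerivWithinAt (s := Set.Ici 0)).congr (fun s hs => hint k s hs) (hint k t ht)

lemma enorm_D_P_le (j : ℕ) (x : E) : ‖S.D (S.P j x)‖ₑ ≤ ‖S.D‖ₑ * ‖S.P j x‖ₑ := S.D.le_opENorm _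

/-- At a fixed time the dissipation factors are bounded by the norm. -/
lemma tsum_N_le (x y : E) :
    ∑' l, S.ω l * ‖S.N l x y‖ₑ ≤ S.KN * ‖S.D‖ₑ ^ 2 * (S.X x * S.X y) := by
  calc _ ≤ ∑' l, S.ω l * ∑' j, ∑' k, S.c l j k *
          ((‖S.D‖ₑ * ‖S.P j x‖ₑ) * (‖S.D‖ₑ * ‖S.P k y‖ₑ)) := by
        refine ENNReal.tsum_le_tsum fun l => mul_le_mul_right ((S.bilinear l x y).trans ?_) _
        refine ENNReal.tsum_le_tsum fun j => ENNReal.tsum_le_tsum fun k => ?_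
        exact mul_le_mul_right (mul_le_mul' (S.enorm_D_P_le j x) (S.enorm_D_P_le k y)) _
    _ ≤ _ := S.sum_bilinear_le _ _
    _ = _ := by
        simp only [mul_left_comm _ ‖S.D‖ₑ, ENNReal.tsum_mul_left, X]
        ring

lemma tsum_supN_N_le (Z : ℝ → E) :
    ∑' l, S.ω l * supN (fun t => S.N l (Z t) (Z t)) ≤ S.KN * ‖S.D‖ₑ ^ 2 * (S.SX Z * S.SX Z) := by
  calc _ ≤ ∑' l, S.ω l * ∑' j, ∑' k, S.c l j k *
          ((‖S.D‖ₑ * supN fun t => S.P j (Z t)) * (‖S.D‖ₑ * supN fun t => S.P k (Z t))) := by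
        refine ENNReal.tsum_le_tsum fun l => mul_le_mul_right (iSup_le fun t => ?_) _
        refine (S.bilinear l _ _).trans ?_
        refine ENNReal.tsum_le_tsum fun j => ENNReal.tsum_le_tsum fun k => mul_le_mul_right ?_ _
        have h : ∀ j, ‖S.D (S.P j (Z t))‖ₑ ≤ ‖S.D‖ₑ * supN fun t => S.P j (Z t) := fun j =>
          (S.enorm_D_P_le j _).trans (mul_le_mul_right (enorm_le_supN (fun t => S.P j (Z t)) t.2) _)
        exact mul_le_mul' (h j) (h k)
    _ ≤ _ := S.sum_bilinear_le _ _
    _ = _ := by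
        simp only [mul_left_comm _ ‖S.D‖ₑ, ENNReal.tsum_mul_left, SX]
        ring

/-! ### Dominated convergence of the sums over the blocks -/

lemma tendsto_tsum_zero {ι : Type*} {l : Filter ι} [l.IsCountablyGenerated] {f : ι → ℕ → ℝ≥0∞}
    {B : ℕ → ℝ≥0∞} (hB : ∑' k, B k ≠ ∞) (hb : ∀ᶠ i in l, ∀ k, f i k ≤ B k)
    (h : ∀ k, Tendsto (fun i => f i k) l (𝓝 0)) : Tendsto (fun i => ∑' k, f i k) l (𝓝 0) := by
  simp only [← lintegral_count]
  rw [← lintegral_zero (μ := Measure.count (α := ℕ))]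
  refine tendsto_lintegral_filter_of_dominated_convergence B (Eventually.of_forall fun i => ?_) ?_ ?_ ?_
  · exact measurable_of_countable _
  · filter_upwards [hb] with i hi
    exact Eventually.of_forall hi
  · rwa [lintegral_count]
  · exact Eventually.of_forall h

/-- A continuous trajectory with finite Chemin-Lerner norm is continuous in the norm `X`: the
suprema over time dominate the series over the blocks. -/
lemma tendsto_X_sub {Z : ℝ → E} (hc : Continuous Z) (hS : S.SX Z ≠ ∞) {t : ℝ} (ht : 0 ≤ t) :
    Tendsto (fun r => S.X (Z r - Z t)) (𝓝[Set.Ici 0] t) (𝓝 0) := by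
  refine tendsto_tsum_zero (B := fun k => 2 * (S.ω k * supN fun t => S.P k (Z t))) ?_ ?_ fun k => ?_
  · rw [ENNReal.tsum_mul_left]
    exact ENNReal.mul_ne_top (by norm_num) hS
  · filter_upwards [self_mem_nhdsWithin] with r hr k
    rw [map_sub, mul_left_comm, two_mul]
    refine mul_le_mul_right ((enorm_sub_le).trans ?_) _
    exact add_le_add (enorm_le_supN (fun t => S.P k (Z t)) hr) (enorm_le_supN (fun t => S.P k (Z t)) ht)
  · have h1 : Continuous fun r => ‖S.P k (Z r - Z t)‖ₑ := by fun_prop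
    have h2 := ENNReal.Tendsto.const_mul (h1.tendsto t) (Or.inr (S.ω_ne_top k))
    simp only [sub_self, map_zero, enorm_zero, mul_zero] at h2
    exact h2.mono_left nhdsWithin_le_nhds

/-- Uniqueness in the class of trajectories that are locally bounded in the norm `X`. -/
theorem unique {Z Z' : ℝ → E} (hc : Continuous Z) (hc' : Continuous Z')
    (hs : S.Solves Z (fun k t => S.N k (Z t) (Z t)))
    (hs' : S.Solves Z' (fun k t => S.N k (Z' t) (Z' t))) (h0 : Z 0 = Z' 0)
    (hb : ∀ T : ℝ, ∃ M : ℝ≥0, ∀ t ∈ Set.Icc 0 T, S.X (Z t) ≤ M ∧ S.X (Z' t) ≤ M) :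
    ∀ t, 0 ≤ t → Z t = Z' t := by
  intro T hT
  obtain ⟨M, hM⟩ := hb T
  set W : ℝ → E := fun t => Z t - Z' t
  have hWc : Continuous W := hc.sub hc'
  have hXsub : ∀ t ∈ Set.Icc 0 T, S.X (W t) ≤ 2 * M := fun t ht => by
    calc S.X (W t) ≤ S.X (Z t) + S.X (Z' t) := by
          rw [X, X, X, ← ENNReal.tsum_add]
          refine ENNReal.tsum_le_tsum fun k => ?_
          rw [← mul_add]
          refine mul_le_mul_right ?_ _
          simp only [W, map_sub]
          exact enorm_sub_le
      _ ≤ M + M := add_le_add (hM t ht).1 (hM t ht).2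
      _ = _ := by ring
  have hWs : S.Solves W (fun k t => S.N k (W t) (Z t) + S.N k (Z' t) (W t)) := by
    intro k t ht
    refine (((hs k t ht).sub (hs' k t ht)).congr_deriv ?_).congr ?_ ?_
    · simp only [W, map_sub, sub_apply]
      abel
    · intro s _
      simp [W]
    · simp [W]
  have hNc : ∀ k, Continuous fun t => S.N k (W t) (Z t) + S.N k (Z' t) (W t) := fun k => by
    fun_prop
  set K : ℝ≥0∞ := S.KL * (S.KN * ‖S.D‖ₑ ^ 2 * (2 * M))
  have hK : K ≠ ∞ := by
    refine ENNReal.mul_ne_top ENNReal.coe_ne_top (ENNReal.mul_ne_top (ENNReal.mul_ne_top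
      ENNReal.coe_ne_top (ENNReal.pow_ne_top enorm_ne_top)) (by finiteness))
  have key : ∀ t ∈ Set.Icc 0 T, S.X (W t) ≤ K * ∫⁻ s in Set.Icc 0 t, S.X (W s) := by
    intro t ht
    have h1 : ∀ k, ‖S.P k (W t)‖ₑ
        ≤ S.KL * ∫⁻ s in Set.Icc 0 t, ‖S.N k (W s) (Z s) + S.N k (Z' s) (W s)‖ₑ := fun k => by
      have := (S.block_linear (k := k) (ζ := fun t => S.P k (W t)) (by fun_prop) (hNc k)
        (fun t _ => S.P_idem k _) (fun t ht => by rw [S.A_P]; exact hWs k t ht) ht.1).1 t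
        ⟨ht.1, le_rfl⟩
      have hW0 : W 0 = 0 := by simp [W, h0]
      simpa [hW0] using this
    calc S.X (W t) ≤ ∑' k, S.ω k *
          (S.KL * ∫⁻ s in Set.Icc 0 t, ‖S.N k (W s) (Z s) + S.N k (Z' s) (W s)‖ₑ) :=
          ENNReal.tsum_le_tsum fun k => mul_le_mul_right (h1 k) _
      _ = S.KL * ∫⁻ s in Set.Icc 0 t,
          ∑' k, S.ω k * ‖S.N k (W s) (Z s) + S.N k (Z' s) (W s)‖ₑ := by
          rw [lintegral_tsum fun k => ((hNc k).enorm.measurable.const_mul _).aemeasurable,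
            ← ENNReal.tsum_mul_left]
          refine tsum_congr fun k => ?_
          rw [lintegral_const_mul _ (hNc k).enorm.measurable]
          ring
      _ ≤ S.KL * ∫⁻ s in Set.Icc 0 t, S.KN * ‖S.D‖ₑ ^ 2 * (2 * M) * S.X (W s) := by
          refine mul_le_mul_right (setLIntegral_mono' measurableSet_Icc fun s hs => ?_) _
          have hsT : s ∈ Set.Icc 0 T := ⟨hs.1, hs.2.trans ht.2⟩
          calc _ ≤ ∑' k, (S.ω k * ‖S.N k (W s) (Z s)‖ₑ + S.ω k * ‖S.N k (Z' s) (W s)‖ₑ) := by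
                refine ENNReal.tsum_le_tsum fun k => ?_
                rw [← mul_add]
                exact mul_le_mul_right (enorm_add_le _ _) _
            _ ≤ S.KN * ‖S.D‖ₑ ^ 2 * (S.X (W s) * S.X (Z s))
                + S.KN * ‖S.D‖ₑ ^ 2 * (S.X (Z' s) * S.X (W s)) := by
                rw [ENNReal.tsum_add]
                exact add_le_add (S.tsum_N_le _ _) (S.tsum_N_le _ _)
            _ ≤ S.KN * ‖S.D‖ₑ ^ 2 * (S.X (W s) * M) + S.KN * ‖S.D‖ₑ ^ 2 * (M * S.X (W s)) := by
                gcongr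
                · exact (hM s hsT).1
                · exact (hM s hsT).2
            _ = _ := by ring
      _ = K * ∫⁻ s in Set.Icc 0 t, S.X (W s) := by
          have hXm : Measurable fun s => S.X (W s) := by
            refine Measurable.tsum fun k => Measurable.const_mul ?_ _
            have : Continuous fun s => S.P k (W s) := by fun_prop
            exact this.enorm.measurable
          rw [lintegral_const_mul _ hXm]
          simp only [K]; ring
  -- on an interval of length `h` after a time up to which the difference vanishes, the supremum of
  -- the difference is at most half of itself
  obtain ⟨h, hh, hKh⟩ : ∃ h : ℝ, 0 < h ∧ K * ENNReal.ofReal h ≤ 2⁻¹ := by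
    refine ⟨(2 * (K.toReal + 1))⁻¹, by positivity, ?_⟩
    rw [← ENNReal.ofReal_toReal hK, ← ENNReal.ofReal_mul ENNReal.toReal_nonneg,
      ← ENNReal.ofReal_ofNat 2, ← ENNReal.ofReal_inv_of_pos (by norm_num),
      ENNReal.toReal_ofReal ENNReal.toReal_nonneg]
    refine ENNReal.ofReal_le_ofReal ?_
    have : 0 ≤ K.toReal := ENNReal.toReal_nonneg
    rw [mul_inv, mul_left_comm]
    refine mul_le_of_le_one_right (by norm_num) ?_
    rw [← div_eq_mul_inv, div_le_one (by positivity)]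
    linarith
  have hzero : ∀ n : ℕ, ∀ t ∈ Set.Icc 0 T, t ≤ n * h → S.X (W t) = 0 := by
    intro n
    induction n with
    | zero =>
      intro t ht htn
      have : t = 0 := le_antisymm (by simpa using htn) ht.1
      subst this
      simp [X, W, h0]
    | succ n ih =>
      set m : ℝ≥0∞ := ⨆ t : {t : ℝ // t ∈ Set.Icc 0 T ∧ t ≤ (n + 1 : ℕ) * h}, S.X (W t)
      have hm : m ≤ 2⁻¹ * m := by
        refine iSup_le fun t' => ?_
        obtain ⟨t, ht, htn⟩ := t'
        refine (key t ht).trans ?_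
        have h1 : ∫⁻ s in Set.Icc 0 t, S.X (W s) ≤ m * ENNReal.ofReal h := by
          calc ∫⁻ s in Set.Icc 0 t, S.X (W s)
              ≤ ∫⁻ s in Set.Icc 0 t, (Set.Icc (n * h) ((n + 1 : ℕ) * h)).indicator (fun _ => m) s := by
                refine setLIntegral_mono' measurableSet_Icc fun s hs => ?_
                have hsT : s ∈ Set.Icc 0 T := ⟨hs.1, hs.2.trans ht.2⟩
                by_cases hsn : s ≤ n * h
                · rw [ih s hsT hsn]; exact zero_le
                · rw [Set.indicator_of_mem (Set.mem_Icc.2 ⟨(not_le.1 hsn).le, hs.2.trans htn⟩)]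
                  exact le_iSup (fun t : {t : ℝ // t ∈ Set.Icc 0 T ∧ t ≤ (n + 1 : ℕ) * h} =>
                    S.X (W t)) ⟨s, hsT, hs.2.trans htn⟩
            _ ≤ ∫⁻ s, (Set.Icc (n * h) ((n + 1 : ℕ) * h)).indicator (fun _ => m) s :=
                setLIntegral_le_lintegral _ _
            _ = m * ENNReal.ofReal h := by
                rw [lintegral_indicator_const measurableSet_Icc, Real.volume_Icc]
                congr 2
                push_cast
                ring
        calc K * ∫⁻ s in Set.Icc 0 t, S.X (W s) ≤ K * (m * ENNReal.ofReal h) := by gcongr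
          _ = (K * ENNReal.ofReal h) * m := by ring
          _ ≤ _ := by gcongr
      have hmt : m ≠ ∞ := by
        refine ne_top_of_le_ne_top (b := 2 * (M : ℝ≥0∞)) (by finiteness) ?_
        exact iSup_le fun t => hXsub t.1 t.2.1
      have hm0 : m = 0 := by
        by_contra hne
        have := ENNReal.mul_lt_mul_left hne hmt (show (2⁻¹ : ℝ≥0∞) < 1 by norm_num)
        rw [one_mul] at this
        exact absurd hm (not_le.2 this)
      intro t ht htn
      exact le_antisymm ((le_iSup (fun t : {t : ℝ // t ∈ Set.Icc 0 T ∧ t ≤ (n + 1 : ℕ) * h} =>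
        S.X (W t)) ⟨t, ht, htn⟩).trans hm0.le) zero_le
  obtain ⟨n, hn⟩ := exists_nat_ge (T / h)
  have hX0 := hzero n T ⟨hT, le_rfl⟩ ((div_le_iff₀ hh).1 hn)
  have := S.enorm_le_X (W T)
  rw [hX0] at this
  exact sub_eq_zero.1 (enorm_eq_zero.1 (le_antisymm this zero_le))

end BlockSystem

/-! ### Multiplication operators on `L²` -/

/-- The space `L²(ℝ³; V)`. -/
abbrev L2 (V : Type*) [NormedAddCommGroup V] : Type _ := Lp V 2 (volume : Measure E3)

/-- The space `ℂⁿ` with its Euclidean norm. -/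
abbrev Cn (n : ℕ) : Type := EuclideanSpace ℂ (Fin n)

section Symbols

variable {V W : Type*} [NormedAddCommGroup V] [NormedSpace ℂ V] [NormedAddCommGroup W]
  [NormedSpace ℂ W]

/-- A bounded measurable operator-valued symbol. -/
def IsSymbol (m : E3 → V →L[ℂ] W) : Prop := StronglyMeasurable m ∧ ∃ C : ℝ, ∀ ξ, ‖m ξ‖ ≤ C

lemma IsSymbol.memLp {m : E3 → V →L[ℂ] W} (hm : IsSymbol m) {C : ℝ} (hC : ∀ ξ, ‖m ξ‖ ≤ C)
    (f : L2 V) : MemLp (fun ξ => m ξ (f ξ)) 2 (volume : Measure E3) := by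
  refine MemLp.of_le_mul (Lp.memLp f) ?_ (Eventually.of_forall fun ξ => (m ξ).le_of_opNorm_le (hC ξ) _)
  exact ((isBoundedBilinearMap_apply (𝕜 := ℂ) (E := V) (F := W)).continuous.comp_stronglyMeasurable
    (hm.1.prodMk (Lp.stronglyMeasurable f))).aestronglyMeasurable

open Classical in
/-- The operator of multiplication by `m` on `L²`. It has the junk value `0` when `m` is not bounded
and measurable, which lets it be written without a proof of `IsSymbol m`. -/
def mulOp (m : E3 → V →L[ℂ] W) : L2 V →L[ℂ] L2 W :=
  if h : IsSymbol m then
    LinearMap.mkContinuous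
      { toFun := fun f => (h.memLp h.2.choose_spec f).toLp _
        map_add' := fun f g => by
          apply Lp.ext
          filter_upwards [MemLp.coeFn_toLp (h.memLp h.2.choose_spec (f + g)),
            MemLp.coeFn_toLp (h.memLp h.2.choose_spec f),
            MemLp.coeFn_toLp (h.memLp h.2.choose_spec g), Lp.coeFn_add f g,
            Lp.coeFn_add ((h.memLp h.2.choose_spec f).toLp _)
              ((h.memLp h.2.choose_spec g).toLp _)] with ξ h1 h2 h3 h4 h5
          rw [h1, h5, Pi.add_apply, h2, h3, h4, Pi.add_apply, map_add]
        map_smul' := fun a f => by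
          apply Lp.ext
          filter_upwards [MemLp.coeFn_toLp (h.memLp h.2.choose_spec (a • f)),
            MemLp.coeFn_toLp (h.memLp h.2.choose_spec f), Lp.coeFn_smul a f,
            Lp.coeFn_smul a ((h.memLp h.2.choose_spec f).toLp _)] with ξ h1 h2 h3 h4
          rw [h1, RingHom.id_apply, h4, Pi.smul_apply, h2, h3, Pi.smul_apply, map_smul] }
      h.2.choose
      (fun f => by
        refine Lp.norm_le_mul_norm_of_ae_le_mul ?_
        filter_upwards [MemLp.coeFn_toLp (h.memLp h.2.choose_spec f)] with ξ h1
        simp only [LinearMap.coe_mk, AddHom.coe_mk]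
        rw [h1]
        exact (m ξ).le_of_opNorm_le (h.2.choose_spec ξ) _)
  else 0

lemma mulOp_ae {m : E3 → V →L[ℂ] W} (h : IsSymbol m) (f : L2 V) :
    mulOp m f =ᵐ[volume] fun ξ => m ξ (f ξ) := by
  rw [mulOp, dif_pos h]
  exact MemLp.coeFn_toLp (h.memLp h.2.choose_spec f)

lemma IsSymbol.add {m n : E3 → V →L[ℂ] W} (hm : IsSymbol m) (hn : IsSymbol n) :
    IsSymbol (fun ξ => m ξ + n ξ) := by
  obtain ⟨C, hC⟩ := hm.2
  obtain ⟨C', hC'⟩ := hn.2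
  exact ⟨hm.1.add hn.1, C + C', fun ξ => (norm_add_le _ _).trans (add_le_add (hC ξ) (hC' ξ))⟩

lemma IsSymbol.sum {ι : Type*} {s : Finset ι} {m : ι → E3 → V →L[ℂ] W}
    (hm : ∀ i ∈ s, IsSymbol (m i)) : IsSymbol (fun ξ => ∑ i ∈ s, m i ξ) := by
  classical
  induction s using Finset.induction_on with
  | empty => exact ⟨by simpa using stronglyMeasurable_const, 0, by simp⟩
  | insert a s ha ih =>
    simp only [Finset.sum_insert ha]
    exact (hm a (Finset.mem_insert_self a s)).add
      (ih fun i hi => hm i (Finset.mem_insert_of_mem hi))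

lemma IsSymbol.smul_const {s : E3 → ℂ} (hs : Measurable s) {C : ℝ} (hC : ∀ ξ, ‖s ξ‖ ≤ C)
    (L : V →L[ℂ] W) : IsSymbol (fun ξ => s ξ • L) :=
  ⟨hs.stronglyMeasurable.smul stronglyMeasurable_const, C * ‖L‖, fun ξ => by
    rw [norm_smul]; exact mul_le_mul_of_nonneg_right (hC ξ) (norm_nonneg _)⟩

end Symbols

/-! ### Scalar and matrix symbols -/

/-- The matrix `M` as a continuous linear map. -/
def matCLM {m n : ℕ} (M : Fin m → Fin n → ℂ) : Cn n →L[ℂ] Cn m :=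
  ∑ a, ∑ b, M a b • (ContinuousLinearMap.toSpanSingleton ℂ (EuclideanSpace.single a (1 : ℂ))).comp
    (EuclideanSpace.proj b : Cn n →L[ℂ] ℂ)

lemma matCLM_apply {m n : ℕ} (M : Fin m → Fin n → ℂ) (z : Cn n) (a : Fin m) :
    matCLM M z a = ∑ b, M a b * z b := by
  simp [matCLM, Pi.single_apply]

lemma isSymbol_matCLM {m n : ℕ} {M : E3 → Fin m → Fin n → ℂ} (hM : ∀ a b, Measurable fun ξ => M ξ a b)
    (hb : ∀ a b, ∃ C : ℝ, ∀ ξ, ‖M ξ a b‖ ≤ C) : IsSymbol fun ξ => matCLM (M ξ) :=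
  IsSymbol.sum fun a _ => IsSymbol.sum fun b _ =>
    IsSymbol.smul_const (hM a b) (hb a b).choose_spec _

/-- The row `R` as a continuous linear form. -/
def rowCLM {n : ℕ} (R : Fin n → ℂ) : Cn n →L[ℂ] ℂ :=
  ∑ b, R b • (EuclideanSpace.proj b : Cn n →L[ℂ] ℂ)

lemma rowCLM_apply {n : ℕ} (R : Fin n → ℂ) (z : Cn n) : rowCLM R z = ∑ b, R b * z b := by
  simp [rowCLM]

lemma isSymbol_rowCLM {n : ℕ} {R : E3 → Fin n → ℂ} (hM : ∀ b, Measurable fun ξ => R ξ b)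
    (hb : ∀ b, ∃ C : ℝ, ∀ ξ, ‖R ξ b‖ ≤ C) : IsSymbol fun ξ => rowCLM (R ξ) :=
  IsSymbol.sum fun b _ => IsSymbol.smul_const (hM b) (hb b).choose_spec _

/-- The symbol `2π|ξ|` of `|D|`: the Fourier transform is normalised with `exp(-2πi x·ξ)`. -/
def rad (ξ : E3) : ℝ := ‖(2 * Real.pi) • ξ‖

lemma rad_nonneg (ξ : E3) : 0 ≤ rad ξ := norm_nonneg _

lemma rad_eq (ξ : E3) : rad ξ = 2 * Real.pi * ‖ξ‖ := by
  rw [rad, norm_smul, Real.norm_of_nonneg (by positivity)]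

lemma continuous_rad : Continuous rad := by unfold rad; fun_prop

/-- The bracket `(1 + |D|²)^{1/2}`. -/
def brk (ξ : E3) : ℝ := √(1 + rad ξ ^ 2)

lemma brk_sq (ξ : E3) : brk ξ ^ 2 = 1 + rad ξ ^ 2 := Real.sq_sqrt (by positivity)

lemma one_le_brk (ξ : E3) : 1 ≤ brk ξ := by
  rw [brk, Real.one_le_sqrt]; nlinarith [sq_nonneg (rad ξ)]

lemma brk_pos (ξ : E3) : 0 < brk ξ := lt_of_lt_of_le one_pos (one_le_brk ξ)

lemma rad_le_brk (ξ : E3) : rad ξ ≤ brk ξ :=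
  Real.le_sqrt_of_sq_le (by linarith)

lemma brk_le (ξ : E3) : brk ξ ≤ 1 + rad ξ := by
  rw [brk, Real.sqrt_le_left (by linarith [rad_nonneg ξ])]
  nlinarith [rad_nonneg ξ]

lemma continuous_brk : Continuous brk := by
  unfold brk; have := continuous_rad; fun_prop

/-- The symbol `⟨D⟩⁻¹`. -/
def kap (ξ : E3) : ℝ := (brk ξ)⁻¹

/-- The symbol `|D|⟨D⟩⁻¹`. -/
def rho (ξ : E3) : ℝ := rad ξ * (brk ξ)⁻¹

lemma kap_pos (ξ : E3) : 0 < kap ξ := inv_pos.2 (brk_pos ξ)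

lemma rho_nonneg (ξ : E3) : 0 ≤ rho ξ := mul_nonneg (rad_nonneg ξ) (kap_pos ξ).le

lemma rho_sq_add_kap_sq (ξ : E3) : rho ξ ^ 2 + kap ξ ^ 2 = 1 := by
  have h := brk_sq ξ
  have h0 := (brk_pos ξ).ne'
  rw [rho, kap]
  field_simp
  linarith

lemma kap_le_one (ξ : E3) : kap ξ ≤ 1 := inv_le_one_of_one_le₀ (one_le_brk ξ)

lemma rho_le_one (ξ : E3) : rho ξ ≤ 1 := by
  nlinarith [rho_sq_add_kap_sq ξ, sq_nonneg (kap ξ), rho_nonneg ξ]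

lemma measurable_kap : Measurable kap := continuous_brk.measurable.inv

lemma measurable_rho : Measurable rho := continuous_rad.measurable.mul measurable_kap

/-! ### Frequency blocks -/

/-- The frequency blocks: the unit ball for `k = 0` and the annulus `2^{k-1} ≤ |D| < 2^k` for
`k ≥ 1`. -/
def blk (k : ℕ) : Set E3 := {ξ | rad ξ < 2 ^ k ∧ (k ≠ 0 → (2 : ℝ) ^ k ≤ 2 * rad ξ)}

lemma measurableSet_blk (k : ℕ) : MeasurableSet (blk k) := by
  refine (measurableSet_lt continuous_rad.measurable measurable_const).inter ?_
  by_cases hk : k = 0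
  · subst hk
    simp only [ne_eq, not_true_eq_false, IsEmpty.forall_iff]
    exact MeasurableSet.univ
  · simp only [ne_eq, hk, not_false_eq_true, forall_const]
    exact measurableSet_le measurable_const (continuous_rad.measurable.const_mul 2)

lemma blk_disjoint {j k : ℕ} {ξ : E3} (hj : ξ ∈ blk j) (hk : ξ ∈ blk k) : j = k := by
  wlog h : j < k generalizing j k
  · rcases lt_trichotomy j k with h1 | h1 | h1
    · exact this hj hk h1
    · exact h1
    · exact (this hk hj h1).symm
  · exfalso
    have h1 : (2 : ℝ) ^ (j + 1) ≤ 2 ^ k := pow_le_pow_right₀ (by norm_num) h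
    have h2 := hk.2 (by omega)
    have h3 := hj.1
    rw [pow_succ] at h1
    linarith

lemma exists_mem_blk (ξ : E3) : ∃ k, ξ ∈ blk k := by
  obtain ⟨n, hn⟩ := pow_unbounded_of_one_lt (rad ξ) (by norm_num : (1 : ℝ) < 2)
  classical
  have h : ∃ n : ℕ, rad ξ < 2 ^ n := ⟨n, hn⟩
  refine ⟨Nat.find h, Nat.find_spec h, fun h0 => ?_⟩
  obtain ⟨m, hm⟩ := Nat.exists_eq_succ_of_ne_zero h0
  have := Nat.find_min h (m := m) (by omega)
  rw [hm, pow_succ]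
  linarith [not_lt.1 this]

/-- The characteristic function of a block. -/
def chi (k : ℕ) (ξ : E3) : ℂ := (blk k).indicator (fun _ => 1) ξ

lemma chi_of_mem {k : ℕ} {ξ : E3} (h : ξ ∈ blk k) : chi k ξ = 1 := Set.indicator_of_mem h _

lemma chi_of_notMem {k : ℕ} {ξ : E3} (h : ξ ∉ blk k) : chi k ξ = 0 := Set.indicator_of_notMem h _

lemma measurable_chi (k : ℕ) : Measurable (chi k) :=
  measurable_const.indicator (measurableSet_blk k)

lemma norm_chi_le (k : ℕ) (ξ : E3) : ‖chi k ξ‖ ≤ 1 := by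
  by_cases h : ξ ∈ blk k
  · simp [chi_of_mem h]
  · simp [chi_of_notMem h]

lemma chi_mul_chi (j k : ℕ) (ξ : E3) : chi j ξ * chi k ξ = if j = k then chi k ξ else 0 := by
  by_cases hk : ξ ∈ blk k
  · by_cases hj : ξ ∈ blk j
    · rw [if_pos (blk_disjoint hj hk), chi_of_mem hj, one_mul]
    · rw [chi_of_notMem hj, zero_mul, if_neg]
      rintro rfl
      exact hj hk
  · rw [chi_of_notMem hk]
    simp

section BlockProj

variable {V W : Type*} [NormedAddCommGroup V] [NormedSpace ℂ V] [NormedAddCommGroup W]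
  [NormedSpace ℂ W]

variable (V) in
/-- The symbol of the sharp frequency cut-off to a block. -/
def chiSym (k : ℕ) : E3 → V →L[ℂ] V := fun ξ => chi k ξ • ContinuousLinearMap.id ℂ V

lemma isSymbol_chiSym (k : ℕ) : IsSymbol (chiSym V k) :=
  IsSymbol.smul_const (measurable_chi k) (norm_chi_le k) _

/-- The sharp frequency cut-off to a block. -/
def proj (k : ℕ) : L2 V →L[ℂ] L2 V := mulOp (chiSym V k)

lemma proj_ae (k : ℕ) (f : L2 V) : proj k f =ᵐ[volume] fun ξ => chi k ξ • f ξ :=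
  mulOp_ae (isSymbol_chiSym k) f

lemma proj_proj (j k : ℕ) (f : L2 V) : proj j (proj k f) = if j = k then proj k f else 0 := by
  apply Lp.ext
  have h4 : (if j = k then proj k f else 0 : L2 V) =ᵐ[volume]
      fun ξ => (if j = k then chi k ξ else 0) • f ξ := by
    split_ifs with h
    · exact proj_ae k f
    · filter_upwards [Lp.coeFn_zero V 2 (volume : Measure E3)] with ξ hξ
      rw [hξ, zero_smul, Pi.zero_apply]
  filter_upwards [proj_ae j (proj k f), proj_ae k f, h4] with ξ h1 h2 h3
  rw [h1, h2, h3, smul_smul, chi_mul_chi]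

lemma eq_zero_of_proj (f : L2 V) (h : ∀ k, proj k f = 0) : f = 0 := by
  rw [Lp.eq_zero_iff_ae_eq_zero]
  have h1 : ∀ᵐ ξ, ∀ k, chi k ξ • f ξ = 0 := by
    rw [ae_all_iff]
    intro k
    filter_upwards [proj_ae k f, Lp.coeFn_zero V 2 (volume : Measure E3)] with ξ h2 h3
    rw [← h2, h k, h3, Pi.zero_apply]
  filter_upwards [h1] with ξ hξ
  obtain ⟨k, hk⟩ := exists_mem_blk ξ
  have := hξ k
  rwa [chi_of_mem hk, one_smul] at this

lemma mulOp_proj {m : E3 → V →L[ℂ] W} (hm : IsSymbol m) (k : ℕ) (f : L2 V) :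
    mulOp m (proj k f) = proj k (mulOp m f) := by
  apply Lp.ext
  filter_upwards [mulOp_ae hm (proj k f), proj_ae k f, proj_ae k (mulOp m f), mulOp_ae hm f]
    with ξ h1 h2 h3 h4
  rw [h1, h2, h3, h4, map_smul]

end BlockProj

/-! ### The Lyapunov functional of the linearised equation -/

/-- The weight of the energy in the Lyapunov functional, so large that the energy absorbs the cross
terms. The parameter `γ` stands for `β - τ`. -/
def lyK (τ γ : ℝ) : ℝ := ((2 * τ - γ) ^ 2 + 2 + τ * γ + γ ^ 2) / γ + 2 + τ + (τ + 1) / (τ * γ)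

/-- Coercivity constant of the Lyapunov functional. -/
def lyc (τ : ℝ) : ℝ := 1 / (16 * (1 + τ) ^ 2)

lemma lyc_pos {τ : ℝ} (hτ : 0 < τ) : 0 < lyc τ := by unfold lyc; positivity

/-- Young's inequality with a factor `s` of modulus at most `1`. -/
lemma young_mul {s ε : ℝ} (hs : s ^ 2 ≤ 1) (x y : ℝ) (hε : 0 < ε) :
    s * x * y ≤ ε * x ^ 2 + y ^ 2 / (4 * ε) := by
  have h1 : (s * y) ^ 2 ≤ y ^ 2 := by
    rw [mul_pow]; exact mul_le_of_le_one_left (sq_nonneg y) hs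
  have h2 : s * x * y ≤ ε * x ^ 2 + (s * y) ^ 2 / (4 * ε) := by
    have : ε * x ^ 2 + (s * y) ^ 2 / (4 * ε) - s * x * y = (2 * ε * x - s * y) ^ 2 / (4 * ε) := by
      field_simp; ring
    have h3 : 0 ≤ (2 * ε * x - s * y) ^ 2 / (4 * ε) := by positivity
    linarith
  have h3 : (s * y) ^ 2 / (4 * ε) ≤ y ^ 2 / (4 * ε) := by gcongr
  linarith

/-- Half the derivative of the Lyapunov functional along `p' = ρκ⁻¹y`, `q' = (κ⁻¹y - q)/τ`,
`y' = -ρκ⁻¹p - γρ²κ⁻¹q`. The functional is the energy `K (p² + τγρ²q² + y²)`, whose derivative is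
`-2Kγρ²q²`, with the cross terms `ρκ py` and `-2τρ²κ qy`, which give the dissipation of `ρp` and `ρy`,
and `κ²(y - κq)²/(8τ)`, which gives that of `κ(y - κq)`. The factors `κ` compensate the factor `κ⁻¹`
of the equation, which is unbounded at high frequencies. -/
lemma lyapunov_diss {τ γ κ ρ : ℝ} (hτ : 0 < τ) (hγ : 0 < γ) (hκ : 0 < κ) (hκ1 : κ ≤ 1)
    (hρ : 0 ≤ ρ) (hρ1 : ρ ≤ 1) (p q y : ℝ) :
    (lyK τ γ * p + (ρ * κ / 2) * y) * (ρ * κ⁻¹ * y)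
      + ((lyK τ γ * τ * γ * ρ ^ 2 + κ ^ 4 / (8 * τ)) * q + (-τ * ρ ^ 2 * κ - κ ^ 3 / (8 * τ)) * y)
        * ((κ⁻¹ * y - q) / τ)
      + ((ρ * κ / 2) * p + (-τ * ρ ^ 2 * κ - κ ^ 3 / (8 * τ)) * q
        + (lyK τ γ + κ ^ 2 / (8 * τ)) * y) * (-(ρ * κ⁻¹) * p - γ * (ρ * κ⁻¹) * ρ * q)
      ≤ -lyc τ * ((ρ * p) ^ 2 + (ρ * q) ^ 2 + (ρ * y) ^ 2 + (κ * (y - κ * q)) ^ 2) := by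
  set K := lyK τ γ with hK
  have hKγ : (2 * τ - γ) ^ 2 + 2 + τ * γ + γ ^ 2 ≤ K * γ := by
    have : K * γ = (2 * τ - γ) ^ 2 + 2 + τ * γ + γ ^ 2 + (2 + τ + (τ + 1) / (τ * γ)) * γ := by
      rw [hK, lyK]; field_simp; ring
    rw [this]
    have : 0 ≤ (2 + τ + (τ + 1) / (τ * γ)) * γ := by positivity
    linarith
  have hc1 : lyc τ ≤ 1 / 4 := by
    unfold lyc
    rw [div_le_div_iff₀ (by positivity) (by norm_num)]
    nlinarith
  have hc2 : lyc τ ≤ 1 / (16 * τ ^ 2) := by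
    unfold lyc
    apply one_div_le_one_div_of_le (by positivity)
    nlinarith
  -- `a, e, f, g` are the dissipated quantities; `hid` writes the derivative in terms of them, with
  -- negative squares of all four and cross terms that the choice of `K` absorbs
  obtain ⟨a, ha⟩ : ∃ a, a = ρ * p := ⟨_, rfl⟩
  obtain ⟨e, he⟩ : ∃ e, e = ρ * q := ⟨_, rfl⟩
  obtain ⟨f, hf⟩ : ∃ f, f = ρ * y := ⟨_, rfl⟩
  obtain ⟨g, hg⟩ : ∃ g, g = κ * (y - κ * q) := ⟨_, rfl⟩
  have hid : (K * p + (ρ * κ / 2) * y) * (ρ * κ⁻¹ * y)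
      + ((K * τ * γ * ρ ^ 2 + κ ^ 4 / (8 * τ)) * q + (-τ * ρ ^ 2 * κ - κ ^ 3 / (8 * τ)) * y)
        * ((κ⁻¹ * y - q) / τ)
      + ((ρ * κ / 2) * p + (-τ * ρ ^ 2 * κ - κ ^ 3 / (8 * τ)) * q
        + (K + κ ^ 2 / (8 * τ)) * y) * (-(ρ * κ⁻¹) * p - γ * (ρ * κ⁻¹) * ρ * q)
      = -K * γ * e ^ 2 + (-f ^ 2 - a ^ 2 + (2 * τ - γ) * ρ * a * e + 2 * κ * e * f
          + 2 * τ * γ * ρ ^ 2 * e ^ 2) / 2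
        + (-(g ^ 2) / τ - a * g - γ * ρ * e * g) / (8 * τ) := by
    rw [ha, he, hf, hg]
    field_simp
    ring
  rw [hid, ← ha, ← he, ← hf, ← hg]
  have hρ' : ρ ^ 2 ≤ 1 := by nlinarith
  have hκ' : κ ^ 2 ≤ 1 := by nlinarith
  have i1 := young_mul hρ' (a) ((2 * τ - γ) * e) (ε := 1 / 8) (by norm_num)
  have i2 := young_mul hκ' f e (ε := 1 / 4) (by norm_num)
  have i3 : τ * γ * e ^ 2 * ρ ^ 2 ≤ τ * γ * e ^ 2 * 1 :=
    mul_le_mul_of_nonneg_left hρ' (by positivity)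
  obtain ⟨g', hg'⟩ : ∃ g', g' = g / τ := ⟨_, rfl⟩
  have i4 : (-(g ^ 2) / τ - a * g - γ * ρ * e * g) / (8 * τ)
      = -(g' ^ 2) / 8 - a * g' / 8 - γ * ρ * e * g' / 8 := by
    rw [hg']; field_simp
  have i5 := young_mul (s := -1) (by norm_num) a g' (ε := 1) (by norm_num)
  have i6 := young_mul (s := -ρ) (by rwa [neg_sq]) (γ * e) g' (ε := 1) (by norm_num)
  have i7 : g' ^ 2 = g ^ 2 / τ ^ 2 := by rw [hg', div_pow]
  have i8 : lyc τ * g ^ 2 ≤ g' ^ 2 / 16 := by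
    have := mul_le_mul_of_nonneg_right hc2 (sq_nonneg g)
    rw [i7]
    refine this.trans (le_of_eq ?_)
    field_simp
  have i9 : ((2 * τ - γ) ^ 2 + 2 + τ * γ + γ ^ 2) * e ^ 2 ≤ K * γ * e ^ 2 :=
    mul_le_mul_of_nonneg_right hKγ (sq_nonneg e)
  have j1 : lyc τ * a ^ 2 ≤ 1 / 4 * a ^ 2 := mul_le_mul_of_nonneg_right hc1 (sq_nonneg a)
  have j2 : lyc τ * e ^ 2 ≤ 1 / 4 * e ^ 2 := mul_le_mul_of_nonneg_right hc1 (sq_nonneg e)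
  have j3 : lyc τ * f ^ 2 ≤ 1 / 4 * f ^ 2 := mul_le_mul_of_nonneg_right hc1 (sq_nonneg f)
  rw [i4]
  linear_combination (1 / 2) * i1 + i2 + i3 + (1 / 8) * i5 + (1 / 8) * i6 + i8 + i9 + j1 + j2 + j3
    + (1 / 16) * sq_nonneg a + (3 / 4) * sq_nonneg e + (7 / 8) * sq_nonneg (γ * e)

/-- Coercivity of the Lyapunov functional. -/
lemma lyapunov_lower {τ γ κ ρ : ℝ} (hτ : 0 < τ) (hγ : 0 < γ)
    (hρκ : ρ ^ 2 + κ ^ 2 = 1) (p q y : ℝ) :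
    lyc τ * (p ^ 2 + q ^ 2 + y ^ 2) ≤
      (lyK τ γ * p + (ρ * κ / 2) * y) * p
      + ((lyK τ γ * τ * γ * ρ ^ 2 + κ ^ 4 / (8 * τ)) * q + (-τ * ρ ^ 2 * κ - κ ^ 3 / (8 * τ)) * y)
        * q
      + ((ρ * κ / 2) * p + (-τ * ρ ^ 2 * κ - κ ^ 3 / (8 * τ)) * q
        + (lyK τ γ + κ ^ 2 / (8 * τ)) * y) * y := by
  set K := lyK τ γ with hK
  have hK1 : 2 + τ ≤ K := by
    rw [hK, lyK]
    have h1 : 0 ≤ ((2 * τ - γ) ^ 2 + 2 + τ * γ + γ ^ 2) / γ := by positivity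
    have h2 : 0 ≤ (τ + 1) / (τ * γ) := by positivity
    linarith
  have hK2 : τ + 1 ≤ K * τ * γ := by
    have : K * τ * γ = τ + 1 + (((2 * τ - γ) ^ 2 + 2 + τ * γ + γ ^ 2) / γ + 2 + τ) * (τ * γ) := by
      rw [hK, lyK]; field_simp; ring
    rw [this]
    have : 0 ≤ (((2 * τ - γ) ^ 2 + 2 + τ * γ + γ ^ 2) / γ + 2 + τ) * (τ * γ) := by positivity
    linarith
  have hκ2 : κ ^ 2 ≤ 1 := by nlinarith
  have hρ2 : ρ ^ 2 ≤ 1 := by nlinarith [sq_nonneg κ]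
  obtain ⟨e, he⟩ : ∃ e, e = ρ * q := ⟨_, rfl⟩
  -- where `ρ` is small, `q` is controlled through `y` and `W`, as `κ` is then close to `1`
  obtain ⟨W, hW⟩ : ∃ W, W = y - κ * q := ⟨_, rfl⟩
  have hid : (K * p + (ρ * κ / 2) * y) * p
      + ((K * τ * γ * ρ ^ 2 + κ ^ 4 / (8 * τ)) * q + (-τ * ρ ^ 2 * κ - κ ^ 3 / (8 * τ)) * y) * q
      + ((ρ * κ / 2) * p + (-τ * ρ ^ 2 * κ - κ ^ 3 / (8 * τ)) * q + (K + κ ^ 2 / (8 * τ)) * y) * y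
      = K * (p ^ 2 + y ^ 2) + K * τ * γ * e ^ 2 + (ρ * κ) * p * y - 2 * τ * (ρ * κ) * e * y
        + (κ * W) ^ 2 / (8 * τ) := by
    rw [he, hW]; field_simp; ring
  rw [hid]
  have hm : (ρ * κ) ^ 2 ≤ 1 := by rw [mul_pow]; nlinarith
  have k1 := young_mul (s := -(ρ * κ)) (by rwa [neg_sq]) p y (ε := 1 / 2) (by norm_num)
  have k2 := young_mul hm e y (ε := 1 / 2) (by norm_num)
  have k3 := mul_le_mul_of_nonneg_left k2 hτ.le
  have k4 : (2 + τ) * (p ^ 2 + y ^ 2) ≤ K * (p ^ 2 + y ^ 2) :=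
    mul_le_mul_of_nonneg_right hK1 (by positivity)
  have k5 : (τ + 1) * e ^ 2 ≤ K * τ * γ * e ^ 2 := mul_le_mul_of_nonneg_right hK2 (sq_nonneg e)
  have hW2 : W ^ 2 ≤ 2 * y ^ 2 + 2 * e ^ 2 + (κ * W) ^ 2 := by
    have h1 : W ^ 2 = (ρ * W) ^ 2 + (κ * W) ^ 2 := by
      rw [mul_pow, mul_pow, ← add_mul, hρκ, one_mul]
    have h2 : ρ * W = ρ * y - κ * e := by rw [hW, he]; ring
    have h3 : ρ ^ 2 * y ^ 2 ≤ 1 * y ^ 2 := mul_le_mul_of_nonneg_right hρ2 (sq_nonneg y)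
    have h4 : κ ^ 2 * e ^ 2 ≤ 1 * e ^ 2 := mul_le_mul_of_nonneg_right hκ2 (sq_nonneg e)
    rw [h1, h2]
    linear_combination 2 * h3 + 2 * h4 + sq_nonneg (ρ * y + κ * e)
  have hq2 : q ^ 2 ≤ 5 * e ^ 2 + 6 * y ^ 2 + 2 * (κ * W) ^ 2 := by
    have h1 : q ^ 2 = e ^ 2 + (κ * q) ^ 2 := by
      rw [he, mul_pow, mul_pow, ← add_mul, hρκ, one_mul]
    have h2 : κ * q = y - W := by rw [hW]; ring
    rw [h1, h2]
    linear_combination sq_nonneg (y + W) + 2 * hW2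
  have hc0 := (lyc_pos hτ).le
  have hc1 : lyc τ * 16 ≤ 1 := by
    unfold lyc
    rw [div_mul_eq_mul_div, div_le_one (by positivity)]
    nlinarith
  have hc2 : lyc τ * 2 ≤ 1 / (8 * τ) := by
    unfold lyc
    rw [div_mul_eq_mul_div, div_le_div_iff₀ (by positivity) (by positivity)]
    nlinarith
  have k6 : lyc τ * 2 * (κ * W) ^ 2 ≤ (κ * W) ^ 2 / (8 * τ) := by
    have := mul_le_mul_of_nonneg_right hc2 (sq_nonneg (κ * W))
    refine this.trans (le_of_eq ?_)
    ring
  have k7 : lyc τ * q ^ 2 ≤ lyc τ * (5 * e ^ 2 + 6 * y ^ 2 + 2 * (κ * W) ^ 2) :=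
    mul_le_mul_of_nonneg_left hq2 hc0
  have k8 : lyc τ * 16 * (p ^ 2 + y ^ 2 + e ^ 2) ≤ 1 * (p ^ 2 + y ^ 2 + e ^ 2) :=
    mul_le_mul_of_nonneg_right hc1 (by positivity)
  have k9 : 0 ≤ lyc τ * (p ^ 2 + y ^ 2 + e ^ 2) := by positivity
  linear_combination k1 + 2 * k3 + k4 + k5 + k6 + k7 + (1 / 2) * k8
    + 7 * mul_nonneg hc0 (sq_nonneg p) + mul_nonneg hc0 (sq_nonneg y)
    + 3 * mul_nonneg hc0 (sq_nonneg e) + sq_nonneg p + mul_nonneg hτ.le (sq_nonneg p)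
    + sq_nonneg y + (1 / 2) * sq_nonneg e

/-! ### Convolution in `L²` localised in frequency -/

lemma lintegral_enorm_mul_le {α : Type*} [MeasurableSpace α] {μ : Measure α} {F G : α → ℝ≥0∞}
    (hF : AEMeasurable F μ) (hG : AEMeasurable G μ) :
    ∫⁻ t, F t * G t ∂μ ≤ (∫⁻ t, F t ^ 2 ∂μ) ^ (1 / 2 : ℝ) * (∫⁻ t, G t ^ 2 ∂μ) ^ (1 / 2 : ℝ) := by
  have := ENNReal.lintegral_mul_le_Lp_mul_Lq μ Real.HolderConjugate.two_two hF hG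
  simpa using this

lemma enorm_L2 {V : Type*} [NormedAddCommGroup V] (f : L2 V) :
    ‖f‖ₑ = (∫⁻ ξ, ‖f ξ‖ₑ ^ 2) ^ (1 / 2 : ℝ) := by
  rw [Lp.enorm_def, eLpNorm_eq_lintegral_rpow_enorm_toReal (by norm_num) (by norm_num)]
  simp

lemma enorm_L2_sq {V : Type*} [NormedAddCommGroup V] (f : L2 V) :
    ‖f‖ₑ ^ 2 = ∫⁻ ξ, ‖f ξ‖ₑ ^ 2 := by
  rw [enorm_L2, ← ENNReal.rpow_natCast, ← ENNReal.rpow_mul]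
  norm_num

/-- The convolution of two functions. For square integrable `f, g` the integral converges at every
point, so that no junk value occurs; the functions need not be integrable. -/
def conv (f g : E3 → ℂ) (ξ : E3) : ℂ := ∫ t, f t * g (ξ - t)

lemma memLp_sub_left {g : E3 → ℂ} (hg : MemLp g 2 (volume : Measure E3)) (ξ : E3) :
    MemLp (fun t => g (ξ - t)) 2 (volume : Measure E3) :=
  hg.comp_measurePreserving (Measure.measurePreserving_sub_left volume ξ)

lemma integrable_conv (f g : L2 ℂ) (ξ : E3) : Integrable (fun t => f t * g (ξ - t)) :=
  MemLp.integrable_mul (p := 2) (q := 2) (Lp.memLp f) (memLp_sub_left (Lp.memLp g) ξ)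

lemma enorm_conv_le (f g : E3 → ℂ) (ξ : E3) :
    ‖conv f g ξ‖ₑ ≤ ∫⁻ t, ‖f t‖ₑ * ‖g (ξ - t)‖ₑ := by
  refine (enorm_integral_le_lintegral_enorm _).trans_eq ?_
  simp [enorm_mul]

lemma norm_conv_le (f g : L2 ℂ) (ξ : E3) : ‖conv f g ξ‖ ≤ ‖f‖ * ‖g‖ := by
  rw [← toReal_enorm, ← toReal_enorm, ← toReal_enorm, ← ENNReal.toReal_mul]
  refine ENNReal.toReal_mono (ENNReal.mul_ne_top enorm_ne_top enorm_ne_top) ?_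
  have m1 : AEMeasurable (fun t => ‖g (ξ - t)‖ₑ) (volume : Measure E3) :=
    (memLp_sub_left (Lp.memLp g) ξ).1.enorm
  refine (enorm_conv_le f g ξ).trans
    ((lintegral_enorm_mul_le (Lp.memLp f).1.enorm m1).trans_eq ?_)
  rw [enorm_L2, enorm_L2, lintegral_sub_left_eq_self (fun t => ‖g t‖ₑ ^ 2) ξ]

lemma conv_congr {f f' g g' : E3 → ℂ} (hf : f =ᵐ[volume] f') (hg : g =ᵐ[volume] g') :
    conv f g = conv f' g' := by
  funext ξ
  refine integral_congr_ae ?_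
  have := (Measure.measurePreserving_sub_left (volume : Measure E3) ξ).quasiMeasurePreserving.ae_eq_comp hg
  filter_upwards [hf, this] with t h1 h2
  simp only [Function.comp_apply] at h2
  rw [h1, h2]

lemma conv_comm (f g : E3 → ℂ) : conv f g = conv g f := by
  funext ξ
  unfold conv
  rw [← integral_sub_left_eq_self _ _ ξ]
  simp [mul_comm]

lemma stronglyMeasurable_conv (f g : L2 ℂ) : StronglyMeasurable (conv f g) := by
  refine StronglyMeasurable.integral_prod_right (f := fun ξ t => f t * g (ξ - t)) ?_
  exact ((Lp.stronglyMeasurable f).comp_measurable measurable_snd).mul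
    ((Lp.stronglyMeasurable g).comp_measurable (measurable_fst.sub measurable_snd))

lemma conv_add_left (f f' g : L2 ℂ) : conv (f + f' : L2 ℂ) g = fun ξ => conv f g ξ + conv f' g ξ := by
  rw [conv_congr (Lp.coeFn_add f f') (ae_eq_refl _)]
  funext ξ
  unfold conv
  rw [← integral_add (integrable_conv f g ξ) (integrable_conv f' g ξ)]
  simp [add_mul]

lemma conv_smul_left (a : ℂ) (f g : L2 ℂ) : conv (a • f : L2 ℂ) g = fun ξ => a * conv f g ξ := by
  rw [conv_congr (Lp.coeFn_smul a f) (ae_eq_refl _)]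
  funext ξ
  unfold conv
  rw [← integral_const_mul]
  simp [mul_assoc]

lemma conv_add_right (f g g' : L2 ℂ) : conv f (g + g' : L2 ℂ) = fun ξ => conv f g ξ + conv f g' ξ := by
  rw [conv_comm, conv_add_left, conv_comm f, conv_comm f]

lemma conv_smul_right (a : ℂ) (f g : L2 ℂ) : conv f (a • g : L2 ℂ) = fun ξ => a * conv f g ξ := by
  rw [conv_comm, conv_smul_left, conv_comm f]

/-! ### Volume of the blocks -/

lemma blk_subset_ball (k : ℕ) : blk k ⊆ Metric.ball 0 (2 ^ k) := by
  intro ξ h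
  have h1 := h.1
  rw [rad_eq] at h1
  have : ‖ξ‖ ≤ 2 * Real.pi * ‖ξ‖ := by nlinarith [norm_nonneg ξ, Real.pi_gt_three]
  simpa using lt_of_le_of_lt this h1

lemma volume_blk_lt_top (k : ℕ) : volume (blk k) < ∞ :=
  (measure_mono (blk_subset_ball k)).trans_lt measure_ball_lt_top

lemma memLp_chi_conv (l : ℕ) (f g : L2 ℂ) :
    MemLp (fun ξ => chi l ξ * conv f g ξ) 2 (volume : Measure E3) := by
  have h : MemLp (chi l) 2 (volume : Measure E3) :=
    memLp_indicator_const 2 (measurableSet_blk l) 1 (Or.inr (volume_blk_lt_top l).ne)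
  refine h.of_le_mul (c := ‖f‖ * ‖g‖) ?_ (Eventually.of_forall fun ξ => ?_)
  · exact ((measurable_chi l).stronglyMeasurable.mul (stronglyMeasurable_conv f g)).aestronglyMeasurable
  · rw [norm_mul, mul_comm]
    exact mul_le_mul_of_nonneg_right (norm_conv_le f g ξ) (norm_nonneg _)

/-- The restriction of the convolution `f * g` to the block `l`. -/
def convBlkFun (l : ℕ) (f g : L2 ℂ) : L2 ℂ := (memLp_chi_conv l f g).toLp _

lemma convBlkFun_ae (l : ℕ) (f g : L2 ℂ) :
    convBlkFun l f g =ᵐ[volume] fun ξ => chi l ξ * conv f g ξ := MemLp.coeFn_toLp _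

lemma norm_convBlkFun_le (l : ℕ) (f g : L2 ℂ) :
    ‖convBlkFun l f g‖ ≤
      ‖(memLp_indicator_const 2 (measurableSet_blk l) (1 : ℂ)
        (Or.inr (volume_blk_lt_top l).ne)).toLp _‖ * ‖f‖ * ‖g‖ := by
  rw [mul_assoc, mul_comm]
  refine Lp.norm_le_mul_norm_of_ae_le_mul ?_
  filter_upwards [convBlkFun_ae l f g, MemLp.coeFn_toLp (memLp_indicator_const 2
    (measurableSet_blk l) (1 : ℂ) (Or.inr (volume_blk_lt_top l).ne))] with ξ h1 h2
  rw [h1, h2, norm_mul, mul_comm]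
  exact mul_le_mul_of_nonneg_right (norm_conv_le f g ξ) (norm_nonneg _)

/-- The bilinear map `(f, g) ↦ 1_{B_l} (f * g)` on `L²`. -/
def convBlk (l : ℕ) : L2 ℂ →L[ℂ] L2 ℂ →L[ℂ] L2 ℂ :=
  LinearMap.mkContinuous₂
    (LinearMap.mk₂ ℂ (convBlkFun l)
      (fun f f' g => by
        apply Lp.ext
        filter_upwards [convBlkFun_ae l (f + f') g, convBlkFun_ae l f g, convBlkFun_ae l f' g,
          Lp.coeFn_add (convBlkFun l f g) (convBlkFun l f' g)] with ξ h1 h2 h3 h4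
        rw [h1, h4, Pi.add_apply, h2, h3, conv_add_left, mul_add])
      (fun a f g => by
        apply Lp.ext
        filter_upwards [convBlkFun_ae l (a • f) g, convBlkFun_ae l f g,
          Lp.coeFn_smul a (convBlkFun l f g)] with ξ h1 h2 h4
        rw [h1, h4, Pi.smul_apply, h2, conv_smul_left, smul_eq_mul]; ring)
      (fun f g g' => by
        apply Lp.ext
        filter_upwards [convBlkFun_ae l f (g + g'), convBlkFun_ae l f g, convBlkFun_ae l f g',
          Lp.coeFn_add (convBlkFun l f g) (convBlkFun l f g')] with ξ h1 h2 h3 h4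
        rw [h1, h4, Pi.add_apply, h2, h3, conv_add_right, mul_add])
      (fun a f g => by
        apply Lp.ext
        filter_upwards [convBlkFun_ae l f (a • g), convBlkFun_ae l f g,
          Lp.coeFn_smul a (convBlkFun l f g)] with ξ h1 h2 h4
        rw [h1, h4, Pi.smul_apply, h2, conv_smul_right, smul_eq_mul]; ring))
    _ (norm_convBlkFun_le l)

lemma convBlk_ae (l : ℕ) (f g : L2 ℂ) :
    convBlk l f g =ᵐ[volume] fun ξ => chi l ξ * conv f g ξ := convBlkFun_ae l f g

lemma convBlk_comm (l : ℕ) (f g : L2 ℂ) : convBlk l f g = convBlk l g f := by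
  apply Lp.ext
  filter_upwards [convBlk_ae l f g, convBlk_ae l g f] with ξ h1 h2
  rw [h1, h2, conv_comm]

/-- Young's inequality `‖f * g‖_{L²} ≤ ‖f‖_{L¹} ‖g‖_{L²}`. -/
lemma enorm_convBlk_le (l : ℕ) (f g : L2 ℂ) :
    ‖convBlk l f g‖ₑ ≤ (∫⁻ t, ‖f t‖ₑ) * ‖g‖ₑ := by
  rw [← ENNReal.pow_le_pow_left_iff two_ne_zero, enorm_L2_sq, mul_pow, enorm_L2_sq]
  have mf : Measurable fun t => ‖f t‖ₑ := (Lp.stronglyMeasurable f).measurable.enorm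
  have mg : Measurable fun t => ‖g t‖ₑ := (Lp.stronglyMeasurable g).measurable.enorm
  have key : ∀ ξ, ‖conv f g ξ‖ₑ ^ 2 ≤ (∫⁻ t, ‖f t‖ₑ) * ∫⁻ t, ‖f t‖ₑ * ‖g (ξ - t)‖ₑ ^ 2 := by
    intro ξ
    have mg' : Measurable fun t => ‖g (ξ - t)‖ₑ := mg.comp (measurable_const.sub measurable_id)
    -- Cauchy-Schwarz for the measure `|f| dt`
    have h := lintegral_enorm_mul_le (μ := volume) (F := fun t => ‖f t‖ₑ ^ (1 / 2 : ℝ))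
      (G := fun t => ‖f t‖ₑ ^ (1 / 2 : ℝ) * ‖g (ξ - t)‖ₑ) (mf.pow_const _).aemeasurable
      ((mf.pow_const _).mul mg').aemeasurable
    have hs : ∀ a : ℝ≥0∞, a ^ (1 / 2 : ℝ) * a ^ (1 / 2 : ℝ) = a := fun a => by
      rw [← ENNReal.rpow_add_of_nonneg _ _ (by norm_num) (by norm_num)]; norm_num
    simp only [← mul_assoc, hs, mul_pow] at h
    simp only [sq (_ ^ (1 / 2 : ℝ)), hs] at h
    refine (pow_le_pow_left' ((enorm_conv_le f g ξ).trans h) 2).trans_eq ?_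
    rw [mul_pow, sq (_ ^ (1 / 2 : ℝ)), sq (_ ^ (1 / 2 : ℝ)), hs, hs]
  calc ∫⁻ ξ, ‖convBlk l f g ξ‖ₑ ^ 2 ≤ ∫⁻ ξ, (∫⁻ t, ‖f t‖ₑ) * ∫⁻ t, ‖f t‖ₑ * ‖g (ξ - t)‖ₑ ^ 2 := by
        refine lintegral_mono_ae ?_
        filter_upwards [convBlk_ae l f g] with ξ h
        refine le_trans ?_ (key ξ)
        rw [h, enorm_mul]
        refine pow_le_pow_left' (mul_le_of_le_one_left' ?_) 2
        rw [← enorm_one (G := ℂ)]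
        exact enorm_le_iff_norm_le.2 ((norm_chi_le l ξ).trans norm_one.ge)
    _ = (∫⁻ t, ‖f t‖ₑ) * ∫⁻ ξ, ∫⁻ t, ‖f t‖ₑ * ‖g (ξ - t)‖ₑ ^ 2 := by
        rw [lintegral_const_mul]
        exact ((mf.comp measurable_snd).mul
          ((mg.comp (measurable_fst.sub measurable_snd)).pow_const 2)).lintegral_prod_right'
    _ = (∫⁻ t, ‖f t‖ₑ) ^ 2 * ∫⁻ ξ, ‖g ξ‖ₑ ^ 2 := by
        rw [lintegral_lintegral_swap, sq, mul_assoc]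
        · congr 1
          rw [← lintegral_mul_const _ mf]
          refine lintegral_congr fun t => ?_
          rw [lintegral_const_mul' _ _ enorm_ne_top, lintegral_sub_right_eq_self (fun ξ => ‖g ξ‖ₑ ^ 2) t]
        · exact ((mf.comp measurable_snd).mul
          ((mg.comp (measurable_fst.sub measurable_snd)).pow_const 2)).aemeasurable

lemma rad_add_le (ξ η : E3) : rad (ξ + η) ≤ rad ξ + rad η := by
  unfold rad; rw [smul_add]; exact norm_add_le _ _

/-- The frequencies of a product of blocks are at most the sum of the frequencies of the factors. -/
lemma convBlk_proj_eq_zero {l j k : ℕ} (h : max j k + 1 < l) (f g : L2 ℂ) :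
    convBlk l (proj j f) (proj k g) = 0 := by
  apply Lp.ext
  filter_upwards [convBlk_ae l (proj j f) (proj k g), Lp.coeFn_zero ℂ 2 (volume : Measure E3)]
    with ξ h1 h2
  rw [h1, h2, Pi.zero_apply]
  by_cases hξ : ξ ∈ blk l
  swap
  · rw [chi_of_notMem hξ, zero_mul]
  rw [conv_congr (proj_ae j f) (proj_ae k g)]
  have : conv (fun ξ => chi j ξ • f ξ) (fun ξ => chi k ξ • g ξ) ξ = 0 := by
    unfold conv
    rw [integral_eq_zero_of_ae]
    refine Eventually.of_forall fun t => ?_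
    simp only [Pi.zero_apply]
    by_cases hj : t ∈ blk j
    · by_cases hk : ξ - t ∈ blk k
      · exfalso
        have h3 := hξ.2 (by omega)
        have h4 := rad_add_le t (ξ - t)
        rw [add_sub_cancel] at h4
        have h5 : (2 : ℝ) ^ j ≤ 2 ^ max j k := pow_le_pow_right₀ (by norm_num) (le_max_left _ _)
        have h6 : (2 : ℝ) ^ k ≤ 2 ^ max j k := pow_le_pow_right₀ (by norm_num) (le_max_right _ _)
        have h7 : (2 : ℝ) ^ (max j k + 2) ≤ 2 ^ l := pow_le_pow_right₀ (by norm_num) (by omega)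
        rw [pow_add] at h7
        linarith [hj.1, hk.1]
      · simp [chi_of_notMem hk]
    · simp [chi_of_notMem hj]
  rw [this, mul_zero]

/-! ### Bernstein's inequality on the blocks -/

/-- `√2`, as an extended nonnegative number; `2^{s/2}` is written as a power of it. -/
def sq2 : ℝ≥0∞ := ENNReal.ofReal √2

lemma sq2_sq : sq2 ^ 2 = 2 := by
  rw [sq2, ← ENNReal.ofReal_pow (by positivity), Real.sq_sqrt (by norm_num)]; simp

lemma one_le_sq2 : 1 ≤ sq2 := by
  rw [sq2, ENNReal.one_le_ofReal]
  exact Real.one_le_sqrt.2 (by norm_num)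

lemma sq2_ne_top : sq2 ≠ ∞ := ENNReal.ofReal_ne_top

lemma rad_le_of_mem_blk_zero {ξ : E3} (h : ξ ∈ blk 0) : rad ξ < 1 := by simpa using h.1

lemma half_le_rho_sq {k : ℕ} (hk : k ≠ 0) {ξ : E3} (h : ξ ∈ blk k) : 1 ≤ 2 * rho ξ ^ 2 := by
  have h1 := h.2 hk
  have h2 : (2 : ℝ) ^ 1 ≤ 2 ^ k := pow_le_pow_right₀ (by norm_num) (by omega)
  have h3 : 1 ≤ rad ξ := by linarith
  have h4 := brk_sq ξ
  have hb := brk_pos ξ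
  have h5 : rho ξ ^ 2 = rad ξ ^ 2 / brk ξ ^ 2 := by unfold rho; rw [mul_pow, inv_pow]; rfl
  rw [h5, h4, mul_div_assoc', le_div_iff₀ (by positivity)]
  nlinarith

/-- The square of the function `1/ρ` is integrable on the blocks: near `ξ = 0` it has the size
`|ξ|^{-2}`, which is integrable in three dimensions. -/
lemma exists_lintegral_inv_rho :
    ∃ C : ℝ≥0, ∀ j, ∫⁻ ξ in blk j, (ENNReal.ofReal (rho ξ))⁻¹ ^ 2 ≤ C * sq2 ^ (6 * j) := by
  have h0 : ∫⁻ ξ in blk 0, (ENNReal.ofReal (rho ξ))⁻¹ ^ 2 < ∞ := by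
    have hi : IntegrableOn (fun ξ : E3 => (fun r : ℝ => (r⁻¹) ^ 2) ‖ξ‖) (Metric.ball 0 1) volume := by
      refine (integrableOn_fun_norm_addHaar (E := E3) (F := ℝ) volume (f := fun r => r⁻¹ ^ 2) (r := 1)).2 ?_
      have : IntegrableOn (fun _ : ℝ => (1 : ℝ)) (Set.Ioo (0 : ℝ) 1) volume := by
        simp
      refine this.congr_fun (fun y hy => ?_) measurableSet_Ioo
      have : y ≠ 0 := hy.1.ne'
      simp [finrank_euclideanSpace]
      field_simp
    have hi' := hi.2
    refine lt_of_le_of_lt ?_ hi'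
    refine (lintegral_mono_ae ?_).trans (lintegral_mono_set ((blk_subset_ball 0).trans (by simp)))
    have : ∀ᵐ ξ : E3 ∂(volume.restrict (blk 0)), ξ ≠ 0 := by
      refine ae_restrict_of_ae ?_
      rw [ae_iff]; simp
    filter_upwards [this, ae_restrict_mem (measurableSet_blk 0)] with ξ h1 h2
    have hn : 0 < ‖ξ‖ := norm_pos_iff.2 h1
    have hr : ‖ξ‖ ≤ rho ξ := by
      have h3 := rad_le_of_mem_blk_zero h2
      have h4 := brk_le ξ
      unfold rho
      rw [← div_eq_mul_inv, le_div_iff₀ (brk_pos ξ)]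
      rw [rad_eq] at *
      nlinarith [Real.pi_gt_three]
    rw [← enorm_norm, ← ofReal_norm, norm_norm, norm_pow, norm_inv, norm_norm,
      ENNReal.ofReal_pow (by positivity), ENNReal.ofReal_inv_of_pos hn]
    gcongr
  have h1 : ∀ j, j ≠ 0 → ∫⁻ ξ in blk j, (ENNReal.ofReal (rho ξ))⁻¹ ^ 2 ≤
      2 * volume (Metric.ball (0 : E3) 1) * sq2 ^ (6 * j) := by
    intro j hj
    calc ∫⁻ ξ in blk j, (ENNReal.ofReal (rho ξ))⁻¹ ^ 2 ≤ ∫⁻ ξ in blk j, 2 := by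
          refine lintegral_mono_ae ?_
          filter_upwards [ae_restrict_mem (measurableSet_blk j)] with ξ h
          have h2 := half_le_rho_sq hj h
          have h3 : rho ξ ≠ 0 := by intro h; rw [h] at h2; norm_num at h2
          have h4 : 0 < rho ξ := (rho_nonneg ξ).lt_of_ne' h3
          rw [← ENNReal.ofReal_inv_of_pos h4, ← ENNReal.ofReal_pow (by positivity)]
          refine ENNReal.ofReal_le_of_le_toReal ?_
          rw [inv_pow, inv_le_comm₀ (by positivity) (by norm_num)]
          simp only [ENNReal.toReal_ofNat]
          linarith
      _ = 2 * volume (blk j) := by simp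
      _ ≤ 2 * (ENNReal.ofReal ((2 ^ j) ^ 3) * volume (Metric.ball (0 : E3) 1)) := by
          gcongr
          refine (measure_mono (blk_subset_ball j)).trans_eq ?_
          rw [Measure.addHaar_ball _ _ (by positivity)]
          simp [finrank_euclideanSpace]
      _ = _ := by
          have : ENNReal.ofReal ((2 ^ j) ^ 3) = sq2 ^ (6 * j) := by
            rw [show 6 * j = 2 * (j * 3) by ring, pow_mul, sq2_sq, ← pow_mul,
              ENNReal.ofReal_pow (by norm_num)]
            simp
          rw [this]; ring
  have hC : (∫⁻ ξ in blk 0, (ENNReal.ofReal (rho ξ))⁻¹ ^ 2) + 2 * volume (Metric.ball (0 : E3) 1) ≠ ∞ :=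
    ENNReal.add_ne_top.2 ⟨h0.ne, ENNReal.mul_ne_top (by simp) measure_ball_lt_top.ne⟩
  refine ⟨((∫⁻ ξ in blk 0, (ENNReal.ofReal (rho ξ))⁻¹ ^ 2) +
    2 * volume (Metric.ball (0 : E3) 1)).toNNReal, fun j => ?_⟩
  rw [ENNReal.coe_toNNReal hC]
  rcases eq_or_ne j 0 with rfl | hj
  · simp
  · refine (h1 j hj).trans ?_
    gcongr
    exact le_add_self

/-- The constant in Bernstein's inequality on the blocks. -/
def bern : ℝ≥0 := exists_lintegral_inv_rho.choose ^ (1 / 2 : ℝ)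

/-- Bernstein's inequality, with the loss of a factor `ρ` at low frequencies. -/
lemma lintegral_enorm_le {V : Type*} [NormedAddCommGroup V] {j : ℕ} {f : L2 ℂ} {w : L2 V} {C : ℝ≥0}
    (hf : ∀ᵐ ξ, ξ ∉ blk j → f ξ = 0) (h : ∀ᵐ ξ, ‖(rho ξ : ℂ) * f ξ‖ ≤ C * ‖w ξ‖) :
    ∫⁻ ξ, ‖f ξ‖ₑ ≤ bern * C * sq2 ^ (3 * j) * ‖w‖ₑ := by
  have hz : ∀ᵐ ξ : E3, rho ξ ≠ 0 := by
    have : ∀ᵐ ξ : E3, ξ ≠ 0 := by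
      rw [ae_iff]; simp
    filter_upwards [this] with ξ hξ
    unfold rho
    refine mul_ne_zero ?_ (inv_ne_zero (brk_pos ξ).ne')
    rw [rad_eq]
    exact mul_ne_zero (by positivity) (norm_ne_zero_iff.2 hξ)
  have e1 : ∫⁻ ξ, ‖f ξ‖ₑ ≤ ∫⁻ ξ in blk j, (ENNReal.ofReal (rho ξ))⁻¹ * (C * ‖w ξ‖ₑ) := by
    rw [← lintegral_indicator (measurableSet_blk j)]
    refine lintegral_mono_ae ?_
    filter_upwards [hf, h, hz] with ξ h1 h2 h3
    by_cases hξ : ξ ∈ blk j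
    swap
    · simp [h1 hξ]
    rw [Set.indicator_of_mem hξ]
    have h4 : ENNReal.ofReal (rho ξ) * ‖f ξ‖ₑ ≤ C * ‖w ξ‖ₑ := by
      have : ‖(rho ξ : ℂ) * f ξ‖ₑ = ENNReal.ofReal (rho ξ) * ‖f ξ‖ₑ := by
        rw [enorm_mul, ← ofReal_norm (rho ξ : ℂ), Complex.norm_real, Real.norm_of_nonneg (rho_nonneg ξ)]
      rw [← this, ← ofReal_norm, ← ofReal_norm, ← ENNReal.ofReal_coe_nnreal,
        ← ENNReal.ofReal_mul (NNReal.coe_nonneg C)]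
      exact ENNReal.ofReal_le_ofReal h2
    have h5 : ENNReal.ofReal (rho ξ) ≠ 0 := by
      simpa using (rho_nonneg ξ).lt_of_ne' h3
    rw [← ENNReal.mul_le_iff_le_inv h5 ENNReal.ofReal_ne_top]
    exact h4
  refine e1.trans ((lintegral_enorm_mul_le
    (measurable_rho.ennreal_ofReal.inv).aemeasurable
    ((Lp.stronglyMeasurable w).enorm.const_mul _).aemeasurable).trans ?_)
  have e2 : (∫⁻ ξ in blk j, (ENNReal.ofReal (rho ξ))⁻¹ ^ 2) ^ (1 / 2 : ℝ) ≤ bern * sq2 ^ (3 * j) := by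
    refine (ENNReal.rpow_le_rpow (exists_lintegral_inv_rho.choose_spec j) (by norm_num)).trans_eq ?_
    rw [ENNReal.mul_rpow_of_nonneg _ _ (by norm_num), bern, ENNReal.coe_rpow_of_nonneg _ (by norm_num),
      show 6 * j = 3 * j * 2 by ring, pow_mul, ← ENNReal.rpow_natCast (sq2 ^ (3 * j)) 2,
      ← ENNReal.rpow_mul]
    norm_num
  have e3 : (∫⁻ ξ in blk j, (C * ‖w ξ‖ₑ) ^ 2) ^ (1 / 2 : ℝ) ≤ C * ‖w‖ₑ := by
    simp only [mul_pow]
    rw [lintegral_const_mul' _ _ (by finiteness), ENNReal.mul_rpow_of_nonneg _ _ (by norm_num), enorm_L2,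
      ← ENNReal.rpow_natCast, ← ENNReal.rpow_mul]
    norm_num
    exact mul_le_mul_right (ENNReal.rpow_le_rpow (setLIntegral_le_lintegral _ _) (by norm_num)) _
  refine (mul_le_mul' e2 e3).trans_eq (by ring)

lemma enorm_le_of_ae_le {V W : Type*} [NormedAddCommGroup V] [NormedAddCommGroup W] {f : L2 V}
    {w : L2 W} {C : ℝ≥0} (h : ∀ᵐ ξ, ‖f ξ‖ ≤ C * ‖w ξ‖) : ‖f‖ₑ ≤ C * ‖w‖ₑ := by
  have := Lp.norm_le_mul_norm_of_ae_le_mul h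
  rw [← ofReal_norm, ← ofReal_norm, ← ENNReal.ofReal_coe_nnreal, ← ENNReal.ofReal_mul (NNReal.coe_nonneg C)]
  exact ENNReal.ofReal_le_ofReal this

/-- The coefficients of the bilinear estimate: the product of the blocks `j` and `k` has no
frequencies in the block `l` unless `l ≤ max j k + 1`. -/
def bilC (K : ℝ≥0) (l j k : ℕ) : ℝ≥0∞ := if l ≤ max j k + 1 then K * sq2 ^ (3 * min j k) else 0

lemma sum_pow_le {a : ℝ≥0∞} (ha : 2 ≤ a) (n : ℕ) : ∑ l ∈ Finset.range n, a ^ l ≤ a ^ n := by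
  induction n with
  | zero => simp
  | succ n ih =>
    rw [Finset.sum_range_succ, pow_succ]
    calc _ ≤ a ^ n + a ^ n := by gcongr
      _ = a ^ n * 2 := by ring
      _ ≤ _ := by gcongr

lemma two_le_sq2_pow {n : ℕ} (hn : 2 ≤ n) : 2 ≤ sq2 ^ n := by
  rw [← sq2_sq]; exact pow_le_pow_right₀ one_le_sq2 hn

/-- The weights `2^{5l/2}` sum up, over the output frequencies `l ≤ max j k + 1`, to a multiple of
`2^{5 max(j,k)/2}`. The Bernstein factor `2^{3 min(j,k)/2}` is then bounded by the weight of the lower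
frequency: the weighted space is an algebra, with room to spare. -/
lemma sum_bilC (K : ℝ≥0) (j k : ℕ) :
    ∑' l, sq2 ^ (5 * l) * bilC K l j k ≤ (32 * K : ℝ≥0) * (sq2 ^ (5 * j) * sq2 ^ (5 * k)) := by
  have h1 : ∀ l ∉ Finset.range (max j k + 2), sq2 ^ (5 * l) * bilC K l j k = 0 := by
    intro l hl
    rw [bilC, if_neg, mul_zero]
    simp at hl; omega
  rw [tsum_eq_sum h1]
  calc ∑ l ∈ Finset.range (max j k + 2), sq2 ^ (5 * l) * bilC K l j k
      ≤ ∑ l ∈ Finset.range (max j k + 2), (sq2 ^ 5) ^ l * (K * sq2 ^ (3 * min j k)) := by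
        refine Finset.sum_le_sum fun l _ => ?_
        rw [pow_mul, bilC]
        gcongr
        split_ifs <;> simp
    _ ≤ (sq2 ^ 5) ^ (max j k + 2) * (K * sq2 ^ (5 * min j k)) := by
        rw [← Finset.sum_mul]
        refine mul_le_mul' (sum_pow_le (two_le_sq2_pow (by norm_num)) _) ?_
        gcongr
        · exact one_le_sq2
        · norm_num
    _ = _ := by
        have : (sq2 ^ 5) ^ (max j k + 2) = sq2 ^ (5 * max j k) * 32 := by
          rw [← pow_mul, mul_add, pow_add]
          congr 1
          rw [show 5 * 2 = 2 * 5 by norm_num, pow_mul, sq2_sq]; norm_num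
        rw [this, ← pow_add, ← mul_add, ← max_add_min j k, mul_add, pow_add]
        push_cast
        ring

/-- The bilinear estimate for a pair of blocks. Both factors are controlled in `L²`, the first one
only after multiplication by `ρ`. Young's inequality is used with the `L¹` norm on the factor of lower
frequency, to which Bernstein's inequality applies. -/
lemma enorm_convBlk_proj_le {V W : Type*} [NormedAddCommGroup V] [NormedAddCommGroup W] {C : ℝ≥0}
    (l j k : ℕ) {f g : L2 ℂ} {x : L2 V} {y : L2 W}
    (hf : ∀ᵐ ξ, ‖(rho ξ : ℂ) * proj j f ξ‖ ≤ C * ‖x ξ‖)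
    (hg : ∀ᵐ ξ, ‖proj k g ξ‖ ≤ C * ‖y ξ‖) :
    ‖convBlk l (proj j f) (proj k g)‖ₑ ≤ bilC (2 * (bern * C ^ 2)) l j k * (‖x‖ₑ * ‖y‖ₑ) := by
  have supp : ∀ (i : ℕ) (h : L2 ℂ), ∀ᵐ ξ, ξ ∉ blk i → proj i h ξ = 0 := by
    intro i h
    filter_upwards [proj_ae i h] with ξ h1 h2
    rw [h1, chi_of_notMem h2, zero_smul]
  unfold bilC
  split_ifs with hl
  swap
  · rw [convBlk_proj_eq_zero (by omega)]; simp
  rcases le_or_gt j k with hjk | hjk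
  · rw [min_eq_left hjk]
    refine (enorm_convBlk_le _ _ _).trans ((mul_le_mul' (lintegral_enorm_le (supp j f) hf)
      (enorm_le_of_ae_le hg)).trans ?_)
    calc _ = (1 * (bern * C ^ 2)) * sq2 ^ (3 * j) * (‖x‖ₑ * ‖y‖ₑ) := by ring
      _ ≤ _ := by push_cast; gcongr; norm_num
  · rw [min_eq_right hjk.le, convBlk_comm]
    have hg' : ∀ᵐ ξ, ‖(rho ξ : ℂ) * proj k g ξ‖ ≤ C * ‖y ξ‖ := by
      filter_upwards [hg] with ξ h
      rw [norm_mul, Complex.norm_real, Real.norm_of_nonneg (rho_nonneg ξ)]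
      exact (mul_le_of_le_one_left (norm_nonneg _) (rho_le_one ξ)).trans h
    -- here `j ≥ 1`, and the factor `ρ` is harmless away from the low frequencies
    have hf' : ∀ᵐ ξ, ‖proj j f ξ‖ ≤ (2 * C : ℝ≥0) * ‖x ξ‖ := by
      filter_upwards [hf, supp j f] with ξ h1 h2
      by_cases hξ : ξ ∈ blk j
      swap
      · rw [h2 hξ, norm_zero]; positivity
      have h3 := half_le_rho_sq (by omega) hξ
      have h4 := rho_nonneg ξ
      have h5 := rho_le_one ξ
      rw [norm_mul, Complex.norm_real, Real.norm_of_nonneg h4] at h1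
      push_cast
      nlinarith [norm_nonneg (proj j f ξ)]
    refine (enorm_convBlk_le _ _ _).trans ((mul_le_mul' (lintegral_enorm_le (supp k g) hg')
      (enorm_le_of_ae_le hf')).trans_eq ?_)
    push_cast
    ring

lemma sum_chi (n : ℕ) (ξ : E3) :
    ∑ k ∈ Finset.range n, chi k ξ = if (exists_mem_blk ξ).choose < n then 1 else 0 := by
  set m := (exists_mem_blk ξ).choose
  have hm : ξ ∈ blk m := (exists_mem_blk ξ).choose_spec
  have : ∀ k ∈ Finset.range n, chi k ξ = if k = m then 1 else 0 := by
    intro k _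
    split_ifs with h
    · rw [h, chi_of_mem hm]
    · exact chi_of_notMem fun h' => h (blk_disjoint h' hm)
  rw [Finset.sum_congr rfl this]
  simp

/-- An element of `L²` is the sum of its blocks. -/
lemma tendsto_sum_proj {V : Type*} [NormedAddCommGroup V] [NormedSpace ℂ V] (f : L2 V) :
    Tendsto (fun n => ∑ k ∈ Finset.range n, proj k f) atTop (𝓝 f) := by
  have hae : ∀ n, (∑ k ∈ Finset.range n, proj k f : L2 V) =ᵐ[volume]
      fun ξ => (∑ k ∈ Finset.range n, chi k ξ) • f ξ := by
    intro n
    induction n with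
    | zero =>
      exact Eventually.of_forall fun ξ => by simp
    | succ n ih =>
      rw [Finset.sum_range_succ]
      filter_upwards [ih, proj_ae n f, Lp.coeFn_add (∑ k ∈ Finset.range n, proj k f) (proj n f)]
        with ξ h1 h2 h3
      rw [h3, Pi.add_apply, h1, h2, Finset.sum_range_succ, add_smul]
  have h2 : Tendsto (fun n => ∫⁻ ξ, ‖f ξ - (∑ k ∈ Finset.range n, chi k ξ) • f ξ‖ₑ ^ 2) atTop
      (𝓝 (∫⁻ _ : E3, 0)) := by
    refine tendsto_lintegral_of_dominated_convergence' (fun ξ => ‖f ξ‖ₑ ^ 2) (fun n => ?_)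
      (fun n => Eventually.of_forall fun ξ => ?_) ?_ (Eventually.of_forall fun ξ => ?_)
    · have : StronglyMeasurable fun ξ => f ξ - (∑ k ∈ Finset.range n, chi k ξ) • f ξ :=
        (Lp.stronglyMeasurable f).sub
          ((Finset.measurable_fun_sum _ fun k _ => measurable_chi k).stronglyMeasurable.smul
            (Lp.stronglyMeasurable f))
      exact (this.enorm.pow_const 2).aemeasurable
    · beta_reduce
      rw [sum_chi]
      split_ifs <;> simp
    · rw [← enorm_L2_sq]; finiteness
    · refine tendsto_const_nhds.congr' ?_
      filter_upwards [eventually_gt_atTop (exists_mem_blk ξ).choose] with n hn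
      rw [sum_chi, if_pos hn]
      simp
  rw [lintegral_zero] at h2
  rw [tendsto_iff_edist_tendsto_0]
  have h3 : ∀ n, edist (∑ k ∈ Finset.range n, proj k f) f =
      (∫⁻ ξ, ‖f ξ - (∑ k ∈ Finset.range n, chi k ξ) • f ξ‖ₑ ^ 2) ^ (1 / 2 : ℝ) := by
    intro n
    rw [edist_comm, edist_eq_enorm_sub, enorm_L2]
    congr 1
    refine lintegral_congr_ae ?_
    filter_upwards [hae n, Lp.coeFn_sub f (∑ k ∈ Finset.range n, proj k f)] with ξ h1 h2
    rw [h2, Pi.sub_apply, h1]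
  simp only [h3]
  have := h2.ennrpow_const (1 / 2 : ℝ)
  simpa using this

/-- Summation of the block estimates of a continuous bilinear map. -/
lemma enorm_bilinear_le {V W : Type*} [NormedAddCommGroup V] [NormedSpace ℂ V]
    [NormedAddCommGroup W] [NormedSpace ℂ W] {F : Type*} [NormedAddCommGroup F] [NormedSpace ℂ F]
    (B : L2 V →L[ℂ] L2 W →L[ℂ] F) {b : ℕ → ℕ → ℝ≥0∞} (f : L2 V) (g : L2 W)
    (h : ∀ j k, ‖B (proj j f) (proj k g)‖ₑ ≤ b j k) : ‖B f g‖ₑ ≤ ∑' j, ∑' k, b j k := by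
  have hc : Continuous fun p : L2 V × L2 W => B p.1 p.2 := B.continuous₂
  have h1 := (hc.tendsto (f, g)).comp ((tendsto_sum_proj f).prodMk_nhds (tendsto_sum_proj g))
  refine le_of_tendsto h1.enorm (Eventually.of_forall fun n => ?_)
  simp only [Function.comp_apply, map_sum, FunLike.coe_sum, Finset.sum_apply]
  calc _ ≤ ∑ k ∈ Finset.range n, ∑ j ∈ Finset.range n, b j k :=
        (enorm_sum_le _ _).trans (Finset.sum_le_sum fun k _ =>
          (enorm_sum_le _ _).trans (Finset.sum_le_sum fun j _ => h j k))
    _ = ∑ j ∈ Finset.range n, ∑ k ∈ Finset.range n, b j k := Finset.sum_comm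
    _ ≤ ∑ j ∈ Finset.range n, ∑' k, b j k :=
        Finset.sum_le_sum fun j _ => ENNReal.sum_le_tsum _
    _ ≤ _ := ENNReal.sum_le_tsum _

/-! ### The linearised equation on the frequency blocks -/

lemma exists_bound_rho_kap {f : ℝ → ℝ → ℝ} (hf : Continuous fun p : ℝ × ℝ => f p.1 p.2) :
    ∃ C : ℝ, ∀ ξ, ‖((f (rho ξ) (kap ξ) : ℝ) : ℂ)‖ ≤ C := by
  obtain ⟨C, hC⟩ := (isCompact_Icc.prod isCompact_Icc : IsCompact
    (Set.Icc (0 : ℝ) 1 ×ˢ Set.Icc (0 : ℝ) 1)).exists_bound_of_continuousOn hf.continuousOn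
  refine ⟨C, fun ξ => ?_⟩
  rw [Complex.norm_real]
  exact hC (rho ξ, kap ξ) ⟨⟨rho_nonneg ξ, rho_le_one ξ⟩, ⟨(kap_pos ξ).le, kap_le_one ξ⟩⟩

lemma brk_le_of_mem_blk {k : ℕ} {ξ : E3} (h : ξ ∈ blk k) : brk ξ ≤ 1 + 2 ^ k :=
  (brk_le ξ).trans (by linarith [h.1])

lemma exists_bound_rho_brk (k : ℕ) {f : ℝ → ℝ → ℝ} (hf : Continuous fun p : ℝ × ℝ => f p.1 p.2) :
    ∃ C : ℝ, ∀ ξ, ‖chi k ξ * ((f (rho ξ) (brk ξ) : ℝ) : ℂ)‖ ≤ C := by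
  obtain ⟨C, hC⟩ := (isCompact_Icc.prod isCompact_Icc : IsCompact
    (Set.Icc (0 : ℝ) 1 ×ˢ Set.Icc (0 : ℝ) (1 + 2 ^ k))).exists_bound_of_continuousOn hf.continuousOn
  refine ⟨max C 0, fun ξ => ?_⟩
  by_cases h : ξ ∈ blk k
  · rw [chi_of_mem h, one_mul, Complex.norm_real]
    exact (hC (rho ξ, brk ξ) ⟨⟨rho_nonneg ξ, rho_le_one ξ⟩,
      ⟨(brk_pos ξ).le, brk_le_of_mem_blk h⟩⟩).trans (le_max_left _ _)
  · simp [chi_of_notMem h]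

lemma measurable_ofReal_comp {f : ℝ → ℝ → ℝ} (hf : Continuous fun p : ℝ × ℝ => f p.1 p.2)
    {a b : E3 → ℝ} (ha : Measurable a) (hb : Measurable b) :
    Measurable fun ξ => ((f (a ξ) (b ξ) : ℝ) : ℂ) :=
  Complex.measurable_ofReal.comp (hf.measurable.comp (ha.prodMk hb))

/-- The generator of the linearised equation in the unknowns `p = |D|(u+τv)^`,
`q = (1+|D|²)^{1/2} v^`, `y = (v+τw)^`, as a function of `ρ = |D|/(1+|D|²)^{1/2}` and
`b = (1+|D|²)^{1/2}`. -/
def genMat (τ γ ρ b : ℝ) : Fin 3 → Fin 3 → ℝ :=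
  ![![0, 0, ρ * b], ![0, -τ⁻¹, b * τ⁻¹], ![-(ρ * b), -γ * (ρ * b) * ρ, 0]]

/-- The symmetric matrix of the Lyapunov functional in the unknowns `p, q, y`, for
`κ = (1+|D|²)^{-1/2}`. -/
def lyMat (τ γ ρ κ : ℝ) : Fin 3 → Fin 3 → ℝ :=
  ![![lyK τ γ, 0, ρ * κ / 2],
    ![0, lyK τ γ * τ * γ * ρ ^ 2 + κ ^ 4 / (8 * τ), -τ * ρ ^ 2 * κ - κ ^ 3 / (8 * τ)],
    ![ρ * κ / 2, -τ * ρ ^ 2 * κ - κ ^ 3 / (8 * τ), lyK τ γ + κ ^ 2 / (8 * τ)]]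

/-- The matrix of the dissipated quantities `ρp, ρq, ρy, κ(y - κq)`; the last one is
`τ (1+|D|²)^{-1/2} w^`. -/
def dissMat (ρ κ : ℝ) : Fin 4 → Fin 3 → ℝ :=
  ![![ρ, 0, 0], ![0, ρ, 0], ![0, 0, ρ], ![0, -κ ^ 2, κ]]

/-- The real matrix `M`, as a complex one. -/
def toC {m n : ℕ} (M : Fin m → Fin n → ℝ) : Fin m → Fin n → ℂ := fun a b => ((M a b : ℝ) : ℂ)

/-- The symbol of the generator, cut off to the block `k` so that it is bounded. -/
def genSym (τ γ : ℝ) (k : ℕ) (ξ : E3) : Cn 3 →L[ℂ] Cn 3 :=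
  matCLM (fun a b => chi k ξ * toC (genMat τ γ (rho ξ) (brk ξ)) a b)

/-- The symbol of the Lyapunov functional. -/
def lySym (τ γ : ℝ) (ξ : E3) : Cn 3 →L[ℂ] Cn 3 := matCLM (toC (lyMat τ γ (rho ξ) (kap ξ)))

/-- The symbol of the dissipated quantities. -/
def dissSym (ξ : E3) : Cn 3 →L[ℂ] Cn 4 := matCLM (toC (dissMat (rho ξ) (kap ξ)))

lemma continuous_genMat (τ γ : ℝ) (a b : Fin 3) :
    Continuous fun p : ℝ × ℝ => genMat τ γ p.1 p.2 a b := by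
  fin_cases a <;> fin_cases b <;> simp [genMat] <;> fun_prop

lemma continuous_lyMat (τ γ : ℝ) (a b : Fin 3) :
    Continuous fun p : ℝ × ℝ => lyMat τ γ p.1 p.2 a b := by
  fin_cases a <;> fin_cases b <;> simp [lyMat] <;> fun_prop

lemma continuous_dissMat (a : Fin 4) (b : Fin 3) :
    Continuous fun p : ℝ × ℝ => dissMat p.1 p.2 a b := by
  fin_cases a <;> fin_cases b <;> simp [dissMat] <;> fun_prop

lemma isSymbol_genSym (τ γ : ℝ) (k : ℕ) : IsSymbol (genSym τ γ k) :=
  isSymbol_matCLM (fun a b => (measurable_chi k).mul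
      (measurable_ofReal_comp (f := fun x y => genMat τ γ x y a b) (continuous_genMat τ γ a b) measurable_rho continuous_brk.measurable))
    (fun a b => exists_bound_rho_brk k (f := fun x y => genMat τ γ x y a b)
      (continuous_genMat τ γ a b))

lemma isSymbol_lySym (τ γ : ℝ) : IsSymbol (lySym τ γ) :=
  isSymbol_matCLM (fun a b =>
      measurable_ofReal_comp (f := fun x y => lyMat τ γ x y a b) (continuous_lyMat τ γ a b) measurable_rho measurable_kap)
    (fun a b => exists_bound_rho_kap (f := fun x y => lyMat τ γ x y a b) (continuous_lyMat τ γ a b))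

lemma isSymbol_dissSym : IsSymbol dissSym :=
  isSymbol_matCLM (fun a b =>
      measurable_ofReal_comp (f := fun x y => dissMat x y a b) (continuous_dissMat a b) measurable_rho measurable_kap)
    (fun a b => exists_bound_rho_kap (f := fun x y => dissMat x y a b) (continuous_dissMat a b))

lemma re_inner_le {V W : Type*} [NormedAddCommGroup V] [InnerProductSpace ℂ V]
    [NormedAddCommGroup W] [InnerProductSpace ℂ W] {f g : L2 V} {w : L2 W} {c : ℝ}
    (h : ∀ᵐ ξ, (inner ℂ (f ξ) (g ξ)).re ≤ c * ‖w ξ‖ ^ 2) :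
    (inner ℂ f g).re ≤ c * ‖w‖ ^ 2 := by
  have h1 : ‖w‖ ^ 2 = ∫ ξ, ‖w ξ‖ ^ 2 := by
    rw [← inner_self_eq_norm_sq (𝕜 := ℂ) w, L2.inner_def, ← integral_re (L2.integrable_inner (𝕜 := ℂ) w w)]
    exact integral_congr_ae (Eventually.of_forall fun ξ => inner_self_eq_norm_sq (𝕜 := ℂ) _)
  have h2 : (inner ℂ f g).re = ∫ ξ, (inner ℂ (f ξ) (g ξ)).re := by
    rw [L2.inner_def]
    exact (integral_re (L2.integrable_inner (𝕜 := ℂ) f g)).symm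
  rw [h1, h2, ← integral_const_mul]
  refine integral_mono_ae (L2.integrable_inner (𝕜 := ℂ) f g).re ?_ h
  exact ((memLp_two_iff_integrable_sq_norm (Lp.memLp w).1).1 (Lp.memLp w)).const_mul c

lemma le_re_inner {V W : Type*} [NormedAddCommGroup V] [InnerProductSpace ℂ V]
    [NormedAddCommGroup W] [InnerProductSpace ℂ W] {f g : L2 V} {w : L2 W} {c : ℝ}
    (h : ∀ᵐ ξ, c * ‖w ξ‖ ^ 2 ≤ (inner ℂ (f ξ) (g ξ)).re) :
    c * ‖w‖ ^ 2 ≤ (inner ℂ f g).re := by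
  have := re_inner_le (f := f) (g := -g) (w := w) (c := -c) (by
    filter_upwards [h, Lp.coeFn_neg g] with ξ h1 h2
    rw [h2, Pi.neg_apply, inner_neg_right, Complex.neg_re]
    linarith)
  rw [inner_neg_right, Complex.neg_re] at this
  linarith

lemma inner_matCLM_re {m n : ℕ} (M N : Fin m → Fin n → ℝ) (x y : Cn n) :
    (inner ℂ (matCLM (toC M) x) (matCLM (toC N) y)).re =
      ∑ a, ((∑ b, M a b * (x b).re) * (∑ b, N a b * (y b).re)
        + (∑ b, M a b * (x b).im) * (∑ b, N a b * (y b).im)) := by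
  rw [PiLp.inner_apply, Complex.re_sum]
  refine Finset.sum_congr rfl fun a _ => ?_
  rw [matCLM_apply, matCLM_apply]
  simp [toC, mul_comm]

lemma inner_matCLM_left_re {n : ℕ} (M : Fin n → Fin n → ℝ) (x y : Cn n) :
    (inner ℂ (matCLM (toC M) x) y).re =
      ∑ a, ((∑ b, M a b * (x b).re) * (y a).re + (∑ b, M a b * (x b).im) * (y a).im) := by
  rw [PiLp.inner_apply, Complex.re_sum]
  refine Finset.sum_congr rfl fun a _ => ?_
  rw [matCLM_apply]
  simp [toC, mul_comm]

lemma norm_sq_matCLM {m n : ℕ} (M : Fin m → Fin n → ℝ) (x : Cn n) :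
    ‖matCLM (toC M) x‖ ^ 2 = ∑ a, ((∑ b, M a b * (x b).re) ^ 2 + (∑ b, M a b * (x b).im) ^ 2) := by
  rw [← inner_self_eq_norm_sq (𝕜 := ℂ)]
  refine (inner_matCLM_re M M x x).trans ?_
  simp only [sq]

lemma norm_sq_Cn {n : ℕ} (z : Cn n) : ‖z‖ ^ 2 = ∑ a, ((z a).re ^ 2 + (z a).im ^ 2) := by
  rw [EuclideanSpace.norm_sq_eq]
  refine Finset.sum_congr rfl fun a _ => ?_
  rw [Complex.sq_norm, Complex.normSq_apply, sq, sq]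

lemma inner_matCLM_symm {n : ℕ} {M : Fin n → Fin n → ℝ} (h : ∀ a b, M a b = M b a) (x y : Cn n) :
    inner ℂ (matCLM (toC M) x) y = inner ℂ x (matCLM (toC M) y) := by
  simp only [PiLp.inner_apply, matCLM_apply, RCLike.inner_apply, map_sum, map_mul, Finset.mul_sum,
    Finset.sum_mul]
  rw [Finset.sum_comm]
  refine Finset.sum_congr rfl fun a _ => Finset.sum_congr rfl fun b _ => ?_
  simp only [toC, Complex.conj_ofReal]
  rw [h a b]
  ring

lemma lySym_symm (τ γ : ℝ) (f g : L2 (Cn 3)) :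
    inner ℂ (mulOp (lySym τ γ) f) g = inner ℂ f (mulOp (lySym τ γ) g) := by
  rw [L2.inner_def, L2.inner_def]
  refine integral_congr_ae ?_
  filter_upwards [mulOp_ae (isSymbol_lySym τ γ) f, mulOp_ae (isSymbol_lySym τ γ) g] with ξ h1 h2
  rw [h1, h2]
  refine inner_matCLM_symm (fun a b => ?_) _ _
  fin_cases a <;> fin_cases b <;> rfl

lemma kap_inv (ξ : E3) : (kap ξ)⁻¹ = brk ξ := inv_inv _

lemma genSym_of_mem {τ γ : ℝ} {k : ℕ} {ξ : E3} (h : ξ ∈ blk k) :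
    genSym τ γ k ξ = matCLM (toC (genMat τ γ (rho ξ) (brk ξ))) := by
  unfold genSym
  simp [chi_of_mem h]

lemma genSym_of_notMem {τ γ : ℝ} {k : ℕ} {ξ : E3} (h : ξ ∉ blk k) : genSym τ γ k ξ = 0 := by
  ext z a
  rw [genSym, matCLM_apply]
  simp [chi_of_notMem h]

/-- The inequality `lyapunov_diss`, applied to real and imaginary parts. -/
lemma lyapunov_diss_pointwise {τ γ : ℝ} (hτ : 0 < τ) (hγ : 0 < γ) {k : ℕ} {ξ : E3} (h : ξ ∈ blk k)
    (z : Cn 3) :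
    (inner ℂ (lySym τ γ ξ z) (genSym τ γ k ξ z)).re ≤ -lyc τ * ‖dissSym ξ z‖ ^ 2 := by
  have key := fun p q y => lyapunov_diss hτ hγ (kap_pos ξ) (kap_le_one ξ) (rho_nonneg ξ)
    (rho_le_one ξ) p q y
  have k1 := key (z 0).re (z 1).re (z 2).re
  have k2 := key (z 0).im (z 1).im (z 2).im
  simp only [kap_inv] at k1 k2
  rw [genSym_of_mem h, lySym, inner_matCLM_re, dissSym, norm_sq_matCLM]
  simp only [Fin.sum_univ_three, Fin.sum_univ_four, dissMat, lyMat, genMat, Matrix.cons_val]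
  refine le_trans (le_of_eq ?_) ((add_le_add k1 k2).trans (le_of_eq ?_)) <;> ring

lemma lyapunov_lower_pointwise {τ γ : ℝ} (hτ : 0 < τ) (hγ : 0 < γ) (ξ : E3) (z : Cn 3) :
    lyc τ * ‖z‖ ^ 2 ≤ (inner ℂ (lySym τ γ ξ z) z).re := by
  have key := fun p q y => lyapunov_lower hτ hγ
    (rho_sq_add_kap_sq ξ) p q y
  have k1 := key (z 0).re (z 1).re (z 2).re
  have k2 := key (z 0).im (z 1).im (z 2).im
  rw [lySym, inner_matCLM_left_re, norm_sq_Cn]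
  simp only [Fin.sum_univ_three, lyMat, Matrix.cons_val]
  refine le_trans (le_of_eq ?_) ((add_le_add k1 k2).trans (le_of_eq ?_)) <;> ring

/-- The constant in the linear estimate. -/
def linC (τ γ : ℝ) : ℝ≥0 := (1 + 2 * ‖mulOp (lySym τ γ)‖ / lyc τ).toNNReal

/-- The sup bound and the dissipation of the forced linear equation on a block, with a constant that
does not depend on the block. -/
lemma linear_estimate {τ γ : ℝ} (hτ : 0 < τ) (hγ : 0 < γ) (k : ℕ) (ζ g : ℝ → L2 (Cn 3))
    (hζ : Continuous ζ) (hg : Continuous g) (hP : ∀ t, 0 ≤ t → proj k (ζ t) = ζ t)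
    (hode : ∀ t, 0 ≤ t →
      HasDerivWithinAt ζ (mulOp (genSym τ γ k) (ζ t) + g t) (Set.Ici 0) t) (T : ℝ) (hT : 0 ≤ T) :
    (∀ t ∈ Set.Icc 0 T, ‖ζ t‖ ≤ linC τ γ * (‖ζ 0‖ + ∫ s in (0 : ℝ)..T, ‖g s‖)) ∧
      ∫ s in (0 : ℝ)..T, ‖mulOp dissSym (ζ s)‖ ^ 2
        ≤ (linC τ γ * (‖ζ 0‖ + ∫ s in (0 : ℝ)..T, ‖g s‖)) ^ 2 := by
  have hc := lyc_pos hτ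
  have hC : (linC τ γ : ℝ) = 1 + 2 * ‖mulOp (lySym τ γ)‖ / lyc τ :=
    Real.coe_toNNReal _ (by positivity)
  rw [hC]
  refine lyapunov_bounds hc (lySym_symm τ γ) hg hζ hode (fun t ht => re_inner_le ?_)
    (fun t ht => le_re_inner ?_) hT
  · have hp := proj_ae k (ζ t)
    rw [hP t ht] at hp
    filter_upwards [hp, mulOp_ae (isSymbol_lySym τ γ) (ζ t),
      mulOp_ae (isSymbol_genSym τ γ k) (ζ t), mulOp_ae isSymbol_dissSym (ζ t)] with ξ h1 h2 h3 h4
    rw [h2, h3, h4]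
    by_cases h : ξ ∈ blk k
    · exact lyapunov_diss_pointwise hτ hγ h _
    · rw [chi_of_notMem h, zero_smul] at h1
      simp [h1]
  · filter_upwards [mulOp_ae (isSymbol_lySym τ γ) (ζ t)] with ξ h1
    rw [h1]
    exact lyapunov_lower_pointwise hτ hγ ξ _

/-! ### The quadratic nonlinearity -/

/-- The components of the unit vector `ξ/|ξ|`, and `0` at `ξ = 0`. -/
def dir (j : Fin 3) (ξ : E3) : ℝ := ξ j / ‖ξ‖

lemma abs_dir_le (j : Fin 3) (ξ : E3) : |dir j ξ| ≤ 1 := by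
  unfold dir
  rw [abs_div, abs_norm]
  exact div_le_one_of_le₀ (by simpa using PiLp.norm_apply_le ξ j) (norm_nonneg _)

lemma measurable_dir (j : Fin 3) : Measurable (dir j) := by
  unfold dir
  have : Continuous fun ξ : E3 => ξ j := by fun_prop
  exact this.measurable.div measurable_norm

/-- The Fourier transforms of `v, ∂₁u, ∂₂u, ∂₃u` in terms of `(p, q, y)`. -/
def leftRow (τ : ℝ) (i : Fin 4) (ξ : E3) : Fin 3 → ℂ :=
  Fin.cons (α := fun _ => Fin 3 → ℂ) ![0, (kap ξ : ℂ), 0]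
    (fun j => ![Complex.I * dir j ξ, -(Complex.I * dir j ξ * (τ * rho ξ)), 0]) i

/-- The Fourier transforms of `w, ∂₁v, ∂₂v, ∂₃v` in terms of `(p, q, y)`. -/
def rightRow (τ : ℝ) (i : Fin 4) (ξ : E3) : Fin 3 → ℂ :=
  Fin.cons (α := fun _ => Fin 3 → ℂ) ![0, -(kap ξ : ℂ) * (τ : ℂ)⁻¹, (τ : ℂ)⁻¹]
    (fun j => ![0, Complex.I * dir j ξ * rho ξ, 0]) i

lemma norm_dir_le (j : Fin 3) (ξ : E3) : ‖(dir j ξ : ℂ)‖ ≤ 1 := by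
  rw [Complex.norm_real]; exact abs_dir_le j ξ

lemma norm_rho_le (ξ : E3) : ‖(rho ξ : ℂ)‖ ≤ 1 := by
  rw [Complex.norm_real, Real.norm_of_nonneg (rho_nonneg ξ)]; exact rho_le_one ξ

lemma norm_kap_le (ξ : E3) : ‖(kap ξ : ℂ)‖ ≤ 1 := by
  rw [Complex.norm_real, Real.norm_of_nonneg (kap_pos ξ).le]; exact kap_le_one ξ

lemma isSymbol_leftRow (τ : ℝ) (i : Fin 4) : IsSymbol fun ξ => rowCLM (leftRow τ i ξ) := by
  have mr := Complex.measurable_ofReal.comp measurable_rho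
  have mk := Complex.measurable_ofReal.comp measurable_kap
  refine isSymbol_rowCLM ?_ ?_
  · refine Fin.cases ?_ (fun j => ?_) i
    · intro b; fin_cases b <;> simp [leftRow]
      exact mk
    · have md := Complex.measurable_ofReal.comp (measurable_dir j)
      intro b; fin_cases b <;> simp [leftRow]
      · exact md.const_mul _
      · exact (md.const_mul _).mul (mr.const_mul _)
  · refine Fin.cases ?_ (fun j => ?_) i
    · intro b; refine ⟨1, fun ξ => ?_⟩
      have := norm_kap_le ξ
      fin_cases b <;> simpa [leftRow] using this
    · intro b; refine ⟨1 + |τ|, fun ξ => ?_⟩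
      have h1 := norm_dir_le j ξ
      have h2 := norm_rho_le ξ
      have h3 := abs_nonneg τ
      fin_cases b <;> simp [leftRow] at h1 h2 ⊢
      · linarith
      · calc |dir j ξ| * (|τ| * |rho ξ|) ≤ 1 * (|τ| * 1) := by gcongr
          _ ≤ _ := by linarith
      · linarith

lemma isSymbol_rightRow (τ : ℝ) (i : Fin 4) : IsSymbol fun ξ => rowCLM (rightRow τ i ξ) := by
  have mr := Complex.measurable_ofReal.comp measurable_rho
  have mk := Complex.measurable_ofReal.comp measurable_kap
  refine isSymbol_rowCLM ?_ ?_
  · refine Fin.cases ?_ (fun j => ?_) i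
    · intro b; fin_cases b <;> simp [rightRow]
      exact (mk.mul_const _)
    · have md := Complex.measurable_ofReal.comp (measurable_dir j)
      intro b; fin_cases b <;> simp [rightRow]
      exact (md.const_mul _).mul mr
  · refine Fin.cases ?_ (fun j => ?_) i
    · intro b; refine ⟨|τ|⁻¹, fun ξ => ?_⟩
      have := norm_kap_le ξ
      have h3 : 0 ≤ |τ|⁻¹ := by positivity
      fin_cases b <;> simp [rightRow] at this ⊢
      exact mul_le_of_le_one_left h3 this
    · intro b; refine ⟨1, fun ξ => ?_⟩
      have h1 := norm_dir_le j ξ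
      have h2 := norm_rho_le ξ
      fin_cases b <;> simp [rightRow] at *
      exact mul_le_one₀ h1 (abs_nonneg _) h2

/-- The Fourier transform of the `i`-th function among `v, ∂₁u, ∂₂u, ∂₃u`. -/
def leftOp (τ : ℝ) (i : Fin 4) : L2 (Cn 3) →L[ℂ] L2 ℂ := mulOp fun ξ => rowCLM (leftRow τ i ξ)

/-- The Fourier transform of the `i`-th function among `w, ∂₁v, ∂₂v, ∂₃v`. -/
def rightOp (τ : ℝ) (i : Fin 4) : L2 (Cn 3) →L[ℂ] L2 ℂ := mulOp fun ξ => rowCLM (rightRow τ i ξ)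

/-- The coefficients of the products in `b v w + 2 ∇u·∇v`. -/
def prodCoef (b : ℝ) (i : Fin 4) : ℂ := Fin.cons (α := fun _ => ℂ) (b : ℂ) (fun _ => 2) i

/-- The map `y ↦ (0, 0, y)`. -/
def lastCLM : ℂ →L[ℂ] Cn 3 :=
  ContinuousLinearMap.toSpanSingleton ℂ (EuclideanSpace.single 2 (1 : ℂ))

lemma isSymbol_lastCLM : IsSymbol (fun _ : E3 => lastCLM) :=
  ⟨stronglyMeasurable_const, ‖lastCLM‖, fun _ => le_rfl⟩

/-- The Fourier transform of `b v w + 2 ∇u·∇v`, restricted to the block `l`, as a bilinear map. -/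
def quadBlk (τ b : ℝ) (l : ℕ) : L2 (Cn 3) →L[ℂ] L2 (Cn 3) →L[ℂ] L2 ℂ :=
  ∑ i : Fin 4, prodCoef b i • (convBlk l).bilinearComp (leftOp τ i) (rightOp τ i)

lemma quadBlk_apply (τ b : ℝ) (l : ℕ) (x y : L2 (Cn 3)) :
    quadBlk τ b l x y = ∑ i : Fin 4, prodCoef b i • convBlk l (leftOp τ i x) (rightOp τ i y) := by
  simp [quadBlk]

/-- The constant in the estimates of the factors of the nonlinearity by the dissipation. -/
def rowC (τ : ℝ) : ℝ≥0 := (1 + |τ| + 3 * |τ|⁻¹).toNNReal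

lemma rowC_eq (τ : ℝ) : (rowC τ : ℝ) = 1 + |τ| + 3 * |τ|⁻¹ := Real.coe_toNNReal _ (by positivity)

lemma norm_dissSym_ge (ξ : E3) (z : Cn 3) :
    rho ξ * ‖z 0‖ ≤ ‖dissSym ξ z‖ ∧ rho ξ * ‖z 1‖ ≤ ‖dissSym ξ z‖ ∧
      rho ξ * ‖z 2‖ ≤ ‖dissSym ξ z‖ ∧ kap ξ * ‖z 2 - kap ξ * z 1‖ ≤ ‖dissSym ξ z‖ := by
  have h := fun a => PiLp.norm_apply_le (dissSym ξ z) a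
  have hr := rho_nonneg ξ
  have hk := (kap_pos ξ).le
  refine ⟨?_, ?_, ?_, ?_⟩
  · refine le_trans (le_of_eq ?_) (h 0)
    simp [dissSym, matCLM_apply, Fin.sum_univ_three, toC, dissMat, abs_of_nonneg hr]
  · refine le_trans (le_of_eq ?_) (h 1)
    simp [dissSym, matCLM_apply, Fin.sum_univ_three, toC, dissMat, abs_of_nonneg hr]
  · refine le_trans (le_of_eq ?_) (h 2)
    simp [dissSym, matCLM_apply, Fin.sum_univ_three, toC, dissMat, abs_of_nonneg hr]
  · refine le_trans (le_of_eq ?_) (h 3)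
    have : (dissSym ξ z) 3 = (kap ξ : ℂ) * (z 2 - kap ξ * z 1) := by
      simp [dissSym, matCLM_apply, Fin.sum_univ_three, toC, dissMat]
      ring
    rw [this, norm_mul, Complex.norm_real, Real.norm_of_nonneg hk]

/-- The factors `v, ∂ⱼu` of the nonlinearity are dissipated up to a factor `ρ`, which is lost at low
frequencies: the equation does not dissipate `v` and `∇u` there. -/
lemma norm_leftRow_le {τ : ℝ} (i : Fin 4) (ξ : E3) (z : Cn 3) :
    ‖(rho ξ : ℂ) * rowCLM (leftRow τ i ξ) z‖ ≤ rowC τ * ‖dissSym ξ z‖ := by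
  obtain ⟨h0, h1, -, -⟩ := norm_dissSym_ge ξ z
  have hd := norm_nonneg (dissSym ξ z)
  have ht : 0 ≤ |τ|⁻¹ := by positivity
  have hr := rho_nonneg ξ
  rw [rowC_eq, norm_mul, Complex.norm_real, Real.norm_of_nonneg hr, rowCLM_apply,
    Fin.sum_univ_three]
  refine Fin.cases ?_ (fun j => ?_) i
  · simp only [leftRow, Fin.cons_zero]
    have hk := norm_kap_le ξ
    simp at hk ⊢
    calc rho ξ * (|kap ξ| * ‖z 1‖) ≤ rho ξ * (1 * ‖z 1‖) := by gcongr
      _ ≤ 1 * ‖dissSym ξ z‖ := by linarith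
      _ ≤ _ := by gcongr; linarith [abs_nonneg τ]
  · simp only [leftRow, Fin.cons_succ]
    have hk := norm_dir_le j ξ
    have hr1 := norm_rho_le ξ
    have e : ‖Complex.I * (dir j ξ : ℂ) * z 0 + -(Complex.I * dir j ξ * (τ * rho ξ)) * z 1 + 0 * z 2‖
        ≤ ‖z 0‖ + |τ| * ‖z 1‖ := by
      rw [zero_mul, add_zero]
      refine (norm_add_le _ _).trans ?_
      simp at *
      rw [abs_of_nonneg hr] at *
      calc |dir j ξ| * ‖z 0‖ + |dir j ξ| * (|τ| * rho ξ) * ‖z 1‖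
          ≤ 1 * ‖z 0‖ + 1 * (|τ| * 1) * ‖z 1‖ := by gcongr
        _ = _ := by ring
    simp only [Matrix.cons_val]
    refine (mul_le_mul_of_nonneg_left e hr).trans ?_
    have := mul_le_mul_of_nonneg_left h1 (abs_nonneg τ)
    have h5 : 0 ≤ 3 * |τ|⁻¹ * ‖dissSym ξ z‖ := by positivity
    linarith

/-- The factors `w, ∂ⱼv` of the nonlinearity are dissipated at all frequencies. -/
lemma norm_rightRow_le {τ : ℝ} (i : Fin 4) (ξ : E3) (z : Cn 3) :
    ‖rowCLM (rightRow τ i ξ) z‖ ≤ rowC τ * ‖dissSym ξ z‖ := by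
  obtain ⟨-, h1, h2, h3⟩ := norm_dissSym_ge ξ z
  have hd := norm_nonneg (dissSym ξ z)
  have ht : 0 ≤ |τ|⁻¹ := by positivity
  have hr := rho_nonneg ξ
  rw [rowC_eq, rowCLM_apply, Fin.sum_univ_three]
  refine Fin.cases ?_ (fun j => ?_) i
  · simp only [rightRow, Fin.cons_zero, Matrix.cons_val]
    have e : 0 * z 0 + -(kap ξ : ℂ) * (τ : ℂ)⁻¹ * z 1 + (τ : ℂ)⁻¹ * z 2
        = (τ : ℂ)⁻¹ * (z 2 - kap ξ * z 1) := by ring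
    rw [e, norm_mul, norm_inv, Complex.norm_real, Real.norm_eq_abs]
    -- low frequencies are controlled through `κ`, high ones through `ρ`
    have hk := (kap_pos ξ).le
    have hk1 := kap_le_one ξ
    have h4 : 1 ≤ rho ξ + kap ξ := by
      have := rho_sq_add_kap_sq ξ
      nlinarith [rho_le_one ξ]
    have h5 : ‖z 2 - kap ξ * z 1‖ ≤ ‖z 2‖ + ‖z 1‖ := by
      refine (norm_sub_le _ _).trans ?_
      rw [norm_mul]
      have := mul_le_of_le_one_left (norm_nonneg (z 1)) (norm_kap_le ξ)
      linarith
    have h6 : ‖z 2 - kap ξ * z 1‖ ≤ 3 * ‖dissSym ξ z‖ := by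
      have := mul_le_mul_of_nonneg_left h5 hr
      have := mul_le_mul_of_nonneg_right h4 (norm_nonneg (z 2 - kap ξ * z 1))
      linarith
    have := mul_le_mul_of_nonneg_left h6 ht
    have h7 : 0 ≤ (1 + |τ|) * ‖dissSym ξ z‖ := by positivity
    linarith
  · simp only [rightRow, Fin.cons_succ, Matrix.cons_val]
    have hk := norm_dir_le j ξ
    simp at hk ⊢
    rw [abs_of_nonneg hr]
    calc |dir j ξ| * rho ξ * ‖z 1‖ ≤ 1 * rho ξ * ‖z 1‖ := by gcongr
      _ ≤ 1 * ‖dissSym ξ z‖ := by linarith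
      _ ≤ _ := by gcongr; linarith [abs_nonneg τ]

/-- The constant in the estimate of the nonlinearity. -/
def quadC (τ b : ℝ) : ℝ≥0 := (∑ i, ‖prodCoef b i‖₊) * (2 * (bern * rowC τ ^ 2))

/-- The nonlinearity is bounded by products of two dissipated quantities, hence integrable in time along
trajectories with square integrable dissipation. -/
lemma enorm_quadBlk_le (τ b : ℝ) (l : ℕ) (x y : L2 (Cn 3)) :
    ‖quadBlk τ b l x y‖ₑ ≤ ∑' j, ∑' k, bilC (quadC τ b) l j k *
      (‖mulOp dissSym (proj j x)‖ₑ * ‖mulOp dissSym (proj k y)‖ₑ) := by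
  refine enorm_bilinear_le _ x y fun j k => ?_
  rw [quadBlk_apply]
  refine (enorm_sum_le _ _).trans ?_
  have h : ∀ i, ‖prodCoef b i • convBlk l (leftOp τ i (proj j x)) (rightOp τ i (proj k y))‖ₑ ≤
      ‖prodCoef b i‖ₑ * (bilC (2 * (bern * rowC τ ^ 2)) l j k *
        (‖mulOp dissSym (proj j x)‖ₑ * ‖mulOp dissSym (proj k y)‖ₑ)) := by
    intro i
    rw [enorm_smul]
    gcongr
    have e1 := mulOp_proj (isSymbol_leftRow τ i) j x
    have e2 := mulOp_proj (isSymbol_rightRow τ i) k y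
    have a1 := mulOp_ae (isSymbol_leftRow τ i) (proj j x)
    have a2 := mulOp_ae (isSymbol_rightRow τ i) (proj k y)
    unfold leftOp rightOp
    rw [e1, e2]
    rw [e1] at a1
    rw [e2] at a2
    refine enorm_convBlk_proj_le l j k ?_ ?_
    · filter_upwards [a1, mulOp_ae isSymbol_dissSym (proj j x)] with ξ h1 h2
      rw [h1, h2]
      exact norm_leftRow_le i ξ _
    · filter_upwards [a2, mulOp_ae isSymbol_dissSym (proj k y)] with ξ h1 h2
      rw [h1, h2]
      exact norm_rightRow_le i ξ _
  refine (Finset.sum_le_sum fun i _ => h i).trans_eq ?_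
  rw [← Finset.sum_mul, ← mul_assoc]
  congr 1
  have e : ∑ i, ‖prodCoef b i‖ₑ = ((∑ i, ‖prodCoef b i‖₊ : ℝ≥0) : ℝ≥0∞) := by
    push_cast; rfl
  rw [e]
  unfold bilC quadC
  split_ifs
  · push_cast; ring
  · simp

/-- The nonlinear term of the system, restricted to the block `l`. -/
def nonlin (τ b : ℝ) (l : ℕ) : L2 (Cn 3) →L[ℂ] L2 (Cn 3) →L[ℂ] L2 (Cn 3) :=
  (ContinuousLinearMap.compL ℂ (L2 (Cn 3)) (L2 ℂ) (L2 (Cn 3)) (mulOp fun _ => lastCLM)).comp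
    (quadBlk τ b l)

lemma nonlin_apply (τ b : ℝ) (l : ℕ) (x y : L2 (Cn 3)) :
    nonlin τ b l x y = mulOp (fun _ => lastCLM) (quadBlk τ b l x y) := rfl

lemma norm_lastCLM (a : ℂ) : ‖lastCLM a‖ = ‖a‖ := by
  simp [lastCLM, norm_smul]

lemma enorm_last_le (g : L2 ℂ) : ‖mulOp (fun _ => lastCLM) g‖ₑ ≤ ‖g‖ₑ := by
  have := enorm_le_of_ae_le (f := mulOp (fun _ => lastCLM) g) (w := g) (C := 1) (by
    filter_upwards [mulOp_ae isSymbol_lastCLM g] with ξ h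
    rw [h, norm_lastCLM]; simp)
  simpa using this

lemma proj_convBlk (l : ℕ) (f g : L2 ℂ) : proj l (convBlk l f g) = convBlk l f g := by
  apply Lp.ext
  filter_upwards [proj_ae l (convBlk l f g), convBlk_ae l f g] with ξ h1 h2
  rw [h1, h2, smul_eq_mul, ← mul_assoc, chi_mul_chi, if_pos rfl]

lemma proj_quadBlk (τ b : ℝ) (l : ℕ) (x y : L2 (Cn 3)) :
    proj l (quadBlk τ b l x y) = quadBlk τ b l x y := by
  rw [quadBlk_apply, map_sum]
  simp only [map_smul, proj_convBlk]

/-- The JMGT equation as a system coupled over the dyadic blocks. The weights `2^{5k/2}` are those of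
the energy space of order `3/2`: the seven functions in the energy carry one derivative more than
`p, q, y`. -/
def sys {τ γ : ℝ} (b : ℝ) (hτ : 0 < τ) (hγ : 0 < γ) : BlockSystem (L2 (Cn 3)) (L2 (Cn 4)) where
  P := proj
  A k := mulOp (genSym τ γ k)
  D := mulOp dissSym
  N := nonlin τ b
  ω k := sq2 ^ (5 * k)
  c := bilC (quadC τ b)
  KL := linC τ γ
  KN := 32 * quadC τ b
  one_le_ω _ := one_le_pow₀ one_le_sq2
  ω_ne_top _ := ENNReal.pow_ne_top sq2_ne_top
  P_P := proj_proj
  eq_zero := eq_zero_of_proj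
  P_A k x := by
    rw [← mulOp_proj (isSymbol_genSym τ γ k)]
    apply Lp.ext
    filter_upwards [mulOp_ae (isSymbol_genSym τ γ k) (proj k x), proj_ae k x,
      mulOp_ae (isSymbol_genSym τ γ k) x] with ξ h1 h2 h3
    rw [h1, h2, h3]
    by_cases h : ξ ∈ blk k
    · rw [chi_of_mem h, one_smul]
    · simp [genSym_of_notMem h]
  A_P k x := by
    apply Lp.ext
    filter_upwards [mulOp_ae (isSymbol_genSym τ γ k) (proj k x), proj_ae k x,
      mulOp_ae (isSymbol_genSym τ γ k) x] with ξ h1 h2 h3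
    rw [h1, h2, h3]
    by_cases h : ξ ∈ blk k
    · rw [chi_of_mem h, one_smul]
    · simp [genSym_of_notMem h]
  P_N k x y := by
    rw [nonlin_apply, ← mulOp_proj isSymbol_lastCLM, proj_quadBlk]
  linear k ζ g := linear_estimate hτ hγ k ζ g
  bilinear l x y := (enorm_last_le _).trans (enorm_quadBlk_le τ b l x y)
  sum_c := sum_bilC _

/-! ### Distributions with square integrable Fourier transform -/

lemma continuous_pairing {h : E3 → ℂ} (hh : MemLp h 2 (volume : Measure E3)) :
    Continuous fun f : L2 ℂ => ∫ ξ, h ξ * f ξ := by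
  have hs : MemLp (fun ξ => star (h ξ)) 2 (volume : Measure E3) := hh.star
  have : (fun f : L2 ℂ => ∫ ξ, h ξ * f ξ) = fun f : L2 ℂ => inner ℂ (hs.toLp _) f := by
    funext f
    rw [L2.inner_def]
    refine integral_congr_ae ?_
    filter_upwards [hs.coeFn_toLp] with ξ h1
    rw [h1]
    simp [mul_comm]
  rw [this]
  fun_prop

/-- The distribution with Fourier transform `f`, as a linear function of `f ∈ L²`. -/
def invF : L2 ℂ →ₗ[ℂ] TDist where
  toFun f := 𝓕⁻ (f : TDist)
  map_add' f g := by
    rw [← Lp.toTemperedDistributionCLM_apply, map_add, FourierTransform.fourierInv_add]; rfl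
  map_smul' a f := by
    rw [← Lp.toTemperedDistributionCLM_apply, map_smul, FourierTransform.fourierInv_smul]; rfl

lemma invF_eq (f : L2 ℂ) : invF f = 𝓕⁻ (f : TDist) := rfl

lemma invF_eq_coe (f : L2 ℂ) : invF f = ((𝓕⁻ f : L2 ℂ) : TDist) :=
  Lp.fourierInv_toTemperedDistribution_eq f

lemma invF_apply (f : L2 ℂ) (ψ : 𝓢(E3, ℂ)) : invF f ψ = ∫ ξ, (𝓕⁻ ψ : 𝓢(E3, ℂ)) ξ * f ξ := by
  rw [invF_eq, TemperedDistribution.fourierInv_apply, Lp.toTemperedDistribution_apply]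
  rfl

lemma continuous_invF_apply (ψ : 𝓢(E3, ℂ)) : Continuous fun f : L2 ℂ => invF f ψ := by
  simp only [invF_apply]
  exact continuous_pairing ((𝓕⁻ ψ : 𝓢(E3, ℂ)).memLp 2)

/-- The pairing with a Schwartz function, as a continuous linear form on the Fourier side. -/
def pairCLM (ψ : 𝓢(E3, ℂ)) : L2 ℂ →L[ℂ] ℂ where
  toFun f := invF f ψ
  map_add' f g := by rw [map_add]; rfl
  map_smul' a f := by rw [map_smul]; rfl
  cont := continuous_invF_apply ψ

lemma coe_injective {f g : L2 ℂ} (h : (f : TDist) = (g : TDist)) : f = g := by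
  have := Lp.ker_toTemperedDistributionCLM_eq_bot (F := ℂ) (μ := (volume : Measure E3)) (p := 2)
  exact LinearMap.ker_eq_bot.1 this h

lemma invF_injective : Function.Injective invF := by
  intro f g h
  rw [invF_eq_coe, invF_eq_coe] at h
  have h2 := congrArg (fun f : L2 ℂ => (𝓕 f : L2 ℂ)) (coe_injective h)
  simpa using h2

lemma l2_coe (g : L2 ℂ) : l2 (g : TDist) = ‖g‖ₑ := by
  unfold l2
  refine le_antisymm (iInf₂_le (f := fun (f : L2 ℂ) (_ : (f : TDist) = (g : TDist)) => ‖f‖ₑ) g rfl)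
    (le_iInf₂ fun f hf => ?_)
  rw [coe_injective hf]

lemma l2_invF (f : L2 ℂ) : l2 (invF f) = ‖f‖ₑ := by
  rw [invF_eq_coe, l2_coe, ← ofReal_norm, ← ofReal_norm]
  congr 1
  conv_rhs => rw [← FourierTransform.fourier_fourierInv_eq (F := L2 ℂ) f, Lp.norm_fourier_eq]

lemma coe_eq_invF (g : L2 ℂ) : (g : TDist) = invF (𝓕 g) := by
  rw [invF_eq_coe, FourierTransform.fourierInv_fourier_eq]

lemma exists_of_l2_lt_top {F : TDist} (h : l2 F < ⊤) : ∃ f : L2 ℂ, F = invF f := by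
  unfold l2 at h
  simp only [iInf_lt_iff] at h
  obtain ⟨g, hg, -⟩ := h
  exact ⟨𝓕 g, by rw [← hg, coe_eq_invF]⟩

/-- Two locally integrable functions with the same integrals against Schwartz functions agree. -/
lemma ae_eq_of_pairing {f g : E3 → ℂ} (hf : LocallyIntegrable f) (hg : LocallyIntegrable g)
    (h : ∀ ψ : 𝓢(E3, ℂ), HasCompactSupport ψ → ∫ ξ, ψ ξ * f ξ = ∫ ξ, ψ ξ * g ξ) : f =ᵐ[volume] g := by
  have : ∀ᵐ ξ, f ξ - g ξ = 0 := by
    refine ae_eq_zero_of_integral_contDiff_smul_eq_zero (hf.sub hg) fun ψ ψs ψc => ?_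
    have h1 : HasCompactSupport (Complex.ofRealCLM ∘ ψ) := ψc.comp_left rfl
    have h2 : ContDiff ℝ ((⊤ : ℕ∞) : WithTop ℕ∞) (Complex.ofRealCLM ∘ ψ) := by fun_prop
    have h3 := h (h1.toSchwartzMap h2) h1
    have e : ∀ f : E3 → ℂ, ∫ ξ, (h1.toSchwartzMap h2) ξ * f ξ = ∫ ξ, ψ ξ • f ξ := by
      intro f
      refine integral_congr_ae (Eventually.of_forall fun ξ => ?_)
      simp [Complex.real_smul]
    rw [e, e] at h3
    have i1 := hf.integrable_smul_left_of_hasCompactSupport ψs.continuous ψc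
    have i2 := hg.integrable_smul_left_of_hasCompactSupport ψs.continuous ψc
    simp only [smul_sub]
    rw [integral_sub i1 i2, h3, sub_self]
  filter_upwards [this] with ξ h
  exact sub_eq_zero.1 h

lemma locallyIntegrable_L2 (f : L2 ℂ) : LocallyIntegrable f :=
  (Lp.memLp f).locallyIntegrable (by norm_num)

lemma locallyIntegrable_mul {m : E3 → ℂ} (hm : Continuous m) (f : L2 ℂ) :
    LocallyIntegrable fun ξ => m ξ * f ξ :=
  (locallyIntegrable_L2 f).continuous_smul hm

/-- `F` is a distribution with Fourier transform the function `h`, which is the product of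
a function of temperate growth and a square integrable function. This is the generality in which
Fourier multipliers act on `F` by multiplication of `h`, and it covers the derivatives of functions
in `L²`. -/
def Hat (F : TDist) (h : E3 → ℂ) : Prop :=
  ∃ (m : E3 → ℂ) (f : L2 ℂ), m.HasTemperateGrowth ∧
    F = TemperedDistribution.fourierMultiplierCLM ℂ m (invF f) ∧ h =ᵐ[volume] fun ξ => m ξ * f ξ

lemma hat_invF (f : L2 ℂ) : Hat (invF f) f :=
  ⟨fun _ => 1, f, .const 1, by simp, by simp⟩

lemma Hat.congr {F : TDist} {h h' : E3 → ℂ} (hF : Hat F h) (e : h' =ᵐ[volume] h) : Hat F h' := by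
  obtain ⟨m, f, hm, h1, h2⟩ := hF
  exact ⟨m, f, hm, h1, e.trans h2⟩

lemma Hat.mult {F : TDist} {h : E3 → ℂ} (hF : Hat F h) {m : E3 → ℂ} (hm : m.HasTemperateGrowth) :
    Hat (TemperedDistribution.fourierMultiplierCLM ℂ m F) fun ξ => m ξ * h ξ := by
  obtain ⟨m', f, hm', h1, h2⟩ := hF
  refine ⟨m' * m, f, hm'.mul hm, ?_, ?_⟩
  · rw [h1, TemperedDistribution.fourierMultiplierCLM_fourierMultiplierCLM_apply hm' hm]
  · filter_upwards [h2] with ξ h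
    rw [h, Pi.mul_apply]; ring

lemma Hat.apply {F : TDist} {h : E3 → ℂ} (hF : Hat F h) (ψ : 𝓢(E3, ℂ)) :
    F ψ = ∫ ξ, (𝓕⁻ ψ : 𝓢(E3, ℂ)) ξ * h ξ := by
  obtain ⟨m, f, hm, rfl, h2⟩ := hF
  rw [TemperedDistribution.fourierMultiplierCLM_apply_apply, invF_apply]
  refine integral_congr_ae ?_
  filter_upwards [h2] with ξ h
  rw [h, FourierTransform.fourierInv_fourier_eq, SchwartzMap.smulLeftCLM_apply_apply hm, smul_eq_mul]
  ring

lemma Hat.locallyIntegrable {F : TDist} {h : E3 → ℂ} (hF : Hat F h) : LocallyIntegrable h := by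
  obtain ⟨m, f, hm, rfl, h2⟩ := hF
  exact (locallyIntegrable_mul hm.1.continuous f).congr h2.symm

/-- The Fourier transform determines the distribution and conversely. -/
lemma Hat.ae_eq_iff {F G : TDist} {h k : E3 → ℂ} (hF : Hat F h) (hG : Hat G k) :
    F = G ↔ h =ᵐ[volume] k := by
  constructor
  · rintro rfl
    refine ae_eq_of_pairing hF.locallyIntegrable hG.locallyIntegrable fun ψ _ => ?_
    have h1 := hF.apply (𝓕 ψ)
    have h2 := hG.apply (𝓕 ψ)
    rw [FourierTransform.fourierInv_fourier_eq] at h1 h2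
    rw [← h1, ← h2]
  · intro e
    ext ψ
    rw [hF.apply, hG.apply]
    refine integral_congr_ae ?_
    filter_upwards [e] with ξ h
    rw [h]

lemma Hat.of_memLp {F : TDist} {h : E3 → ℂ} (hF : Hat F h) (hh : MemLp h 2 volume) :
    F = invF (hh.toLp h) :=
  (hF.ae_eq_iff (hat_invF _)).2 hh.coeFn_toLp.symm

/-- Plancherel's theorem. -/
lemma Hat.l2_eq {F : TDist} {h : E3 → ℂ} (hF : Hat F h) :
    l2 F = eLpNorm h 2 (volume : Measure E3) := by
  by_cases hh : MemLp h 2 volume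
  · rw [hF.of_memLp hh, l2_invF, Lp.enorm_toLp]
  · have hm : AEStronglyMeasurable h volume := by
      obtain ⟨m, f, hm, -, h2⟩ := hF
      exact (hm.1.continuous.aestronglyMeasurable.mul (Lp.memLp f).1).congr h2.symm
    have h1 : eLpNorm h 2 (volume : Measure E3) = ⊤ := by
      by_contra h2
      exact hh ⟨hm, lt_top_iff_ne_top.2 h2⟩
    rw [h1]
    by_contra h2
    obtain ⟨f, rfl⟩ := exists_of_l2_lt_top (lt_top_iff_ne_top.2 h2)
    exact hh ((Lp.memLp f).ae_eq (((hat_invF f).ae_eq_iff hF).1 rfl))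

/-! ### Differential operators and dyadic blocks -/

lemma hasTemperateGrowth_ofReal_comp {m : E3 → ℝ} (hm : m.HasTemperateGrowth) :
    (fun ξ => ((m ξ : ℝ) : ℂ)).HasTemperateGrowth :=
  Function.HasTemperateGrowth.comp Function.Complex.hasTemperateGrowth_ofReal hm

lemma Hat.smul {F : TDist} {h : E3 → ℂ} (hF : Hat F h) (c : ℂ) : Hat (c • F) fun ξ => c * h ξ := by
  have := hF.mult (.const c)
  rwa [TemperedDistribution.fourierMultiplierCLM_const] at this

lemma Hat.grad {F : TDist} {h : E3 → ℂ} (hF : Hat F h) (j : Fin 3) :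
    Hat (grad F j) fun ξ => 2 * Real.pi * Complex.I * (ξ j : ℂ) * h ξ := by
  unfold JMGT.grad
  rw [TemperedDistribution.lineDeriv_eq_fourierMultiplierCLM]
  have hm : (fun ξ : E3 => ((inner ℝ ξ (EuclideanSpace.single j (1 : ℝ)) : ℝ) : ℂ)).HasTemperateGrowth := by
    fun_prop
  refine ((hF.mult hm).smul _).congr (Eventually.of_forall fun ξ => ?_)
  simp [EuclideanSpace.inner_single_right]
  ring

lemma Hat.laplacian {F : TDist} {h : E3 → ℂ} (hF : Hat F h) :
    Hat (Δ F) fun ξ => -((rad ξ : ℂ) ^ 2 * h ξ) := by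
  rw [TemperedDistribution.laplacian_eq_fourierMultiplierCLM]
  have hm : (fun ξ : E3 => ((‖ξ‖ ^ 2 : ℝ) : ℂ)).HasTemperateGrowth := by
    fun_prop
  have := (hF.mult hm).smul (-(2 * Real.pi) ^ 2 : ℝ)
  have e : ((-(2 * Real.pi) ^ 2 : ℝ) : ℂ) • TemperedDistribution.fourierMultiplierCLM ℂ
      (fun ξ : E3 => ((‖ξ‖ ^ 2 : ℝ) : ℂ)) F = (-(2 * Real.pi) ^ 2 : ℝ) •
      TemperedDistribution.fourierMultiplierCLM ℂ (fun ξ : E3 => ((‖ξ‖ ^ 2 : ℝ) : ℂ)) F := by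
    ext ψ; simp
  rw [e] at this
  refine this.congr (Eventually.of_forall fun ξ => ?_)
  beta_reduce
  rw [rad_eq]
  push_cast
  ring

lemma hasCompactSupport_comp_smul {m : E3 → ℝ} {R : ℝ} (hR : ∀ ξ, m ξ ≠ 0 → ‖ξ‖ ≤ R) {a : ℝ}
    (ha : 0 < a) : HasCompactSupport fun ξ => m (a • ξ) := by
  refine HasCompactSupport.intro (K := Metric.closedBall 0 (R / a)) (isCompact_closedBall _ _) ?_
  intro ξ hξ
  by_contra h
  have := hR _ h
  rw [norm_smul, Real.norm_of_nonneg ha.le] at this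
  apply hξ
  rw [mem_closedBall_zero_iff, le_div_iff₀ ha]
  linarith

lemma hasTemperateGrowth_comp_smul {m : E3 → ℝ} (hs : ContDiff ℝ ((⊤ : ℕ∞) : WithTop ℕ∞) m) {R : ℝ}
    (hR : ∀ ξ, m ξ ≠ 0 → ‖ξ‖ ≤ R) {a : ℝ} (ha : 0 < a) :
    (fun ξ => ((m (a • ξ) : ℝ) : ℂ)).HasTemperateGrowth :=
  hasTemperateGrowth_ofReal_comp ((hasCompactSupport_comp_smul hR ha).hasTemperateGrowth
    (by fun_prop))

/-- The symbol of the dyadic block of order `q`; the factor `2π` comes from the normalisation of the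
Fourier transform. -/
def phiq (φ : E3 → ℝ) (q : ℤ) (ξ : E3) : ℝ := φ ((2 : ℝ) ^ (-q) • (2 * Real.pi) • ξ)

section LP

variable {φ χ : E3 → ℝ}

lemma hasTemperateGrowth_phiq (hLP : IsLittlewoodPaley φ χ) (q : ℤ) : (fun ξ => ((phiq φ q ξ : ℝ) : ℂ)).HasTemperateGrowth := by
  unfold phiq
  simp only [smul_smul]
  exact hasTemperateGrowth_comp_smul hLP.smooth_annulus (fun ξ h => (hLP.supp_annulus ξ h).2)
    (by positivity)

lemma Hat.block {F : TDist} {h : E3 → ℂ} (hLP : IsLittlewoodPaley φ χ) (hF : Hat F h) (q : ℤ) :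
    Hat (block φ q F) fun ξ => (phiq φ q ξ : ℂ) * h ξ :=
  hF.mult (hasTemperateGrowth_phiq hLP q)

lemma phiq_nonneg (hLP : IsLittlewoodPaley φ χ) (q : ℤ) (ξ : E3) : 0 ≤ phiq φ q ξ := (hLP.range_annulus _).1

lemma phiq_le_one (hLP : IsLittlewoodPaley φ χ) (q : ℤ) (ξ : E3) : phiq φ q ξ ≤ 1 := (hLP.range_annulus _).2

lemma supp_phiq (hLP : IsLittlewoodPaley φ χ) {q : ℤ} {ξ : E3} (h : phiq φ q ξ ≠ 0) :
    3 / 4 * (2 : ℝ) ^ q ≤ rad ξ ∧ rad ξ ≤ 8 / 3 * (2 : ℝ) ^ q := by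
  have h1 := hLP.supp_annulus _ h
  have hq : (0 : ℝ) < 2 ^ q := by positivity
  rw [norm_smul, norm_zpow, Real.norm_ofNat, zpow_neg, inv_mul_eq_div, le_div_iff₀ hq,
    div_le_iff₀ hq] at h1
  exact h1

lemma sum_phiq (hLP : IsLittlewoodPaley φ χ) {ξ : E3} (h : ξ ≠ 0) : HasSum (fun q : ℤ => phiq φ q ξ) 1 :=
  hLP.sum_hom _ (smul_ne_zero (by positivity) h)

end LP

/-! ### From weak to strong time derivatives -/

/-- The primitive `a + ∫₀ᵗ b` of a function on the half-line. -/
def primitive {E : Type*} [NormedAddCommGroup E] [NormedSpace ℝ E] (a : E) (b : ℝ → E) (t : ℝ) : E :=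
  a + ∫ s in (0 : ℝ)..t, b (max s 0)

section Primitive

variable {E : Type*} [NormedAddCommGroup E] [NormedSpace ℝ E] [CompleteSpace E]

lemma primitive_zero (a : E) (b : ℝ → E) : primitive a b 0 = a := by simp [primitive]

lemma continuous_max_of_continuousOn {b : ℝ → E} (hb : ContinuousOn b (Set.Ici 0)) :
    Continuous fun s => b (max s 0) :=
  hb.comp_continuous (by fun_prop) fun s => le_max_right s 0

lemma hasDerivAt_primitive (a : E) {b : ℝ → E} (hb : ContinuousOn b (Set.Ici 0)) {t : ℝ} (ht : 0 ≤ t) :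
    HasDerivAt (primitive a b) (b t) t := by
  have := ((continuous_max_of_continuousOn hb).integral_hasStrictDerivAt 0 t).hasDerivAt.const_add a
  rwa [max_eq_left ht] at this

lemma apply_primitive {F : Type*} [NormedAddCommGroup F] [NormedSpace ℝ F] (L : E →L[ℝ] F)
    {a : E} {b : ℝ → E} {u : ℝ → F} (hb : ContinuousOn b (Set.Ici 0)) (h0 : u 0 = L a)
    (hu : ∀ t, 0 ≤ t → HasDerivWithinAt u (L (b t)) (Set.Ici 0) t) {t : ℝ} (ht : 0 ≤ t) :
    u t = L (primitive a b t) := by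
  have hd : ∀ s, 0 ≤ s → HasDerivWithinAt (fun r => u r - L (primitive a b r)) 0 (Set.Ici 0) s := by
    intro s hs
    have h1 := L.hasFDerivAt.comp_hasDerivAt s (hasDerivAt_primitive a hb hs)
    have := (hu s hs).sub h1.hasDerivWithinAt
    rw [sub_self] at this
    exact this
  have := constant_of_has_deriv_right_zero (f := fun r => u r - L (primitive a b r)) (a := 0) (b := t)
    (fun s hs => (hd s hs.1).continuousWithinAt.mono fun r hr => hr.1)
    (fun s hs => (hd s hs.1).mono (Set.Ici_subset_Ici.2 hs.1)) t ⟨ht, le_rfl⟩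
  rw [h0, primitive_zero, sub_self] at this
  exact sub_eq_zero.1 this

end Primitive

/-- A distribution-valued function of time with a weak derivative that is continuous in `L²` is a
primitive of it. -/
lemma eq_invF_primitive {U : ℝ → TDist} {a : L2 ℂ} {b : ℝ → L2 ℂ}
    (hb : ContinuousOn b (Set.Ici 0)) (h0 : U 0 = invF a)
    (hU : ∀ t, 0 ≤ t → ∀ ψ : 𝓢(E3, ℂ),
      HasDerivWithinAt (fun r => U r ψ) (invF (b t) ψ) (Set.Ici 0) t) {t : ℝ} (ht : 0 ≤ t) :
    U t = invF (primitive a b t) := by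
  ext ψ
  exact apply_primitive ((pairCLM ψ).restrictScalars ℝ) hb (by rw [h0]; rfl)
    (fun s hs => hU s hs ψ) ht

/-- A weak derivative in time that is continuous in `L²` is a strong one. -/
lemma hasDerivWithinAt_of_weak {a b : ℝ → L2 ℂ} (hb : ContinuousOn b (Set.Ici 0))
    (h : ∀ t, 0 ≤ t → ∀ ψ : 𝓢(E3, ℂ),
      HasDerivWithinAt (fun r => invF (a r) ψ) (invF (b t) ψ) (Set.Ici 0) t) {t : ℝ} (ht : 0 ≤ t) :
    HasDerivWithinAt a (b t) (Set.Ici 0) t := by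
  refine (hasDerivAt_primitive (a 0) hb ht).hasDerivWithinAt.congr_of_mem (fun s hs => ?_) ht
  exact invF_injective (eq_invF_primitive (U := fun r => invF (a r)) hb rfl h hs)

/-- The same on frequency blocks: the equations on the blocks determine the derivative in `L²`. -/
lemma hasDerivWithinAt_of_proj {V : Type*} [NormedAddCommGroup V] [NormedSpace ℂ V] [CompleteSpace V]
    {a b : ℝ → L2 V} (hb : ContinuousOn b (Set.Ici 0))
    (h : ∀ t, 0 ≤ t → ∀ k,
      HasDerivWithinAt (fun r => proj k (a r)) (proj k (b t)) (Set.Ici 0) t) {t : ℝ} (ht : 0 ≤ t) :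
    HasDerivWithinAt a (b t) (Set.Ici 0) t := by
  refine (hasDerivAt_primitive (a 0) hb ht).hasDerivWithinAt.congr_of_mem (fun s hs => ?_) ht
  rw [← sub_eq_zero]
  refine eq_zero_of_proj _ fun k => ?_
  have := apply_primitive ((proj k : L2 V →L[ℂ] L2 V).restrictScalars ℝ) hb (a := a 0)
    (u := fun r => proj k (a r)) rfl (fun r hr => h r hr k) hs
  rw [map_sub, sub_eq_zero]
  exact this

/-! ### Products and convolutions -/

lemma integrable_mul_conv {θ : E3 → ℂ} (hθ : Integrable θ) (f g : L2 ℂ) :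
    Integrable fun ξ => θ ξ * conv f g ξ :=
  hθ.mul_bdd (c := ‖f‖ * ‖g‖) (stronglyMeasurable_conv f g).aestronglyMeasurable
    (Eventually.of_forall (norm_conv_le f g))

lemma continuous_integral_conv_left {θ : E3 → ℂ} (hθ : Integrable θ) (g : L2 ℂ) :
    Continuous fun f : L2 ℂ => ∫ ξ, θ ξ * conv f g ξ := by
  let L : L2 ℂ →ₗ[ℂ] ℂ :=
    { toFun := fun f => ∫ ξ, θ ξ * conv f g ξ
      map_add' := fun f f' => by
        rw [← integral_add (integrable_mul_conv hθ f g) (integrable_mul_conv hθ f' g), conv_add_left]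
        simp only [mul_add]
      map_smul' := fun a f => by
        rw [conv_smul_left, RingHom.id_apply, smul_eq_mul, ← integral_const_mul]
        refine integral_congr_ae (Eventually.of_forall fun ξ => ?_)
        simp only
        ring }
  refine (L.mkContinuous ((∫ ξ, ‖θ ξ‖) * ‖g‖) fun f => ?_).continuous
  refine (norm_integral_le_integral_norm _).trans ?_
  rw [mul_assoc, ← integral_mul_const]
  refine integral_mono (integrable_mul_conv hθ f g).norm (hθ.norm.mul_const _) fun ξ => ?_
  simp only [norm_mul]
  rw [mul_comm ‖g‖]
  gcongr
  exact norm_conv_le f g ξ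

lemma continuous_integral_conv_right {θ : E3 → ℂ} (hθ : Integrable θ) (f : L2 ℂ) :
    Continuous fun g : L2 ℂ => ∫ ξ, θ ξ * conv f g ξ := by
  simp only [conv_comm f]
  exact continuous_integral_conv_left hθ f

lemma memLp_schwartz_mul (ψ : 𝓢(E3, ℂ)) (w : L2 ℂ) :
    MemLp (fun x => ψ x * w x) 2 (volume : Measure E3) := by
  refine MemLp.of_le_mul (c := (SchwartzMap.seminorm ℂ 0 0) ψ) (Lp.memLp w)
    (ψ.continuous.aestronglyMeasurable.mul (Lp.memLp w).1) (Eventually.of_forall fun x => ?_)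
  rw [norm_mul]
  gcongr
  exact ψ.norm_le_seminorm ℂ x

lemma conv_schwartz (f g : 𝓢(E3, ℂ)) (ξ : E3) :
    SchwartzMap.convolution (ContinuousLinearMap.mul ℂ ℂ) f g ξ = conv f g ξ := by
  rw [SchwartzMap.convolution_apply]
  rfl

lemma integral_mul_fourierInv_schwartz (ψ f g : 𝓢(E3, ℂ)) :
    ∫ x, ψ x * ((𝓕⁻ f : 𝓢(E3, ℂ)) x * (𝓕⁻ g : 𝓢(E3, ℂ)) x) =
      ∫ ξ, (𝓕⁻ ψ : 𝓢(E3, ℂ)) ξ * conv f g ξ := by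
  set h := SchwartzMap.convolution (ContinuousLinearMap.mul ℂ ℂ) f g
  have e1 : ∀ x, (𝓕⁻ h : 𝓢(E3, ℂ)) x = (𝓕⁻ f : 𝓢(E3, ℂ)) x * (𝓕⁻ g : 𝓢(E3, ℂ)) x := by
    intro x
    have e : ∀ k : 𝓢(E3, ℂ), (𝓕⁻ k : 𝓢(E3, ℂ)) x = (𝓕 k : 𝓢(E3, ℂ)) (-x) := by
      intro k
      rw [SchwartzMap.fourierInv_coe, Real.fourierInv_eq_fourier_neg, SchwartzMap.fourier_coe]
    rw [e, e, e, SchwartzMap.fourier_convolution, SchwartzMap.pairing_apply_apply]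
    rfl
  have := SchwartzMap.integral_fourierInv_smul_eq ψ h
  simp only [smul_eq_mul] at this
  simp only [← e1, ← conv_schwartz]
  exact this.symm

/-- Closed properties of `L²` functions need only be checked for Schwartz functions. -/
lemma schwartz_dense_induction {p : L2 ℂ → Prop} (hc : IsClosed {f | p f})
    (h : ∀ f : 𝓢(E3, ℂ), p (f.toLp 2)) (f : L2 ℂ) : p f :=
  (SchwartzMap.denseRange_toLpCLM (E := E3) (F := ℂ) (p := 2) (μ := volume)
    ENNReal.ofNat_ne_top).induction_on (p := p) f hc h

lemma continuous_integral_fourierInv_left (ψ : 𝓢(E3, ℂ)) (w : L2 ℂ) :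
    Continuous fun f : L2 ℂ => ∫ x, ψ x * ((𝓕⁻ f : L2 ℂ) x * w x) := by
  have hc : Continuous fun f : L2 ℂ => (𝓕⁻ f : L2 ℂ) := (Lp.fourierTransformₗᵢ E3 ℂ).symm.continuous
  have := (continuous_pairing (memLp_schwartz_mul ψ w)).comp hc
  refine this.congr fun f => integral_congr_ae (Eventually.of_forall fun x => ?_)
  simp only
  ring

lemma continuous_integral_fourierInv_right (ψ : 𝓢(E3, ℂ)) (w : L2 ℂ) :
    Continuous fun f : L2 ℂ => ∫ x, ψ x * (w x * (𝓕⁻ f : L2 ℂ) x) := by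
  refine (continuous_integral_fourierInv_left ψ w).congr fun f =>
    integral_congr_ae (Eventually.of_forall fun x => ?_)
  simp only
  ring

lemma integral_mul_fourierInv_toLp (ψ f g : 𝓢(E3, ℂ)) :
    ∫ x, ψ x * ((𝓕⁻ (f.toLp 2 : L2 ℂ) : L2 ℂ) x * (𝓕⁻ (g.toLp 2 : L2 ℂ) : L2 ℂ) x) =
      ∫ ξ, (𝓕⁻ ψ : 𝓢(E3, ℂ)) ξ * conv (f.toLp 2 : L2 ℂ) (g.toLp 2 : L2 ℂ) ξ := by
  have ef : (𝓕⁻ (f.toLp 2 : L2 ℂ) : L2 ℂ) = (𝓕⁻ f).toLp 2 := SchwartzMap.toLp_fourierInv_eq f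
  have eg : (𝓕⁻ (g.toLp 2 : L2 ℂ) : L2 ℂ) = (𝓕⁻ g).toLp 2 := SchwartzMap.toLp_fourierInv_eq g
  have e := conv_congr (f.coeFn_toLp 2 (volume : Measure E3)) (g.coeFn_toLp 2 (volume : Measure E3))
  rw [ef, eg, e]
  refine Eq.trans ?_ (integral_mul_fourierInv_schwartz ψ f g)
  refine integral_congr_ae ?_
  filter_upwards [(𝓕⁻ f : 𝓢(E3, ℂ)).coeFn_toLp 2, (𝓕⁻ g : 𝓢(E3, ℂ)).coeFn_toLp 2] with x h1 h2
  rw [h1, h2]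

lemma integral_mul_fourierInv (ψ : 𝓢(E3, ℂ)) (f g : L2 ℂ) :
    ∫ x, ψ x * ((𝓕⁻ f : L2 ℂ) x * (𝓕⁻ g : L2 ℂ) x) =
      ∫ ξ, (𝓕⁻ ψ : 𝓢(E3, ℂ)) ξ * conv f g ξ := by
  have hθ : Integrable (𝓕⁻ ψ : 𝓢(E3, ℂ)) := (𝓕⁻ ψ : 𝓢(E3, ℂ)).integrable
  revert f
  refine schwartz_dense_induction (isClosed_eq (continuous_integral_fourierInv_left ψ _)
    (continuous_integral_conv_left hθ g)) fun f => ?_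
  revert g
  exact schwartz_dense_induction (isClosed_eq (continuous_integral_fourierInv_right ψ _)
    (continuous_integral_conv_right hθ _)) fun g => integral_mul_fourierInv_toLp ψ f g

/-- The Fourier transform of a product of square integrable functions is the convolution of the
Fourier transforms. -/
lemma integral_mul_mul (ψ : 𝓢(E3, ℂ)) (v w : L2 ℂ) :
    ∫ x, ψ x * (v x * w x) =
      ∫ ξ, (𝓕⁻ ψ : 𝓢(E3, ℂ)) ξ * conv (𝓕 v : L2 ℂ) (𝓕 w : L2 ℂ) ξ := by
  rw [← integral_mul_fourierInv, FourierTransform.fourierInv_fourier_eq (F := L2 ℂ) v,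
    FourierTransform.fourierInv_fourier_eq (F := L2 ℂ) w]

/-! ### Real-valued distributions -/

section Conj

variable {V W : Type*} [NormedAddCommGroup V] [NormedSpace ℂ V] [NormedAddCommGroup W]
  [NormedSpace ℂ W]

/-- The map `f ↦ c (f(-·))`. For the complex conjugation `c`, its fixed points are the Fourier
transforms of real-valued functions. -/
def flipConj (c : V →L[ℝ] V) : L2 V →L[ℝ] L2 V :=
  (Lp.compMeasurePreservingₗᵢ ℝ (fun ξ : E3 => -ξ)
    (Measure.measurePreserving_neg (volume : Measure E3))).toContinuousLinearMap.comp
    (c.compLpL 2 volume)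

lemma flipConj_ae (c : V →L[ℝ] V) (f : L2 V) :
    flipConj c f =ᵐ[volume] fun ξ => c (f (-ξ)) := by
  have hm := Measure.measurePreserving_neg (volume : Measure E3)
  have h1 := Lp.coeFn_compMeasurePreserving (c.compLp f) hm
  have h2 := hm.quasiMeasurePreserving.ae_eq_comp (c.coeFn_compLp' f)
  exact h1.trans h2

lemma flipConj_mulOp {c : V →L[ℝ] V} {c' : W →L[ℝ] W} {m : E3 → V →L[ℂ] W} (hm : IsSymbol m)
    (h : ∀ ξ z, c' (m (-ξ) z) = m ξ (c z)) (f : L2 V) :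
    flipConj c' (mulOp m f) = mulOp m (flipConj c f) := by
  apply Lp.ext
  have hn := (Measure.measurePreserving_neg (volume : Measure E3)).quasiMeasurePreserving.ae
    (mulOp_ae hm f)
  filter_upwards [flipConj_ae c' (mulOp m f), flipConj_ae c f, mulOp_ae hm (flipConj c f), hn]
    with ξ h1 h2 h3 h4
  rw [h1, h3, h2, h4, h]

lemma rad_neg (ξ : E3) : rad (-ξ) = rad ξ := by
  unfold rad; rw [smul_neg, norm_neg]

lemma brk_neg (ξ : E3) : brk (-ξ) = brk ξ := by unfold brk; rw [rad_neg]

lemma kap_neg (ξ : E3) : kap (-ξ) = kap ξ := by unfold kap; rw [brk_neg]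

lemma rho_neg (ξ : E3) : rho (-ξ) = rho ξ := by unfold rho; rw [brk_neg, rad_neg]

lemma chi_neg (k : ℕ) (ξ : E3) : chi k (-ξ) = chi k ξ := by
  unfold chi blk
  simp only [Set.indicator, Set.mem_ofPred_eq, rad_neg]

lemma dir_neg (j : Fin 3) (ξ : E3) : dir j (-ξ) = -dir j ξ := by
  unfold dir; simp [neg_div]

lemma conj_chi (k : ℕ) (ξ : E3) : (starRingEnd ℂ) (chi k ξ) = chi k ξ := by
  by_cases h : ξ ∈ blk k
  · rw [chi_of_mem h, map_one]
  · rw [chi_of_notMem h, map_zero]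

end Conj

/-- Complex conjugation on `ℂ`. -/
def conj1 : ℂ →L[ℝ] ℂ := Complex.conjCLE.toContinuousLinearMap

/-- Complex conjugation on `ℂⁿ`. -/
def conjn (n : ℕ) : Cn n →L[ℝ] Cn n :=
  LinearMap.toContinuousLinearMap
    { toFun := fun z => WithLp.toLp 2 fun a => (starRingEnd ℂ) (z a)
      map_add' := fun x y => by ext a; simp
      map_smul' := fun r x => by ext a; simp }

lemma conj1_apply (a : ℂ) : conj1 a = (starRingEnd ℂ) a := rfl

lemma conjn_apply {n : ℕ} (z : Cn n) (a : Fin n) : conjn n z a = (starRingEnd ℂ) (z a) := rfl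

lemma conv_flipConj (f g : L2 ℂ) (ξ : E3) :
    conv (flipConj conj1 f) (flipConj conj1 g) ξ = (starRingEnd ℂ) (conv f g (-ξ)) := by
  rw [conv_congr (flipConj_ae conj1 f) (flipConj_ae conj1 g)]
  unfold conv
  rw [← integral_conj, ← integral_neg_eq_self _ volume]
  refine integral_congr_ae (Eventually.of_forall fun t => ?_)
  simp only [conj1_apply, map_mul, neg_neg]
  congr 3
  abel_nf

lemma flipConj_convBlk (l : ℕ) (f g : L2 ℂ) :
    flipConj conj1 (convBlk l f g) = convBlk l (flipConj conj1 f) (flipConj conj1 g) := by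
  apply Lp.ext
  have hn := (Measure.measurePreserving_neg (volume : Measure E3)).quasiMeasurePreserving.ae
    (convBlk_ae l f g)
  filter_upwards [flipConj_ae conj1 (convBlk l f g),
    convBlk_ae l (flipConj conj1 f) (flipConj conj1 g), hn] with ξ h1 h2 h3
  rw [h1, h2, h3, conv_flipConj, conj1_apply, map_mul, conj_chi, chi_neg]

/-- The complex conjugate of a Schwartz function. -/
def conjS : 𝓢(E3, ℂ) →L[ℝ] 𝓢(E3, ℂ) := SchwartzMap.postcompCLM conj1

lemma conjS_apply (ψ : 𝓢(E3, ℂ)) (x : E3) : conjS ψ x = (starRingEnd ℂ) (ψ x) := rfl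

lemma fourierInv_conjS (ψ : 𝓢(E3, ℂ)) (ξ : E3) :
    (𝓕⁻ (conjS ψ) : 𝓢(E3, ℂ)) ξ = (starRingEnd ℂ) ((𝓕⁻ ψ : 𝓢(E3, ℂ)) (-ξ)) := by
  rw [SchwartzMap.fourierInv_coe, SchwartzMap.fourierInv_coe, Real.fourierInv_eq',
    Real.fourierInv_eq', ← integral_conj]
  refine integral_congr_ae (Eventually.of_forall fun x => ?_)
  simp only [conjS_apply, smul_eq_mul, map_mul, ← Complex.exp_conj]
  congr 2
  simp [Complex.conj_ofNat]

lemma invF_flipConj (f : L2 ℂ) (ψ : 𝓢(E3, ℂ)) :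
    invF (flipConj conj1 f) ψ = (starRingEnd ℂ) (invF f (conjS ψ)) := by
  rw [invF_apply, invF_apply, ← integral_conj, ← integral_neg_eq_self _ volume]
  have hn := (Measure.measurePreserving_neg (volume : Measure E3)).quasiMeasurePreserving.ae
    (flipConj_ae conj1 f)
  refine integral_congr_ae ?_
  filter_upwards [hn] with ξ h
  rw [h, map_mul, fourierInv_conjS, conj1_apply, neg_neg, Complex.conj_conj]

/-- A distribution is real-valued if and only if its Fourier transform is invariant under reflection and
complex conjugation. -/
lemma isReal_invF_iff (f : L2 ℂ) : IsReal (invF f) ↔ flipConj conj1 f = f := by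
  constructor
  · intro h
    apply invF_injective
    have hr : ∀ ψ : 𝓢(E3, ℂ), (∀ x, (ψ x).im = 0) → invF (flipConj conj1 f) ψ = invF f ψ := by
      intro ψ hψ
      have : conjS ψ = ψ := by
        ext x; exact Complex.conj_eq_iff_im.2 (hψ x)
      rw [invF_flipConj, this]
      exact Complex.conj_eq_iff_im.2 (h ψ hψ)
    ext ψ
    obtain ⟨ψ₁, h₁⟩ : ∃ ψ₁ : 𝓢(E3, ℂ), ψ₁ = ψ + conjS ψ := ⟨_, rfl⟩
    obtain ⟨ψ₂, h₂⟩ : ∃ ψ₂ : 𝓢(E3, ℂ), ψ₂ = Complex.I • (conjS ψ - ψ) := ⟨_, rfl⟩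
    have hs : ψ = (2 : ℂ)⁻¹ • ψ₁ + (Complex.I * (2 : ℂ)⁻¹) • ψ₂ := by
      rw [h₁, h₂]
      ext x
      simp only [add_apply, smul_apply, sub_apply, smul_eq_mul]
      linear_combination (-(conjS ψ x - ψ x) / 2) * Complex.I_mul_I
    have r₁ : ∀ x, (ψ₁ x).im = 0 := by
      intro x
      rw [h₁]
      simp [conjS_apply]
    have r₂ : ∀ x, (ψ₂ x).im = 0 := by
      intro x
      rw [h₂]
      simp [conjS_apply]
    rw [hs]
    simp only [map_add, map_smul]
    rw [hr ψ₁ r₁, hr ψ₂ r₂]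
  · intro h ψ hψ
    have : conjS ψ = ψ := by
      ext x; exact Complex.conj_eq_iff_im.2 (hψ x)
    have h2 := invF_flipConj f ψ
    rw [h, this] at h2
    exact Complex.conj_eq_iff_im.1 h2.symm

/-! ### Minkowski's inequality for nonnegative functions -/

/-- The `L²` norm of a nonnegative function. -/
def sqNorm {α : Type*} [MeasurableSpace α] (μ : Measure α) (G : α → ℝ≥0∞) : ℝ≥0∞ :=
  (∫⁻ a, G a ^ 2 ∂μ) ^ (1 / 2 : ℝ)

section SqNorm

variable {α : Type*} [MeasurableSpace α] {μ : Measure α}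

lemma sqNorm_mono {F G : α → ℝ≥0∞} (h : ∀ᵐ a ∂μ, F a ≤ G a) : sqNorm μ F ≤ sqNorm μ G := by
  refine ENNReal.rpow_le_rpow (lintegral_mono_ae ?_) (by norm_num)
  filter_upwards [h] with a ha
  gcongr

lemma sqrt_sq_ennreal (a : ℝ≥0∞) : (a ^ 2) ^ (1 / 2 : ℝ) = a := by
  rw [← ENNReal.rpow_natCast, ← ENNReal.rpow_mul]; norm_num

lemma sq_sqrt_ennreal (a : ℝ≥0∞) : (a ^ (1 / 2 : ℝ)) ^ 2 = a := by
  rw [← ENNReal.rpow_natCast, ← ENNReal.rpow_mul]; norm_num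

lemma sqNorm_const_mul {c : ℝ≥0∞} (hc : c ≠ ∞) (G : α → ℝ≥0∞) :
    sqNorm μ (fun a => c * G a) = c * sqNorm μ G := by
  unfold sqNorm
  simp only [mul_pow]
  rw [lintegral_const_mul' _ _ (by finiteness), ENNReal.mul_rpow_of_nonneg _ _ (by norm_num),
    sqrt_sq_ennreal]

lemma sqNorm_add_le {F G : α → ℝ≥0∞} (hF : AEMeasurable F μ) (hG : AEMeasurable G μ) :
    sqNorm μ (fun a => F a + G a) ≤ sqNorm μ F + sqNorm μ G := by
  have := ENNReal.lintegral_Lp_add_le (p := 2) hF hG (by norm_num)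
  simpa [sqNorm] using this

lemma sqNorm_sum_le {ι : Type*} (s : Finset ι) {G : ι → α → ℝ≥0∞} (hG : ∀ i, AEMeasurable (G i) μ) :
    sqNorm μ (fun a => ∑ i ∈ s, G i a) ≤ ∑ i ∈ s, sqNorm μ (G i) := by
  classical
  induction s using Finset.induction_on with
  | empty => simp [sqNorm]
  | insert i s hi ih =>
    simp only [Finset.sum_insert hi]
    exact (sqNorm_add_le (hG i) (Finset.aemeasurable_fun_sum s fun i _ => hG i)).trans
      (add_le_add_right ih _)

/-- Minkowski's inequality for series. -/
lemma sqNorm_tsum_le {G : ℕ → α → ℝ≥0∞} (hG : ∀ i, AEMeasurable (G i) μ) :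
    sqNorm μ (fun a => ∑' i, G i a) ≤ ∑' i, sqNorm μ (G i) := by
  have h1 : Tendsto (fun n => ∫⁻ a, (∑ i ∈ Finset.range n, G i a) ^ 2 ∂μ) atTop
      (𝓝 (∫⁻ a, (∑' i, G i a) ^ 2 ∂μ)) := by
    refine lintegral_tendsto_of_tendsto_of_monotone (fun n =>
      (Finset.aemeasurable_fun_sum _ fun i _ => hG i).pow_const 2)
      (Eventually.of_forall fun a => ?_) (Eventually.of_forall fun a => ?_)
    · intro m n hmn
      exact pow_le_pow_left' (Finset.sum_le_sum_of_subset (Finset.range_mono hmn)) 2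
    · exact (ENNReal.continuous_pow 2).continuousAt.tendsto.comp
        (ENNReal.tendsto_nat_tsum fun i => G i a)
  refine le_of_tendsto (h1.ennrpow_const (1 / 2)) (Eventually.of_forall fun n => ?_)
  exact (sqNorm_sum_le (Finset.range n) hG).trans (ENNReal.sum_le_tsum _)

end SqNorm

lemma enorm_eq_sqNorm {V : Type*} [NormedAddCommGroup V] (f : L2 V) :
    ‖f‖ₑ = sqNorm volume fun ξ => ‖f ξ‖ₑ := enorm_L2 f

lemma eLpNorm_two_eq_sqNorm {α V : Type*} [MeasurableSpace α] {μ : Measure α} [NormedAddCommGroup V]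
    (f : α → V) : eLpNorm f 2 μ = sqNorm μ fun a => ‖f a‖ₑ := by
  rw [eLpNorm_eq_lintegral_rpow_enorm_toReal (by norm_num) (by norm_num)]
  simp [sqNorm]

/-- The `L^θ` norm in time on the whole half-line. -/
def halfLineNorm (θ : ℝ≥0∞) (G : ℝ → ℝ≥0∞) : ℝ≥0∞ := eLpNorm G θ (volume.restrict (Set.Ici 0))

lemma timeNorm_mono {θ T : ℝ≥0∞} {F G : ℝ → ℝ≥0∞} (h : ∀ t, 0 ≤ t → F t ≤ G t) :
    timeNorm θ T F ≤ halfLineNorm θ G := by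
  have hs : {t : ℝ | 0 ≤ t ∧ ENNReal.ofReal t ≤ T} ⊆ Set.Ici 0 := fun t ht => ht.1
  refine le_trans (eLpNorm_mono_measure _ (Measure.restrict_mono hs le_rfl)) ?_
  refine eLpNorm_mono_enorm_ae ?_
  filter_upwards [ae_restrict_mem measurableSet_Ici] with t ht
  simpa using h t ht

lemma halfLineNorm_tsum_le {θ : ℝ≥0∞} (hθ : θ = 2 ∨ θ = ∞) {G : ℕ → ℝ → ℝ≥0∞}
    (hG : ∀ i, Measurable (G i)) :
    halfLineNorm θ (fun t => ∑' i, G i t) ≤ ∑' i, halfLineNorm θ (G i) := by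
  rcases hθ with rfl | rfl
  · have : ∀ G : ℝ → ℝ≥0∞, halfLineNorm 2 G = sqNorm (volume.restrict (Set.Ici 0)) G := by
      intro G
      rw [halfLineNorm, eLpNorm_eq_lintegral_rpow_enorm_toReal (by norm_num) (by norm_num)]
      simp [sqNorm]
    simp only [this]
    exact sqNorm_tsum_le fun i => (hG i).aemeasurable
  · unfold halfLineNorm
    simp only [eLpNorm_exponent_top, eLpNormEssSup, enorm_eq_self]
    refine essSup_le_of_ae_le _ ?_
    have := ae_all_iff.2 fun i => ENNReal.ae_le_essSup (μ := volume.restrict (Set.Ici 0)) (G i)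
    filter_upwards [this] with t ht
    exact ENNReal.tsum_le_tsum ht

lemma halfLineNorm_const_mul {θ : ℝ≥0∞} (hθ : θ = 2 ∨ θ = ∞) {c : ℝ≥0∞} (hc : c ≠ ∞)
    (G : ℝ → ℝ≥0∞) : halfLineNorm θ (fun t => c * G t) = c * halfLineNorm θ G := by
  rcases hθ with rfl | rfl
  · have : ∀ G : ℝ → ℝ≥0∞, halfLineNorm 2 G = sqNorm (volume.restrict (Set.Ici 0)) G := by
      intro G
      rw [halfLineNorm, eLpNorm_eq_lintegral_rpow_enorm_toReal (by norm_num) (by norm_num)]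
      simp [sqNorm]
    rw [this, this, sqNorm_const_mul hc]
  · unfold halfLineNorm
    simp only [eLpNorm_exponent_top, eLpNormEssSup, enorm_eq_self]
    exact ENNReal.essSup_const_mul

/-! ### Distributions dominated by an element of `L²` -/

/-- The Fourier transform of the vector `F` is bounded by `C (1+|D|²)^{1/2} |Y|`. All the functions in
the energy and in the dissipation are dominated in this way. -/
def Dom {ι : Type} [Fintype ι] {V : Type*} [NormedAddCommGroup V] (F : ι → TDist) (Y : L2 V)
    (C : ℝ≥0) : Prop :=
  ∃ h : ι → E3 → ℂ, (∀ i, Hat (F i) (h i)) ∧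
    ∀ᵐ ξ, ∑ i, ‖h i ξ‖ ^ 2 ≤ (C * brk ξ * ‖Y ξ‖) ^ 2

lemma Hat.aestronglyMeasurable {F : TDist} {h : E3 → ℂ} (hF : Hat F h) :
    AEStronglyMeasurable h (volume : Measure E3) := hF.locallyIntegrable.aestronglyMeasurable

lemma l2Vec_eq {ι : Type} [Fintype ι] {F : ι → TDist} {h : ι → E3 → ℂ}
    (hF : ∀ i, Hat (F i) (h i)) :
    l2Vec F = sqNorm volume fun ξ => (∑ i, ‖h i ξ‖ₑ ^ 2) ^ (1 / 2 : ℝ) := by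
  unfold l2Vec sqNorm
  congr 1
  simp only [sq_sqrt_ennreal]
  rw [lintegral_finsetSum']
  · refine Finset.sum_congr rfl fun i _ => ?_
    rw [(hF i).l2_eq, eLpNorm_two_eq_sqNorm, sqNorm, sq_sqrt_ennreal]
  · exact fun i _ => ((hF i).aestronglyMeasurable.enorm).pow_const 2

lemma sqrt_le_of_sq_le {a b : ℝ≥0∞} (h : a ≤ b ^ 2) : a ^ (1 / 2 : ℝ) ≤ b := by
  rw [← sqrt_sq_ennreal b]
  exact ENNReal.rpow_le_rpow h (by norm_num)

lemma sum_enorm_sq_le {ι : Type} [Fintype ι] {z : ι → ℂ} {C a : ℝ} {V : Type*}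
    [NormedAddCommGroup V] {y : V} (hC : 0 ≤ C) (ha : 0 ≤ a)
    (h : ∑ i, ‖z i‖ ^ 2 ≤ (C * a * ‖y‖) ^ 2) :
    (∑ i, ‖z i‖ₑ ^ 2) ^ (1 / 2 : ℝ) ≤ ENNReal.ofReal C * ENNReal.ofReal a * ‖y‖ₑ := by
  refine sqrt_le_of_sq_le ?_
  have e : ∑ i, ‖z i‖ₑ ^ 2 = ENNReal.ofReal (∑ i, ‖z i‖ ^ 2) := by
    rw [ENNReal.ofReal_sum_of_nonneg fun i _ => by positivity]
    refine Finset.sum_congr rfl fun i _ => ?_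
    rw [ENNReal.ofReal_pow (norm_nonneg _), ofReal_norm]
  rw [e, ← ofReal_norm, ← ENNReal.ofReal_mul hC, ← ENNReal.ofReal_mul (by positivity),
    ← ENNReal.ofReal_pow (by positivity)]
  exact ENNReal.ofReal_le_ofReal h

lemma ofReal_brk_le {k : ℕ} {ξ : E3} (h : ξ ∈ blk k) : ENNReal.ofReal (brk ξ) ≤ 2 * sq2 ^ (2 * k) := by
  rw [pow_mul, sq2_sq]
  have h1 := brk_le_of_mem_blk h
  have h2 : (1 : ℝ) ≤ 2 ^ k := one_le_pow₀ (by norm_num)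
  have : ENNReal.ofReal (2 * 2 ^ k) = 2 * 2 ^ k := by
    rw [ENNReal.ofReal_mul (by norm_num), ENNReal.ofReal_pow (by norm_num)]; simp
  rw [← this]
  exact ENNReal.ofReal_le_ofReal (by linarith)

lemma ae_proj_of_mem {V : Type*} [NormedAddCommGroup V] [NormedSpace ℂ V] (Y : L2 V) :
    ∀ᵐ ξ, ∀ k, ξ ∈ blk k → proj k Y ξ = Y ξ := by
  rw [ae_all_iff]
  intro k
  filter_upwards [proj_ae k Y] with ξ h hk
  rw [h, chi_of_mem hk, one_smul]

section Besov

variable {ι : Type} [Fintype ι] {V : Type*} [NormedAddCommGroup V] [NormedSpace ℂ V]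

lemma measurable_enorm_proj (k : ℕ) (Y : L2 V) : Measurable fun ξ => ‖proj k Y ξ‖ₑ :=
  (Lp.stronglyMeasurable _).enorm

lemma Dom.l2Vec_le {F : ι → TDist} {Y : L2 V} {C : ℝ≥0} (hF : Dom F Y C) :
    l2Vec F ≤ ∑' k, 2 * C * (sq2 ^ (2 * k) * ‖proj k Y‖ₑ) := by
  obtain ⟨h, h1, h2⟩ := hF
  rw [l2Vec_eq h1]
  calc _ ≤ sqNorm volume (fun ξ => ∑' k, 2 * C * sq2 ^ (2 * k) * ‖proj k Y ξ‖ₑ) := by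
        refine sqNorm_mono ?_
        filter_upwards [h2, ae_proj_of_mem Y] with ξ h2 h3
        obtain ⟨k, hk⟩ := exists_mem_blk ξ
        refine (sum_enorm_sq_le C.2 (brk_pos ξ).le h2).trans ?_
        refine le_trans ?_ (ENNReal.le_tsum k)
        rw [h3 k hk, NNReal.val_eq_coe, ENNReal.ofReal_coe_nnreal, mul_comm 2 (C : ℝ≥0∞),
          mul_assoc (C : ℝ≥0∞) 2]
        gcongr
        exact ofReal_brk_le hk
    _ ≤ _ := by
        refine (sqNorm_tsum_le fun k => ((measurable_enorm_proj k Y).const_mul _).aemeasurable).trans ?_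
        refine ENNReal.tsum_le_tsum fun k => ?_
        rw [sqNorm_const_mul (by have := sq2_ne_top; finiteness), enorm_eq_sqNorm, mul_assoc]

/-- The Littlewood-Paley block of order `q` only meets the frequency blocks `k ≥ q`. -/
lemma Dom.block_le {φ χ : E3 → ℝ} (hLP : IsLittlewoodPaley φ χ) {F : ι → TDist} {Y : L2 V} {C : ℝ≥0}
    (hF : Dom F Y C) (q : ℤ) :
    l2Vec (fun i => block φ q (F i)) ≤
      ∑' k : ℕ, if q ≤ k then 2 * C * (sq2 ^ (2 * k) * ‖proj k Y‖ₑ) else 0 := by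
  obtain ⟨h, h1, h2⟩ := hF
  rw [l2Vec_eq fun i => (h1 i).block hLP q]
  calc _ ≤ sqNorm volume (fun ξ => ∑' k : ℕ,
        (if q ≤ k then 2 * C * sq2 ^ (2 * k) else 0) * ‖proj k Y ξ‖ₑ) := by
        refine sqNorm_mono ?_
        filter_upwards [h2, ae_proj_of_mem Y] with ξ h2 h3
        obtain ⟨k, hk⟩ := exists_mem_blk ξ
        by_cases hq : phiq φ q ξ = 0
        · simp [hq]
        have hqk : q ≤ k := by
          have h4 := (supp_phiq hLP hq).1
          have h5 := hk.1
          by_contra h6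
          have h7 : (2 : ℝ) ^ ((k : ℤ) + 1) ≤ 2 ^ q := zpow_le_zpow_right₀ (by norm_num) (by omega)
          rw [zpow_add₀ (by norm_num), zpow_one, zpow_natCast] at h7
          have : (0 : ℝ) < 2 ^ k := by positivity
          linarith
        refine le_trans (b := (∑ i, ‖h i ξ‖ₑ ^ 2) ^ (1 / 2 : ℝ)) ?_ ?_
        · refine ENNReal.rpow_le_rpow (Finset.sum_le_sum fun i _ => ?_) (by norm_num)
          refine pow_le_pow_left' (enorm_le_iff_norm_le.2 ?_) 2
          rw [norm_mul, Complex.norm_real, Real.norm_of_nonneg (phiq_nonneg hLP q ξ)]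
          exact mul_le_of_le_one_left (norm_nonneg _) (phiq_le_one hLP q ξ)
        refine (sum_enorm_sq_le C.2 (brk_pos ξ).le h2).trans ?_
        refine le_trans ?_ (ENNReal.le_tsum k)
        rw [if_pos hqk, h3 k hk, NNReal.val_eq_coe, ENNReal.ofReal_coe_nnreal,
          mul_comm 2 (C : ℝ≥0∞), mul_assoc (C : ℝ≥0∞) 2]
        gcongr
        exact ofReal_brk_le hk
    _ ≤ _ := by
        refine (sqNorm_tsum_le fun k => ((measurable_enorm_proj k Y).const_mul _).aemeasurable).trans ?_
        refine ENNReal.tsum_le_tsum fun k => ?_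
        have := sq2_ne_top
        rw [sqNorm_const_mul (by split_ifs <;> finiteness), enorm_eq_sqNorm]
        split_ifs
        · rw [mul_assoc]
        · rw [zero_mul]

/-- The sum of the geometric series `∑ 2^{-si}`, the constant in the summation over the dyadic
blocks. -/
def geomC (s : ℝ) : ℝ≥0∞ := (1 - ENNReal.ofReal ((2 : ℝ) ^ (-s)))⁻¹

lemma geomC_ne_top {s : ℝ} (hs : 0 < s) : geomC s ≠ ∞ := by
  unfold geomC
  rw [ENNReal.inv_ne_top]
  refine (tsub_pos_of_lt (ENNReal.ofReal_lt_one.2 ?_)).ne'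
  exact Real.rpow_lt_one_of_one_lt_of_neg (by norm_num) (by linarith)

lemma one_le_geomC (s : ℝ) : 1 ≤ geomC s := by
  unfold geomC
  rw [ENNReal.one_le_inv]
  exact tsub_le_self

lemma tsum_int_le (s : ℝ) (k : ℤ) :
    ∑' q : ℤ, (if q ≤ k then ENNReal.ofReal ((2 : ℝ) ^ ((q : ℝ) * s)) else 0) =
      geomC s * ENNReal.ofReal ((2 : ℝ) ^ ((k : ℝ) * s)) := by
  have hinj : Function.Injective fun i : ℕ => k - (i : ℤ) := fun i j h => by
    simpa using h
  rw [← hinj.tsum_eq]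
  · have : ∀ i : ℕ, (if k - (i : ℤ) ≤ k then ENNReal.ofReal ((2 : ℝ) ^ (((k - (i : ℤ) : ℤ) : ℝ) * s)) else 0)
        = ENNReal.ofReal ((2 : ℝ) ^ ((k : ℝ) * s)) * ENNReal.ofReal ((2 : ℝ) ^ (-s)) ^ i := by
      intro i
      rw [if_pos (by omega), ← ENNReal.ofReal_pow (by positivity),
        ← ENNReal.ofReal_mul (by positivity), ← Real.rpow_natCast, ← Real.rpow_mul (by norm_num),
        ← Real.rpow_add (by norm_num)]
      congr 2
      push_cast
      ring
    simp only [this]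
    rw [ENNReal.tsum_mul_left, ENNReal.tsum_geometric, mul_comm]
    rfl
  · intro q hq
    simp only [Function.mem_support, ne_eq, ite_eq_right_iff, Classical.not_imp] at hq
    exact ⟨(k - q).toNat, by simp only; omega⟩

/-- The sum over the Littlewood-Paley blocks of positive order `s` converges at low frequencies, so that
the homogeneous norm is bounded by the sum over the frequency blocks. -/
lemma sum_blocks_le (s : ℝ) (g : ℕ → ℝ≥0∞) :
    ∑' q : ℤ, ENNReal.ofReal ((2 : ℝ) ^ ((q : ℝ) * s)) * (∑' k : ℕ, if q ≤ k then g k else 0) =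
      geomC s * ∑' k : ℕ, ENNReal.ofReal ((2 : ℝ) ^ ((k : ℝ) * s)) * g k := by
  simp only [← ENNReal.tsum_mul_left]
  rw [ENNReal.tsum_comm]
  refine tsum_congr fun k => ?_
  have := tsum_int_le s k
  simp only [Int.cast_natCast] at this
  rw [← mul_assoc, ← this, ← ENNReal.tsum_mul_right]
  refine tsum_congr fun q => ?_
  split_ifs <;> simp

lemma ofReal_two_rpow (m k : ℕ) : ENNReal.ofReal ((2 : ℝ) ^ ((k : ℝ) * (m / 2))) = sq2 ^ (m * k) := by
  rw [sq2, ← ENNReal.ofReal_pow (by positivity), Real.sqrt_eq_rpow, ← Real.rpow_natCast,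
    ← Real.rpow_mul (by norm_num)]
  congr 2
  push_cast
  ring

lemma Dom.homBesov_le {φ χ : E3 → ℝ} (hLP : IsLittlewoodPaley φ χ) {F : ι → TDist} {Y : L2 V} {C : ℝ≥0}
    (hF : Dom F Y C) (m : ℕ) :
    homBesov φ (m / 2) F ≤ 2 * C * geomC (m / 2) * ∑' k, sq2 ^ ((m + 2) * k) * ‖proj k Y‖ₑ := by
  unfold homBesov
  refine (ENNReal.tsum_le_tsum fun q => mul_le_mul_right (hF.block_le hLP q) _).trans ?_
  rw [sum_blocks_le, mul_comm (2 * (C : ℝ≥0∞)), mul_assoc, ← ENNReal.tsum_mul_left (a := 2 * (C : ℝ≥0∞))]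
  refine le_of_eq (congrArg _ (tsum_congr fun k => ?_))
  rw [ofReal_two_rpow, add_mul, pow_add]
  ring

/-- The sum `∑ₖ 2^{nk/2} ‖Pₖ Y‖` over the sharp frequency blocks, `‖Pₖ Y‖` being the `L²` norm. -/
def wNorm (n : ℕ) (Y : L2 V) : ℝ≥0∞ := ∑' k, sq2 ^ (n * k) * ‖proj k Y‖ₑ

lemma Dom.l2Vec_le_wNorm {F : ι → TDist} {Y : L2 V} {C : ℝ≥0} (hF : Dom F Y C) (m : ℕ) :
    l2Vec F ≤ 2 * C * wNorm (m + 2) Y := by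
  refine hF.l2Vec_le.trans ?_
  rw [wNorm, ← ENNReal.tsum_mul_left]
  refine ENNReal.tsum_le_tsum fun k => ?_
  gcongr
  · exact one_le_sq2
  · omega

/-- The sum `∑ₖ 2^{nk/2} ‖Pₖ Y‖_{L^θ(0,∞;L²)}`. -/
def wChemin (θ : ℝ≥0∞) (n : ℕ) (Y : ℝ → L2 V) : ℝ≥0∞ :=
  ∑' k, sq2 ^ (n * k) * halfLineNorm θ fun t => ‖proj k (Y t)‖ₑ

/-- The Chemin-Lerner norm of a dominated function is bounded by the sum over the frequency blocks, with
one derivative more. -/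
lemma chemin_le {φ χ : E3 → ℝ} (hLP : IsLittlewoodPaley φ χ) {θ : ℝ≥0∞} (hθ : θ = 2 ∨ θ = ∞) (T : ℝ≥0∞)
    {F : ℝ → ι → TDist} {Y : ℝ → L2 V} (hY : Continuous Y) {C : ℝ≥0}
    (hF : ∀ t, 0 ≤ t → Dom (F t) (Y t) C) (m : ℕ) :
    chemin φ θ T (m / 2) F ≤ 4 * C * geomC (m / 2) * wChemin θ (m + 2) Y := by
  have hm : ∀ k, Measurable fun t => ‖proj k (Y t)‖ₑ := fun k =>
    ((proj k : L2 V →L[ℂ] L2 V).continuous.comp hY).enorm.measurable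
  have hc : ∀ k : ℕ, 2 * C * sq2 ^ (2 * k) ≠ ∞ := fun k => by
    have := sq2_ne_top
    finiteness
  have h1 : timeNorm θ T (fun t => l2Vec (F t)) ≤ 2 * C * wChemin θ (m + 2) Y := by
    refine (timeNorm_mono fun t ht => (hF t ht).l2Vec_le).trans ?_
    refine (halfLineNorm_tsum_le hθ fun k => ((hm k).const_mul _).const_mul _).trans ?_
    rw [wChemin, ← ENNReal.tsum_mul_left]
    refine ENNReal.tsum_le_tsum fun k => ?_
    simp only [← mul_assoc]
    rw [halfLineNorm_const_mul hθ (hc k)]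
    gcongr
    · exact one_le_sq2
    · omega
  have h2 : homChemin φ θ T (m / 2) F ≤ 2 * C * geomC (m / 2) * wChemin θ (m + 2) Y := by
    unfold homChemin
    have e : ∀ q : ℤ, timeNorm θ T (fun t => l2Vec (fun i => block φ q (F t i))) ≤
        ∑' k : ℕ, if q ≤ k then 2 * C * (sq2 ^ (2 * k) * halfLineNorm θ fun t => ‖proj k (Y t)‖ₑ)
          else 0 := by
      intro q
      refine (timeNorm_mono fun t ht => (hF t ht).block_le hLP q).trans ?_
      refine (halfLineNorm_tsum_le hθ fun k => ?_).trans ?_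
      · split_ifs
        · exact ((hm k).const_mul _).const_mul _
        · exact measurable_const
      · refine ENNReal.tsum_le_tsum fun k => ?_
        split_ifs
        · simp only [← mul_assoc]
          rw [halfLineNorm_const_mul hθ (hc k)]
        · simp [halfLineNorm]
    refine (ENNReal.tsum_le_tsum fun q => mul_le_mul_right (e q) _).trans ?_
    rw [sum_blocks_le, mul_comm (2 * (C : ℝ≥0∞)), mul_assoc, wChemin,
      ← ENNReal.tsum_mul_left (a := 2 * (C : ℝ≥0∞))]
    refine le_of_eq (congrArg _ (tsum_congr fun k => ?_))
    rw [ofReal_two_rpow, add_mul, pow_add]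
    ring
  unfold chemin
  calc _ ≤ 2 * C * wChemin θ (m + 2) Y + 2 * C * geomC (m / 2) * wChemin θ (m + 2) Y :=
        add_le_add h1 h2
    _ ≤ 2 * C * geomC (m / 2) * wChemin θ (m + 2) Y + 2 * C * geomC (m / 2) * wChemin θ (m + 2) Y := by
        refine add_le_add ?_ le_rfl
        exact mul_le_mul_left (le_mul_of_one_le_right' (one_le_geomC _)) _
    _ = _ := by ring

end Besov

/-! ### States in the Fourier picture and the energy norms -/

/-- The square integrable functions `a, b, c` are the Fourier transforms of the components
`u, v, w` of the state `U`, and `Z` is the triple `(|D|(u + τv), (1+|D|²)^{1/2} v, v + τw)^`, where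
`|D|` has the symbol `rad`. The sums `∑ₖ 2^{(s+1)k} ‖Pₖ Z‖` are equivalent to the energy norms of
order `s` of `U`. -/
structure Rep (τ : ℝ) (U : State) (Z : L2 (Cn 3)) (a b c : L2 ℂ) : Prop where
  hu : cu U = invF a
  hv : cv U = invF b
  hw : cw U = invF c
  ae : ∀ᵐ ξ, Z ξ 0 = rad ξ * (a ξ + τ * b ξ) ∧ Z ξ 1 = brk ξ * b ξ ∧ Z ξ 2 = b ξ + τ * c ξ

lemma hat_add_smul (τ : ℝ) (a b : L2 ℂ) :
    Hat (invF a + (τ : ℂ) • invF b) fun ξ => a ξ + τ * b ξ := by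
  rw [← map_smul, ← map_add]
  refine (hat_invF _).congr ?_
  filter_upwards [Lp.coeFn_add a ((τ : ℂ) • b), Lp.coeFn_smul (τ : ℂ) b] with ξ h1 h2
  rw [h1, Pi.add_apply, h2, Pi.smul_apply, smul_eq_mul]

section Rep

variable {τ : ℝ} {U : State} {Z : L2 (Cn 3)} {a b c : L2 ℂ}

lemma Rep.hat_uv (h : Rep τ U Z a b c) : Hat (uv τ U) fun ξ => a ξ + τ * b ξ := by
  rw [uv, h.hu, h.hv]; exact hat_add_smul τ a b

lemma Rep.hat_vw (h : Rep τ U Z a b c) : Hat (vw τ U) fun ξ => b ξ + τ * c ξ := by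
  rw [vw, h.hv, h.hw]; exact hat_add_smul τ b c

lemma Rep.hat_v (h : Rep τ U Z a b c) : Hat (cv U) b := by
  rw [h.hv]; exact hat_invF b

lemma Rep.hat_w (h : Rep τ U Z a b c) : Hat (cw U) c := by
  rw [h.hw]; exact hat_invF c

/-- `Rep` is linear in all arguments. -/
lemma Rep.sub {U' : State} {Z' : L2 (Cn 3)} {a' b' c' : L2 ℂ} (h : Rep τ U Z a b c)
    (h' : Rep τ U' Z' a' b' c') : Rep τ (U - U') (Z - Z') (a - a') (b - b') (c - c') := by
  refine ⟨?_, ?_, ?_, ?_⟩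
  · rw [map_sub, ← h.hu, ← h'.hu]; rfl
  · rw [map_sub, ← h.hv, ← h'.hv]; rfl
  · rw [map_sub, ← h.hw, ← h'.hw]; rfl
  · filter_upwards [h.ae, h'.ae, Lp.coeFn_sub Z Z', Lp.coeFn_sub a a', Lp.coeFn_sub b b',
      Lp.coeFn_sub c c'] with ξ h1 h2 h3 h4 h5 h6
    rw [h3, h4, h5, h6]
    simp only [Pi.sub_apply, PiLp.sub_apply]
    rw [h1.1, h1.2.1, h1.2.2, h2.1, h2.2.1, h2.2.2]
    refine ⟨?_, ?_, ?_⟩ <;> ring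

lemma Rep.smul (h : Rep τ U Z a b c) (s : ℂ) : Rep τ (s • U) (s • Z) (s • a) (s • b) (s • c) := by
  refine ⟨?_, ?_, ?_, ?_⟩
  · rw [map_smul, ← h.hu]; rfl
  · rw [map_smul, ← h.hv]; rfl
  · rw [map_smul, ← h.hw]; rfl
  · filter_upwards [h.ae, Lp.coeFn_smul s Z, Lp.coeFn_smul s a, Lp.coeFn_smul s b,
      Lp.coeFn_smul s c] with ξ h1 h3 h4 h5 h6
    rw [h3, h4, h5, h6]
    simp only [Pi.smul_apply, PiLp.smul_apply, smul_eq_mul]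
    rw [h1.1, h1.2.1, h1.2.2]
    refine ⟨?_, ?_, ?_⟩ <;> ring

lemma Rep.norms (h : Rep τ U Z a b c) : ∀ᵐ ξ, rad ξ * ‖a ξ + τ * b ξ‖ = ‖Z ξ 0‖ ∧
    brk ξ * ‖b ξ‖ = ‖Z ξ 1‖ ∧ ‖b ξ + τ * c ξ‖ = ‖Z ξ 2‖ ∧
    ‖τ‖ * ‖c ξ‖ = ‖Z ξ 2 - kap ξ * Z ξ 1‖ := by
  filter_upwards [h.ae] with ξ h
  rw [h.1, h.2.1, h.2.2]
  refine ⟨?_, ?_, rfl, ?_⟩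
  · rw [norm_mul, Complex.norm_real, Real.norm_of_nonneg (rad_nonneg ξ)]
  · rw [norm_mul, Complex.norm_real, Real.norm_of_nonneg (brk_pos ξ).le]
  · have : b ξ + τ * c ξ - kap ξ * (brk ξ * b ξ) = τ * c ξ := by
      have : (brk ξ : ℂ) ≠ 0 := by exact_mod_cast (brk_pos ξ).ne'
      rw [kap]; push_cast; field_simp; ring
    rw [this, norm_mul, Complex.norm_real]

end Rep

section Dom

variable {V : Type*} [NormedAddCommGroup V] [NormedSpace ℂ V] {F : TDist} {h : E3 → ℂ} {Y : L2 V}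
  {C : ℝ≥0}

lemma Dom.single (hF : Hat F h) (e : ∀ᵐ ξ, ‖h ξ‖ ≤ C * brk ξ * ‖Y ξ‖) : Dom ![F] Y C := by
  refine ⟨![h], fun i => by fin_cases i; exact hF, ?_⟩
  filter_upwards [e] with ξ e
  simpa using pow_le_pow_left₀ (norm_nonneg _) e 2

lemma Dom.laplacian (hF : Hat F h) (e : ∀ᵐ ξ, rad ξ ^ 2 * ‖h ξ‖ ≤ C * brk ξ * ‖Y ξ‖) :
    Dom ![Δ F] Y C := by
  refine Dom.single hF.laplacian ?_
  filter_upwards [e] with ξ e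
  rwa [norm_neg, norm_mul, norm_pow, Complex.norm_real, Real.norm_of_nonneg (rad_nonneg ξ)]

lemma sum_norm_sq_grad (ξ : E3) (z : ℂ) :
    ∑ j, ‖2 * Real.pi * Complex.I * (ξ j : ℂ) * z‖ ^ 2 = (rad ξ * ‖z‖) ^ 2 := by
  simp only [norm_mul, mul_pow, ← Finset.sum_mul, ← Finset.mul_sum, rad_eq,
    EuclideanSpace.norm_sq_eq ξ]
  simp [abs_of_pos Real.pi_pos]

lemma Dom.grad (hF : Hat F h) (e : ∀ᵐ ξ, rad ξ * ‖h ξ‖ ≤ C * brk ξ * ‖Y ξ‖) :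
    Dom (grad F) Y C := by
  refine ⟨_, fun j => hF.grad j, ?_⟩
  filter_upwards [e] with ξ e
  rw [sum_norm_sq_grad]
  exact pow_le_pow_left₀ (by have := rad_nonneg ξ; positivity) e 2

end Dom

/-- The constant in the bounds of the energy by the Fourier picture of a state. -/
def domC (τ : ℝ) : ℝ≥0 := 1 + 2 * ‖τ‖₊⁻¹

lemma coe_domC (τ : ℝ) : (domC τ : ℝ) = 1 + 2 * ‖τ‖⁻¹ := by simp [domC]

lemma le_domC_mul (τ : ℝ) {x b y : ℝ} (h : x ≤ b * y) (hb : 0 ≤ b) (hy : 0 ≤ y) :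
    x ≤ domC τ * b * y := by
  rw [mul_assoc]
  refine h.trans (le_mul_of_one_le_left (mul_nonneg hb hy) ?_)
  rw [coe_domC]
  have : 0 ≤ ‖τ‖⁻¹ := by positivity
  linarith

lemma le_domC_mul' {τ : ℝ} (hτ : τ ≠ 0) {x b y : ℝ} (h : ‖τ‖ * x ≤ 2 * (b * y)) (hb : 0 ≤ b) (hy : 0 ≤ y) :
    x ≤ domC τ * b * y := by
  have h1 : 0 < ‖τ‖ := norm_pos_iff.2 hτ
  have h2 : x ≤ ‖τ‖⁻¹ * (2 * (b * y)) := by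
    rwa [← div_eq_inv_mul, le_div_iff₀ h1, mul_comm]
  have h3 := mul_nonneg hb hy
  rw [coe_domC]
  nlinarith

section Upper

variable {τ : ℝ} {U : State} {Z : L2 (Cn 3)} {a b c : L2 ℂ}

/-- The seven functions in the energy are dominated by `Z`. -/
lemma Rep.doms (hτ : τ ≠ 0) (h : Rep τ U Z a b c) :
    Dom ![vw τ U] Z (domC τ) ∧ Dom (grad (vw τ U)) Z (domC τ) ∧ Dom ![Δ (cv U)] Z (domC τ) ∧
    Dom (grad (cv U)) Z (domC τ) ∧ Dom ![Δ (uv τ U)] Z (domC τ) ∧ Dom (grad (uv τ U)) Z (domC τ) ∧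
    Dom ![cw U] Z (domC τ) := by
  have key : ∀ᵐ ξ, rad ξ * ‖a ξ + τ * b ξ‖ ≤ ‖Z ξ‖ ∧ brk ξ * ‖b ξ‖ ≤ ‖Z ξ‖ ∧
      ‖b ξ + τ * c ξ‖ ≤ ‖Z ξ‖ ∧ ‖τ‖ * ‖c ξ‖ ≤ 2 * ‖Z ξ‖ := by
    filter_upwards [h.norms] with ξ h
    have hz := PiLp.norm_apply_le (Z ξ)
    rw [h.1, h.2.1, h.2.2.1, h.2.2.2]
    refine ⟨hz 0, hz 1, hz 2, (norm_sub_le _ _).trans ?_⟩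
    have : ‖(kap ξ : ℂ) * Z ξ 1‖ ≤ 1 * ‖Z ξ‖ := by
      rw [norm_mul]
      exact mul_le_mul (norm_kap_le ξ) (hz 1) (norm_nonneg _) zero_le_one
    linarith [hz 2]
  refine ⟨Dom.single h.hat_vw ?_, Dom.grad h.hat_vw ?_, Dom.laplacian h.hat_v ?_,
    Dom.grad h.hat_v ?_, Dom.laplacian h.hat_uv ?_, Dom.grad h.hat_uv ?_, Dom.single h.hat_w ?_⟩
  all_goals
    filter_upwards [key] with ξ k
    have hb := one_le_brk ξ
    have hrb := rad_le_brk ξ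
    have hr := rad_nonneg ξ
    have hn := norm_nonneg (Z ξ)
    have hbn : ‖Z ξ‖ ≤ brk ξ * ‖Z ξ‖ := le_mul_of_one_le_left hn hb
  · refine le_domC_mul τ ?_ (brk_pos ξ).le hn
    linarith
  · refine le_domC_mul τ ?_ (brk_pos ξ).le hn
    exact mul_le_mul hrb k.2.2.1 (norm_nonneg _) (by linarith)
  · refine le_domC_mul τ ?_ (brk_pos ξ).le hn
    calc _ ≤ brk ξ * (brk ξ * ‖b ξ‖) := by
          rw [← mul_assoc, ← sq]; gcongr
      _ ≤ _ := by have := k.2.1; gcongr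
  · refine le_domC_mul τ ?_ (brk_pos ξ).le hn
    refine le_trans ?_ (k.2.1.trans hbn)
    gcongr
  · refine le_domC_mul τ ?_ (brk_pos ξ).le hn
    calc _ = rad ξ * (rad ξ * ‖a ξ + τ * b ξ‖) := by ring
      _ ≤ _ := mul_le_mul hrb k.1 (by positivity) (by linarith)
  · refine le_domC_mul τ ?_ (brk_pos ξ).le hn
    linarith
  · refine le_domC_mul' hτ ?_ (brk_pos ξ).le hn
    linarith

/-- The five functions in the dissipation are dominated by the dissipated part of `Z`. -/
lemma Rep.doms_diss (hτ : τ ≠ 0) (h : Rep τ U Z a b c) :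
    Dom (grad (cv U)) (mulOp dissSym Z) (domC τ) ∧ Dom ![Δ (cv U)] (mulOp dissSym Z) (domC τ) ∧
    Dom ![cw U] (mulOp dissSym Z) (domC τ) ∧ Dom ![Δ (uv τ U)] (mulOp dissSym Z) (domC τ) ∧
    Dom (grad (vw τ U)) (mulOp dissSym Z) (domC τ) := by
  have key : ∀ᵐ ξ, rad ξ * (rad ξ * ‖a ξ + τ * b ξ‖) ≤ brk ξ * ‖mulOp dissSym Z ξ‖ ∧
      rad ξ * ‖b ξ‖ ≤ ‖mulOp dissSym Z ξ‖ ∧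
      rad ξ * ‖b ξ + τ * c ξ‖ ≤ brk ξ * ‖mulOp dissSym Z ξ‖ ∧
      ‖τ‖ * ‖c ξ‖ ≤ brk ξ * ‖mulOp dissSym Z ξ‖ := by
    filter_upwards [h.norms, mulOp_ae isSymbol_dissSym Z] with ξ h hd
    obtain ⟨d0, d1, d2, d3⟩ := norm_dissSym_ge ξ (Z ξ)
    rw [← hd] at d0 d1 d2 d3
    have hb := brk_pos ξ
    have e : rad ξ = brk ξ * rho ξ := by unfold rho; field_simp
    have e' : brk ξ * kap ξ = 1 := mul_inv_cancel₀ hb.ne'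
    refine ⟨?_, ?_, ?_, ?_⟩
    · rw [h.1, e, mul_assoc]; gcongr
    · rw [e, mul_right_comm, h.2.1, mul_comm]; exact d1
    · rw [h.2.2.1, e, mul_assoc]; gcongr
    · rw [h.2.2.2]
      calc _ = brk ξ * (kap ξ * ‖Z ξ 2 - kap ξ * Z ξ 1‖) := by rw [← mul_assoc, e', one_mul]
        _ ≤ _ := by gcongr
  refine ⟨Dom.grad h.hat_v ?_, Dom.laplacian h.hat_v ?_, Dom.single h.hat_w ?_,
    Dom.laplacian h.hat_uv ?_, Dom.grad h.hat_vw ?_⟩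
  all_goals
    filter_upwards [key] with ξ k
    have hb := one_le_brk ξ
    have hrb := rad_le_brk ξ
    have hr := rad_nonneg ξ
    have hn := norm_nonneg (mulOp dissSym Z ξ)
    have hbn : ‖mulOp dissSym Z ξ‖ ≤ brk ξ * ‖mulOp dissSym Z ξ‖ := le_mul_of_one_le_left hn hb
  · refine le_domC_mul τ ?_ (brk_pos ξ).le hn
    linarith
  · refine le_domC_mul τ ?_ (brk_pos ξ).le hn
    calc _ = rad ξ * (rad ξ * ‖b ξ‖) := by ring
      _ ≤ _ := mul_le_mul hrb k.2.1 (by positivity) (by linarith)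
  · refine le_domC_mul' hτ ?_ (brk_pos ξ).le hn
    linarith [mul_nonneg (by linarith : 0 ≤ brk ξ) hn]
  · refine le_domC_mul τ ?_ (brk_pos ξ).le hn
    calc _ = rad ξ * (rad ξ * ‖a ξ + τ * b ξ‖) := by ring
      _ ≤ _ := k.1
  · exact le_domC_mul τ k.2.2.1 (brk_pos ξ).le hn

lemma sqrt_sum_seven_le {x a₁ a₂ a₃ a₄ a₅ a₆ a₇ : ℝ≥0∞} (h₁ : a₁ ≤ x) (h₂ : a₂ ≤ x) (h₃ : a₃ ≤ x)
    (h₄ : a₄ ≤ x) (h₅ : a₅ ≤ x) (h₆ : a₆ ≤ x) (h₇ : a₇ ≤ x) :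
    (a₁ ^ 2 + a₂ ^ 2 + a₃ ^ 2 + a₄ ^ 2 + a₅ ^ 2 + a₆ ^ 2 + a₇ ^ 2) ^ (1 / 2 : ℝ) ≤ 7 * x := by
  refine sqrt_le_of_sq_le ?_
  calc _ ≤ x ^ 2 + x ^ 2 + x ^ 2 + x ^ 2 + x ^ 2 + x ^ 2 + x ^ 2 := by gcongr
    _ = 7 * x ^ 2 := by ring
    _ ≤ 49 * x ^ 2 := by gcongr; norm_num
    _ = _ := by ring

/-- The constant in the bounds of the energy norms of order `m/2`. -/
def upC (τ : ℝ) (m : ℕ) : ℝ≥0∞ := 28 * domC τ * geomC (m / 2)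

lemma upC_ne_top (τ : ℝ) {m : ℕ} (hm : 0 < m) : upC τ m ≠ ∞ := by
  have := geomC_ne_top (s := (m : ℝ) / 2) (by positivity)
  unfold upC
  finiteness

/-- The energy norm is bounded by the norm of the Fourier picture; `Rep.wNorm_le` is the converse. -/
lemma Rep.energy_le {φ χ : E3 → ℝ} (hLP : IsLittlewoodPaley φ χ) (hτ : τ ≠ 0) (h : Rep τ U Z a b c)
    (m : ℕ) : energy φ τ (m / 2) U ≤ upC τ m * wNorm (m + 2) Z := by
  obtain ⟨h1, h2, h3, h4, h5, h6, h7⟩ := h.doms hτ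
  have e1 : energyL2 τ U ≤ 7 * (2 * domC τ * wNorm (m + 2) Z) :=
    sqrt_sum_seven_le (h1.l2Vec_le_wNorm m) (h2.l2Vec_le_wNorm m) (h3.l2Vec_le_wNorm m)
      (h4.l2Vec_le_wNorm m) (h5.l2Vec_le_wNorm m) (h6.l2Vec_le_wNorm m) (h7.l2Vec_le_wNorm m)
  have e2 : energyHom φ τ (m / 2) U ≤ 7 * (2 * domC τ * geomC (m / 2) * wNorm (m + 2) Z) :=
    sqrt_sum_seven_le (h1.homBesov_le hLP m) (h2.homBesov_le hLP m) (h3.homBesov_le hLP m)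
      (h4.homBesov_le hLP m) (h5.homBesov_le hLP m) (h6.homBesov_le hLP m) (h7.homBesov_le hLP m)
  have e3 : 2 * domC τ * wNorm (m + 2) Z ≤ 2 * domC τ * geomC (m / 2) * wNorm (m + 2) Z :=
    mul_le_mul_left (le_mul_of_one_le_right' (one_le_geomC _)) _
  calc _ ≤ 7 * (2 * domC τ * geomC (m / 2) * wNorm (m + 2) Z) +
        7 * (2 * domC τ * geomC (m / 2) * wNorm (m + 2) Z) :=
        add_le_add (e1.trans (mul_le_mul_right e3 _)) e2
    _ = _ := by rw [upC]; ring

lemma energyChemin_le {φ χ : E3 → ℝ} (hLP : IsLittlewoodPaley φ χ) (hτ : τ ≠ 0) {U : ℝ → State}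
    {Z : ℝ → L2 (Cn 3)} (hZ : Continuous Z) {a b c : ℝ → L2 ℂ}
    (h : ∀ t, 0 ≤ t → Rep τ (U t) (Z t) (a t) (b t) (c t)) (T : ℝ≥0∞) (m : ℕ) :
    energyChemin φ τ T (m / 2) U ≤ upC τ m * wChemin ∞ (m + 2) Z := by
  have key : ∀ {ι : Type} [Fintype ι] {F : ℝ → ι → TDist}, (∀ t, 0 ≤ t → Dom (F t) (Z t) (domC τ)) →
      chemin φ ∞ T (m / 2) F ≤ 4 * domC τ * geomC (m / 2) * wChemin ∞ (m + 2) Z :=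
    fun hF => chemin_le hLP (Or.inr rfl) T hZ hF m
  have e : upC τ m * wChemin ∞ (m + 2) Z =
      let x := 4 * domC τ * geomC (m / 2) * wChemin ∞ (m + 2) Z; x + x + x + x + x + x + x := by
    simp only [upC]; ring
  rw [e]
  have hd := fun t ht => (h t ht).doms hτ
  exact add_le_add (add_le_add (add_le_add (add_le_add (add_le_add (add_le_add
    (key fun t ht => (hd t ht).1) (key fun t ht => (hd t ht).2.1))
    (key fun t ht => (hd t ht).2.2.1)) (key fun t ht => (hd t ht).2.2.2.1))
    (key fun t ht => (hd t ht).2.2.2.2.1)) (key fun t ht => (hd t ht).2.2.2.2.2.1))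
    (key fun t ht => (hd t ht).2.2.2.2.2.2)

lemma dissipationChemin_le {φ χ : E3 → ℝ} (hLP : IsLittlewoodPaley φ χ) (hτ : τ ≠ 0) {U : ℝ → State}
    {Z : ℝ → L2 (Cn 3)} (hZ : Continuous Z) {a b c : ℝ → L2 ℂ}
    (h : ∀ t, 0 ≤ t → Rep τ (U t) (Z t) (a t) (b t) (c t)) (T : ℝ≥0∞) (m : ℕ) :
    dissipationChemin φ τ T (m / 2) U ≤ upC τ m * wChemin 2 (m + 2) (fun t => mulOp dissSym (Z t)) := by
  have key : ∀ {ι : Type} [Fintype ι] {F : ℝ → ι → TDist},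
      (∀ t, 0 ≤ t → Dom (F t) (mulOp dissSym (Z t)) (domC τ)) → chemin φ 2 T (m / 2) F ≤
        4 * domC τ * geomC (m / 2) * wChemin 2 (m + 2) (fun t => mulOp dissSym (Z t)) :=
    fun hF => chemin_le hLP (Or.inl rfl) T ((mulOp dissSym).continuous.comp hZ) hF m
  have e : let x := 4 * domC τ * geomC (m / 2) * wChemin 2 (m + 2) (fun t => mulOp dissSym (Z t))
      x + x + x + x + x ≤ upC τ m * wChemin 2 (m + 2) (fun t => mulOp dissSym (Z t)) := by
    refine le_trans (b := upC τ m * wChemin 2 (m + 2) (fun t => mulOp dissSym (Z t)) * (20 / 28)) ?_ ?_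
    · refine le_of_eq ?_
      have : (28 : ℝ≥0∞) * (20 / 28) = 20 := ENNReal.mul_div_cancel (by norm_num) (by norm_num)
      calc _ = 20 * (domC τ * geomC (m / 2) * wChemin 2 (m + 2) (fun t => mulOp dissSym (Z t))) := by
            ring
        _ = (28 : ℝ≥0∞) * (20 / 28) * (domC τ * geomC (m / 2) *
            wChemin 2 (m + 2) (fun t => mulOp dissSym (Z t))) := by rw [this]
        _ = _ := by rw [upC]; ring
    · refine mul_le_of_le_one_right' (ENNReal.div_le_of_le_mul (by norm_num))
  refine le_trans ?_ e
  have hd := fun t ht => (h t ht).doms_diss hτ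
  exact add_le_add (add_le_add (add_le_add (add_le_add
    (key fun t ht => (hd t ht).1) (key fun t ht => (hd t ht).2.1))
    (key fun t ht => (hd t ht).2.2.1)) (key fun t ht => (hd t ht).2.2.2.1))
    (key fun t ht => (hd t ht).2.2.2.2)

end Upper

/-! ### Lower bounds of the energy norms -/

section Lower

variable {φ χ : E3 → ℝ} {ι : Type} [Fintype ι]

/-- The Euclidean length of the values of a finite family of functions. -/
def vecLen (h : ι → E3 → ℂ) (ξ : E3) : ℝ≥0∞ := (∑ i, ‖h i ξ‖ₑ ^ 2) ^ (1 / 2 : ℝ)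

/-- On the sharp block `k + 1` the Littlewood-Paley sum has only the three terms of order `k + 1`, `k`
and `k - 1`. -/
lemma sum_three_phiq (hLP : IsLittlewoodPaley φ χ) {k : ℕ} {ξ : E3} (h : ξ ∈ blk (k + 1)) :
    ∑ i ∈ Finset.range 3, phiq φ ((k : ℤ) + 1 - i) ξ = 1 := by
  have h1 := h.1
  have h2 := h.2 (by omega)
  have hk : (0 : ℝ) < 2 ^ (k + 1) := by positivity
  have h0 : ξ ≠ 0 := by
    rintro rfl
    rw [rad_eq, norm_zero] at h2
    linarith
  have hinj : Set.InjOn (fun i : ℕ => (k : ℤ) + 1 - i) (Finset.range 3) := fun i _ j _ e => by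
    simpa using e
  have e : ∑ q ∈ (Finset.range 3).image (fun i : ℕ => (k : ℤ) + 1 - i), phiq φ q ξ = 1 := by
    refine (hasSum_sum_of_ne_finset_zero fun q hq => ?_).unique (sum_phiq hLP h0)
    by_contra hne
    obtain ⟨h3, h4⟩ := supp_phiq hLP hne
    apply hq
    have hq1 : q ≤ k + 1 := by
      by_contra h6
      have h7 : (2 : ℝ) ^ (((k + 1 : ℕ) : ℤ) + 1) ≤ 2 ^ q :=
        zpow_le_zpow_right₀ (by norm_num) (by push_cast; omega)
      rw [zpow_add₀ (by norm_num), zpow_one, zpow_natCast] at h7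
      linarith
    have hq2 : (k : ℤ) - 1 ≤ q := by
      by_contra h6
      have h7 : (2 : ℝ) ^ (q + 3) ≤ 2 ^ ((k + 1 : ℕ) : ℤ) :=
        zpow_le_zpow_right₀ (by norm_num) (by push_cast; omega)
      rw [zpow_add₀ (by norm_num), zpow_natCast] at h7
      norm_num at h7
      linarith
    simp only [Finset.mem_image, Finset.mem_range]
    exact ⟨(k + 1 - q).toNat, by omega, by omega⟩
  rwa [Finset.sum_image hinj] at e

lemma vecLen_mul (c : ℂ) (h : ι → E3 → ℂ) (ξ : E3) :
    (∑ i, ‖c * h i ξ‖ₑ ^ 2) ^ (1 / 2 : ℝ) = ‖c‖ₑ * vecLen h ξ := by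
  simp only [enorm_mul, mul_pow, ← Finset.mul_sum, vecLen]
  rw [ENNReal.mul_rpow_of_nonneg _ _ (by norm_num), sqrt_sq_ennreal]

lemma aemeasurable_vecLen {F : ι → TDist} {h : ι → E3 → ℂ} (hF : ∀ i, Hat (F i) (h i)) :
    AEMeasurable (vecLen h) volume :=
  (Finset.aemeasurable_fun_sum _ fun i _ =>
    ((hF i).aestronglyMeasurable.enorm).pow_const 2).pow_const _

lemma sqNorm_blk_le (hLP : IsLittlewoodPaley φ χ) {F : ι → TDist} {h : ι → E3 → ℂ}
    (hF : ∀ i, Hat (F i) (h i)) (k : ℕ) :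
    sqNorm volume (fun ξ => ‖chi (k + 1) ξ‖ₑ * vecLen h ξ) ≤
      ∑ i ∈ Finset.range 3, l2Vec (fun j => block φ ((k : ℤ) + 1 - i) (F j)) := by
  have e : ∀ q : ℤ, l2Vec (fun j => block φ q (F j)) =
      sqNorm volume fun ξ => ‖(phiq φ q ξ : ℂ)‖ₑ * vecLen h ξ := by
    intro q
    rw [l2Vec_eq fun i => (hF i).block hLP q]
    simp only [vecLen_mul]
  simp only [e]
  refine le_trans (sqNorm_mono (Eventually.of_forall fun ξ => ?_)) (sqNorm_sum_le _ fun i => ?_)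
  · by_cases hk : ξ ∈ blk (k + 1)
    · rw [chi_of_mem hk, ← Finset.sum_mul]
      gcongr
      calc ‖(1 : ℂ)‖ₑ = ‖∑ i ∈ Finset.range 3, (phiq φ ((k : ℤ) + 1 - i) ξ : ℂ)‖ₑ := by
            rw [← Complex.ofReal_sum, sum_three_phiq hLP hk, Complex.ofReal_one]
        _ ≤ _ := enorm_sum_le _ _
    · simp [chi_of_notMem hk]
  · exact (hasTemperateGrowth_phiq hLP _).1.continuous.enorm.aemeasurable.mul (aemeasurable_vecLen hF)

lemma sq2_pow_le (m k : ℕ) {i : ℕ} (hi : i < 3) :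
    sq2 ^ (m * (k + 1)) ≤
      sq2 ^ (m * 2) * ENNReal.ofReal ((2 : ℝ) ^ ((((k : ℤ) + 1 - i : ℤ) : ℝ) * (m / 2))) := by
  rw [← ofReal_two_rpow, ← ofReal_two_rpow, ← ENNReal.ofReal_mul (by positivity),
    ← Real.rpow_add (by norm_num)]
  refine ENNReal.ofReal_le_ofReal (Real.rpow_le_rpow_of_exponent_le (by norm_num) ?_)
  rw [← add_mul]
  gcongr
  have : (i : ℝ) ≤ 2 := by exact_mod_cast Nat.le_of_lt_succ hi
  push_cast
  linarith

lemma tsum_sqNorm_blk_le (hLP : IsLittlewoodPaley φ χ) {F : ι → TDist} {h : ι → E3 → ℂ}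
    (hF : ∀ i, Hat (F i) (h i)) (m : ℕ) :
    ∑' k : ℕ, sq2 ^ (m * (k + 1)) * sqNorm volume (fun ξ => ‖chi (k + 1) ξ‖ₑ * vecLen h ξ) ≤
      3 * sq2 ^ (m * 2) * homBesov φ (m / 2) F := by
  have e : ∀ k : ℕ, sq2 ^ (m * (k + 1)) * sqNorm volume (fun ξ => ‖chi (k + 1) ξ‖ₑ * vecLen h ξ) ≤
      ∑ i ∈ Finset.range 3, sq2 ^ (m * 2) *
        (ENNReal.ofReal ((2 : ℝ) ^ ((((k : ℤ) + 1 - i : ℤ) : ℝ) * (m / 2))) *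
          l2Vec (fun j => block φ ((k : ℤ) + 1 - i) (F j))) := by
    intro k
    refine (mul_le_mul_right (sqNorm_blk_le hLP hF k) _).trans ?_
    rw [Finset.mul_sum]
    refine Finset.sum_le_sum fun i hi => ?_
    rw [← mul_assoc]
    exact mul_le_mul_left (sq2_pow_le m k (Finset.mem_range.1 hi)) _
  refine (ENNReal.tsum_le_tsum e).trans ?_
  rw [Summable.tsum_finsetSum fun i _ => ENNReal.summable]
  have e2 : ∀ i ∈ Finset.range 3, ∑' k : ℕ, sq2 ^ (m * 2) *
        (ENNReal.ofReal ((2 : ℝ) ^ ((((k : ℤ) + 1 - i : ℤ) : ℝ) * (m / 2))) *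
          l2Vec (fun j => block φ ((k : ℤ) + 1 - i) (F j))) ≤ sq2 ^ (m * 2) * homBesov φ (m / 2) F := by
    intro i _
    rw [ENNReal.tsum_mul_left]
    refine mul_le_mul_right ?_ _
    have hinj : Function.Injective fun k : ℕ => (k : ℤ) + 1 - i := fun a b e => by
      simpa using e
    exact ENNReal.tsum_comp_le_tsum_of_injective hinj
      fun q : ℤ => ENNReal.ofReal ((2 : ℝ) ^ ((q : ℝ) * (m / 2))) * l2Vec (fun j => block φ q (F j))
  refine (Finset.sum_le_sum e2).trans (le_of_eq ?_)
  simp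
  ring

end Lower

lemma ofReal_mul_norm {r : ℝ} (hr : 0 ≤ r) (z : ℂ) : ‖(r : ℂ) * z‖ₑ = ENNReal.ofReal (r * ‖z‖) := by
  rw [← ofReal_norm, norm_mul, Complex.norm_real, Real.norm_of_nonneg hr]

lemma vecLen_single (h : E3 → ℂ) (ξ : E3) : vecLen ![h] ξ = ENNReal.ofReal ‖h ξ‖ := by
  rw [vecLen, Fintype.sum_unique, sqrt_sq_ennreal, ofReal_norm]
  rfl

lemma vecLen_laplacian (h : E3 → ℂ) (ξ : E3) :
    vecLen ![fun ξ => -((rad ξ : ℂ) ^ 2 * h ξ)] ξ = ENNReal.ofReal (rad ξ ^ 2 * ‖h ξ‖) := by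
  rw [vecLen_single, norm_neg, norm_mul, norm_pow, Complex.norm_real,
    Real.norm_of_nonneg (rad_nonneg ξ)]

lemma vecLen_grad (h : E3 → ℂ) (ξ : E3) :
    vecLen (fun (j : Fin 3) ξ => 2 * Real.pi * Complex.I * (ξ j : ℂ) * h ξ) ξ =
      ENNReal.ofReal (rad ξ * ‖h ξ‖) := by
  have e : ∑ j : Fin 3, ‖2 * Real.pi * Complex.I * (ξ j : ℂ) * h ξ‖ₑ ^ 2 =
      ENNReal.ofReal (rad ξ * ‖h ξ‖) ^ 2 := by
    rw [← ENNReal.ofReal_pow (mul_nonneg (rad_nonneg ξ) (norm_nonneg _)), ← sum_norm_sq_grad,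
      ENNReal.ofReal_sum_of_nonneg fun i _ => by positivity]
    refine Finset.sum_congr rfl fun i _ => ?_
    rw [ENNReal.ofReal_pow (norm_nonneg _), ofReal_norm]
  rw [vecLen, e, sqrt_sq_ennreal]

lemma norm_le_sum_three (z : Cn 3) : ‖z‖ ≤ ‖z 0‖ + ‖z 1‖ + ‖z 2‖ := by
  refine abs_le_of_sq_le_sq' ?_ (by positivity) |>.2
  rw [EuclideanSpace.norm_sq_eq, Fin.sum_univ_three]
  nlinarith [norm_nonneg (z 0), norm_nonneg (z 1), norm_nonneg (z 2),
    mul_nonneg (norm_nonneg (z 0)) (norm_nonneg (z 1)), mul_nonneg (norm_nonneg (z 0)) (norm_nonneg (z 2)),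
    mul_nonneg (norm_nonneg (z 1)) (norm_nonneg (z 2))]

lemma sqNorm_three_le {α : Type*} [MeasurableSpace α] {μ : Measure α} {f g h : α → ℝ≥0∞}
    (hf : AEMeasurable f μ) (hg : AEMeasurable g μ) (hh : AEMeasurable h μ) {K : ℝ≥0∞} (hK : K ≠ ∞) :
    sqNorm μ (fun x => K * (f x + g x + h x)) ≤ K * (sqNorm μ f + sqNorm μ g + sqNorm μ h) := by
  rw [sqNorm_const_mul hK]
  gcongr
  exact (sqNorm_add_le (hf.add hg) hh).trans (add_le_add_left (sqNorm_add_le hf hg) _)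

/-- The constant in the bounds of the Fourier picture of a state by its energy. -/
def lowK (τ : ℝ) : ℝ≥0 := 4 + 2 * ‖τ‖₊

lemma ofReal_lowK_mul (τ : ℝ) {x y z : ℝ} (hx : 0 ≤ x) (hy : 0 ≤ y) (hz : 0 ≤ z) :
    ENNReal.ofReal (lowK τ * (x + y + z)) =
      lowK τ * (ENNReal.ofReal x + ENNReal.ofReal y + ENNReal.ofReal z) := by
  rw [ENNReal.ofReal_mul (NNReal.coe_nonneg _), ENNReal.ofReal_add (by positivity) hz,
    ENNReal.ofReal_add hx hy, ENNReal.ofReal_coe_nnreal]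

section Lower

variable {φ χ : E3 → ℝ} {τ : ℝ} {U : State} {Z : L2 (Cn 3)} {a b c : L2 ℂ}

lemma le_sqrt_sum_seven {a₁ a₂ a₃ a₄ a₅ a₆ a₇ : ℝ≥0∞} (x : ℝ≥0∞) (hx : x = a₁ ∨ x = a₂ ∨ x = a₃ ∨ x = a₄ ∨ x = a₅ ∨ x = a₆ ∨ x = a₇) :
    x ≤ (a₁ ^ 2 + a₂ ^ 2 + a₃ ^ 2 + a₄ ^ 2 + a₅ ^ 2 + a₆ ^ 2 + a₇ ^ 2) ^ (1 / 2 : ℝ) := by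
  rw [← sqrt_sq_ennreal x]
  refine ENNReal.rpow_le_rpow ?_ (by norm_num)
  have h : ∀ p q : ℝ≥0∞, p ≤ p + q ∧ q ≤ p + q := fun p q => ⟨le_self_add, le_add_self⟩
  rcases hx with rfl | rfl | rfl | rfl | rfl | rfl | rfl
  · exact (((((h _ _).1.trans (h _ _).1).trans (h _ _).1).trans (h _ _).1).trans (h _ _).1).trans (h _ _).1
  · exact (((((h _ _).2.trans (h _ _).1).trans (h _ _).1).trans (h _ _).1).trans (h _ _).1).trans (h _ _).1
  · exact ((((h _ _).2.trans (h _ _).1).trans (h _ _).1).trans (h _ _).1).trans (h _ _).1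
  · exact (((h _ _).2.trans (h _ _).1).trans (h _ _).1).trans (h _ _).1
  · exact ((h _ _).2.trans (h _ _).1).trans (h _ _).1
  · exact (h _ _).2.trans (h _ _).1
  · exact (h _ _).2

lemma Rep.enorm_proj_zero_le (h : Rep τ U Z a b c) :
    ‖proj 0 Z‖ₑ ≤ lowK τ * (l2Vec (JMGT.grad (uv τ U)) + l2Vec ![vw τ U] + l2Vec ![cw U]) := by
  have h1 := fun j => h.hat_uv.grad j
  have h2 : ∀ i : Fin 1, Hat (![vw τ U] i) (![fun ξ => b ξ + τ * c ξ] i) := fun i => by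
    fin_cases i; exact h.hat_vw
  have h3 : ∀ i : Fin 1, Hat (![cw U] i) ((![c] : Fin 1 → E3 → ℂ) i) := fun i => by
    fin_cases i; exact h.hat_w
  rw [l2Vec_eq h1, l2Vec_eq h2, l2Vec_eq h3, enorm_eq_sqNorm]
  refine le_trans ?_ (sqNorm_three_le (aemeasurable_vecLen h1) (aemeasurable_vecLen h2)
    (aemeasurable_vecLen h3) ENNReal.coe_ne_top)
  refine sqNorm_mono ?_
  filter_upwards [h.norms, proj_ae 0 Z] with ξ ⟨n1, n2, n3, n4⟩ hp
  by_cases hk : ξ ∈ blk 0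
  · rw [vecLen_grad, vecLen_single, vecLen_single, ← ofReal_lowK_mul τ
      (mul_nonneg (rad_nonneg ξ) (norm_nonneg _)) (norm_nonneg _) (norm_nonneg _), hp, chi_of_mem hk,
      one_smul, ← ofReal_norm]
    refine ENNReal.ofReal_le_ofReal ((norm_le_sum_three _).trans ?_)
    rw [n1, n3]
    have hr := hk.1
    have hb : brk ξ ≤ 2 := by linarith [brk_le ξ, hk.1]
    have h4 : ‖b ξ‖ ≤ ‖Z ξ 2‖ + ‖τ‖ * ‖c ξ‖ := by
      have : b ξ = (b ξ + τ * c ξ) - τ * c ξ := by ring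
      calc ‖b ξ‖ = ‖(b ξ + τ * c ξ) - τ * c ξ‖ := by rw [← this]
        _ ≤ _ := norm_sub_le _ _
        _ = _ := by rw [n3, norm_mul, Complex.norm_real]
    have h5 : ‖Z ξ 1‖ ≤ 2 * ‖b ξ‖ := by rw [← n2]; gcongr
    have e : (lowK τ : ℝ) = 4 + 2 * ‖τ‖ := by simp [lowK]
    rw [e]
    have hz := norm_nonneg (Z ξ 0)
    have hz2 := norm_nonneg (Z ξ 2)
    have hc := norm_nonneg (c ξ)
    have ht := norm_nonneg τ
    nlinarith [mul_nonneg ht hz, mul_nonneg ht hz2, mul_nonneg ht hc]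
  · rw [hp, chi_of_notMem hk, zero_smul, enorm_zero]
    exact zero_le

lemma Rep.enorm_proj_succ_le (h : Rep τ U Z a b c) (k : ℕ) :
    sq2 ^ (2 * (k + 1)) * ‖proj (k + 1) Z‖ₑ ≤ lowK τ *
      (sqNorm volume (fun ξ => ‖chi (k + 1) ξ‖ₑ *
          vecLen ![fun ξ => -((rad ξ : ℂ) ^ 2 * (a ξ + τ * b ξ))] ξ) +
        sqNorm volume (fun ξ => ‖chi (k + 1) ξ‖ₑ * vecLen ![fun ξ => -((rad ξ : ℂ) ^ 2 * b ξ)] ξ) +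
        sqNorm volume (fun ξ => ‖chi (k + 1) ξ‖ₑ * vecLen (fun (j : Fin 3) ξ =>
          2 * Real.pi * Complex.I * (ξ j : ℂ) * (b ξ + τ * c ξ)) ξ)) := by
  have hm := (measurable_chi (k + 1)).enorm.aemeasurable (μ := volume)
  have h1 : ∀ i : Fin 1, Hat (![Δ (uv τ U)] i)
      ((![fun ξ => -((rad ξ : ℂ) ^ 2 * (a ξ + τ * b ξ))] : Fin 1 → E3 → ℂ) i) := fun i => by
    fin_cases i; exact h.hat_uv.laplacian
  have h2 : ∀ i : Fin 1, Hat (![Δ (cv U)] i)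
      ((![fun ξ => -((rad ξ : ℂ) ^ 2 * b ξ)] : Fin 1 → E3 → ℂ) i) := fun i => by
    fin_cases i; exact h.hat_v.laplacian
  have h3 := fun j => h.hat_vw.grad j
  have ht : sq2 ^ (2 * (k + 1)) ≠ ∞ := by have := sq2_ne_top; finiteness
  rw [enorm_eq_sqNorm, ← sqNorm_const_mul ht]
  refine le_trans ?_ (sqNorm_three_le (hm.mul (aemeasurable_vecLen h1)) (hm.mul (aemeasurable_vecLen h2))
    (hm.mul (aemeasurable_vecLen h3)) ENNReal.coe_ne_top)
  refine sqNorm_mono ?_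
  filter_upwards [h.norms, proj_ae (k + 1) Z] with ξ ⟨n1, n2, n3, n4⟩ hp
  by_cases hk : ξ ∈ blk (k + 1)
  · have hr := rad_nonneg ξ
    rw [Pi.mul_apply, Pi.mul_apply, Pi.mul_apply, vecLen_grad, vecLen_laplacian, vecLen_laplacian, hp,
      chi_of_mem hk, one_smul, enorm_one, one_mul, one_mul, one_mul, ← ofReal_lowK_mul τ (by positivity)
      (by positivity) (by positivity), ← ofReal_norm, pow_mul, sq2_sq]
    have e2 : (2 : ℝ≥0∞) ^ (k + 1) = ENNReal.ofReal (2 ^ (k + 1)) := by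
      rw [ENNReal.ofReal_pow (by norm_num)]; simp
    rw [e2, ← ENNReal.ofReal_mul (by positivity)]
    refine ENNReal.ofReal_le_ofReal ?_
    have hk2 := hk.2 (by omega)
    have h2k : (2 : ℝ) ≤ 2 ^ (k + 1) := by
      rw [pow_succ]; linarith [one_le_pow₀ (M₀ := ℝ) (a := 2) (n := k) (by norm_num)]
    have hb : brk ξ ≤ 2 * rad ξ := by linarith [brk_le ξ]
    have e : (lowK τ : ℝ) = 4 + 2 * ‖τ‖ := by simp [lowK]
    rw [e]
    calc (2 : ℝ) ^ (k + 1) * ‖Z ξ‖ ≤ 2 * rad ξ * (‖Z ξ 0‖ + ‖Z ξ 1‖ + ‖Z ξ 2‖) :=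
          mul_le_mul hk2 (norm_le_sum_three _) (norm_nonneg _) (by positivity)
      _ = 2 * rad ξ * (rad ξ * ‖a ξ + τ * b ξ‖ + brk ξ * ‖b ξ‖ + ‖b ξ + τ * c ξ‖) := by
          rw [n1, n2, n3]
      _ ≤ 2 * rad ξ * (rad ξ * ‖a ξ + τ * b ξ‖ + 2 * rad ξ * ‖b ξ‖ + ‖b ξ + τ * c ξ‖) := by gcongr
      _ = 2 * (rad ξ ^ 2 * ‖a ξ + τ * b ξ‖) + 4 * (rad ξ ^ 2 * ‖b ξ‖) +
            2 * (rad ξ * ‖b ξ + τ * c ξ‖) := by ring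
      _ ≤ (4 + 2 * ‖τ‖) * (rad ξ ^ 2 * ‖a ξ + τ * b ξ‖) + (4 + 2 * ‖τ‖) * (rad ξ ^ 2 * ‖b ξ‖) +
            (4 + 2 * ‖τ‖) * (rad ξ * ‖b ξ + τ * c ξ‖) := by
          have := norm_nonneg τ
          gcongr <;> linarith
      _ = _ := by ring
  · rw [hp, chi_of_notMem hk, zero_smul, enorm_zero, mul_zero]
    exact zero_le

lemma tsum_mul_three (K : ℝ≥0∞) (s f g h : ℕ → ℝ≥0∞) :
    ∑' k, s k * (K * (f k + g k + h k)) = K * (∑' k, s k * f k + ∑' k, s k * g k + ∑' k, s k * h k) := by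
  rw [← ENNReal.tsum_add, ← ENNReal.tsum_add, ← ENNReal.tsum_mul_left]
  exact tsum_congr fun k => by ring

/-- The norm of the Fourier picture is bounded by the energy. The blocks of positive order are controlled
by the homogeneous norms of `Δ(u + τv)`, `Δv` and `∇(v + τw)`, and the block of order `0` by the `L²`
norms. -/
lemma Rep.wNorm_le (hLP : IsLittlewoodPaley φ χ) (h : Rep τ U Z a b c) (m : ℕ) :
    wNorm (m + 2) Z ≤ 9 * lowK τ * sq2 ^ (m * 2) * energy φ τ (m / 2) U := by
  have h1 : ∀ i : Fin 1, Hat (![Δ (uv τ U)] i)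
      ((![fun ξ => -((rad ξ : ℂ) ^ 2 * (a ξ + τ * b ξ))] : Fin 1 → E3 → ℂ) i) := fun i => by
    fin_cases i; exact h.hat_uv.laplacian
  have h2 : ∀ i : Fin 1, Hat (![Δ (cv U)] i)
      ((![fun ξ => -((rad ξ : ℂ) ^ 2 * b ξ)] : Fin 1 → E3 → ℂ) i) := fun i => by
    fin_cases i; exact h.hat_v.laplacian
  have h3 := fun j => h.hat_vw.grad j
  have low : ‖proj 0 Z‖ₑ ≤ 9 * lowK τ * sq2 ^ (m * 2) * energyL2 τ U := by
    refine h.enorm_proj_zero_le.trans ?_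
    have e1 : l2Vec (JMGT.grad (uv τ U)) ≤ energyL2 τ U := le_sqrt_sum_seven _ (by simp)
    have e2 : l2Vec ![vw τ U] ≤ energyL2 τ U := le_sqrt_sum_seven _ (by simp)
    have e3 : l2Vec ![cw U] ≤ energyL2 τ U := le_sqrt_sum_seven _ (by simp)
    calc _ ≤ (lowK τ : ℝ≥0∞) * (energyL2 τ U + energyL2 τ U + energyL2 τ U) := by gcongr
      _ = 3 * lowK τ * 1 * energyL2 τ U := by ring
      _ ≤ _ := by
        gcongr ?_ * lowK τ * ?_ * energyL2 τ U
        · norm_num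
        · exact one_le_pow₀ one_le_sq2
  have high : ∑' k : ℕ, sq2 ^ ((m + 2) * (k + 1)) * ‖proj (k + 1) Z‖ₑ ≤
      9 * lowK τ * sq2 ^ (m * 2) * energyHom φ τ (m / 2) U := by
    have e : ∀ k : ℕ, sq2 ^ ((m + 2) * (k + 1)) * ‖proj (k + 1) Z‖ₑ =
        sq2 ^ (m * (k + 1)) * (sq2 ^ (2 * (k + 1)) * ‖proj (k + 1) Z‖ₑ) := fun k => by
      rw [add_mul, pow_add, mul_assoc]
    simp only [e]
    refine (ENNReal.tsum_le_tsum fun k => mul_le_mul_right (h.enorm_proj_succ_le k) _).trans ?_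
    rw [tsum_mul_three]
    have e1 : homBesov φ (m / 2) ![Δ (uv τ U)] ≤ energyHom φ τ (m / 2) U :=
      le_sqrt_sum_seven _ (by simp)
    have e2 : homBesov φ (m / 2) ![Δ (cv U)] ≤ energyHom φ τ (m / 2) U := le_sqrt_sum_seven _ (by simp)
    have e3 : homBesov φ (m / 2) (JMGT.grad (vw τ U)) ≤ energyHom φ τ (m / 2) U :=
      le_sqrt_sum_seven _ (by simp)
    calc _ ≤ (lowK τ : ℝ≥0∞) * (3 * sq2 ^ (m * 2) * energyHom φ τ (m / 2) U +
          3 * sq2 ^ (m * 2) * energyHom φ τ (m / 2) U + 3 * sq2 ^ (m * 2) * energyHom φ τ (m / 2) U) := by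
          refine mul_le_mul_right (add_le_add (add_le_add ?_ ?_) ?_) _
          · exact (tsum_sqNorm_blk_le hLP h1 m).trans (mul_le_mul_right e1 _)
          · exact (tsum_sqNorm_blk_le hLP h2 m).trans (mul_le_mul_right e2 _)
          · exact (tsum_sqNorm_blk_le hLP h3 m).trans (mul_le_mul_right e3 _)
      _ = _ := by ring
  rw [wNorm, tsum_eq_zero_add' ENNReal.summable, mul_zero, pow_zero, one_mul, energy, mul_add]
  exact add_le_add low high

/-! ### The Fourier picture of a state of finite energy -/

lemma l2_le_l2Vec {ι : Type} [Fintype ι] (F : ι → TDist) (i : ι) : l2 (F i) ≤ l2Vec F := by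
  rw [l2Vec, ← sqrt_sq_ennreal (l2 (F i))]
  exact ENNReal.rpow_le_rpow (Finset.single_le_sum (f := fun i => l2 (F i) ^ 2)
    (fun _ _ => zero_le) (Finset.mem_univ i)) (by norm_num)

lemma energyL2_ge (τ : ℝ) (U : State) : l2 (vw τ U) ≤ energyL2 τ U ∧ l2 (cw U) ≤ energyL2 τ U ∧
    (∀ j, l2 (JMGT.grad (cv U) j) ≤ energyL2 τ U) ∧ ∀ j, l2 (JMGT.grad (uv τ U) j) ≤ energyL2 τ U := by
  refine ⟨?_, ?_, fun j => ?_, fun j => ?_⟩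
  · exact (l2_le_l2Vec ![vw τ U] 0).trans (le_sqrt_sum_seven _ (by simp))
  · exact (l2_le_l2Vec ![cw U] 0).trans (le_sqrt_sum_seven _ (by simp))
  · exact (l2_le_l2Vec _ j).trans (le_sqrt_sum_seven _ (by simp))
  · exact (l2_le_l2Vec _ j).trans (le_sqrt_sum_seven _ (by simp))

lemma memLp_rad_mul {F : TDist} {h : E3 → ℂ} (hF : Hat F h) (hl : ∀ j, l2 (JMGT.grad F j) < ∞) :
    MemLp (fun ξ => (rad ξ : ℂ) * h ξ) 2 volume := by
  refine ⟨continuous_rad.measurable.complex_ofReal.aestronglyMeasurable.mul hF.aestronglyMeasurable, ?_⟩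
  have h1 := l2Vec_eq (fun j => hF.grad j)
  have h2 : eLpNorm (fun ξ => (rad ξ : ℂ) * h ξ) 2 volume = l2Vec (JMGT.grad F) := by
    rw [h1, eLpNorm_two_eq_sqNorm]
    congr 1
    ext ξ
    rw [ofReal_mul_norm (rad_nonneg ξ), ← vecLen_grad, vecLen]
  rw [h2]
  refine ENNReal.rpow_lt_top_of_nonneg (by norm_num) ?_
  exact (ENNReal.sum_lt_top.2 fun j _ => ENNReal.pow_lt_top (hl j)).ne

/-- A state of finite energy has a Fourier picture. -/
lemma exists_rep {a : L2 ℂ} (hu : cu U = invF a) (hU : energyL2 τ U < ∞) :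
    ∃ Z b c, Rep τ U Z a b c := by
  obtain ⟨l1, l2, l3, l4⟩ := energyL2_ge τ U
  obtain ⟨y, hy⟩ := exists_of_l2_lt_top (l1.trans_lt hU)
  obtain ⟨c, hc⟩ := exists_of_l2_lt_top (l2.trans_lt hU)
  have hv : cv U = invF (y - (τ : ℂ) • c) := by
    rw [map_sub, map_smul, ← hy, ← hc, vw]; abel
  set b := y - (τ : ℂ) • c with hb
  have m1 : MemLp (fun ξ => (brk ξ : ℂ) * b ξ) 2 volume := by
    have m2 := memLp_rad_mul (F := cv U) (h := b) (by rw [hv]; exact hat_invF b)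
      fun j => (l3 j).trans_lt hU
    refine ((Lp.memLp b).norm.add m2.norm).mono
      (continuous_brk.measurable.complex_ofReal.aestronglyMeasurable.mul (Lp.memLp b).1)
      (Eventually.of_forall fun ξ => ?_)
    have hr := rad_nonneg ξ
    simp only [Pi.add_apply, norm_mul, Complex.norm_real, Real.norm_of_nonneg hr,
      Real.norm_of_nonneg (brk_pos ξ).le]
    rw [Real.norm_of_nonneg (by positivity)]
    nlinarith [brk_le ξ, norm_nonneg (b ξ)]
  have hh : Hat (uv τ U) fun ξ => a ξ + τ * b ξ := by
    rw [uv, hu, hv]; exact hat_add_smul τ a b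
  have m3 := memLp_rad_mul hh fun j => (l4 j).trans_lt hU
  have m4 : MemLp (fun ξ => (!₂[(rad ξ : ℂ) * (a ξ + τ * b ξ), (brk ξ : ℂ) * b ξ, y ξ] : Cn 3)) 2 volume := by
    refine MemLp.of_eval_piLp fun i => ?_
    fin_cases i
    · exact m3
    · exact m1
    · exact Lp.memLp y
  refine ⟨m4.toLp _, b, c, hu, hv, hc, ?_⟩
  filter_upwards [m4.coeFn_toLp, Lp.coeFn_sub y ((τ : ℂ) • c), Lp.coeFn_smul (τ : ℂ) c] with ξ e1 e2 e3
  rw [e1, hb, e2, Pi.sub_apply, e3, Pi.smul_apply, smul_eq_mul]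
  refine ⟨?_, ?_, ?_⟩ <;> simp

end Lower

/-! ### The evolution equation in `L²` -/

/-- The constant in the bound of the generator by `(1+|D|²)^{1/2}`. -/
def genC (τ γ : ℝ) : ℝ≥0 := (2 + 2 * τ⁻¹ + γ).toNNReal

lemma norm_genMat_le {τ γ : ℝ} (hτ : 0 < τ) (hγ : 0 < γ) (ξ : E3) (z : Cn 3) :
    ‖matCLM (toC (genMat τ γ (rho ξ) (brk ξ))) z‖ ≤ genC τ γ * brk ξ * ‖z‖ := by
  have hb := one_le_brk ξ
  have hb0 := (brk_pos ξ).le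
  have hr := rho_nonneg ξ
  have hr1 := rho_le_one ξ
  have hi : 0 ≤ τ⁻¹ := by positivity
  have hz := PiLp.norm_apply_le z
  have hn := norm_nonneg z
  have e : (genC τ γ : ℝ) = 2 + 2 * τ⁻¹ + γ := Real.coe_toNNReal _ (by positivity)
  have hrb : rho ξ * brk ξ ≤ brk ξ := mul_le_of_le_one_left hb0 hr1
  have hrb0 : 0 ≤ rho ξ * brk ξ := mul_nonneg hr hb0
  refine (norm_le_sum_three _).trans ?_
  have h0 : ‖matCLM (toC (genMat τ γ (rho ξ) (brk ξ))) z 0‖ ≤ brk ξ * ‖z‖ := by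
    rw [matCLM_apply]
    simp only [Fin.sum_univ_three, toC, genMat, Matrix.cons_val, Complex.ofReal_zero, zero_mul, zero_add]
    rw [norm_mul, Complex.norm_real, Real.norm_of_nonneg hrb0]
    exact mul_le_mul hrb (hz 2) (norm_nonneg _) hb0
  have h1 : ‖matCLM (toC (genMat τ γ (rho ξ) (brk ξ))) z 1‖ ≤ 2 * τ⁻¹ * (brk ξ * ‖z‖) := by
    rw [matCLM_apply]
    simp only [Fin.sum_univ_three, toC, genMat, Matrix.cons_val, Complex.ofReal_zero, zero_mul, zero_add]
    refine (norm_add_le _ _).trans ?_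
    rw [norm_mul, norm_mul, Complex.norm_real, Complex.norm_real, norm_neg, Real.norm_of_nonneg hi,
      Real.norm_of_nonneg (mul_nonneg hb0 hi)]
    have h2 : ‖z 1‖ ≤ brk ξ * ‖z‖ := (hz 1).trans (le_mul_of_one_le_left hn hb)
    calc _ ≤ τ⁻¹ * (brk ξ * ‖z‖) + brk ξ * τ⁻¹ * ‖z‖ := by
          gcongr; exact hz 2
      _ = _ := by ring
  have h2 : ‖matCLM (toC (genMat τ γ (rho ξ) (brk ξ))) z 2‖ ≤ (1 + γ) * (brk ξ * ‖z‖) := by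
    rw [matCLM_apply]
    simp only [Fin.sum_univ_three, toC, genMat, Matrix.cons_val, Complex.ofReal_zero, zero_mul, add_zero]
    refine (norm_add_le _ _).trans ?_
    rw [norm_mul, norm_mul, Complex.norm_real, Complex.norm_real, norm_neg, Real.norm_of_nonneg hrb0,
      neg_mul, neg_mul, norm_neg, Real.norm_of_nonneg (by positivity)]
    calc _ ≤ brk ξ * ‖z‖ + γ * brk ξ * 1 * ‖z‖ := by
          gcongr
          · exact hz 0
          · exact hz 1
      _ = _ := by ring
  rw [e]
  linarith

lemma enorm_gen_le {τ γ : ℝ} (hτ : 0 < τ) (hγ : 0 < γ) (k : ℕ) (x : L2 (Cn 3)) :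
    ‖mulOp (genSym τ γ k) x‖ₑ ≤ 2 * genC τ γ * (sq2 ^ (2 * k) * ‖proj k x‖ₑ) := by
  have := enorm_le_of_ae_le (f := mulOp (genSym τ γ k) x) (w := proj k x)
    (C := genC τ γ * (2 * 2 ^ k)) (by
      filter_upwards [mulOp_ae (isSymbol_genSym τ γ k) x, proj_ae k x] with ξ h1 h2
      rw [h1, h2]
      by_cases h : ξ ∈ blk k
      · rw [genSym_of_mem h, chi_of_mem h, one_smul]
        refine (norm_genMat_le hτ hγ ξ _).trans ?_
        have h3 := brk_le_of_mem_blk h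
        have h4 : (1 : ℝ) ≤ 2 ^ k := one_le_pow₀ (by norm_num)
        push_cast
        gcongr
        linarith
      · rw [genSym_of_notMem h, zero_apply, norm_zero]
        positivity)
  refine this.trans (le_of_eq ?_)
  rw [pow_mul, sq2_sq]
  push_cast
  ring

/-- The block `k` of the right-hand side of the evolution equation. -/
def evolBlk (τ γ b : ℝ) (k : ℕ) (x : L2 (Cn 3)) : L2 (Cn 3) :=
  mulOp (genSym τ γ k) x + nonlin τ b k x x

/-- The right-hand side of the evolution equation, as the sum of its blocks. The sum converges for
elements of finite norm `wNorm 5`; the series has a junk value for the others. -/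
def evol (τ γ b : ℝ) (x : L2 (Cn 3)) : L2 (Cn 3) := ∑' k, evolBlk τ γ b k x

lemma evolBlk_sub (τ γ b : ℝ) (k : ℕ) (x y : L2 (Cn 3)) : evolBlk τ γ b k x - evolBlk τ γ b k y =
    mulOp (genSym τ γ k) (x - y) + (nonlin τ b k (x - y) x + nonlin τ b k y (x - y)) := by
  simp only [evolBlk, map_sub, sub_apply]
  abel

lemma evolBlk_zero (τ γ b : ℝ) (k : ℕ) : evolBlk τ γ b k 0 = 0 := by simp [evolBlk]

lemma wNorm_zero {V : Type*} [NormedAddCommGroup V] [NormedSpace ℂ V] (n : ℕ) : wNorm n (0 : L2 V) = 0 := by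
  simp [wNorm]

lemma wNorm_add_le {V : Type*} [NormedAddCommGroup V] [NormedSpace ℂ V] (n : ℕ) (x y : L2 V) :
    wNorm n (x + y) ≤ wNorm n x + wNorm n y := by
  rw [wNorm, wNorm, wNorm, ← ENNReal.tsum_add]
  refine ENNReal.tsum_le_tsum fun k => ?_
  rw [map_add, ← mul_add]
  exact mul_le_mul_right (enorm_add_le _ _) _

lemma wNorm_mono {V : Type*} [NormedAddCommGroup V] [NormedSpace ℂ V] {m n : ℕ} (h : m ≤ n) (x : L2 V) :
    wNorm m x ≤ wNorm n x := by
  refine ENNReal.tsum_le_tsum fun k => ?_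
  gcongr
  exact one_le_sq2

section Evolution

variable {τ γ : ℝ} (b : ℝ)

lemma enorm_le_wNorm (n : ℕ) (x : L2 (Cn 3)) : ‖x‖ₑ ≤ wNorm n x :=
  ((sys (τ := 1) (γ := 1) 0 one_pos one_pos).enorm_le_tsum x).trans
    (ENNReal.tsum_le_tsum fun _ => le_mul_of_one_le_left' (one_le_pow₀ one_le_sq2))

/-- The constant in the local Lipschitz bound of the right-hand side of the evolution equation. -/
def evolC (τ γ b : ℝ) : ℝ≥0∞ := 2 * genC τ γ + 32 * quadC τ b * ‖mulOp dissSym‖ₑ ^ 2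

lemma evolC_ne_top : evolC τ γ b ≠ ∞ := by
  unfold evolC
  finiteness

lemma tsum_nonlin_le (hτ : 0 < τ) (x y : L2 (Cn 3)) : ∑' k, sq2 ^ (3 * k) * ‖nonlin τ b k x y‖ₑ ≤
    32 * quadC τ b * ‖mulOp dissSym‖ₑ ^ 2 * (wNorm 5 x * wNorm 5 y) := by
  have h := (sys (γ := 1) b hτ one_pos).tsum_N_le x y
  have e : ((sys (γ := 1) b hτ one_pos).KN : ℝ≥0∞) = 32 * quadC τ b := by
    change ((32 * quadC τ b : ℝ≥0) : ℝ≥0∞) = _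
    push_cast; rfl
  rw [e] at h
  refine le_trans (ENNReal.tsum_le_tsum fun k => ?_) h
  refine mul_le_mul_left ?_ _
  exact pow_le_pow_right' one_le_sq2 (by omega)

lemma tsum_gen_le (hτ : 0 < τ) (hγ : 0 < γ) (x : L2 (Cn 3)) :
    ∑' k, sq2 ^ (3 * k) * ‖mulOp (genSym τ γ k) x‖ₑ ≤ 2 * genC τ γ * wNorm 5 x := by
  rw [wNorm, ← ENNReal.tsum_mul_left]
  refine ENNReal.tsum_le_tsum fun k => ?_
  calc _ ≤ sq2 ^ (3 * k) * (2 * genC τ γ * (sq2 ^ (2 * k) * ‖proj k x‖ₑ)) :=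
        mul_le_mul_right (enorm_gen_le hτ hγ k x) _
    _ = 2 * genC τ γ * (sq2 ^ (3 * k + 2 * k) * ‖proj k x‖ₑ) := by rw [pow_add]; ring
    _ = _ := by rw [← add_mul]

lemma tsum_evolBlk_sub_le (hτ : 0 < τ) (hγ : 0 < γ) (x y : L2 (Cn 3)) :
    ∑' k, sq2 ^ (3 * k) * ‖evolBlk τ γ b k x - evolBlk τ γ b k y‖ₑ ≤
      evolC τ γ b * (wNorm 5 (x - y) * (1 + wNorm 5 x + wNorm 5 y)) := by
  have e : ∀ k, sq2 ^ (3 * k) * ‖evolBlk τ γ b k x - evolBlk τ γ b k y‖ₑ ≤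
      sq2 ^ (3 * k) * ‖mulOp (genSym τ γ k) (x - y)‖ₑ + (sq2 ^ (3 * k) * ‖nonlin τ b k (x - y) x‖ₑ +
        sq2 ^ (3 * k) * ‖nonlin τ b k y (x - y)‖ₑ) := fun k => by
    rw [evolBlk_sub, ← mul_add, ← mul_add]
    exact mul_le_mul_right ((enorm_add_le _ _).trans (add_le_add_right (enorm_add_le _ _) _)) _
  refine (ENNReal.tsum_le_tsum e).trans ?_
  rw [ENNReal.tsum_add, ENNReal.tsum_add]
  refine (add_le_add (tsum_gen_le hτ hγ _) (add_le_add (tsum_nonlin_le b hτ _ _)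
    (tsum_nonlin_le b hτ _ _))).trans ?_
  set Q : ℝ≥0∞ := 32 * quadC τ b * ‖mulOp dissSym‖ₑ ^ 2 with hQ
  have h : evolC τ γ b = 2 * genC τ γ + Q := rfl
  rw [h]
  calc _ ≤ 2 * genC τ γ * wNorm 5 (x - y) + (Q * (wNorm 5 (x - y) * wNorm 5 x) +
        Q * (wNorm 5 y * wNorm 5 (x - y))) + (Q * wNorm 5 (x - y) +
          2 * genC τ γ * (wNorm 5 (x - y) * (wNorm 5 x + wNorm 5 y))) := le_self_add
    _ = _ := by ring

lemma summable_evolBlk (hτ : 0 < τ) (hγ : 0 < γ) {x : L2 (Cn 3)} (hx : wNorm 5 x ≠ ∞) : Summable fun k => evolBlk τ γ b k x := by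
  have h := tsum_evolBlk_sub_le b hτ hγ x 0
  simp only [evolBlk_zero, sub_zero, wNorm_zero, add_zero] at h
  have h1 : ∑' k, ‖evolBlk τ γ b k x‖ₑ ≠ ∞ := by
    refine ((ENNReal.tsum_le_tsum fun k => ?_).trans h).trans_lt ?_ |>.ne
    · exact le_mul_of_one_le_left' (one_le_pow₀ one_le_sq2)
    · have := evolC_ne_top (τ := τ) (γ := γ) b
      finiteness
  refine Summable.of_norm ?_
  simpa using ENNReal.summable_toReal h1

lemma proj_evolBlk (hτ : 0 < τ) (hγ : 0 < γ) (k : ℕ) (x : L2 (Cn 3)) : proj k (evolBlk τ γ b k x) = evolBlk τ γ b k x := by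
  have h1 := (sys b hτ hγ).P_A k x
  have h2 := (sys b hτ hγ).P_N k x x
  rw [evolBlk, map_add]
  exact congrArg₂ _ h1 h2

lemma proj_evol (hτ : 0 < τ) (hγ : 0 < γ) {x : L2 (Cn 3)} (hx : wNorm 5 x ≠ ∞) (k : ℕ) :
    proj k (evol τ γ b x) = evolBlk τ γ b k x :=
  (sys b hτ hγ).P_tsum (fun k => proj_evolBlk b hτ hγ k x) (summable_evolBlk b hτ hγ hx) k

/-- The right-hand side is locally Lipschitz with the loss of one derivative, from `wNorm 5` to `wNorm 3`. -/
lemma wNorm_evol_sub_le (hτ : 0 < τ) (hγ : 0 < γ) {x y : L2 (Cn 3)} (hx : wNorm 5 x ≠ ∞) (hy : wNorm 5 y ≠ ∞) :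
    wNorm 3 (evol τ γ b x - evol τ γ b y) ≤
      evolC τ γ b * (wNorm 5 (x - y) * (1 + wNorm 5 x + wNorm 5 y)) := by
  refine le_trans (le_of_eq ?_) (tsum_evolBlk_sub_le b hτ hγ x y)
  refine tsum_congr fun k => ?_
  rw [map_sub, proj_evol b hτ hγ hx, proj_evol b hτ hγ hy]

/-- The Fourier transform of `b v w + 2 ∇u·∇v`. -/
def quadHat (τ b : ℝ) (x : L2 (Cn 3)) (ξ : E3) : ℂ :=
  ∑ i : Fin 4, prodCoef b i * conv (leftOp τ i x) (rightOp τ i x) ξ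

/-- The right-hand side without the decomposition into blocks. -/
lemma evol_ae (hτ : 0 < τ) (hγ : 0 < γ) {x : L2 (Cn 3)} (hx : wNorm 5 x ≠ ∞) : ∀ᵐ ξ, evol τ γ b x ξ =
    matCLM (toC (genMat τ γ (rho ξ) (brk ξ))) (x ξ) + lastCLM (quadHat τ b x ξ) := by
  have h1 : ∀ᵐ ξ, ∀ k, evolBlk τ γ b k x ξ = genSym τ γ k ξ (x ξ) + lastCLM (chi k ξ * quadHat τ b x ξ) := by
    rw [ae_all_iff]
    intro k
    have h2 : ∀ᵐ ξ, ∀ i, convBlk k (leftOp τ i x) (rightOp τ i x) ξ =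
        chi k ξ * conv (leftOp τ i x) (rightOp τ i x) ξ := ae_all_iff.2 fun i => convBlk_ae _ _ _
    have h3 := Lp.coeFn_finsetSum (p := 2) (μ := (volume : Measure E3)) (s := Finset.univ)
      (fun i : Fin 4 => prodCoef b i • convBlk k (leftOp τ i x) (rightOp τ i x))
    have h4 : ∀ᵐ ξ, ∀ i : Fin 4, (prodCoef b i • convBlk k (leftOp τ i x) (rightOp τ i x) : L2 ℂ) ξ =
        prodCoef b i * convBlk k (leftOp τ i x) (rightOp τ i x) ξ :=
      ae_all_iff.2 fun i => Lp.coeFn_smul _ _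
    filter_upwards [Lp.coeFn_add (mulOp (genSym τ γ k) x) (nonlin τ b k x x),
      mulOp_ae (isSymbol_genSym τ γ k) x, mulOp_ae isSymbol_lastCLM (quadBlk τ b k x x), h2, h3, h4]
      with ξ e1 e2 e3 e4 e5 e6
    rw [evolBlk, e1, Pi.add_apply, e2, nonlin_apply, e3, quadBlk_apply, e5]
    congr 2
    simp only [e6, e4, quadHat, Finset.sum_apply, Finset.mul_sum]
    exact Finset.sum_congr rfl fun i _ => by ring
  filter_upwards [h1, ae_proj_of_mem (evol τ γ b x)] with ξ h1 h2
  obtain ⟨k, hk⟩ := exists_mem_blk ξ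
  have h3 := h2 k hk
  rw [proj_evol b hτ hγ hx, h1 k, genSym_of_mem hk, chi_of_mem hk, one_mul] at h3
  exact h3.symm

section Trajectory

variable {Z : ℝ → L2 (Cn 3)}

lemma tendsto_evol_sub (hτ : 0 < τ) (hγ : 0 < γ) (hX : ∀ t, 0 ≤ t → wNorm 5 (Z t) ≠ ∞) {t : ℝ} (ht : 0 ≤ t)
    (h : Tendsto (fun r => wNorm 5 (Z r - Z t)) (𝓝[Set.Ici 0] t) (𝓝 0)) :
    Tendsto (fun r => wNorm 3 (evol τ γ b (Z r) - evol τ γ b (Z t))) (𝓝[Set.Ici 0] t) (𝓝 0) := by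
  have h1 : Tendsto (fun r => evolC τ γ b * (wNorm 5 (Z r - Z t) *
      (1 + (wNorm 5 (Z r - Z t) + wNorm 5 (Z t)) + wNorm 5 (Z t)))) (𝓝[Set.Ici 0] t)
      (𝓝 (evolC τ γ b * (0 * (1 + (0 + wNorm 5 (Z t)) + wNorm 5 (Z t))))) := by
    have := hX t ht
    have h2 : Tendsto (fun r => 1 + (wNorm 5 (Z r - Z t) + wNorm 5 (Z t)) + wNorm 5 (Z t))
        (𝓝[Set.Ici 0] t) (𝓝 (1 + (0 + wNorm 5 (Z t)) + wNorm 5 (Z t))) :=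
      (tendsto_const_nhds.add (h.add tendsto_const_nhds)).add tendsto_const_nhds
    refine ENNReal.Tendsto.const_mul (ENNReal.Tendsto.mul h (Or.inr ?_) h2 (Or.inr ?_))
      (Or.inr (evolC_ne_top b))
    · finiteness
    · finiteness
  rw [zero_mul, mul_zero] at h1
  refine tendsto_of_tendsto_of_tendsto_of_le_of_le' tendsto_const_nhds h1
    (Eventually.of_forall fun _ => zero_le) ?_
  filter_upwards [self_mem_nhdsWithin] with r hr
  refine (wNorm_evol_sub_le b hτ hγ (hX r hr) (hX t ht)).trans ?_
  gcongr
  calc wNorm 5 (Z r) = wNorm 5 ((Z r - Z t) + Z t) := by rw [sub_add_cancel]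
    _ ≤ _ := wNorm_add_le 5 _ _

lemma continuousOn_of_tendsto_wNorm {Y : ℝ → L2 (Cn 3)} {n : ℕ} (h : ∀ t, 0 ≤ t →
    Tendsto (fun r => wNorm n (Y r - Y t)) (𝓝[Set.Ici 0] t) (𝓝 0)) : ContinuousOn Y (Set.Ici 0) := by
  intro t ht
  rw [ContinuousWithinAt, tendsto_iff_edist_tendsto_0]
  simp only [edist_eq_enorm_sub]
  exact tendsto_of_tendsto_of_tendsto_of_le_of_le tendsto_const_nhds (h t ht)
    (fun _ => zero_le) fun r => enorm_le_wNorm n _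

/-- The equations on the blocks add up to an equation in `L²`. -/
lemma hasDerivWithinAt_of_solves (hτ : 0 < τ) (hγ : 0 < γ) (hX : ∀ t, 0 ≤ t → wNorm 5 (Z t) ≠ ∞)
    (hc : ContinuousOn (fun t => evol τ γ b (Z t)) (Set.Ici 0))
    (hs : (sys b hτ hγ).Solves Z fun k t => (sys b hτ hγ).N k (Z t) (Z t)) {t : ℝ} (ht : 0 ≤ t) :
    HasDerivWithinAt Z (evol τ γ b (Z t)) (Set.Ici 0) t :=
  hasDerivWithinAt_of_proj hc (fun t ht k => by rw [proj_evol b hτ hγ (hX t ht)]; exact hs k t ht) ht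

lemma solves_of_hasDerivWithinAt (hτ : 0 < τ) (hγ : 0 < γ) (hX : ∀ t, 0 ≤ t → wNorm 5 (Z t) ≠ ∞)
    (h : ∀ t, 0 ≤ t → HasDerivWithinAt Z (evol τ γ b (Z t)) (Set.Ici 0) t) :
    (sys b hτ hγ).Solves Z fun k t => (sys b hτ hγ).N k (Z t) (Z t) := by
  intro k t ht
  have h1 := ((proj k : L2 (Cn 3) →L[ℂ] L2 (Cn 3)).restrictScalars ℝ).hasFDerivAt.comp_hasDerivWithinAt t (h t ht)
  have h2 := proj_evol b hτ hγ (hX t ht) k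
  simp only [ContinuousLinearMap.coe_restrictScalars', h2] at h1
  exact h1

lemma tsum_supN_evol_lt_top (hτ : 0 < τ) (hγ : 0 < γ) (hX : ∀ t, 0 ≤ t → wNorm 5 (Z t) ≠ ∞) (hS : (sys b hτ hγ).SX Z ≠ ∞) :
    ∑' k, sq2 ^ (3 * k) * supN (fun t => proj k (evol τ γ b (Z t))) < ∞ := by
  have e : ∀ k, sq2 ^ (3 * k) * supN (fun t => proj k (evol τ γ b (Z t))) ≤
      2 * genC τ γ * (sq2 ^ (5 * k) * supN (fun t => proj k (Z t))) +
        sq2 ^ (5 * k) * supN (fun t => nonlin τ b k (Z t) (Z t)) := fun k => by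
    have h1 : supN (fun t => proj k (evol τ γ b (Z t))) ≤
        2 * genC τ γ * (sq2 ^ (2 * k) * supN fun t => proj k (Z t)) +
          supN (fun t => nonlin τ b k (Z t) (Z t)) := by
      refine iSup_le fun t => ?_
      beta_reduce
      rw [proj_evol b hτ hγ (hX t t.2), evolBlk]
      refine (enorm_add_le _ _).trans (add_le_add ((enorm_gen_le hτ hγ k _).trans ?_)
        (enorm_le_supN (fun t => nonlin τ b k (Z t) (Z t)) t.2))
      gcongr
      exact enorm_le_supN (fun t => proj k (Z t)) t.2
    refine (mul_le_mul_right h1 _).trans ?_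
    rw [mul_add]
    refine add_le_add (le_of_eq ?_) (mul_le_mul_left (pow_le_pow_right' one_le_sq2 (by omega)) _)
    rw [show 5 * k = 3 * k + 2 * k by ring, pow_add]
    ring
  refine (ENNReal.tsum_le_tsum e).trans_lt ?_
  rw [ENNReal.tsum_add, ENNReal.tsum_mul_left]
  refine ENNReal.add_lt_top.2 ⟨?_, ?_⟩
  · exact ENNReal.mul_lt_top (by finiteness) hS.lt_top
  · refine lt_of_le_of_lt ((sys b hτ hγ).tsum_supN_N_le Z) ?_
    exact ENNReal.mul_lt_top (by finiteness) (ENNReal.mul_lt_top hS.lt_top hS.lt_top)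

lemma wChemin_top_le {V : Type*} [NormedAddCommGroup V] [NormedSpace ℂ V] (n : ℕ) (Y : ℝ → L2 V) :
    wChemin ∞ n Y ≤ ∑' k, sq2 ^ (n * k) * supN (fun t => proj k (Y t)) := by
  refine ENNReal.tsum_le_tsum fun k => mul_le_mul_right ?_ _
  simp only [halfLineNorm, eLpNorm_exponent_top, eLpNormEssSup, enorm_eq_self]
  refine essSup_le_of_ae_le _ ?_
  filter_upwards [ae_restrict_mem measurableSet_Ici] with t ht
  exact enorm_le_supN (fun t => proj k (Y t)) ht

/-- The equation holds with respect to the stronger norm `wNorm 3`: on each block it does, and by the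
mean value inequality the difference quotients are dominated by a summable sequence. -/
lemma tendsto_difference_quotient (hτ : 0 < τ) (hγ : 0 < γ) (hX : ∀ t, 0 ≤ t → wNorm 5 (Z t) ≠ ∞) (hS : (sys b hτ hγ).SX Z ≠ ∞)
    (h : ∀ t, 0 ≤ t → HasDerivWithinAt Z (evol τ γ b (Z t)) (Set.Ici 0) t) {t : ℝ} (ht : 0 ≤ t) :
    Tendsto (fun r => wNorm 3 ((((r - t)⁻¹ : ℝ) : ℂ) • (Z r - Z t) - evol τ γ b (Z t)))
      (𝓝[Set.Ici 0 \ {t}] t) (𝓝 0) := by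
  set Y : ℝ → L2 (Cn 3) := fun t => evol τ γ b (Z t) with hY
  have hsum := tsum_supN_evol_lt_top b hτ hγ hX hS
  have hfin : ∀ k, supN (fun t => proj k (Y t)) ≠ ∞ := fun k => by
    have h1 := ENNReal.ne_top_of_tsum_ne_top hsum.ne k
    intro h2
    rw [h2, ENNReal.mul_top] at h1
    · exact h1 rfl
    · exact (lt_of_lt_of_le one_pos (one_le_pow₀ one_le_sq2)).ne'
  have hd : ∀ k s, 0 ≤ s → HasDerivWithinAt (fun r => proj k (Z r)) (proj k (Y s)) (Set.Ici 0) s :=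
    fun k s hs => ((proj k : L2 (Cn 3) →L[ℂ] L2 (Cn 3)).restrictScalars ℝ).hasFDerivAt.comp_hasDerivWithinAt s
      (h s hs)
  refine BlockSystem.tendsto_tsum_zero
    (B := fun k => 2 * (sq2 ^ (3 * k) * supN (fun t => proj k (Y t)))) ?_ ?_ fun k => ?_
  · rw [ENNReal.tsum_mul_left]
    exact ENNReal.mul_ne_top (by norm_num) hsum.ne
  · filter_upwards [self_mem_nhdsWithin] with r hr k
    rw [mul_left_comm, two_mul]
    refine mul_le_mul_right ?_ _
    rw [map_sub, map_smul, map_sub]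
    refine enorm_sub_le.trans (add_le_add ?_ (enorm_le_supN (fun t => proj k (Y t)) ht))
    have hb := (convex_Ici (0 : ℝ)).norm_image_sub_le_of_norm_hasDerivWithin_le (f := fun r => proj k (Z r))
      (f' := fun s => proj k (Y s)) (C := (supN (fun t => proj k (Y t))).toReal) (x := t) (y := r)
      (fun s hs => hd k s hs) (fun s hs => by
        rw [← toReal_enorm]
        exact ENNReal.toReal_mono (hfin k) (enorm_le_supN (fun t => proj k (Y t)) hs)) ht hr.1
    have hrt : 0 < ‖r - t‖ := norm_pos_iff.2 (sub_ne_zero.2 fun e => hr.2 e)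
    have h3 : ‖(((r - t)⁻¹ : ℝ) : ℂ) • (proj k (Z r) - proj k (Z t))‖ ≤
        (supN (fun t => proj k (Y t))).toReal := by
      rw [norm_smul, Complex.norm_real, norm_inv, inv_mul_le_iff₀ hrt, mul_comm]
      exact hb
    rw [← ofReal_norm, ← ENNReal.ofReal_toReal (hfin k)]
    exact ENNReal.ofReal_le_ofReal h3
  · have h1 := hasDerivWithinAt_iff_tendsto_slope.1 (hd k t ht)
    have h2 := (h1.sub_const (proj k (Y t))).enorm
    rw [sub_self, enorm_zero] at h2
    have h3 := ENNReal.Tendsto.const_mul h2 (Or.inr (ENNReal.pow_ne_top sq2_ne_top : sq2 ^ (3 * k) ≠ ∞))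
    rw [mul_zero] at h3
    refine h3.congr fun r => ?_
    rw [slope_def_module, map_sub, map_smul, map_sub]
    rfl

end Trajectory

end Evolution

/-! ### Square integrability of the data -/

lemma hasTemperateGrowth_inv {m : E3 → ℝ} (hm : m.HasTemperateGrowth) (h : ∀ ξ, 1 / 100 < m ξ) :
    (fun ξ => (m ξ)⁻¹).HasTemperateGrowth := by
  set t : Set ℝ := {y | 1 / 100 < y}
  have ht : IsOpen t := isOpen_lt' _
  have h0 : ∀ x ∈ t, x ≠ 0 := fun x hx => (lt_trans (by norm_num) hx : (0 : ℝ) < x).ne'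
  refine Function.HasTemperateGrowth.comp' (g := fun x : ℝ => x⁻¹) (t := t) ?_ ht.uniqueDiffOn
    (contDiffOn_inv ℝ |>.mono h0) (fun N => ?_) hm
  · rintro - ⟨ξ, rfl⟩
    exact h ξ
  · refine ⟨0, N.factorial * 100 ^ (N + 1), by positivity, fun n hn x hx => ?_⟩
    have hx0 : 0 < x := lt_trans (by norm_num) hx
    have hx1 : x⁻¹ ≤ 100 := by
      rw [inv_le_comm₀ hx0 (by norm_num)]
      have : (1 / 100 : ℝ) < x := hx
      linarith
    rw [norm_iteratedFDerivWithin_eq_norm_iteratedDerivWithin, iteratedDerivWithin_of_isOpen ht hx,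
      iteratedDeriv_eq_iterate, iter_deriv_inv, pow_zero, mul_one, norm_mul, norm_mul, norm_pow,
      norm_neg, norm_one, one_pow, one_mul, Real.norm_natCast, norm_zpow, Real.norm_of_nonneg hx0.le]
    have e : x ^ (-1 - n : ℤ) = x⁻¹ ^ (n + 1) := by
      rw [← zpow_natCast, inv_zpow', ]
      congr 1
      push_cast
      ring
    rw [e]
    gcongr
    calc x⁻¹ ^ (n + 1) ≤ 100 ^ (n + 1) := by gcongr
      _ ≤ _ := by exact_mod_cast Nat.pow_le_pow_right (by norm_num) (by omega)

/-- The annuli of nonnegative order do not meet the ball `|ξ| < 3/4`. -/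
lemma chi_eq_one {φ χ : E3 → ℝ} (hLP : IsLittlewoodPaley φ χ) {ξ : E3} (h : ‖ξ‖ < 3 / 4) : χ ξ = 1 := by
  have h1 : ∀ q : ℕ, φ ((2 : ℝ) ^ (-(q : ℤ)) • ξ) = 0 := by
    intro q
    by_contra h2
    have h3 := (hLP.supp_annulus _ h2).1
    rw [norm_smul, norm_zpow, Real.norm_ofNat, zpow_neg, zpow_natCast] at h3
    have h4 : ((2 : ℝ) ^ q)⁻¹ ≤ 1 := inv_le_one_of_one_le₀ (one_le_pow₀ (by norm_num))
    have h5 : ((2 : ℝ) ^ q)⁻¹ * ‖ξ‖ ≤ 1 * ‖ξ‖ := by gcongr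
    linarith
  have h2 := hLP.sum_inhom ξ
  simp only [h1] at h2
  linarith [h2.unique hasSum_zero]

/-- A distribution is square integrable if its low frequencies and its Laplacian are: the symbol
`|ξ|² + χ` is bounded from below. -/
lemma exists_L2_of_laplacian {φ χ : E3 → ℝ} (hLP : IsLittlewoodPaley φ χ) {u : TDist}
    (h1 : l2 (multD χ u) < ∞) (h2 : l2 (Δ u) < ∞) : ∃ a : L2 ℂ, u = invF a := by
  obtain ⟨f, hf⟩ := exists_of_l2_lt_top h1
  obtain ⟨g, hg⟩ := exists_of_l2_lt_top h2
  set m : E3 → ℝ := fun ξ => ‖ξ‖ ^ 2 + χ ((2 * Real.pi) • ξ) with hm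
  have hχ : (fun ξ : E3 => χ ((2 * Real.pi) • ξ)).HasTemperateGrowth :=
    (hasCompactSupport_comp_smul hLP.supp_ball (by positivity)).hasTemperateGrowth
      (hLP.smooth_ball.comp (by fun_prop))
  have hsq : (fun ξ : E3 => ‖ξ‖ ^ 2).HasTemperateGrowth := by fun_prop
  have hmt : m.HasTemperateGrowth := hsq.add hχ
  have hlow : ∀ ξ, 1 / 100 < m ξ := by
    intro ξ
    have hc := (hLP.range_ball ((2 * Real.pi) • ξ)).1
    by_cases h : ‖(2 * Real.pi) • ξ‖ < 3 / 4
    · simp only [hm, chi_eq_one hLP h]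
      linarith [sq_nonneg ‖ξ‖]
    · -- here `2π|ξ| ≥ 3/4`, so that `|ξ| ≥ 0.11` and `|ξ|² > 1/100`
      rw [not_lt, norm_smul, Real.norm_of_nonneg (by positivity)] at h
      have h3 := Real.pi_lt_d2
      have h4 : 0.11 ≤ ‖ξ‖ := by
        by_contra h5
        rw [not_le] at h5
        nlinarith [Real.pi_pos, norm_nonneg ξ]
      simp only [hm]
      nlinarith
  have hmc := hasTemperateGrowth_ofReal_comp hmt
  have hic := hasTemperateGrowth_ofReal_comp (hasTemperateGrowth_inv hmt hlow)
  -- the multiplier with symbol `|ξ|² + χ` maps `u` to a square integrable function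
  have e1 : TemperedDistribution.fourierMultiplierCLM ℂ (fun ξ => ((m ξ : ℝ) : ℂ)) u =
      invF ((-(2 * Real.pi : ℂ) ^ 2)⁻¹ • g + f) := by
    have e2 : TemperedDistribution.fourierMultiplierCLM ℂ (fun ξ : E3 => ((m ξ : ℝ) : ℂ)) u =
        TemperedDistribution.fourierMultiplierCLM ℂ (fun ξ : E3 => ((‖ξ‖ ^ 2 : ℝ) : ℂ)) u + multD χ u := by
      ext ψ
      rw [multD, add_apply, TemperedDistribution.fourierMultiplierCLM_apply_apply,
        TemperedDistribution.fourierMultiplierCLM_apply_apply,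
        TemperedDistribution.fourierMultiplierCLM_apply_apply, ← map_add, ← FourierTransform.fourier_add]
      congr 2
      ext ξ
      rw [add_apply, SchwartzMap.smulLeftCLM_apply_apply hmc,
        SchwartzMap.smulLeftCLM_apply_apply (hasTemperateGrowth_ofReal_comp hsq),
        SchwartzMap.smulLeftCLM_apply_apply (hasTemperateGrowth_ofReal_comp hχ), ← add_smul]
      simp [hm]
    have e3 : Δ u = (-(2 * Real.pi : ℂ) ^ 2) •
        TemperedDistribution.fourierMultiplierCLM ℂ (fun ξ : E3 => ((‖ξ‖ ^ 2 : ℝ) : ℂ)) u := by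
      rw [TemperedDistribution.laplacian_eq_fourierMultiplierCLM]
      ext ψ
      simp
    have hpi : (-(2 * Real.pi : ℂ) ^ 2) ≠ 0 :=
      neg_ne_zero.2 (pow_ne_zero 2 (mul_ne_zero two_ne_zero (by exact_mod_cast Real.pi_pos.ne')))
    rw [e2, map_add, map_smul, ← hf, ← hg, e3, smul_smul, inv_mul_cancel₀ hpi, one_smul]
  have e4 : u = TemperedDistribution.fourierMultiplierCLM ℂ (fun ξ => (((m ξ)⁻¹ : ℝ) : ℂ))
      (TemperedDistribution.fourierMultiplierCLM ℂ (fun ξ => ((m ξ : ℝ) : ℂ)) u) := by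
    rw [TemperedDistribution.fourierMultiplierCLM_fourierMultiplierCLM_apply hmc hic]
    have : ((fun ξ => ((m ξ : ℝ) : ℂ)) * fun ξ => (((m ξ)⁻¹ : ℝ) : ℂ)) = fun _ => (1 : ℂ) := by
      ext ξ
      have h0 : (0 : ℝ) < m ξ := lt_trans (by norm_num) (hlow ξ)
      rw [Pi.mul_apply, ← Complex.ofReal_mul, mul_inv_cancel₀ h0.ne', Complex.ofReal_one]
    rw [this]
    simp
  rw [e1] at e4
  have hH := (hat_invF ((-(2 * Real.pi : ℂ) ^ 2)⁻¹ • g + f)).mult hic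
  rw [← e4] at hH
  have hmem : MemLp (fun ξ => (((m ξ)⁻¹ : ℝ) : ℂ) * ((-(2 * Real.pi : ℂ) ^ 2)⁻¹ • g + f : L2 ℂ) ξ) 2 volume := by
    refine MemLp.of_le_mul (c := 100) (Lp.memLp ((-(2 * Real.pi : ℂ) ^ 2)⁻¹ • g + f)) hH.aestronglyMeasurable
      (Eventually.of_forall fun ξ => ?_)
    have h0 : (0 : ℝ) < m ξ := lt_trans (by norm_num) (hlow ξ)
    rw [norm_mul, Complex.norm_real, norm_inv, Real.norm_of_nonneg h0.le]
    gcongr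
    rw [inv_le_comm₀ h0 (by norm_num)]
    linarith [hlow ξ]
  exact ⟨_, hH.of_memLp hmem⟩

/-! ### The equation in the Fourier picture -/

/-- The component `i` of an element of `L²(ℝ³; ℂ³)`. -/
def comp (i : Fin 3) : L2 (Cn 3) →L[ℂ] L2 ℂ := mulOp fun _ => EuclideanSpace.proj i

lemma isSymbol_comp (i : Fin 3) : IsSymbol fun _ : E3 => (EuclideanSpace.proj i : Cn 3 →L[ℂ] ℂ) :=
  ⟨stronglyMeasurable_const, _, fun _ => le_rfl⟩

lemma comp_ae (i : Fin 3) (x : L2 (Cn 3)) : ∀ᵐ ξ, comp i x ξ = x ξ i := mulOp_ae (isSymbol_comp i) x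

lemma leftOp_zero_ae (τ : ℝ) (x : L2 (Cn 3)) : ∀ᵐ ξ, leftOp τ 0 x ξ = kap ξ * x ξ 1 := by
  filter_upwards [mulOp_ae (isSymbol_leftRow τ 0) x] with ξ h
  rw [leftOp, h, rowCLM_apply]
  simp [Fin.sum_univ_three, leftRow]

lemma rightOp_zero_ae (τ : ℝ) (x : L2 (Cn 3)) :
    ∀ᵐ ξ, rightOp τ 0 x ξ = (τ : ℂ)⁻¹ * (x ξ 2 - kap ξ * x ξ 1) := by
  filter_upwards [mulOp_ae (isSymbol_rightRow τ 0) x] with ξ h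
  rw [rightOp, h, rowCLM_apply]
  simp [Fin.sum_univ_three, rightRow]
  ring

lemma leftOp_succ_ae (τ : ℝ) (j : Fin 3) (x : L2 (Cn 3)) :
    ∀ᵐ ξ, leftOp τ j.succ x ξ = Complex.I * dir j ξ * (x ξ 0 - τ * rho ξ * x ξ 1) := by
  filter_upwards [mulOp_ae (isSymbol_leftRow τ j.succ) x] with ξ h
  rw [leftOp, h, rowCLM_apply]
  simp [Fin.sum_univ_three, leftRow]
  ring

lemma rightOp_succ_ae (τ : ℝ) (j : Fin 3) (x : L2 (Cn 3)) :
    ∀ᵐ ξ, rightOp τ j.succ x ξ = Complex.I * dir j ξ * rho ξ * x ξ 1 := by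
  filter_upwards [mulOp_ae (isSymbol_rightRow τ j.succ) x] with ξ h
  rw [rightOp, h, rowCLM_apply]
  simp [Fin.sum_univ_three, rightRow]

lemma smul_rightOp_zero {τ : ℝ} (hτ : τ ≠ 0) (x : L2 (Cn 3)) :
    (τ : ℂ) • rightOp τ 0 x = comp 2 x - leftOp τ 0 x := by
  apply Lp.ext
  filter_upwards [Lp.coeFn_smul (τ : ℂ) (rightOp τ 0 x), Lp.coeFn_sub (comp 2 x) (leftOp τ 0 x),
    comp_ae 2 x, leftOp_zero_ae τ x, rightOp_zero_ae τ x] with ξ h1 h2 h3 h4 h5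
  have : (τ : ℂ) ≠ 0 := by exact_mod_cast hτ
  rw [h1, h2, Pi.smul_apply, Pi.sub_apply, h3, h4, h5, smul_eq_mul, mul_inv_cancel_left₀ this]

lemma rad_mul_dir (j : Fin 3) (ξ : E3) : rad ξ * dir j ξ = 2 * Real.pi * ξ j := by
  rw [rad_eq, dir]
  by_cases h : ξ = 0
  · simp [h]
  · have : ‖ξ‖ ≠ 0 := norm_ne_zero_iff.2 h
    field_simp

lemma ofReal_brk_mul_kap (ξ : E3) : (brk ξ : ℂ) * kap ξ = 1 := by
  rw [← Complex.ofReal_mul, kap, mul_inv_cancel₀ (brk_pos ξ).ne', Complex.ofReal_one]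

lemma rho_mul_brk (ξ : E3) : rho ξ * brk ξ = rad ξ := by
  rw [rho, mul_assoc, inv_mul_cancel₀ (brk_pos ξ).ne', mul_one]

section Rep

variable {τ : ℝ} {U : State} {Z : L2 (Cn 3)} {a b c : L2 ℂ}

lemma Rep.leftOp_zero (h : Rep τ U Z a b c) : leftOp τ 0 Z = b := by
  apply Lp.ext
  filter_upwards [leftOp_zero_ae τ Z, h.ae] with ξ h1 h2
  rw [h1, h2.2.1]
  linear_combination (b ξ) * ofReal_brk_mul_kap ξ

lemma Rep.rightOp_zero (hτ : τ ≠ 0) (h : Rep τ U Z a b c) : rightOp τ 0 Z = c := by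
  apply Lp.ext
  filter_upwards [rightOp_zero_ae τ Z, h.ae] with ξ h1 h2
  have ht : (τ : ℂ) ≠ 0 := by exact_mod_cast hτ
  have e : b ξ + τ * c ξ - kap ξ * (brk ξ * b ξ) = τ * c ξ := by
    linear_combination -(b ξ) * ofReal_brk_mul_kap ξ
  rw [h1, h2.2.1, h2.2.2, e, inv_mul_cancel_left₀ ht]

lemma Rep.leftOp_succ (h : Rep τ U Z a b c) (j : Fin 3) :
    ∀ᵐ ξ, leftOp τ j.succ Z ξ = 2 * Real.pi * Complex.I * (ξ j : ℂ) * a ξ := by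
  filter_upwards [leftOp_succ_ae τ j Z, h.ae] with ξ h1 h2
  have e1 : (rho ξ : ℂ) * brk ξ = rad ξ := by exact_mod_cast rho_mul_brk ξ
  have e2 : (rad ξ : ℂ) * dir j ξ = 2 * Real.pi * ξ j := by exact_mod_cast rad_mul_dir j ξ
  rw [h1, h2.1, h2.2.1]
  linear_combination (Complex.I * a ξ) * e2 - (Complex.I * dir j ξ * τ * b ξ) * e1

lemma Rep.rightOp_succ (h : Rep τ U Z a b c) (j : Fin 3) :
    ∀ᵐ ξ, rightOp τ j.succ Z ξ = 2 * Real.pi * Complex.I * (ξ j : ℂ) * b ξ := by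
  filter_upwards [rightOp_succ_ae τ j Z, h.ae] with ξ h1 h2
  have e1 : (rho ξ : ℂ) * brk ξ = rad ξ := by exact_mod_cast rho_mul_brk ξ
  have e2 : (rad ξ : ℂ) * dir j ξ = 2 * Real.pi * ξ j := by exact_mod_cast rad_mul_dir j ξ
  rw [h1, h2.2.1]
  linear_combination (Complex.I * b ξ) * e2 + (Complex.I * dir j ξ * b ξ) * e1

lemma Rep.hat_u (h : Rep τ U Z a b c) : Hat (cu U) a := by
  rw [h.hu]; exact hat_invF a

lemma fourier_eq_of_coe {g : L2 ℂ} {f : L2 ℂ} (h : (g : TDist) = invF f) : (𝓕 g : L2 ℂ) = f :=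
  invF_injective (by rw [← coe_eq_invF, h])

lemma exists_coe_eq_invF (f : L2 ℂ) : ∃ g : L2 ℂ, (g : TDist) = invF f := ⟨𝓕⁻ f, (invF_eq_coe f).symm⟩

lemma Rep.grad_u (h : Rep τ U Z a b c) (j : Fin 3) : grad (cu U) j = invF (leftOp τ j.succ Z) :=
  ((h.hat_u.grad j).ae_eq_iff (hat_invF _)).2 (by
    filter_upwards [h.leftOp_succ j] with ξ e using e.symm)

lemma Rep.grad_v (h : Rep τ U Z a b c) (j : Fin 3) : grad (cv U) j = invF (rightOp τ j.succ Z) :=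
  ((h.hat_v.grad j).ae_eq_iff (hat_invF _)).2 (by
    filter_upwards [h.rightOp_succ j] with ξ e using e.symm)

lemma integrable_schwartz_mul_mul (ψ : 𝓢(E3, ℂ)) (f g : L2 ℂ) : Integrable fun x => ψ x * (f x * g x) := by
  have := (memLp_schwartz_mul ψ f).integrable_mul (Lp.memLp g)
  refine this.congr (Eventually.of_forall fun x => ?_)
  simp only [Pi.mul_apply]
  ring

/-- The quadratic terms of the equation, in the Fourier picture. -/
lemma integral_quadratic (τ κ : ℝ) (x : L2 (Cn 3)) {v w : L2 ℂ} {gu gv : Fin 3 → L2 ℂ}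
    (hv : (𝓕 v : L2 ℂ) = leftOp τ 0 x) (hw : (𝓕 w : L2 ℂ) = rightOp τ 0 x)
    (hgu : ∀ j, (𝓕 (gu j) : L2 ℂ) = leftOp τ j.succ x)
    (hgv : ∀ j, (𝓕 (gv j) : L2 ℂ) = rightOp τ j.succ x) (ψ : 𝓢(E3, ℂ)) :
    ∫ y, ψ y * ((κ : ℂ) * (v y * w y) + 2 * ∑ j, gu j y * gv j y) =
      ∫ ξ, (𝓕⁻ ψ : 𝓢(E3, ℂ)) ξ * quadHat τ κ x ξ := by
  have i1 := integrable_schwartz_mul_mul ψ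
  have i2 := integrable_mul_conv (𝓕⁻ ψ : 𝓢(E3, ℂ)).integrable
  calc _ = ∫ y, ((κ : ℂ) * (ψ y * (v y * w y)) + ∑ j, 2 * (ψ y * (gu j y * gv j y))) := by
        congr 1
        ext y
        simp only [mul_add, Finset.mul_sum]
        congr 1
        · ring
        · exact Finset.sum_congr rfl fun j _ => by ring
    _ = (κ : ℂ) * (∫ y, ψ y * (v y * w y)) + ∑ j, 2 * ∫ y, ψ y * (gu j y * gv j y) := by
        rw [integral_add ((i1 v w).const_mul _) (integrable_finsetSum _ fun j _ => (i1 _ _).const_mul _),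
          integral_const_mul, integral_finsetSum _ fun j _ => (i1 _ _).const_mul _]
        simp only [integral_const_mul]
    _ = ∑ i : Fin 4, prodCoef κ i * ∫ ξ, (𝓕⁻ ψ : 𝓢(E3, ℂ)) ξ * conv (leftOp τ i x) (rightOp τ i x) ξ := by
        rw [Fin.sum_univ_succ (n := 3)]
        simp only [integral_mul_mul, hv, hw, hgu, hgv]
        rfl
    _ = _ := by
        simp only [quadHat, Finset.mul_sum]
        rw [integral_finsetSum _ fun i _ => ?_]
        · refine Finset.sum_congr rfl fun i _ => ?_
          rw [← integral_const_mul]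
          congr 1
          ext ξ
          ring
        · refine ((i2 (leftOp τ i x) (rightOp τ i x)).const_mul (prodCoef κ i)).congr
            (Eventually.of_forall fun ξ => ?_)
          ring

lemma integrable_quadHat (τ κ : ℝ) (x : L2 (Cn 3)) (ψ : 𝓢(E3, ℂ)) :
    Integrable fun ξ => (𝓕⁻ ψ : 𝓢(E3, ℂ)) ξ * quadHat τ κ x ξ := by
  simp only [quadHat, Finset.mul_sum]
  refine integrable_finsetSum _ fun i _ => ?_
  refine ((integrable_mul_conv (𝓕⁻ ψ : 𝓢(E3, ℂ)).integrable (leftOp τ i x) (rightOp τ i x)).const_mul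
    (prodCoef κ i)).congr (Eventually.of_forall fun ξ => ?_)
  ring

lemma integrable_schwartz_mul (ψ : 𝓢(E3, ℂ)) (f : L2 ℂ) : Integrable fun ξ => ψ ξ * f ξ :=
  (ψ.memLp 2 volume).integrable_mul (Lp.memLp f)

section Evol

variable {β κ : ℝ}

lemma evol_zero_ae (hτ : 0 < τ) (hγ : 0 < β - τ) {x : L2 (Cn 3)} (hx : wNorm 5 x ≠ ∞) :
    ∀ᵐ ξ, evol τ (β - τ) κ x ξ 0 = rad ξ * x ξ 2 ∧
      evol τ (β - τ) κ x ξ 1 = (τ : ℂ)⁻¹ * (brk ξ * x ξ 2 - x ξ 1) ∧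
      evol τ (β - τ) κ x ξ 2 = -(rad ξ * x ξ 0) - (β - τ) * rad ξ * rho ξ * x ξ 1 + quadHat τ κ x ξ := by
  filter_upwards [evol_ae κ hτ hγ hx] with ξ h
  rw [h]
  have e1 : (rho ξ : ℂ) * brk ξ = rad ξ := by exact_mod_cast rho_mul_brk ξ
  simp only [PiLp.add_apply, matCLM_apply, Fin.sum_univ_three, toC, genMat, lastCLM]
  simp
  refine ⟨?_, ?_, ?_⟩
  · exact Or.inl e1
  · ring
  · rw [← e1]; ring

/-- The equation `v_t = w` is contained in the first-order system. -/
lemma leftOp_zero_evol (hτ : 0 < τ) (hγ : 0 < β - τ) {x : L2 (Cn 3)} (hx : wNorm 5 x ≠ ∞) :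
    leftOp τ 0 (evol τ (β - τ) κ x) = rightOp τ 0 x := by
  apply Lp.ext
  filter_upwards [leftOp_zero_ae τ (evol τ (β - τ) κ x), rightOp_zero_ae τ x, evol_zero_ae hτ hγ hx]
    with ξ h1 h2 h3
  rw [h1, h2, h3.2.1]
  linear_combination ((τ : ℂ)⁻¹ * x ξ 2) * ofReal_brk_mul_kap ξ

/-- The time derivative of a state in the Fourier picture. -/
lemma rep_evol (hτ : 0 < τ) (hγ : 0 < β - τ) {x : L2 (Cn 3)} (hx : wNorm 5 x ≠ ∞) :
    Rep τ (invF (leftOp τ 0 x), invF (rightOp τ 0 x), invF (rightOp τ 0 (evol τ (β - τ) κ x)))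
      (evol τ (β - τ) κ x) (leftOp τ 0 x) (rightOp τ 0 x) (rightOp τ 0 (evol τ (β - τ) κ x)) := by
  refine ⟨rfl, rfl, rfl, ?_⟩
  have hlz := leftOp_zero_ae τ (evol τ (β - τ) κ x)
  rw [leftOp_zero_evol hτ hγ hx] at hlz
  filter_upwards [leftOp_zero_ae τ x, rightOp_zero_ae τ x, evol_zero_ae (κ := κ) hτ hγ hx, hlz,
    rightOp_zero_ae τ (evol τ (β - τ) κ x)] with ξ h0 h1 h2 h3 h4
  have ht : (τ : ℂ) ≠ 0 := by exact_mod_cast hτ.ne'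
  refine ⟨?_, ?_, ?_⟩
  · rw [h2.1, h0, h1, mul_inv_cancel_left₀ ht]
    ring
  · rw [h3]
    linear_combination -(evol τ (β - τ) κ x ξ 1) * ofReal_brk_mul_kap ξ
  · rw [h4, h3, mul_inv_cancel_left₀ ht]
    ring

/-- The right-hand side of the third equation in the Fourier picture. -/
lemma Rep.third_equation (hτ : 0 < τ) (hγ : 0 < β - τ) (h : Rep τ U Z a b c) (hZ : wNorm 5 Z ≠ ∞)
    {v w : L2 ℂ} {gu gv : Fin 3 → L2 ℂ} (hv : (v : TDist) = cv U) (hw : (w : TDist) = cw U)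
    (hgu : ∀ j, (gu j : TDist) = grad (cu U) j) (hgv : ∀ j, (gv j : TDist) = grad (cv U) j)
    (ψ : 𝓢(E3, ℂ)) :
    (Δ (cu U) + (β : ℂ) • Δ (cv U) - cw U) ψ +
        ∫ x, ψ x * ((κ : ℂ) * (v x * w x) + 2 * ∑ j, gu j x * gv j x) =
      invF (comp 2 (evol τ (β - τ) κ Z) - c) ψ := by
  rw [integral_quadratic τ κ Z
    (by rw [h.leftOp_zero]; exact fourier_eq_of_coe (hv.trans h.hv))
    (by rw [h.rightOp_zero hτ.ne']; exact fourier_eq_of_coe (hw.trans h.hw))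
    (fun j => fourier_eq_of_coe ((hgu j).trans (h.grad_u j)))
    (fun j => fourier_eq_of_coe ((hgv j).trans (h.grad_v j)))]
  have e1 : Δ (cu U) + (β : ℂ) • Δ (cv U) = Δ (invF a + (β : ℂ) • invF b) := by
    rw [h.hu, h.hv]
    simp only [TemperedDistribution.laplacian_eq_fourierMultiplierCLM, map_add, map_smul, smul_add]
    rw [smul_comm]
  rw [e1, h.hw, sub_apply, (hat_add_smul β a b).laplacian.apply ψ, map_sub, sub_apply]
  have e2 : ∀ᵐ ξ, (𝓕⁻ ψ : 𝓢(E3, ℂ)) ξ * -((rad ξ : ℂ) ^ 2 * (a ξ + β * b ξ)) =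
      (𝓕⁻ ψ : 𝓢(E3, ℂ)) ξ * comp 2 (evol τ (β - τ) κ Z) ξ -
        (𝓕⁻ ψ : 𝓢(E3, ℂ)) ξ * quadHat τ κ Z ξ := by
    filter_upwards [h.ae, evol_zero_ae (κ := κ) hτ hγ hZ, comp_ae 2 (evol τ (β - τ) κ Z)]
      with ξ h1 h2 h3
    have e1 : (rho ξ : ℂ) * brk ξ = rad ξ := by exact_mod_cast rho_mul_brk ξ
    rw [h3, h2.2.2, h1.1, h1.2.1]
    linear_combination ((𝓕⁻ ψ : 𝓢(E3, ℂ)) ξ * (β - τ) * rad ξ * b ξ) * e1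
  rw [integral_congr_ae e2, integral_sub (integrable_schwartz_mul _ _) (integrable_quadHat τ κ Z ψ),
    ← invF_apply]
  ring

end Evol

end Rep

/-! ### The Fourier picture on the blocks -/

/-- The multiplier with symbol `chi k ξ * m ξ`, with values in the component `i` of `ℂ³`. -/
def blkOp (k : ℕ) (m : E3 → ℝ) (i : Fin 3) : L2 ℂ →L[ℂ] L2 (Cn 3) :=
  mulOp fun ξ => (chi k ξ * (m ξ : ℂ)) •
    ContinuousLinearMap.toSpanSingleton ℂ (EuclideanSpace.single i (1 : ℂ) : Cn 3)

lemma blkOp_ae {k : ℕ} {m : E3 → ℝ} (hm : Measurable m) {C : ℝ} (hC : ∀ ξ ∈ blk k, ‖m ξ‖ ≤ C) (i : Fin 3)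
    (f : L2 ℂ) : ∀ᵐ ξ, blkOp k m i f ξ = EuclideanSpace.single i (chi k ξ * m ξ * f ξ) := by
  have hs : IsSymbol fun ξ => (chi k ξ * (m ξ : ℂ)) •
      ContinuousLinearMap.toSpanSingleton ℂ (EuclideanSpace.single i (1 : ℂ) : Cn 3) := by
    refine IsSymbol.smul_const ((measurable_chi k).mul hm.complex_ofReal) (C := max C 0) (fun ξ => ?_) _
    change ‖chi k ξ * (m ξ : ℂ)‖ ≤ _
    by_cases h : ξ ∈ blk k
    · rw [chi_of_mem h, one_mul, Complex.norm_real]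
      exact (hC ξ h).trans (le_max_left _ _)
    · simp [chi_of_notMem h]
  filter_upwards [mulOp_ae hs f] with ξ h
  rw [blkOp, h]
  ext j
  by_cases hj : j = i
  · subst hj
    simp
  · simp [hj]

/-- The block `k` of the Fourier picture, as a function of the Fourier transforms of `u, v, w`. Unlike
the Fourier picture itself, which needs one derivative in `L²`, it is a bounded operator. -/
def blkMap (τ : ℝ) (k : ℕ) : L2 ℂ × L2 ℂ × L2 ℂ →L[ℂ] L2 (Cn 3) :=
  (blkOp k rad 0).comp (.fst ℂ _ _ + (τ : ℂ) • (ContinuousLinearMap.fst ℂ _ _).comp (.snd ℂ _ _)) +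
    (blkOp k brk 1).comp ((ContinuousLinearMap.fst ℂ _ _).comp (.snd ℂ _ _)) +
    (blkOp k (fun _ => 1) 2).comp ((ContinuousLinearMap.fst ℂ _ _).comp (.snd ℂ _ _) +
      (τ : ℂ) • (ContinuousLinearMap.snd ℂ _ _).comp (.snd ℂ _ _))

lemma blkMap_ae (τ : ℝ) (k : ℕ) (a b c : L2 ℂ) : ∀ᵐ ξ, blkMap τ k (a, b, c) ξ =
    chi k ξ • !₂[(rad ξ : ℂ) * (a ξ + τ * b ξ), (brk ξ : ℂ) * b ξ, b ξ + τ * c ξ] := by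
  have e : blkMap τ k (a, b, c) = blkOp k rad 0 (a + (τ : ℂ) • b) + blkOp k brk 1 b +
      blkOp k (fun _ => 1) 2 (b + (τ : ℂ) • c) := rfl
  have h0 := blkOp_ae (k := k) (m := rad) continuous_rad.measurable (C := 2 ^ k) (fun ξ h => by
    rw [Real.norm_of_nonneg (rad_nonneg ξ)]; exact h.1.le) 0 (a + (τ : ℂ) • b)
  have h1 := blkOp_ae (k := k) (m := brk) continuous_brk.measurable (C := 1 + 2 ^ k) (fun ξ h => by
    rw [Real.norm_of_nonneg (brk_pos ξ).le]; exact brk_le_of_mem_blk h) 1 b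
  have h2 := blkOp_ae (k := k) (m := fun _ => 1) measurable_const (C := 1) (fun ξ h => by simp) 2
    (b + (τ : ℂ) • c)
  filter_upwards [h0, h1, h2, Lp.coeFn_add (blkOp k rad 0 (a + (τ : ℂ) • b) + blkOp k brk 1 b)
      (blkOp k (fun _ => 1) 2 (b + (τ : ℂ) • c)),
    Lp.coeFn_add (blkOp k rad 0 (a + (τ : ℂ) • b)) (blkOp k brk 1 b), Lp.coeFn_add a ((τ : ℂ) • b),
    Lp.coeFn_add b ((τ : ℂ) • c), Lp.coeFn_smul (τ : ℂ) b, Lp.coeFn_smul (τ : ℂ) c]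
    with ξ h0 h1 h2 h3 h4 h5 h6 h7 h8
  rw [e, h3, Pi.add_apply, h4, Pi.add_apply, h0, h1, h2, h5, h6, Pi.add_apply, Pi.add_apply, h7, h8]
  ext i
  fin_cases i
  · simp; ring
  · simp; ring
  · simp

lemma Rep.proj_eq {τ : ℝ} {U : State} {Z : L2 (Cn 3)} {a b c : L2 ℂ} (h : Rep τ U Z a b c) (k : ℕ) :
    proj k Z = blkMap τ k (a, b, c) := by
  apply Lp.ext
  filter_upwards [proj_ae k Z, blkMap_ae τ k a b c, h.ae] with ξ h1 h2 h3
  rw [h1, h2]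
  congr 1
  ext i
  fin_cases i
  · simpa using h3.1
  · simpa using h3.2.1
  · simpa using h3.2.2

/-- The relation between a state and its Fourier picture may be checked on the blocks. -/
lemma Rep.of_proj {τ : ℝ} {Z : L2 (Cn 3)} {a b c : L2 ℂ} (h : ∀ k, proj k Z = blkMap τ k (a, b, c)) :
    Rep τ (invF a, invF b, invF c) Z a b c := by
  refine ⟨rfl, rfl, rfl, ?_⟩
  filter_upwards [ae_proj_of_mem Z, ae_all_iff.2 fun k => blkMap_ae τ k a b c] with ξ h1 h2
  obtain ⟨k, hk⟩ := exists_mem_blk ξ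
  have h3 := h2 k
  rw [← h, h1 k hk, chi_of_mem hk, one_smul] at h3
  rw [h3]
  simp

/-! ### Trajectories -/

/-- The states `U t` have the Fourier picture `Z t`, which has finite norm and solves the evolution
equation strongly in `L²`. As `|D|` has no bounded inverse, the equation `u_t = v` for the Fourier
transforms `a, b` of `u, v` in `L²` is a separate condition. The equation `v_t = w` is a consequence. -/
structure IsTrajectory (τ β κ : ℝ) (U : ℝ → State) (Z : ℝ → L2 (Cn 3)) (a b c : ℝ → L2 ℂ) : Prop where
  finite : ∀ t, 0 ≤ t → wNorm 5 (Z t) ≠ ∞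
  rep : ∀ t, 0 ≤ t → Rep τ (U t) (Z t) (a t) (b t) (c t)
  deriv : ∀ t, 0 ≤ t → HasDerivWithinAt Z (evol τ (β - τ) κ (Z t)) (Set.Ici 0) t
  deriv_u : ∀ t, 0 ≤ t → HasDerivWithinAt a (b t) (Set.Ici 0) t

lemma hasDerivWithinAt_clm {E F : Type*} [NormedAddCommGroup E] [NormedSpace ℂ E] [NormedAddCommGroup F]
    [NormedSpace ℂ F] (L : E →L[ℂ] F) {f : ℝ → E} {f' : E} {s : Set ℝ} {t : ℝ} (h : HasDerivWithinAt f f' s t) :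
    HasDerivWithinAt (fun r => L (f r)) (L f') s t :=
  (L.restrictScalars ℝ).hasFDerivAt.comp_hasDerivWithinAt t h

section Solution

variable {τ β κ : ℝ} {U : ℝ → State} {Z : ℝ → L2 (Cn 3)} {a b c : ℝ → L2 ℂ}

lemma IsTrajectory.deriv_v (hτ : 0 < τ) (hγ : 0 < β - τ) (h : IsTrajectory τ β κ U Z a b c) {t : ℝ}
    (ht : 0 ≤ t) : HasDerivWithinAt b (c t) (Set.Ici 0) t := by
  have h1 := hasDerivWithinAt_clm (leftOp τ 0) (h.deriv t ht)
  rw [leftOp_zero_evol hτ hγ (h.finite t ht), (h.rep t ht).rightOp_zero hτ.ne'] at h1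
  exact h1.congr_of_mem (fun s hs => ((h.rep s hs).leftOp_zero).symm) ht

lemma IsTrajectory.deriv_w (hτ : 0 < τ) (hγ : 0 < β - τ) (h : IsTrajectory τ β κ U Z a b c) {t : ℝ}
    (ht : 0 ≤ t) : HasDerivWithinAt (fun r => (τ : ℂ) • c r)
      (comp 2 (evol τ (β - τ) κ (Z t)) - c t) (Set.Ici 0) t := by
  have h1 := (hasDerivWithinAt_clm (comp 2) (h.deriv t ht)).sub (h.deriv_v hτ hγ ht)
  refine h1.congr_of_mem (fun s hs => ?_) ht
  rw [← (h.rep s hs).rightOp_zero hτ.ne', smul_rightOp_zero hτ.ne', (h.rep s hs).leftOp_zero]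
  rfl

/-- A trajectory with real-valued components is a solution in the sense of tempered distributions. -/
lemma IsTrajectory.isSolution {B A : ℝ} (hτ : 0 < τ) (hγ : 0 < β - τ) (hκ : κ = B / A)
    (h : IsTrajectory τ β κ U Z a b c) (hr : ∀ t, 0 ≤ t → flipConj conj1 (a t) = a t ∧
      flipConj conj1 (b t) = b t ∧ flipConj conj1 (c t) = c t) : IsSolution τ β A B (U 0) U := by
  have hu : ∀ ψ : 𝓢(E3, ℂ), ∀ s, 0 ≤ s → cu (U s) ψ = pairCLM ψ (a s) := fun ψ s hs => by
    rw [(h.rep s hs).hu]; rfl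
  have hv : ∀ ψ : 𝓢(E3, ℂ), ∀ s, 0 ≤ s → cv (U s) ψ = pairCLM ψ (b s) := fun ψ s hs => by
    rw [(h.rep s hs).hv]; rfl
  have hw : ∀ ψ : 𝓢(E3, ℂ), ∀ s, 0 ≤ s → cw (U s) ψ = pairCLM ψ (c s) := fun ψ s hs => by
    rw [(h.rep s hs).hw]; rfl
  refine ⟨fun t ht => ?_, rfl, fun t ht ψ => ?_, fun t ht ψ => ?_, fun t ht => ?_⟩
  · obtain ⟨h1, h2, h3⟩ := hr t ht
    rw [(h.rep t ht).hu, (h.rep t ht).hv, (h.rep t ht).hw]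
    exact ⟨(isReal_invF_iff _).2 h1, (isReal_invF_iff _).2 h2, (isReal_invF_iff _).2 h3⟩
  · have := hasDerivWithinAt_clm (pairCLM ψ) (h.deriv_u t ht)
    rw [← hv ψ t ht] at this
    exact this.congr_of_mem (fun s hs => hu ψ s hs) ht
  · have := hasDerivWithinAt_clm (pairCLM ψ) (h.deriv_v hτ hγ ht)
    rw [← hw ψ t ht] at this
    exact this.congr_of_mem (fun s hs => hv ψ s hs) ht
  · have hR := h.rep t ht
    obtain ⟨v, ev⟩ := exists_coe_eq_invF (b t)
    obtain ⟨w, ew⟩ := exists_coe_eq_invF (c t)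
    choose gu egu using fun j : Fin 3 => exists_coe_eq_invF (leftOp τ j.succ (Z t))
    choose gv egv using fun j : Fin 3 => exists_coe_eq_invF (rightOp τ j.succ (Z t))
    have hv' := ev.trans hR.hv.symm
    have hw' := ew.trans hR.hw.symm
    have hgu := fun j => (egu j).trans (hR.grad_u j).symm
    have hgv := fun j => (egv j).trans (hR.grad_v j).symm
    refine ⟨v, w, gu, gv, hv', hw', hgu, hgv, fun ψ => ?_⟩
    have e := hR.third_equation (κ := κ) hτ hγ (h.finite t ht) hv' hw' hgu hgv ψ
    rw [hκ] at e
    rw [e]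
    have := hasDerivWithinAt_clm (pairCLM ψ) (h.deriv_w hτ hγ ht)
    rw [hκ] at this
    refine this.congr_of_mem (fun s hs => ?_) ht
    rw [hw ψ s hs, map_smul, smul_eq_mul]

end Solution

/-! ### Real-valued solutions -/

section Real

variable {τ γ : ℝ}

lemma conjn_matCLM {m n : ℕ} {M M' : Fin m → Fin n → ℂ} (h : ∀ i j, (starRingEnd ℂ) (M i j) = M' i j) (z : Cn n) :
    conjn m (matCLM M z) = matCLM M' (conjn n z) := by
  ext i
  simp [conjn_apply, matCLM_apply, h]

lemma conj1_rowCLM {n : ℕ} {R R' : Fin n → ℂ} (h : ∀ j, (starRingEnd ℂ) (R j) = R' j) (z : Cn n) :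
    conj1 (rowCLM R z) = rowCLM R' (conjn n z) := by
  simp [conj1_apply, conjn_apply, rowCLM_apply, h]

lemma flipConj_gen (k : ℕ) (x : L2 (Cn 3)) : flipConj (conjn 3) (mulOp (genSym τ γ k) x) =
    mulOp (genSym τ γ k) (flipConj (conjn 3) x) := by
  refine flipConj_mulOp (isSymbol_genSym τ γ k) (fun ξ z => conjn_matCLM (fun i j => ?_) z) x
  rw [map_mul, toC, Complex.conj_ofReal, chi_neg, conj_chi, rho_neg, brk_neg]
  rfl

lemma flipConj_proj {V : Type*} [NormedAddCommGroup V] [NormedSpace ℂ V] {c : V →L[ℝ] V}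
    (hc : ∀ (s : ℂ) (z : V), c (s • z) = (starRingEnd ℂ) s • c z) (k : ℕ) (x : L2 V) :
    flipConj c (proj k x) = proj k (flipConj c x) := by
  refine flipConj_mulOp (isSymbol_chiSym k) (fun ξ z => ?_) x
  simp only [chiSym, smul_apply, ContinuousLinearMap.id_apply, hc, conj_chi, chi_neg]

lemma conjn_smul {n : ℕ} (s : ℂ) (z : Cn n) : conjn n (s • z) = (starRingEnd ℂ) s • conjn n z := by
  ext i
  simp [conjn_apply]

lemma flipConj_leftOp (i : Fin 4) (x : L2 (Cn 3)) :
    flipConj conj1 (leftOp τ i x) = leftOp τ i (flipConj (conjn 3) x) := by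
  refine flipConj_mulOp (isSymbol_leftRow τ i) (fun ξ z => conj1_rowCLM (fun j => ?_) z) x
  refine Fin.cases ?_ (fun l => ?_) i <;> fin_cases j <;>
    simp [leftRow, dir_neg, kap_neg, rho_neg]

lemma flipConj_rightOp (i : Fin 4) (x : L2 (Cn 3)) :
    flipConj conj1 (rightOp τ i x) = rightOp τ i (flipConj (conjn 3) x) := by
  refine flipConj_mulOp (isSymbol_rightRow τ i) (fun ξ z => conj1_rowCLM (fun j => ?_) z) x
  refine Fin.cases ?_ (fun l => ?_) i <;> fin_cases j <;>
    simp [rightRow, dir_neg, kap_neg, rho_neg]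

lemma flipConj_real_smul {V : Type*} [NormedAddCommGroup V] [NormedSpace ℂ V] (c : V →L[ℝ] V) (s : ℝ)
    (f : L2 V) : flipConj c ((s : ℂ) • f) = (s : ℂ) • flipConj c f := by
  have e : ∀ f : L2 V, (s : ℂ) • f = s • f := fun f => by
    apply Lp.ext
    filter_upwards [Lp.coeFn_smul (s : ℂ) f, Lp.coeFn_smul s f] with ξ h1 h2
    rw [h1, h2, Pi.smul_apply, Pi.smul_apply, Complex.coe_smul]
  rw [e, e, map_smul]

lemma prodCoef_eq_ofReal (κ : ℝ) (i : Fin 4) : ∃ s : ℝ, prodCoef κ i = s := by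
  refine Fin.cases ⟨κ, rfl⟩ (fun j => ⟨2, ?_⟩) i
  simp [prodCoef]

lemma flipConj_nonlin (κ : ℝ) (l : ℕ) (x y : L2 (Cn 3)) : flipConj (conjn 3) (nonlin τ κ l x y) =
    nonlin τ κ l (flipConj (conjn 3) x) (flipConj (conjn 3) y) := by
  rw [nonlin_apply, nonlin_apply, flipConj_mulOp (c := conj1) isSymbol_lastCLM (fun ξ z => ?_)]
  · rw [quadBlk_apply, quadBlk_apply, map_sum]
    congr 1
    refine Finset.sum_congr rfl fun i _ => ?_
    obtain ⟨s, hs⟩ := prodCoef_eq_ofReal κ i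
    rw [hs, flipConj_real_smul, flipConj_convBlk, flipConj_leftOp, flipConj_rightOp]
  · ext i
    fin_cases i <;> simp [lastCLM, conjn_apply, conj1_apply]

lemma enorm_flipConj_le (x : L2 (Cn 3)) : ‖flipConj (conjn 3) x‖ₑ ≤ ‖x‖ₑ := by
  have h : ‖flipConj (conjn 3) x‖ = ‖(conjn 3).compLp x‖ :=
    (Lp.compMeasurePreservingₗᵢ ℝ (fun ξ : E3 => -ξ)
      (Measure.measurePreserving_neg (volume : Measure E3))).norm_map _
  refine enorm_le_iff_norm_le.2 (h.le.trans ?_)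
  have h2 : ‖(conjn 3).compLp x‖ ≤ 1 * ‖x‖ := by
    refine Lp.norm_le_mul_norm_of_ae_le_mul ?_
    filter_upwards [(conjn 3).coeFn_compLp x] with ξ h3
    rw [h3, one_mul, EuclideanSpace.norm_eq, EuclideanSpace.norm_eq]
    simp [conjn_apply]
  rwa [one_mul] at h2

lemma wNorm_flipConj_le (n : ℕ) (x : L2 (Cn 3)) : wNorm n (flipConj (conjn 3) x) ≤ wNorm n x := by
  refine ENNReal.tsum_le_tsum fun k => ?_
  rw [← flipConj_proj conjn_smul]
  exact mul_le_mul_right (enorm_flipConj_le _) _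

/-- The system is invariant under reflection and complex conjugation. -/
lemma solves_flipConj {κ : ℝ} (hτ : 0 < τ) (hγ : 0 < γ) {Z : ℝ → L2 (Cn 3)}
    (h : (sys κ hτ hγ).Solves Z fun k t => (sys κ hτ hγ).N k (Z t) (Z t)) :
    (sys κ hτ hγ).Solves (fun t => flipConj (conjn 3) (Z t)) fun k t =>
      (sys κ hτ hγ).N k (flipConj (conjn 3) (Z t)) (flipConj (conjn 3) (Z t)) := by
  intro k t ht
  have h1 := (flipConj (conjn 3)).hasFDerivAt.comp_hasDerivWithinAt t (h k t ht)
  have e1 : ∀ x, flipConj (conjn 3) ((sys κ hτ hγ).P k x) = (sys κ hτ hγ).P k (flipConj (conjn 3) x) :=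
    flipConj_proj conjn_smul k
  have e2 : ∀ x, flipConj (conjn 3) ((sys κ hτ hγ).A k x) = (sys κ hτ hγ).A k (flipConj (conjn 3) x) :=
    flipConj_gen k
  have e3 : ∀ x, flipConj (conjn 3) ((sys κ hτ hγ).N k x x) =
      (sys κ hτ hγ).N k (flipConj (conjn 3) x) (flipConj (conjn 3) x) := fun x => flipConj_nonlin κ k x x
  rw [map_add, e2, e3] at h1
  refine h1.congr_of_mem (fun s _ => ?_) ht
  exact (e1 _).symm

lemma Rep.flipConj_eq {U : State} {Z : L2 (Cn 3)} {a b c : L2 ℂ} (h : Rep τ U Z a b c)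
    (ha : flipConj conj1 a = a) (hb : flipConj conj1 b = b) (hc : flipConj conj1 c = c) :
    flipConj (conjn 3) Z = Z := by
  have hn := (Measure.measurePreserving_neg (volume : Measure E3)).quasiMeasurePreserving.ae h.ae
  apply Lp.ext
  have ea := flipConj_ae conj1 a
  have eb := flipConj_ae conj1 b
  have ec := flipConj_ae conj1 c
  rw [ha] at ea
  rw [hb] at eb
  rw [hc] at ec
  filter_upwards [h.ae, hn, ea, eb, ec, flipConj_ae (conjn 3) Z] with ξ h1 h2 ea eb ec h3
  rw [h3]
  ext i
  rw [conjn_apply]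
  fin_cases i
  · change (starRingEnd ℂ) (Z (-ξ) 0) = Z ξ 0
    rw [h1.1, h2.1, ea, eb]
    simp [conj1_apply, rad_neg]
  · change (starRingEnd ℂ) (Z (-ξ) 1) = Z ξ 1
    rw [h1.2.1, h2.2.1, eb]
    simp [conj1_apply, brk_neg]
  · change (starRingEnd ℂ) (Z (-ξ) 2) = Z ξ 2
    rw [h1.2.2, h2.2.2, eb, ec]
    simp [conj1_apply]

end Real

/-! ### Trajectories of the Fourier picture -/

lemma eq_of_hasDerivWithinAt {E : Type*} [NormedAddCommGroup E] [NormedSpace ℝ E] {f g f' : ℝ → E}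
    (hf : ∀ t, 0 ≤ t → HasDerivWithinAt f (f' t) (Set.Ici 0) t)
    (hg : ∀ t, 0 ≤ t → HasDerivWithinAt g (f' t) (Set.Ici 0) t) (h0 : f 0 = g 0) {t : ℝ} (ht : 0 ≤ t) :
    f t = g t :=
  eq_of_has_deriv_right_eq (a := 0) (b := t)
    (fun x hx => (hf x hx.1).mono (Set.Ici_subset_Ici.2 hx.1))
    (fun x hx => (hg x hx.1).mono (Set.Ici_subset_Ici.2 hx.1))
    (fun x hx => (hf x hx.1).continuousWithinAt.mono Set.Icc_subset_Ici_self)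
    (fun x hx => (hg x hx.1).continuousWithinAt.mono Set.Icc_subset_Ici_self) h0 t ⟨ht, le_rfl⟩

lemma hasDerivWithinAt_blkMap (τ : ℝ) (k : ℕ) {a b c : ℝ → L2 ℂ} {a' b' c' : L2 ℂ} {s : Set ℝ} {t : ℝ}
    (ha : HasDerivWithinAt a a' s t) (hb : HasDerivWithinAt b b' s t) (hc : HasDerivWithinAt c c' s t) :
    HasDerivWithinAt (fun r => blkMap τ k (a r, b r, c r)) (blkMap τ k (a', b', c')) s t :=
  hasDerivWithinAt_clm (blkMap τ k) (ha.prodMk (hb.prodMk hc))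

section Trajectory

variable {τ β κ : ℝ} {Z : ℝ → L2 (Cn 3)}

/-- A solution of the first-order system is a trajectory, once `u` is recovered by integration in
time: both sides of `Rep` have the same time derivative on every block. -/
lemma isTrajectory_of_evol (hτ : 0 < τ) (hγ : 0 < β - τ) {U₀ : State} {a₀ b₀ c₀ : L2 ℂ}
    (h0 : Rep τ U₀ (Z 0) a₀ b₀ c₀) (hX : ∀ t, 0 ≤ t → wNorm 5 (Z t) ≠ ∞)
    (hd : ∀ t, 0 ≤ t → HasDerivWithinAt Z (evol τ (β - τ) κ (Z t)) (Set.Ici 0) t) {a : ℝ → L2 ℂ}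
    (ha : ∀ t, 0 ≤ t → HasDerivWithinAt a (leftOp τ 0 (Z t)) (Set.Ici 0) t) (ha0 : a 0 = a₀) :
    IsTrajectory τ β κ
      (fun t => (invF (a t), invF (leftOp τ 0 (Z t)), invF (rightOp τ 0 (Z t)))) Z a
      (fun t => leftOp τ 0 (Z t)) (fun t => rightOp τ 0 (Z t)) := by
  refine ⟨hX, fun t ht => Rep.of_proj fun k => ?_, hd, ha⟩
  refine eq_of_hasDerivWithinAt (f' := fun t => proj k (evol τ (β - τ) κ (Z t)))
    (f := fun t => proj k (Z t))
    (g := fun t => blkMap τ k (a t, leftOp τ 0 (Z t), rightOp τ 0 (Z t)))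
    (fun s hs => hasDerivWithinAt_clm (proj k) (hd s hs)) (fun s hs => ?_) ?_ ht
  · rw [(rep_evol hτ hγ (hX s hs)).proj_eq k]
    have h1 := hasDerivWithinAt_clm (leftOp τ 0) (hd s hs)
    rw [leftOp_zero_evol hτ hγ (hX s hs)] at h1
    exact hasDerivWithinAt_blkMap τ k (ha s hs) h1 (hasDerivWithinAt_clm (rightOp τ 0) (hd s hs))
  · rw [h0.proj_eq k, ha0, h0.leftOp_zero, h0.rightOp_zero hτ.ne']

end Trajectory

/-! ### Uniqueness -/

section Unique

/-- A function continuous with respect to `wNorm n` is bounded on compact intervals. -/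
lemma exists_bound_wNorm {n : ℕ} {Z : ℝ → L2 (Cn 3)} (hX : ∀ t, 0 ≤ t → wNorm n (Z t) ≠ ∞)
    (hc : ∀ t, 0 ≤ t → Tendsto (fun r => wNorm n (Z r - Z t)) (𝓝[Set.Ici 0] t) (𝓝 0)) (T : ℝ) :
    ∃ M : ℝ≥0, ∀ t ∈ Set.Icc 0 T, wNorm n (Z t) ≤ M := by
  refine isCompact_Icc.induction_on (p := fun s => ∃ M : ℝ≥0, ∀ t ∈ s, wNorm n (Z t) ≤ M) ⟨0, by simp⟩
    (fun s t hst ⟨M, hM⟩ => ⟨M, fun x hx => hM x (hst hx)⟩) (fun s t ⟨M, hM⟩ ⟨M', hM'⟩ => ?_)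
    fun x hx => ?_
  · refine ⟨max M M', fun x hx => ?_⟩
    rcases hx with hx | hx
    · exact (hM x hx).trans (ENNReal.coe_le_coe.2 (le_max_left _ _))
    · exact (hM' x hx).trans (ENNReal.coe_le_coe.2 (le_max_right _ _))
  · have h1 := ((hc x hx.1).mono_left (nhdsWithin_mono x (s := Set.Icc 0 T) fun _ hy => hy.1)).eventually
      (eventually_le_nhds zero_lt_one)
    refine ⟨_, h1, 1 + (wNorm n (Z x)).toNNReal, fun r hr => ?_⟩
    rw [ENNReal.coe_add, ENNReal.coe_toNNReal (hX x hx.1)]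
    calc wNorm n (Z r) = wNorm n ((Z r - Z x) + Z x) := by rw [sub_add_cancel]
      _ ≤ _ := (wNorm_add_le n _ _).trans (by
        rw [ENNReal.coe_one]
        exact add_le_add_left hr _)

variable {τ γ κ : ℝ} {Z Z' : ℝ → L2 (Cn 3)}

/-- Uniqueness for the first-order system in the class of functions continuous with respect to `wNorm 5`. -/
lemma eq_of_solves (hτ : 0 < τ) (hγ : 0 < γ) (hX : ∀ t, 0 ≤ t → wNorm 5 (Z t) ≠ ∞)
    (hX' : ∀ t, 0 ≤ t → wNorm 5 (Z' t) ≠ ∞)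
    (hc : ∀ t, 0 ≤ t → Tendsto (fun r => wNorm 5 (Z r - Z t)) (𝓝[Set.Ici 0] t) (𝓝 0))
    (hc' : ∀ t, 0 ≤ t → Tendsto (fun r => wNorm 5 (Z' r - Z' t)) (𝓝[Set.Ici 0] t) (𝓝 0))
    (hs : (sys κ hτ hγ).Solves Z fun k t => (sys κ hτ hγ).N k (Z t) (Z t))
    (hs' : (sys κ hτ hγ).Solves Z' fun k t => (sys κ hτ hγ).N k (Z' t) (Z' t)) (h0 : Z 0 = Z' 0)
    {t : ℝ} (ht : 0 ≤ t) : Z t = Z' t := by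
  -- `unique` asks for trajectories on the whole line: continue both by constants for `t < 0`
  have key : ∀ {Y : ℝ → L2 (Cn 3)},
      (sys κ hτ hγ).Solves Y (fun k t => (sys κ hτ hγ).N k (Y t) (Y t)) →
      (sys κ hτ hγ).Solves (fun t => Y (max t 0))
        (fun k t => (sys κ hτ hγ).N k (Y (max t 0)) (Y (max t 0))) := fun {Y} h k s hs => by
    have h1 := h k s hs
    simp only at h1 ⊢
    rw [max_eq_left hs]
    exact h1.congr_of_mem (fun r hr => by rw [max_eq_left hr]) hs
  have := (sys κ hτ hγ).unique (continuous_max_of_continuousOn (continuousOn_of_tendsto_wNorm hc))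
    (continuous_max_of_continuousOn (continuousOn_of_tendsto_wNorm hc')) (key hs) (key hs')
    (by simpa using h0) (fun T => ?_) t ht
  · simpa [max_eq_left ht] using this
  · obtain ⟨M, hM⟩ := exists_bound_wNorm hX hc T
    obtain ⟨M', hM'⟩ := exists_bound_wNorm hX' hc' T
    refine ⟨max M M', fun s hs => ?_⟩
    rw [max_eq_left hs.1]
    exact ⟨(hM s hs).trans (ENNReal.coe_le_coe.2 (le_max_left _ _)),
      (hM' s hs).trans (ENNReal.coe_le_coe.2 (le_max_right _ _))⟩

end Unique

section TrajectoryUnique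

variable {τ β κ : ℝ} {U U' : ℝ → State} {Z Z' : ℝ → L2 (Cn 3)} {a b c a' b' c' : ℝ → L2 ℂ}

/-- A trajectory is determined by its initial state. -/
lemma IsTrajectory.eq (hτ : 0 < τ) (hγ : 0 < β - τ) (h : IsTrajectory τ β κ U Z a b c)
    (h' : IsTrajectory τ β κ U' Z' a' b' c')
    (hc : ∀ t, 0 ≤ t → Tendsto (fun r => wNorm 5 (Z r - Z t)) (𝓝[Set.Ici 0] t) (𝓝 0))
    (hc' : ∀ t, 0 ≤ t → Tendsto (fun r => wNorm 5 (Z' r - Z' t)) (𝓝[Set.Ici 0] t) (𝓝 0))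
    (h0 : U 0 = U' 0) {t : ℝ} (ht : 0 ≤ t) : U t = U' t := by
  have r0 := h.rep 0 le_rfl
  have r0' := h'.rep 0 le_rfl
  have ea : a 0 = a' 0 := invF_injective (by rw [← r0.hu, ← r0'.hu, h0])
  have eb : b 0 = b' 0 := invF_injective (by rw [← r0.hv, ← r0'.hv, h0])
  have ec : c 0 = c' 0 := invF_injective (by rw [← r0.hw, ← r0'.hw, h0])
  have eZ : Z 0 = Z' 0 := (sys κ hτ hγ).ext_P fun k => by
    change proj k (Z 0) = proj k (Z' 0)
    rw [r0.proj_eq k, r0'.proj_eq k, ea, eb, ec]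
  have hZ : ∀ s, 0 ≤ s → Z s = Z' s := fun s hs =>
    eq_of_solves hτ hγ h.finite h'.finite hc hc' (solves_of_hasDerivWithinAt κ hτ hγ h.finite h.deriv)
      (solves_of_hasDerivWithinAt κ hτ hγ h'.finite h'.deriv) eZ hs
  have hb : ∀ s, 0 ≤ s → b s = b' s := fun s hs => by
    rw [← (h.rep s hs).leftOp_zero, ← (h'.rep s hs).leftOp_zero, hZ s hs]
  have hc : ∀ s, 0 ≤ s → c s = c' s := fun s hs => by
    rw [← (h.rep s hs).rightOp_zero hτ.ne', ← (h'.rep s hs).rightOp_zero hτ.ne', hZ s hs]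
  have ha : a t = a' t := eq_of_hasDerivWithinAt h.deriv_u
    (fun s hs => by rw [hb s hs]; exact h'.deriv_u s hs) ea ht
  have r := h.rep t ht
  have r' := h'.rep t ht
  refine Prod.ext ?_ (Prod.ext ?_ ?_)
  · exact r.hu.trans (by rw [ha]; exact r'.hu.symm)
  · exact r.hv.trans (by rw [hb t ht]; exact r'.hv.symm)
  · exact r.hw.trans (by rw [hc t ht]; exact r'.hw.symm)

end TrajectoryUnique

/-! ### Regularity of trajectories -/

section Regular

variable {φ χ : E3 → ℝ} {τ β κ : ℝ} {U : ℝ → State} {Z : ℝ → L2 (Cn 3)} {a b c : ℝ → L2 ℂ}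

/-- Continuity of the Fourier picture gives continuity with respect to the energy. -/
lemma isCont_of_rep (hLP : IsLittlewoodPaley φ χ) (hτ : τ ≠ 0) {m : ℕ} (hm : 0 < m)
    (h : ∀ t, 0 ≤ t → Rep τ (U t) (Z t) (a t) (b t) (c t)) (hf : ∀ t, 0 ≤ t → wNorm (m + 2) (Z t) ≠ ∞)
    (hc : ∀ t, 0 ≤ t → Tendsto (fun r => wNorm (m + 2) (Z r - Z t)) (𝓝[Set.Ici 0] t) (𝓝 0)) :
    IsCont φ τ (m / 2) U := by
  intro t ht
  refine ⟨((h t ht).energy_le hLP hτ m).trans_lt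
    (ENNReal.mul_lt_top (upC_ne_top τ hm).lt_top (hf t ht).lt_top), ?_⟩
  have h1 := ENNReal.Tendsto.const_mul (hc t ht) (Or.inr (upC_ne_top τ hm))
  rw [mul_zero] at h1
  refine tendsto_of_tendsto_of_tendsto_of_le_of_le' tendsto_const_nhds h1
    (Eventually.of_forall fun _ => zero_le) (eventually_nhdsWithin_of_forall fun r hr => ?_)
  exact ((h r hr).sub (h t ht)).energy_le hLP hτ m

lemma IsTrajectory.isContTilde (hLP : IsLittlewoodPaley φ χ) (hτ : 0 < τ) (hγ : 0 < β - τ)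
    (h : IsTrajectory τ β κ U Z a b c) (hZ : Continuous Z) (hS : (sys κ hτ hγ).SX Z ≠ ∞) :
    IsContTilde φ τ (3 / 2) U := by
  have e : (3 / 2 : ℝ) = (3 : ℕ) / 2 := by norm_num
  rw [e]
  refine ⟨isCont_of_rep hLP hτ.ne' (by norm_num) h.rep h.finite
    fun t ht => (sys κ hτ hγ).tendsto_X_sub hZ hS ht, ?_⟩
  exact (energyChemin_le hLP hτ.ne' hZ h.rep ∞ 3).trans_lt (ENNReal.mul_lt_top
    (upC_ne_top τ (by norm_num)).lt_top ((wChemin_top_le 5 Z).trans_lt hS.lt_top))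

lemma IsTrajectory.isContDiffTilde (hLP : IsLittlewoodPaley φ χ) (hτ : 0 < τ) (hγ : 0 < β - τ)
    (h : IsTrajectory τ β κ U Z a b c) (hZ : Continuous Z) (hZ0 : ∀ t, Z t = Z (max t 0))
    (hS : (sys κ hτ hγ).SX Z ≠ ∞) : IsContDiffTilde φ τ (1 / 2) U := by
  have e : (1 / 2 : ℝ) = (1 : ℕ) / 2 := by norm_num
  have hc : ∀ t, 0 ≤ t → Tendsto (fun r => wNorm 5 (Z r - Z t)) (𝓝[Set.Ici 0] t) (𝓝 0) :=
    fun t ht => (sys κ hτ hγ).tendsto_X_sub hZ hS ht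
  have hc3 : ∀ t, 0 ≤ t → Tendsto (fun r => wNorm 3 (Z r - Z t)) (𝓝[Set.Ici 0] t) (𝓝 0) :=
    fun t ht => tendsto_of_tendsto_of_tendsto_of_le_of_le tendsto_const_nhds (hc t ht)
      (fun _ => zero_le) fun r => wNorm_mono (by norm_num) _
  have hce := fun t ht => tendsto_evol_sub κ hτ hγ h.finite ht (hc t ht)
  have hr := fun (t : ℝ) (ht : 0 ≤ t) => rep_evol (κ := κ) hτ hγ (h.finite t ht)
  have hfin := tsum_supN_evol_lt_top κ hτ hγ h.finite hS
  have hcont : Continuous fun t => evol τ (β - τ) κ (Z t) := by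
    have := continuous_max_of_continuousOn (continuousOn_of_tendsto_wNorm hce)
    simpa only [← hZ0] using this
  rw [e]
  refine ⟨isCont_of_rep hLP hτ.ne' one_pos h.rep
    (fun t ht => ((wNorm_mono (by norm_num) _).trans_lt (h.finite t ht).lt_top).ne) hc3,
    fun t => (invF (leftOp τ 0 (Z t)), invF (rightOp τ 0 (Z t)),
      invF (rightOp τ 0 (evol τ (β - τ) κ (Z t)))), fun t ht => ?_,
    isCont_of_rep hLP hτ.ne' one_pos hr (fun t ht => ?_) hce, ?_⟩
  · have h1 := ENNReal.Tendsto.const_mul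
      (tendsto_difference_quotient κ hτ hγ h.finite hS h.deriv ht)
      (Or.inr (upC_ne_top τ one_pos))
    rw [mul_zero] at h1
    refine tendsto_of_tendsto_of_tendsto_of_le_of_le' tendsto_const_nhds h1
      (Eventually.of_forall fun _ => zero_le) (eventually_nhdsWithin_of_forall fun r hr' => ?_)
    exact ((((h.rep r hr'.1).sub (h.rep t ht)).smul _).sub (hr t ht)).energy_le hLP hτ.ne' 1
  · refine (lt_of_le_of_lt (ENNReal.tsum_le_tsum fun k => ?_) hfin).ne
    exact mul_le_mul_right (enorm_le_supN (fun t => proj k (evol τ (β - τ) κ (Z t))) ht) _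
  · exact (energyChemin_le hLP hτ.ne' hcont hr ∞ 1).trans_lt (ENNReal.mul_lt_top
      (upC_ne_top τ one_pos).lt_top ((wChemin_top_le 3 _).trans_lt hfin))

end Regular

/-! ### Global existence -/

section Existence

variable {τ β κ : ℝ}

/-- Small real-valued data launch a global real-valued trajectory. -/
lemma exists_trajectory (hτ : 0 < τ) (hγ : 0 < β - τ) {U₀ : State} {z : L2 (Cn 3)} {a₀ b₀ c₀ : L2 ℂ}
    (h0 : Rep τ U₀ z a₀ b₀ c₀) (ha : flipConj conj1 a₀ = a₀) (hb : flipConj conj1 b₀ = b₀)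
    (hc : flipConj conj1 c₀ = c₀) (hX : wNorm 5 z ≠ ∞)
    (hsmall : 8 * ((sys κ hτ hγ).KL * (sys κ hτ hγ).KN * ((sys κ hτ hγ).KL * wNorm 5 z)) ≤ 1) :
    ∃ (U : ℝ → State) (Z : ℝ → L2 (Cn 3)) (a b c : ℝ → L2 ℂ), U 0 = U₀ ∧ IsTrajectory τ β κ U Z a b c ∧
      (∀ t, 0 ≤ t → flipConj conj1 (a t) = a t ∧ flipConj conj1 (b t) = b t ∧
        flipConj conj1 (c t) = c t) ∧
      Continuous Z ∧ (∀ t, Z t = Z (max t 0)) ∧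
      (sys κ hτ hγ).SX Z ≤ 2 * ((sys κ hτ hγ).KL * wNorm 5 z) ∧
      (sys κ hτ hγ).SD Z ≤ 2 * ((sys κ hτ hγ).KL * wNorm 5 z) := by
  obtain ⟨Z, hZ, hZ0, hz, hs, hSX, hSD⟩ := (sys κ hτ hγ).exists_global z hX hsmall
  have hS : (sys κ hτ hγ).SX Z ≠ ∞ := (hSX.trans_lt (ENNReal.mul_lt_top ENNReal.ofNat_lt_top
    (ENNReal.mul_lt_top ENNReal.coe_lt_top hX.lt_top))).ne
  have hfin : ∀ t, 0 ≤ t → wNorm 5 (Z t) ≠ ∞ := fun t ht =>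
    (((sys κ hτ hγ).X_le_SX Z ht).trans_lt hS.lt_top).ne
  have htend : ∀ t, 0 ≤ t → Tendsto (fun r => wNorm 5 (Z r - Z t)) (𝓝[Set.Ici 0] t) (𝓝 0) :=
    fun t ht => (sys κ hτ hγ).tendsto_X_sub hZ hS ht
  have hd : ∀ t, 0 ≤ t → HasDerivWithinAt Z (evol τ (β - τ) κ (Z t)) (Set.Ici 0) t := fun t ht =>
    hasDerivWithinAt_of_solves κ hτ hγ hfin
      (continuousOn_of_tendsto_wNorm fun t ht => tendsto_evol_sub κ hτ hγ hfin ht (htend t ht)) hs ht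
  have hbc : ContinuousOn (fun t => leftOp τ 0 (Z t)) (Set.Ici 0) :=
    ((leftOp τ 0).continuous.comp hZ).continuousOn
  have h0' : Rep τ U₀ (Z 0) a₀ b₀ c₀ := by rw [hz]; exact h0
  have htr := isTrajectory_of_evol (κ := κ) hτ hγ h0' hfin hd
    (fun t ht => (hasDerivAt_primitive a₀ hbc ht).hasDerivWithinAt) (primitive_zero _ _)
  -- the reflected conjugate solves the same problem, so that it agrees with `Z`
  have hreal : ∀ t, 0 ≤ t → flipConj (conjn 3) (Z t) = Z t := fun t ht =>
    eq_of_solves hτ hγ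
      (fun t ht => ((wNorm_flipConj_le 5 _).trans_lt (hfin t ht).lt_top).ne) hfin
      (fun t ht => tendsto_of_tendsto_of_tendsto_of_le_of_le tendsto_const_nhds (htend t ht)
        (fun _ => zero_le) fun r => by
          simp only
          rw [← map_sub]
          exact wNorm_flipConj_le 5 _) htend
      (solves_flipConj hτ hγ hs) hs (h0'.flipConj_eq ha hb hc) ht
  refine ⟨_, Z, _, _, _, ?_, htr, fun t ht => ⟨?_, ?_, ?_⟩, hZ, hZ0, hSX, hSD⟩
  · refine Prod.ext ?_ (Prod.ext ?_ ?_)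
    · exact (congrArg invF (primitive_zero _ _)).trans h0.hu.symm
    · exact (congrArg invF h0'.leftOp_zero).trans h0.hv.symm
    · exact (congrArg invF (h0'.rightOp_zero hτ.ne')).trans h0.hw.symm
  · refine (apply_primitive (flipConj conj1) hbc (u := primitive a₀ fun t => leftOp τ 0 (Z t)) ?_
      (fun s hs => ?_) ht).symm
    · rw [primitive_zero, ha]
    · rw [flipConj_leftOp, hreal s hs]
      exact (hasDerivAt_primitive a₀ hbc hs).hasDerivWithinAt
  · rw [flipConj_leftOp, hreal t ht]
  · rw [flipConj_rightOp, hreal t ht]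

end Existence

/-! ### Solutions are trajectories -/

section FromSolution

variable {φ χ : E3 → ℝ} {τ β A B : ℝ}

/-- The `L²` part of the energy controls `v` and `w` in `L²`. -/
lemma enorm_le_energyL2 {U : State} {b c : L2 ℂ} (hv : cv U = invF b) (hw : cw U = invF c) :
    ‖c‖ₑ ≤ energyL2 τ U ∧ ‖b‖ₑ ≤ (1 + ‖(τ : ℂ)‖ₑ) * energyL2 τ U := by
  obtain ⟨h1, h2, -, -⟩ := energyL2_ge τ U
  rw [hw, l2_invF] at h2
  rw [vw, hv, hw, ← map_smul, ← map_add, l2_invF] at h1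
  refine ⟨h2, ?_⟩
  calc ‖b‖ₑ = ‖(b + (τ : ℂ) • c) - (τ : ℂ) • c‖ₑ := by rw [add_sub_cancel_right]
    _ ≤ ‖b + (τ : ℂ) • c‖ₑ + ‖(τ : ℂ) • c‖ₑ := enorm_sub_le
    _ ≤ _ := by
      rw [enorm_smul, add_mul, one_mul]
      exact add_le_add h1 (mul_le_mul_right h2 _)

/-- The constant in the estimate of the block norm of order `5/2` by the energy of order `3/2`. -/
def lowC (τ : ℝ) : ℝ≥0∞ := 9 * lowK τ * sq2 ^ 6

lemma lowC_ne_top : lowC τ ≠ ∞ := by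
  have := ENNReal.pow_ne_top (n := 6) sq2_ne_top
  unfold lowC
  finiteness

lemma Rep.wNorm_five_le {U : State} {Z : L2 (Cn 3)} {a b c : L2 ℂ} (hLP : IsLittlewoodPaley φ χ)
    (h : Rep τ U Z a b c) : wNorm 5 Z ≤ lowC τ * energy φ τ (3 / 2) U := by
  have := h.wNorm_le hLP 3
  norm_num at this
  exact this

/-- Every solution of finite energy, continuous in time, is a trajectory of the Fourier picture. Only
the initial value of `u` is known to be square integrable; at later times this follows by integration
of `u_t = v`. -/
lemma exists_trajectory_of_isSolution (hLP : IsLittlewoodPaley φ χ) (hτ : 0 < τ) (hγ : 0 < β - τ)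
    {U₀ : State} {a₀ : L2 ℂ} (h0 : cu U₀ = invF a₀) {U : ℝ → State} (hs : IsSolution τ β A B U₀ U)
    (hc : IsCont φ τ (3 / 2) U) :
    ∃ (Z : ℝ → L2 (Cn 3)) (a b c : ℝ → L2 ℂ), IsTrajectory τ β (B / A) U Z a b c ∧
      ∀ t, 0 ≤ t → Tendsto (fun r => wNorm 5 (Z r - Z t)) (𝓝[Set.Ici 0] t) (𝓝 0) := by
  have hL : ∀ t, 0 ≤ t → energyL2 τ (U t) < ∞ := fun t ht => le_self_add.trans_lt (hc t ht).1
  have hvw : ∀ t, ∃ b c, 0 ≤ t → cv (U t) = invF b ∧ cw (U t) = invF c := fun t => by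
    by_cases ht : 0 ≤ t
    · obtain ⟨h1, h2, -, -⟩ := energyL2_ge τ (U t)
      obtain ⟨y, hy⟩ := exists_of_l2_lt_top (h1.trans_lt (hL t ht))
      obtain ⟨c, hc⟩ := exists_of_l2_lt_top (h2.trans_lt (hL t ht))
      refine ⟨y - (τ : ℂ) • c, c, fun _ => ⟨?_, hc⟩⟩
      rw [map_sub, map_smul, ← hy, ← hc, vw]
      abel
    · exact ⟨0, 0, fun h => absurd h ht⟩
  choose b c hbc using hvw
  have hbcont : ContinuousOn b (Set.Ici 0) := fun t ht => by
    rw [ContinuousWithinAt, tendsto_iff_edist_tendsto_0]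
    have hτ1 : 1 + ‖(τ : ℂ)‖ₑ ≠ ∞ := ENNReal.add_ne_top.2 ⟨ENNReal.one_ne_top, enorm_ne_top⟩
    have h1 := ENNReal.Tendsto.const_mul (hc t ht).2 (Or.inr hτ1)
    rw [mul_zero] at h1
    refine tendsto_of_tendsto_of_tendsto_of_le_of_le' tendsto_const_nhds h1
      (Eventually.of_forall fun _ => zero_le) (eventually_nhdsWithin_of_forall fun r hr => ?_)
    rw [edist_eq_enorm_sub]
    refine (enorm_le_energyL2 (τ := τ) (U := U r - U t) (c := c r - c t) ?_ ?_).2.trans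
      (mul_le_mul_right le_self_add _)
    · rw [map_sub, ← (hbc r hr).1, ← (hbc t ht).1]; rfl
    · rw [map_sub, ← (hbc r hr).2, ← (hbc t ht).2]; rfl
  set a := primitive a₀ b with ha
  have ha' : ∀ t, 0 ≤ t → HasDerivWithinAt a (b t) (Set.Ici 0) t := fun t ht =>
    (hasDerivAt_primitive a₀ hbcont ht).hasDerivWithinAt
  have hu : ∀ t, 0 ≤ t → cu (U t) = invF (a t) := fun t ht =>
    eq_invF_primitive (U := fun t => cu (U t)) hbcont (by rw [hs.init, h0]) (fun s hs' ψ => by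
      rw [← (hbc s hs').1]; exact hs.eq_u s hs' ψ) ht
  have hrep : ∀ t, ∃ Z, 0 ≤ t → Rep τ (U t) Z (a t) (b t) (c t) := fun t => by
    by_cases ht : 0 ≤ t
    · obtain ⟨Z, b', c', h⟩ := exists_rep (hu t ht) (hL t ht)
      rw [← invF_injective ((hbc t ht).1.symm.trans h.hv),
        ← invF_injective ((hbc t ht).2.symm.trans h.hw)] at h
      exact ⟨Z, fun _ => h⟩
    · exact ⟨0, fun h => absurd h ht⟩
  choose Z hZ using hrep
  have hM : lowC τ ≠ ∞ := lowC_ne_top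
  have hfin : ∀ t, 0 ≤ t → wNorm 5 (Z t) ≠ ∞ := fun t ht =>
    (((hZ t ht).wNorm_five_le hLP).trans_lt (ENNReal.mul_lt_top hM.lt_top (hc t ht).1)).ne
  have htend : ∀ t, 0 ≤ t → Tendsto (fun r => wNorm 5 (Z r - Z t)) (𝓝[Set.Ici 0] t) (𝓝 0) :=
    fun t ht => by
      have h1 := ENNReal.Tendsto.const_mul (hc t ht).2 (Or.inr hM)
      rw [mul_zero] at h1
      exact tendsto_of_tendsto_of_tendsto_of_le_of_le' tendsto_const_nhds h1
        (Eventually.of_forall fun _ => zero_le) (eventually_nhdsWithin_of_forall fun r hr =>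
          ((hZ r hr).sub (hZ t ht)).wNorm_five_le hLP)
  have hecont := continuousOn_of_tendsto_wNorm fun t ht =>
    tendsto_evol_sub (γ := β - τ) (B / A) hτ hγ hfin ht (htend t ht)
  have hccont : ContinuousOn c (Set.Ici 0) :=
    ((rightOp τ 0).continuous.comp_continuousOn (continuousOn_of_tendsto_wNorm htend)).congr
      fun t ht => ((hZ t ht).rightOp_zero hτ.ne').symm
  -- the weak derivatives in the definition of a solution are continuous in `L²`, hence strong
  have hb' : ∀ t, 0 ≤ t → HasDerivWithinAt b (c t) (Set.Ici 0) t := fun t ht =>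
    hasDerivWithinAt_of_weak hccont (fun s hs' ψ => by
      have h1 := hs.eq_v s hs' ψ
      rw [(hbc s hs').2] at h1
      exact h1.congr_of_mem (fun r hr => by rw [(hbc r hr).1]) hs') ht
  have hc' : ∀ t, 0 ≤ t → HasDerivWithinAt (fun r => (τ : ℂ) • c r)
      (comp 2 (evol τ (β - τ) (B / A) (Z t)) - c t) (Set.Ici 0) t := fun t ht =>
    hasDerivWithinAt_of_weak (((comp 2).continuous.comp_continuousOn hecont).sub hccont)
      (fun s hs' ψ => by
        obtain ⟨v, w, gu, gv, hv, hw, hgu, hgv, h1⟩ := hs.eq_w s hs'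
        have h2 := h1 ψ
        rw [(hZ s hs').third_equation hτ hγ (hfin s hs') hv hw hgu hgv ψ] at h2
        exact h2.congr_of_mem (fun r hr => by
          rw [(hbc r hr).2, map_smul]; rfl) hs') ht
  have hd : ∀ t, 0 ≤ t →
      HasDerivWithinAt c (rightOp τ 0 (evol τ (β - τ) (B / A) (Z t))) (Set.Ici 0) t := fun t ht => by
    have hτ' : (τ : ℂ) ≠ 0 := Complex.ofReal_ne_zero.2 hτ.ne'
    have h1 := (hc' t ht).const_smul ((τ : ℂ)⁻¹)
    have e : comp 2 (evol τ (β - τ) (B / A) (Z t)) - c t =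
        (τ : ℂ) • rightOp τ 0 (evol τ (β - τ) (B / A) (Z t)) := by
      rw [smul_rightOp_zero hτ.ne', leftOp_zero_evol hτ hγ (hfin t ht), (hZ t ht).rightOp_zero hτ.ne']
    rw [e, inv_smul_smul₀ hτ'] at h1
    exact h1.congr_of_mem (fun r _ => (inv_smul_smul₀ hτ' _).symm) ht
  refine ⟨Z, a, b, c, ⟨hfin, hZ, fun t ht => ?_, ha'⟩, htend⟩
  -- on each block `Z` is a bounded operator applied to `(a, b, c)`
  refine hasDerivWithinAt_of_proj hecont (fun s hs' k => ?_) ht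
  have h1 := hasDerivWithinAt_blkMap τ k (ha' s hs') (hb' s hs') (hd s hs')
  have h2 := (rep_evol (κ := B / A) hτ hγ (hfin s hs')).proj_eq k
  rw [(hZ s hs').leftOp_zero, (hZ s hs').rightOp_zero hτ.ne'] at h2
  rw [h2]
  exact h1.congr_of_mem (fun r hr => (hZ r hr).proj_eq k) hs'

end FromSolution

/-! ### The data -/

section Data

variable {φ χ : E3 → ℝ} {τ : ℝ}

lemma l2_laplacian_lt_top {U : State} (h : energyL2 τ U < ∞) : l2 (Δ (cu U)) < ∞ := by
  have h1 : l2 (Δ (cv U)) < ∞ := (((l2_le_l2Vec ![Δ (cv U)] 0).trans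
    (le_sqrt_sum_seven _ (by simp))).trans_lt h)
  have h2 : l2 (Δ (uv τ U)) < ∞ := (((l2_le_l2Vec ![Δ (uv τ U)] 0).trans
    (le_sqrt_sum_seven _ (by simp))).trans_lt h)
  obtain ⟨f, hf⟩ := exists_of_l2_lt_top h1
  obtain ⟨g, hg⟩ := exists_of_l2_lt_top h2
  have e : Δ (cu U) = invF (g - (τ : ℂ) • f) := by
    rw [map_sub, map_smul, ← hf, ← hg, uv]
    simp only [← TemperedDistribution.laplacianCLM_apply, map_add, map_smul]
    abel
  rw [e, l2_invF]
  exact enorm_lt_top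

lemma l2_multD_lt_top {s : ℝ} {f : TDist} (h : inhomBesov φ χ s f < ∞) : l2 (multD χ f) < ∞ := by
  have h1 := le_self_add.trans_lt h
  rcases ENNReal.mul_lt_top_iff.1 h1 with h2 | h2 | h2
  · exact h2.2
  · exact absurd h2 (ENNReal.ofReal_pos.2 (by positivity)).ne'
  · rw [h2]; exact ENNReal.zero_lt_top

end Data

/-! ### Size of the solution -/

section Size

variable {φ χ : E3 → ℝ} {τ β κ : ℝ}

/-- The frequency cut-off commutes with the dissipation. -/
lemma wChemin_two_dissSym (hτ : 0 < τ) (hγ : 0 < β - τ) (Z : ℝ → L2 (Cn 3)) :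
    wChemin 2 5 (fun t => mulOp dissSym (Z t)) = (sys κ hτ hγ).SD Z := by
  refine tsum_congr fun k => congrArg _ ?_
  change halfLineNorm 2 (fun t => ‖proj k (mulOp dissSym (Z t))‖ₑ) =
    l2N fun t => mulOp dissSym (proj k (Z t))
  simp only [mulOp_proj isSymbol_dissSym]
  exact eLpNorm_enorm _

/-- The constant in the estimate of the trajectory by its data. -/
def solC (κ : ℝ) (hτ : 0 < τ) (hγ : 0 < β - τ) : ℝ≥0∞ :=
  4 * (upC τ 3 * ((sys κ hτ hγ).KL * lowC τ))

lemma solC_ne_top (hτ : 0 < τ) (hγ : 0 < β - τ) : solC κ hτ hγ ≠ ∞ :=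
  ENNReal.mul_ne_top ENNReal.ofNat_ne_top (ENNReal.mul_ne_top (upC_ne_top τ (by norm_num))
    (ENNReal.mul_ne_top ENNReal.coe_ne_top lowC_ne_top))

/-- The inverse of the size of the admissible data. -/
def smallC (κ : ℝ) (hτ : 0 < τ) (hγ : 0 < β - τ) : ℝ≥0∞ :=
  8 * ((sys κ hτ hγ).KL * (sys κ hτ hγ).KN * ((sys κ hτ hγ).KL * lowC τ))

lemma smallC_ne_top (hτ : 0 < τ) (hγ : 0 < β - τ) : smallC κ hτ hγ ≠ ∞ :=
  ENNReal.mul_ne_top ENNReal.ofNat_ne_top (ENNReal.mul_ne_top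
    (ENNReal.mul_ne_top ENNReal.coe_ne_top ENNReal.coe_ne_top)
    (ENNReal.mul_ne_top ENNReal.coe_ne_top lowC_ne_top))

/-- The bounds of the first-order system, in terms of the Chemin-Lerner norms of the state. -/
lemma chemin_add_dissipation_le (hLP : IsLittlewoodPaley φ χ) (hτ : 0 < τ) (hγ : 0 < β - τ)
    {U : ℝ → State} {Z : ℝ → L2 (Cn 3)} {a b c : ℝ → L2 ℂ} (h : IsTrajectory τ β κ U Z a b c)
    (hZ : Continuous Z) {e : ℝ≥0∞} (hX : (sys κ hτ hγ).SX Z ≤ 2 * ((sys κ hτ hγ).KL * (lowC τ * e)))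
    (hD : (sys κ hτ hγ).SD Z ≤ 2 * ((sys κ hτ hγ).KL * (lowC τ * e))) (T : ℝ≥0∞) :
    energyChemin φ τ T (3 / 2) U + dissipationChemin φ τ T (3 / 2) U ≤ solC κ hτ hγ * e := by
  have e3 : (3 / 2 : ℝ) = (3 : ℕ) / 2 := by norm_num
  rw [e3]
  calc _ ≤ upC τ 3 * (2 * ((sys κ hτ hγ).KL * (lowC τ * e))) +
        upC τ 3 * (2 * ((sys κ hτ hγ).KL * (lowC τ * e))) := add_le_add
        ((energyChemin_le hLP hτ.ne' hZ h.rep T 3).trans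
          (mul_le_mul_right ((wChemin_top_le 5 Z).trans hX) _))
        ((dissipationChemin_le hLP hτ.ne' hZ h.rep T 3).trans
          (mul_le_mul_right ((wChemin_two_dissSym (κ := κ) hτ hγ Z).le.trans hD) _))
    _ = _ := by rw [solC]; ring

end Size

end JMGT

end

theorem theorem3p1 (φ χ : JMGT.E3 → ℝ) (hLP : JMGT.IsLittlewoodPaley φ χ)
    (τ β A B : ℝ) (hτ : 0 < τ) (hβ : τ < β) (hA : A ≠ 0) :
    ∃ δ : ℝ, 0 < δ ∧ ∃ C : ℝ, 0 < C ∧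
      ∀ u₀ v₀ w₀ : JMGT.TDist,
        JMGT.IsReal u₀ → JMGT.IsReal v₀ → JMGT.IsReal w₀ →
        JMGT.inhomBesov φ χ (7 / 2) u₀ < ∞ →
        JMGT.inhomBesov φ χ (7 / 2) v₀ < ∞ →
        JMGT.inhomBesov φ χ (5 / 2) w₀ < ∞ →
        JMGT.energy φ τ (3 / 2) (u₀, v₀, w₀) ≤ ENNReal.ofReal δ →
        ∃ U : ℝ → JMGT.State,
          JMGT.IsGlobalSolution φ τ β A B (u₀, v₀, w₀) U ∧
          (∀ T : ℝ≥0∞,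
            JMGT.energyChemin φ τ T (3 / 2) U + JMGT.dissipationChemin φ τ T (3 / 2) U
              ≤ ENNReal.ofReal C * JMGT.energy φ τ (3 / 2) (u₀, v₀, w₀)) ∧
          ∀ U' : ℝ → JMGT.State,
            JMGT.IsGlobalSolution φ τ β A B (u₀, v₀, w₀) U' →
            ∀ t : ℝ, 0 ≤ t → U' t = U t := by
  have hγ : 0 < β - τ := sub_pos.2 hβ
  set Q := JMGT.smallC (B / A) hτ hγ with hQ
  set K := JMGT.solC (B / A) hτ hγ with hK
  refine ⟨(Q.toReal + 1)⁻¹, by positivity, K.toReal + 1, by positivity,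
    fun u₀ v₀ w₀ hu hv hw hu2 _ _ hE => ?_⟩
  set U₀ : JMGT.State := (u₀, v₀, w₀)
  set e := JMGT.energy φ τ (3 / 2) U₀
  have hE' : e < ∞ := hE.trans_lt ENNReal.ofReal_lt_top
  have hL : JMGT.energyL2 τ U₀ < ∞ := le_self_add.trans_lt hE'
  obtain ⟨a₀, (ha₀ : JMGT.cu U₀ = JMGT.invF a₀)⟩ := JMGT.exists_L2_of_laplacian hLP (JMGT.l2_multD_lt_top hu2)
    (JMGT.l2_laplacian_lt_top hL)
  obtain ⟨z, b₀, c₀, h0⟩ := JMGT.exists_rep ha₀ hL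
  have hz : JMGT.wNorm 5 z ≤ JMGT.lowC τ * e := h0.wNorm_five_le hLP
  have hX : JMGT.wNorm 5 z ≠ ∞ := (hz.trans_lt (ENNReal.mul_lt_top JMGT.lowC_ne_top.lt_top hE')).ne
  have hQe : Q * e ≤ 1 := by
    calc Q * e ≤ ENNReal.ofReal Q.toReal * ENNReal.ofReal (Q.toReal + 1)⁻¹ :=
          mul_le_mul' (ENNReal.ofReal_toReal (JMGT.smallC_ne_top hτ hγ)).ge hE
      _ = ENNReal.ofReal (Q.toReal / (Q.toReal + 1)) := by
          rw [← ENNReal.ofReal_mul ENNReal.toReal_nonneg, div_eq_mul_inv]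
      _ ≤ 1 := by
          rw [ENNReal.ofReal_le_one, div_le_one (by positivity)]
          linarith
  obtain ⟨U, Z, a, b, c, hU0, hU, hreal, hZ, hZ0, hSX, hSD⟩ := JMGT.exists_trajectory
    (κ := B / A) hτ hγ h0 ((JMGT.isReal_invF_iff a₀).1 (h0.hu ▸ hu))
    ((JMGT.isReal_invF_iff b₀).1 (h0.hv ▸ hv)) ((JMGT.isReal_invF_iff c₀).1 (h0.hw ▸ hw)) hX (by
      refine le_trans ?_ hQe
      rw [hQ, JMGT.smallC]
      calc _ ≤ 8 * ((JMGT.sys (B / A) hτ hγ).KL * (JMGT.sys (B / A) hτ hγ).KN *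
            ((JMGT.sys (B / A) hτ hγ).KL * (JMGT.lowC τ * e))) := by gcongr
        _ = _ := by ring)
  have hle : 2 * ((JMGT.sys (B / A) hτ hγ).KL * JMGT.wNorm 5 z) ≤
      2 * ((JMGT.sys (B / A) hτ hγ).KL * (JMGT.lowC τ * e)) := by gcongr
  have hS : (JMGT.sys (B / A) hτ hγ).SX Z ≠ ∞ := (hSX.trans_lt (ENNReal.mul_lt_top
    ENNReal.ofNat_lt_top (ENNReal.mul_lt_top ENNReal.coe_lt_top hX.lt_top))).ne
  refine ⟨U, ⟨hU0 ▸ hU.isSolution hτ hγ rfl hreal, hU.isContTilde hLP hτ hγ hZ hS,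
    hU.isContDiffTilde hLP hτ hγ hZ hZ0 hS⟩, fun T => ?_, fun U' hU' t ht => ?_⟩
  · refine (JMGT.chemin_add_dissipation_le hLP hτ hγ hU hZ (hSX.trans hle) (hSD.trans hle) T).trans
      (mul_le_mul_left ?_ _)
    calc K = ENNReal.ofReal K.toReal := (ENNReal.ofReal_toReal (JMGT.solC_ne_top hτ hγ)).symm
      _ ≤ _ := ENNReal.ofReal_le_ofReal (by linarith)
  · obtain ⟨Z', a', b', c', h', hc'⟩ :=
      JMGT.exists_trajectory_of_isSolution hLP hτ hγ ha₀ hU'.1 hU'.2.1.1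
    exact JMGT.IsTrajectory.eq hτ hγ h' hU hc'
      (fun t ht => (JMGT.sys (B / A) hτ hγ).tendsto_X_sub hZ hS ht) (hU'.1.init.trans hU0.symm) ht
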